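/- Let $k$ be a field of characteristic $0$, let $q,\xi,p_0,p_1\in k^\times$ with $\mathrm{ord}(q)\in\mathbb Z_{\ge 3}\cup\{\infty\}$ and $p_0,p_1\neq\pm1$. Let $J=\{\xi^{\pm1}q^{2m}\mid m\in\mathbb Z\}$, $\theta(i)=i^{-1}$, and let $\Gamma$ be the quiver with vertex set $J$ and one arrow $i\to q^2i$ for each $i$, that is $a_{ij}=\delta_{j=q^2i}$; put $\lambda(i)=\delta_{i=p_1}+\delta_{i=-p_0}$. Let $\beta\in\mathbb N[J]$ be $\theta$-invariant with $\sum_i\beta(i)=2n$ and $\beta(i)$ even whenever $\theta(i)=i$, and let ${}^\theta J^\beta$ be the finite set of $\nu=\nu_1\cdots\nu_n\in J^n$ with $\sum_l(\nu_l+\theta(\nu_l))=\beta$. The group generated by $s_0,\dots,s_{n-1}$ acts on it: $s_0$ replaces $\nu_1$ by $\theta(\nu_1)$, and $s_m$ ($m\ge1$) exchanges $\nu_m,\nu_{m+1}$. Put $P_{ij}(u,v)=\delta_{i\ne j}(v-u)^{a_{ij}}$, $P_i(u)=\delta_{i\neq\theta(i)}(-u)^{\lambda(i)}$, $Q_{ij}(u,v)=P_{ij}(u,v)P_{ji}(v,u)$,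 $Q'_i(u)=P_i(u)P_{\theta(i)}(-u)$. The orientifold KLR algebra ${}^\theta R(\beta;\lambda)$ is the unital $k$-algebra generated by $e(\nu)$ ($\nu\in{}^\theta J^\beta$), $x_1,\dots,x_n$, $\tau_0,\dots,\tau_{n-1}$ with the following relations (for all indices for which they make sense; $m,m'\geq1$). * $\sum_\nu e(\nu)=1$, $e(\nu)e(\nu')=\delta_{\nu\nu'}e(\nu)$, $x_le(\nu)=e(\nu)x_l$, $\tau_ie(\nu)=e(s_i\nu)\tau_i$ ($i\ge0$), $x_lx_{l'}=x_{l'}x_l$; * $\tau_m^2e(\nu)=Q_{\nu_m,\nu_{m+1}}(x_{m+1},x_m)e(\nu)$, $\tau_0^2e(\nu)=Q'_{\nu_1}(-x_1)e(\nu)$; * $\tau_m\tau_{m'}=\tau_{m'}\tau_m$ if $m\ne m'\pm1$, $\tau_0\tau_m=\tau_m\tau_0$ if $m\neq1$, and $(\tau_{m+1}\tau_m\tau_{m+1}-\tau_m\tau_{m+1}\tau_m)e(\nu)=\delta_{\nu_m,\nu_{m+2}}\frac{Q_{\nu_m,\nu_{m+1}}(x_{m+1},x_m)-Q_{\nu_m,\nu_{m+1}}(x_{m+1},x_{m+2})}{x_m-x_{m+2}}e(\nu)$;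 * $((\tau_1\tau_0)^2-(\tau_0\tau_1)^2)e(\nu)$ equals $\frac{Q'_{\nu_2}(x_2)-Q'_{\nu_1}(x_1)}{x_1+x_2}\tau_1e(\nu)$ if $\nu_1\ne\nu_2=\theta(\nu_1)$; it equals $\frac{Q_{\nu_1\nu_2}(x_2,-x_1)-Q_{\nu_1\nu_2}(-x_2,-x_1)}{x_2}\tau_0e(\nu)$ if $\nu_1\neq\theta(\nu_1)$, $\nu_2=\theta(\nu_2)$; it equals $\frac{Q_{\nu_1\nu_2}(x_2,-x_1)-Q_{\nu_1\nu_2}(x_2,x_1)}{x_1x_2}(x_1\tau_0+1)e(\nu)$ if $\theta(\nu_1)=\nu_1\ne\nu_2=\theta(\nu_2)$; and it is $0$ otherwise; * $(\tau_mx_l-x_{s_m(l)}\tau_m)e(\nu)$ equals $-e(\nu)$ if $l=m$, $\nu_m=\nu_{m+1}$; $e(\nu)$ if $l=m+1$, $\nu_m=\nu_{m+1}$; $0$ otherwise; $(\tau_0x_1+x_1\tau_0)e(\nu)=-2\delta_{\nu_1=\theta(\nu_1)}e(\nu)$; $\tau_0x_l=x_l\tau_0$ for $l\ne1$. The affine Hecke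 algebra $H=H_{C_n}(p_0,p_1)$ is generated by $T_0,\dots,T_{n-1}$ and commuting invertible $X_1,\dots,X_n$ with $(T_m-q)(T_m+q^{-1})=0$, $(T_0-p_0)(T_0+p_1^{-1})=0$, the braid relations of type $C_n$, $T_mX_mT_m=X_{m+1}$, $T_0X_1^{-1}T_0=p_0p_1^{-1}X_1+(p_0p_1^{-1}-1)T_0$, $T_mX_l=X_lT_m$ ($l\neq m,m+1$) and $T_0X_l=X_lT_0$ ($l\ne1$). Put $$\Phi_m=1+\frac{X_m-X_{m+1}}{qX_m-q^{-1}X_{m+1}}(T_m-q),\qquad \Phi_0=1+p_1\frac{X_1^2-1}{(X_1+p_0)(X_1-p_1)}(T_0-p_0).$$ Let ${}^\theta P_\beta=\bigoplus_\nu k[x_1,\dots,x_n]e(\nu)$, ${}^\theta\hat P_\beta=\bigoplus_\nu k[[x_1,\dots,x_n]]e(\nu)$, $O=k[X_1^{\pm1},\dots,X_n^{\pm1}]$, ${}^\theta\hat O_\beta=\bigoplus_\nu k[[X_1-\nu_1,\dots,X_n-\nu_n]]e(\nu)$, and let ${}^\theta\hat K_\beta$ be the total ring of fractions of ${}^\theta\hat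 O_\beta$. The tensor products ${}^\theta R(\beta;\lambda)\otimes_{{}^\theta P_\beta}{}^\theta\hat P_\beta$ and $H\otimes_O{}^\theta\hat O_\beta$ are algebras, presented by the two factors, the identification of the two copies of ${}^\theta P_\beta$ (resp. $O$), and the rules $$\tau_i\,f e(\nu)=s_i(f)\,\tau_ie(\nu)+\delta_{s_i\nu=\nu}\,\tfrac{s_i(f)-f}{d_i}\,e(\nu),\qquad d_0=x_1,\ d_m=x_m-x_{m+1},$$ $$T_mF=s_m(F)T_m-(q-q^{-1})X_{m+1}\tfrac{F-s_m(F)}{X_m-X_{m+1}},$$ $$T_0F=s_0(F)T_0+\big((p_0-p_1^{-1})X_1^2-(p_0p_1^{-1}-1)X_1\big)\tfrac{F-s_0(F)}{X_1^2-1}$$ for power series $f$ and $F\in{}^\theta\hat O_\beta$, where $s_0(x_1)=-x_1$, $s_0(X_1)=X_1^{-1}$ and $s_m$ exchanges the variables with indices $m$, $m+1$ (the canonical maps from the tensor products to the algebras so presented are bijective), and $H\otimes_O{}^\theta\hat O_\beta$ embeds into its localization over ${}^\theta\hat K_\beta$. **Theorem.** There is an algebra isomorphism ${}^\theta\hat P_\beta\cong{}^\theta\hat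 O_\beta$, $e(\nu)\mapsto e(\nu)$, $x_le(\nu)\mapsto\left(\frac{\nu_l}{X_l}-\frac{X_l}{\nu_l}\right)e(\nu)$, and it extends to an algebra isomorphism $${}^\theta R(\beta;\lambda)\otimes_{{}^\theta P_\beta}{}^\theta\hat P_\beta\;\cong\;H_{C_n}(p_0,p_1)\otimes_O{}^\theta\hat O_\beta$$ such that, for $1\le m\le n-1$, $$\tau_me(\nu)\mapsto\begin{cases}\left(\frac{X_m}{\nu_{m+1}}+\frac{\nu_m}{X_{m+1}}\right)^{-1}\left(\frac{X_{m+1}}{X_m}-1\right)^{-1}(\Phi_m-1)\,e(\nu)&\text{if }\nu_m=\nu_{m+1},\\[4pt] \Phi_m\left(\frac{X_m}{\nu_{m+1}}+\frac{\nu_m}{X_{m+1}}\right)\left(\frac{\nu_{m+1}}{\nu_m}-\frac{X_{m+1}}{X_m}\right)e(\nu)&\text{if }\nu_m=q^2\nu_{m+1},\\[4pt] \Phi_m\,e(\nu)&\text{otherwise,}\end{cases}$$ $$\tau_0e(\nu)\mapsto\begin{cases}\nu_1\left(X_1^{-1}-X_1\right)^{-1}(\Phi_0-1)\,e(\nu)&\text{if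 }\nu_1=\theta(\nu_1),\\[4pt] \Phi_0\left(\frac{X_1}{\nu_1}-\frac{\nu_1}{X_1}\right)^{\lambda(\theta(\nu_1))}e(\nu)&\text{otherwise.}\end{cases}$$ -/

import Mathlib

open scoped TensorProduct

noncomputable section

/-! ## Quivers with involution and framing -/

/-- A quiver with vertex set `J` and finitely many arrows between any two vertices, recorded by the
numbers `arr i j` of arrows `i → j`, without loops, with a contravariant involution `θ`, and with a
framing `lam` that vanishes at the fixed points of `θ`. -/
structure EnhancedQuiver (J : Type*) where
  arr : J → J → ℕ
  arr_self : ∀ i, arr i i = 0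
  θ : J → J
  θ_invol : Function.Involutive θ
  arr_θ : ∀ i j, arr (θ j) (θ i) = arr i j
  lam : J → ℕ
  lam_fixed : ∀ i, θ i = i → lam i = 0

/-- The predecessor `k - 1` of an index `k` (only used when `k ≠ 0`). -/
def prev {n : ℕ} (k : Fin n) : Fin n := ⟨k.1 - 1, lt_of_le_of_lt (Nat.sub_le _ _) k.2⟩

namespace EnhancedQuiver

variable {J : Type*} (Γ : EnhancedQuiver J)

open Classical in
/-- The action of the simple reflection `s_k`, `0 ≤ k ≤ n - 1`, of the Weyl group of type `B_n` on
sequences. Positions are numbered from `0`, so `s_0` applies `θ` to the entry at `0` and, for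
`k ≥ 1`, `s_k` exchanges the entries at `k - 1` and `k`. -/
def weylSeq {n : ℕ} (k : Fin n) (ν : Fin n → J) : Fin n → J :=
  if k.1 = 0 then Function.update ν k (Γ.θ (ν k)) else fun l => ν (Equiv.swap (prev k) k l)

/-- The isotropic compositions of `β` of length `n`: the sequences `ν` with
`∑ (ν_l + θ(ν_l)) = β`. -/
def Comp (β : J →₀ ℕ) (n : ℕ) : Type _ :=
  {ν : Fin n → J //
    ∑ l, (Finsupp.single (ν l) 1 + Finsupp.single (Γ.θ (ν l)) 1) = β}

variable {Γ} {β : J →₀ ℕ} {n : ℕ}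

instance : CoeFun (Γ.Comp β n) (fun _ => Fin n → J) := ⟨Subtype.val⟩

instance : Finite (Γ.Comp β n) := by
  classical
  have key : ∀ (ν : Γ.Comp β n) (l : Fin n), ν.1 l ∈ β.support := by
    intro ν l
    rw [Finsupp.mem_support_iff]
    have h := DFunLike.congr_fun ν.2 (ν.1 l)
    rw [Finsupp.finsetSum_apply] at h
    have h2 := Finset.single_le_sum (f := fun i =>
      (Finsupp.single (ν.1 i) 1 + Finsupp.single (Γ.θ (ν.1 i)) 1 : J →₀ ℕ) (ν.1 l))
      (fun _ _ => Nat.zero_le _) (Finset.mem_univ l)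
    simp only [Finsupp.add_apply, Finsupp.single_eq_same] at h2 h
    omega
  exact Finite.of_injective
    (fun (ν : Γ.Comp β n) (l : Fin n) => (⟨ν.1 l, key ν l⟩ : β.support))
    (fun ν μ h => Subtype.ext (funext fun l => congrArg Subtype.val (congrFun h l)))

instance : Fintype (Γ.Comp β n) := Fintype.ofFinite _

/-- The action of the simple reflections on isotropic compositions of `β`. -/
def Comp.s (k : Fin n) (ν : Γ.Comp β n) : Γ.Comp β n :=
  ⟨Γ.weylSeq k ν, by
    classical
    refine Eq.trans ?_ ν.2
    unfold weylSeq
    split_ifs with hk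
    · refine Finset.sum_congr rfl fun l _ => ?_
      by_cases h : l = k
      · subst h
        rw [Function.update_self, Γ.θ_invol, add_comm]
      · rw [Function.update_of_ne h]
    · exact Equiv.sum_comp (Equiv.swap (prev k) k)
        (fun l => (Finsupp.single (ν.1 l) 1 + Finsupp.single (Γ.θ (ν.1 l)) 1 : J →₀ ℕ))⟩

/-! ## Orientifold KLR algebras -/

variable (Γ)

open Classical in
/-- `P_{ij}(u,v) = δ_{i ≠ j} (v - u)^{a_{ij}}`. -/
def P {A : Type*} [CommRing A] (i j : J) (u v : A) : A :=
  if i = j then 0 else (v - u) ^ Γ.arr i j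

open Classical in
/-- `P_i(u) = δ_{i ≠ θ(i)} (-u)^{λ(i)}`. -/
def P' {A : Type*} [CommRing A] (i : J) (u : A) : A :=
  if i = Γ.θ i then 0 else (-u) ^ Γ.lam i

/-- `Q_{ij}(u,v) = P_{ij}(u,v) P_{ji}(v,u)`. -/
def Q {A : Type*} [CommRing A] (i j : J) (u v : A) : A := Γ.P i j u v * Γ.P j i v u

/-- `Q'_i(u) = P_i(u) P_{θ(i)}(-u)`. -/
def Q' {A : Type*} [CommRing A] (i : J) (u : A) : A := Γ.P' i u * Γ.P' (Γ.θ i) (-u)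

/-- Generators `e(ν)`, `x_l`, `τ_k` of the orientifold KLR algebra. -/
inductive OGen (β : J →₀ ℕ) (n : ℕ) : Type _
  | e (ν : Γ.Comp β n)
  | x (l : Fin n)
  | τ (k : Fin n)

end EnhancedQuiver

/-- The value of a polynomial at a family `x_0, …, x_{n-1}` of elements of an algebra that is not
assumed commutative; monomials are evaluated in increasing order of the index. -/
def orderedEval {k A : Type*} [CommRing k] [Ring A] [Algebra k A] {n : ℕ} (x : Fin n → A)
    (g : MvPolynomial (Fin n) k) : A :=
  ∑ m ∈ g.support, g.coeff m • (List.ofFn fun l => x l ^ m l).prod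

namespace EnhancedQuiver

open MvPolynomial (X)

section Rel

variable (k : Type*) [Field k] {J : Type*} (Γ : EnhancedQuiver J) (β : J →₀ ℕ) (n : ℕ)

/-- The free generator `e(ν)`. -/
abbrev fe (ν : Γ.Comp β n) : FreeAlgebra k (Γ.OGen β n) := FreeAlgebra.ι k (OGen.e ν)
/-- The free generator `x_l`. -/
abbrev fx (l : Fin n) : FreeAlgebra k (Γ.OGen β n) := FreeAlgebra.ι k (OGen.x l)
/-- The free generator `τ_k`. -/
abbrev fτ (i : Fin n) : FreeAlgebra k (Γ.OGen β n) := FreeAlgebra.ι k (OGen.τ i)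
/-- A polynomial in the free generators `x_l`. -/
abbrev fpoly (g : MvPolynomial (Fin n) k) : FreeAlgebra k (Γ.OGen β n) :=
  orderedEval (fx k Γ β n) g

/-- Defining relations of the orientifold KLR algebra. The variables `x_1, …, x_n` and the entries
`ν_1, …, ν_n` are numbered from `0` here, while `τ_0, …, τ_{n-1}` keep their indices: for `i ≠ 0`,
the element `τ_i` involves the positions `prev i` and `i`. A quotient of polynomials `f / d` is
written as the polynomial `g` with `d * g = f`; it exists and is unique in each case. -/
inductive ORel : FreeAlgebra k (Γ.OGen β n) → FreeAlgebra k (Γ.OGen β n) → Prop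
  -- idempotent relations
  | e_sum : ORel (∑ ν, fe k Γ β n ν) 1
  | e_mul_self (ν) : ORel (fe k Γ β n ν * fe k Γ β n ν) (fe k Γ β n ν)
  | e_mul_ne (ν μ) (h : ν ≠ μ) : ORel (fe k Γ β n ν * fe k Γ β n μ) 0
  | x_e (l ν) : ORel (fx k Γ β n l * fe k Γ β n ν) (fe k Γ β n ν * fx k Γ β n l)
  | τ_e (i : Fin n) (ν : Γ.Comp β n) :
      ORel (fτ k Γ β n i * fe k Γ β n ν) (fe k Γ β n (ν.s i) * fτ k Γ β n i)
  -- polynomial relations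
  | x_x (l l') : ORel (fx k Γ β n l * fx k Γ β n l') (fx k Γ β n l' * fx k Γ β n l)
  -- quadratic relations
  | τ_sq (i : Fin n) (hi : i.1 ≠ 0) (ν : Γ.Comp β n) :
      ORel (fτ k Γ β n i * fτ k Γ β n i * fe k Γ β n ν)
        (fpoly k Γ β n (Γ.Q (ν (prev i)) (ν i) (X i) (X (prev i))) * fe k Γ β n ν)
  | τ_sq_zero (i : Fin n) (hi : i.1 = 0) (ν : Γ.Comp β n) :
      ORel (fτ k Γ β n i * fτ k Γ β n i * fe k Γ β n ν)
        (fpoly k Γ β n (Γ.Q' (ν i) (-X i)) * fe k Γ β n ν)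
  -- deformed braid relations
  | τ_comm (i j : Fin n) (h : i.1 ≠ j.1 + 1) (h' : j.1 ≠ i.1 + 1) :
      ORel (fτ k Γ β n i * fτ k Γ β n j) (fτ k Γ β n j * fτ k Γ β n i)
  | braid_ne (i j : Fin n) (hi : i.1 ≠ 0) (hj : j.1 = i.1 + 1) (ν : Γ.Comp β n)
      (hν : ν (prev i) ≠ ν j) :
      ORel ((fτ k Γ β n j * fτ k Γ β n i * fτ k Γ β n j
          - fτ k Γ β n i * fτ k Γ β n j * fτ k Γ β n i) * fe k Γ β n ν) 0
  | braid_eq (i j : Fin n) (hi : i.1 ≠ 0) (hj : j.1 = i.1 + 1) (ν : Γ.Comp β n)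
      (hν : ν (prev i) = ν j) (g : MvPolynomial (Fin n) k)
      (hg : (X (prev i) - X j) * g =
        Γ.Q (ν (prev i)) (ν i) (X i) (X (prev i)) - Γ.Q (ν (prev i)) (ν i) (X i) (X j)) :
      ORel ((fτ k Γ β n j * fτ k Γ β n i * fτ k Γ β n j
          - fτ k Γ β n i * fτ k Γ β n j * fτ k Γ β n i) * fe k Γ β n ν)
        (fpoly k Γ β n g * fe k Γ β n ν)
  | braid_zero_a (o i : Fin n) (ho : o.1 = 0) (hi : i.1 = 1) (ν : Γ.Comp β n)
      (h₁ : ν o ≠ ν i) (h₂ : ν i = Γ.θ (ν o)) (g : MvPolynomial (Fin n) k)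
      (hg : (X o + X i) * g = Γ.Q' (ν i) (X i) - Γ.Q' (ν o) (X o)) :
      ORel (((fτ k Γ β n i * fτ k Γ β n o) ^ 2 - (fτ k Γ β n o * fτ k Γ β n i) ^ 2)
          * fe k Γ β n ν)
        (fpoly k Γ β n g * fτ k Γ β n i * fe k Γ β n ν)
  | braid_zero_b (o i : Fin n) (ho : o.1 = 0) (hi : i.1 = 1) (ν : Γ.Comp β n)
      (h₁ : ν o ≠ Γ.θ (ν o)) (h₂ : ν i = Γ.θ (ν i)) (g : MvPolynomial (Fin n) k)
      (hg : X i * g = Γ.Q (ν o) (ν i) (X i) (-X o) - Γ.Q (ν o) (ν i) (-X i) (-X o)) :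
      ORel (((fτ k Γ β n i * fτ k Γ β n o) ^ 2 - (fτ k Γ β n o * fτ k Γ β n i) ^ 2)
          * fe k Γ β n ν)
        (fpoly k Γ β n g * fτ k Γ β n o * fe k Γ β n ν)
  | braid_zero_c (o i : Fin n) (ho : o.1 = 0) (hi : i.1 = 1) (ν : Γ.Comp β n)
      (h₁ : ν o = Γ.θ (ν o)) (h₂ : ν o ≠ ν i) (h₃ : ν i = Γ.θ (ν i))
      (g : MvPolynomial (Fin n) k)
      (hg : X o * X i * g = Γ.Q (ν o) (ν i) (X i) (-X o) - Γ.Q (ν o) (ν i) (X i) (X o)) :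
      ORel (((fτ k Γ β n i * fτ k Γ β n o) ^ 2 - (fτ k Γ β n o * fτ k Γ β n i) ^ 2)
          * fe k Γ β n ν)
        (fpoly k Γ β n g * (fx k Γ β n o * fτ k Γ β n o + 1) * fe k Γ β n ν)
  | braid_zero_d (o i : Fin n) (ho : o.1 = 0) (hi : i.1 = 1) (ν : Γ.Comp β n)
      (ha : ¬(ν o ≠ ν i ∧ ν i = Γ.θ (ν o)))
      (hb : ¬(ν o ≠ Γ.θ (ν o) ∧ ν i = Γ.θ (ν i)))
      (hc : ¬(ν o = Γ.θ (ν o) ∧ ν o ≠ ν i ∧ ν i = Γ.θ (ν i))) :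
      ORel (((fτ k Γ β n i * fτ k Γ β n o) ^ 2 - (fτ k Γ β n o * fτ k Γ β n i) ^ 2)
          * fe k Γ β n ν) 0
  -- mixed relations
  | mixed_ne (i : Fin n) (hi : i.1 ≠ 0) (l : Fin n) (ν : Γ.Comp β n)
      (h : ν (prev i) ≠ ν i ∨ (l ≠ prev i ∧ l ≠ i)) :
      ORel ((fτ k Γ β n i * fx k Γ β n l
          - fx k Γ β n (Equiv.swap (prev i) i l) * fτ k Γ β n i) * fe k Γ β n ν) 0
  | mixed_left (i : Fin n) (hi : i.1 ≠ 0) (ν : Γ.Comp β n) (h : ν (prev i) = ν i) :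
      ORel ((fτ k Γ β n i * fx k Γ β n (prev i) - fx k Γ β n i * fτ k Γ β n i) * fe k Γ β n ν)
        (-fe k Γ β n ν)
  | mixed_right (i : Fin n) (hi : i.1 ≠ 0) (ν : Γ.Comp β n) (h : ν (prev i) = ν i) :
      ORel ((fτ k Γ β n i * fx k Γ β n i - fx k Γ β n (prev i) * fτ k Γ β n i) * fe k Γ β n ν)
        (fe k Γ β n ν)
  | mixed_zero_ne (o : Fin n) (ho : o.1 = 0) (ν : Γ.Comp β n) (h : ν o ≠ Γ.θ (ν o)) :
      ORel ((fτ k Γ β n o * fx k Γ β n o + fx k Γ β n o * fτ k Γ β n o) * fe k Γ β n ν) 0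
  | mixed_zero_eq (o : Fin n) (ho : o.1 = 0) (ν : Γ.Comp β n) (h : ν o = Γ.θ (ν o)) :
      ORel ((fτ k Γ β n o * fx k Γ β n o + fx k Γ β n o * fτ k Γ β n o) * fe k Γ β n ν)
        (-2 * fe k Γ β n ν)
  | mixed_zero_comm (o : Fin n) (ho : o.1 = 0) (l : Fin n) (hl : l ≠ o) :
      ORel (fτ k Γ β n o * fx k Γ β n l) (fx k Γ β n l * fτ k Γ β n o)

end Rel

variable (k : Type*) [Field k] {J : Type*} (Γ : EnhancedQuiver J) (β : J →₀ ℕ) (n : ℕ)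

/-- The orientifold KLR algebra `^θR(β; λ)`. -/
def OKLR : Type _ := RingQuot (ORel k Γ β n)

instance : Ring (OKLR k Γ β n) := inferInstanceAs (Ring (RingQuot (ORel k Γ β n)))
instance : Algebra k (OKLR k Γ β n) := inferInstanceAs (Algebra k (RingQuot (ORel k Γ β n)))

variable {k Γ β n}

/-- The generator `e(ν)`. -/
def OKLR.e (ν : Γ.Comp β n) : OKLR k Γ β n := RingQuot.mkAlgHom k (ORel k Γ β n) (fe k Γ β n ν)
/-- The generator `x_{l+1}`. -/
def OKLR.x (l : Fin n) : OKLR k Γ β n := RingQuot.mkAlgHom k (ORel k Γ β n) (fx k Γ β n l)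
/-- The generator `τ_i`. -/
def OKLR.τ (i : Fin n) : OKLR k Γ β n := RingQuot.mkAlgHom k (ORel k Γ β n) (fτ k Γ β n i)

end EnhancedQuiver

/-! ## Extension of scalars along an algebra of power series

Let `A`, `B` be `k`-algebras and `S ⊆ B` a commutative subalgebra that also maps to `A`. The algebra
structure on `A ⊗_S B` which extends those of `A` and `B` is presented by the elements of `A` and
`B`, subject to all relations in `A` and in `B`, the identification of the two images of `S`, and
the rules for moving elements of `B` past the generators of `A`. -/

section Ext

variable (k A B : Type*) [Field k] [Ring A] [Algebra k A] [Ring B] [Algebra k B]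
  (glue : A → B → Prop) (cross : FreeAlgebra k (A ⊕ B) → FreeAlgebra k (A ⊕ B) → Prop)

/-- The free generator attached to an element of `A`. -/
abbrev fl (a : A) : FreeAlgebra k (A ⊕ B) := FreeAlgebra.ι k (Sum.inl a)
/-- The free generator attached to an element of `B`. -/
abbrev fr (b : B) : FreeAlgebra k (A ⊕ B) := FreeAlgebra.ι k (Sum.inr b)

/-- Defining relations: those of `A`, those of `B`, the identifications `a = b` for the pairs
`glue a b`, and the relations `cross`. -/
inductive ExtRel : FreeAlgebra k (A ⊕ B) → FreeAlgebra k (A ⊕ B) → Prop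
  | l_add (a a' : A) : ExtRel (fl k A B (a + a')) (fl k A B a + fl k A B a')
  | l_mul (a a' : A) : ExtRel (fl k A B (a * a')) (fl k A B a * fl k A B a')
  | l_const (c : k) : ExtRel (fl k A B (algebraMap k A c)) (algebraMap k _ c)
  | r_add (b b' : B) : ExtRel (fr k A B (b + b')) (fr k A B b + fr k A B b')
  | r_mul (b b' : B) : ExtRel (fr k A B (b * b')) (fr k A B b * fr k A B b')
  | r_const (c : k) : ExtRel (fr k A B (algebraMap k B c)) (algebraMap k _ c)
  | glue (a : A) (b : B) (h : glue a b) : ExtRel (fl k A B a) (fr k A B b)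
  | cross (u v : FreeAlgebra k (A ⊕ B)) (h : cross u v) : ExtRel u v

/-- The algebra presented by `ExtRel`. -/
def ExtAlg : Type _ := RingQuot (ExtRel k A B glue cross)

instance : Ring (ExtAlg k A B glue cross) :=
  inferInstanceAs (Ring (RingQuot (ExtRel k A B glue cross)))
instance : Algebra k (ExtAlg k A B glue cross) :=
  inferInstanceAs (Algebra k (RingQuot (ExtRel k A B glue cross)))

/-- The quotient map. -/
def ExtAlg.mk : FreeAlgebra k (A ⊕ B) →ₐ[k] ExtAlg k A B glue cross :=
  RingQuot.mkAlgHom k (ExtRel k A B glue cross)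

variable {k A B glue cross} in
lemma ExtAlg.mk_rel {u v : FreeAlgebra k (A ⊕ B)} (h : ExtRel k A B glue cross u v) :
    ExtAlg.mk k A B glue cross u = ExtAlg.mk k A B glue cross v :=
  RingQuot.mkAlgHom_rel k h

/-- The canonical homomorphism from `A`. -/
def ExtAlg.inl : A →ₐ[k] ExtAlg k A B glue cross where
  toFun a := ExtAlg.mk k A B glue cross (fl k A B a)
  map_one' := by
    have h := ExtAlg.mk_rel (ExtRel.l_const (glue := glue) (cross := cross) (A := A) (B := B) (1 : k))
    rwa [map_one, map_one, map_one] at h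
  map_mul' a a' := by rw [ExtAlg.mk_rel (ExtRel.l_mul a a'), map_mul]
  map_zero' := by
    have h := ExtAlg.mk_rel (ExtRel.l_const (glue := glue) (cross := cross) (A := A) (B := B) (0 : k))
    rwa [map_zero, map_zero, map_zero] at h
  map_add' a a' := by rw [ExtAlg.mk_rel (ExtRel.l_add a a'), map_add]
  commutes' c := by rw [ExtAlg.mk_rel (ExtRel.l_const c), AlgHom.commutes]

/-- The canonical homomorphism from `B`. -/
def ExtAlg.inr : B →ₐ[k] ExtAlg k A B glue cross where
  toFun b := ExtAlg.mk k A B glue cross (fr k A B b)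
  map_one' := by
    have h := ExtAlg.mk_rel (ExtRel.r_const (glue := glue) (cross := cross) (A := A) (B := B) (1 : k))
    rwa [map_one, map_one, map_one] at h
  map_mul' b b' := by rw [ExtAlg.mk_rel (ExtRel.r_mul b b'), map_mul]
  map_zero' := by
    have h := ExtAlg.mk_rel (ExtRel.r_const (glue := glue) (cross := cross) (A := A) (B := B) (0 : k))
    rwa [map_zero, map_zero, map_zero] at h
  map_add' b b' := by rw [ExtAlg.mk_rel (ExtRel.r_add b b'), map_add]
  commutes' c := by rw [ExtAlg.mk_rel (ExtRel.r_const c), AlgHom.commutes]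

variable {k A B}

/-- The subspace of `A ⊗_k B` spanned by the elements `a s ⊗ b - a ⊗ s b`, where `s` runs through
the pairs identified by `glue`; if these generate the algebra `S`, the quotient is `A ⊗_S B`. -/
def balanced : Submodule k (A ⊗[k] B) :=
  Submodule.span k {z | ∃ (a s : A) (t b : B), glue s t ∧ z = (a * s) ⊗ₜ[k] b - a ⊗ₜ[k] (t * b)}

variable (k) in
/-- The canonical map `A ⊗_S B → ExtAlg`, `a ⊗ b ↦ a b`. -/
def tensorToExt : ((A ⊗[k] B) ⧸ balanced (k := k) glue) →ₗ[k] ExtAlg k A B glue cross :=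
  (balanced glue).liftQ
    (LinearMap.mul' k (ExtAlg k A B glue cross) ∘ₗ
      TensorProduct.map (ExtAlg.inl k A B glue cross).toLinearMap
        (ExtAlg.inr k A B glue cross).toLinearMap)
    (by
      rw [balanced, Submodule.span_le]
      rintro _ ⟨a, s, t, b, h, rfl⟩
      have hst : ExtAlg.inl k A B glue cross s = ExtAlg.inr k A B glue cross t :=
        ExtAlg.mk_rel (ExtRel.glue s t h)
      simp [hst, mul_assoc])

end Ext

/-! ## The completed orientifold KLR algebra -/

namespace EnhancedQuiver

variable (k : Type*) [Field k] {J : Type*} (Γ : EnhancedQuiver J) (β : J →₀ ℕ) (n : ℕ)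

/-- `^θP̂_β = ⨁_ν k[[x_1, …, x_n]] e(ν)`; the set of all `ν` is finite. -/
abbrev Phat : Type _ := Γ.Comp β n → MvPowerSeries (Fin n) k

variable {k n}

/-- The action of `s_i` on `k[[x_1, …, x_n]]`: `s_0` changes the sign of the first variable, and
`s_i`, `i ≠ 0`, exchanges two variables. -/
def actx (i : Fin n) (f : MvPowerSeries (Fin n) k) : MvPowerSeries (Fin n) k :=
  MvPowerSeries.subst (fun l : Fin n =>
    if i.1 = 0 then (if l = i then -MvPowerSeries.X l else MvPowerSeries.X l)
    else (MvPowerSeries.X (Equiv.swap (prev i) i l) : MvPowerSeries (Fin n) k)) f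

variable (k n)

open Classical in
/-- The two copies of the generators `e(ν)`, `x_l` of `^θP_β`. -/
inductive OGlue : OKLR k Γ β n → Phat k Γ β n → Prop
  | e (ν : Γ.Comp β n) : OGlue (OKLR.e ν) (Pi.single ν 1)
  | x (l : Fin n) : OGlue (OKLR.x l) (fun _ => MvPowerSeries.X l)

open Classical in
/-- The rules for moving `f e(ν)`, with `f` a power series, past `τ_i`:
`τ_i f e(ν) = s_i(f) τ_i e(ν) + ((s_i(f) - f) / d) e(ν)`, where `d = x_i - x_{i+1}`
(`d = x_1` for `i = 0`) and the last term is present only if `s_i ν = ν`. -/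
inductive OCross : FreeAlgebra k (OKLR k Γ β n ⊕ Phat k Γ β n) →
    FreeAlgebra k (OKLR k Γ β n ⊕ Phat k Γ β n) → Prop
  | ne (i : Fin n) (hi : i.1 ≠ 0) (ν : Γ.Comp β n) (h : ν (prev i) ≠ ν i)
      (f : MvPowerSeries (Fin n) k) :
      OCross (fl k _ _ (OKLR.τ i) * fr k _ _ (Pi.single ν f))
        (fr k _ _ (Pi.single (ν.s i) (actx i f)) * fl k _ _ (OKLR.τ i))
  | eq (i : Fin n) (hi : i.1 ≠ 0) (ν : Γ.Comp β n) (h : ν (prev i) = ν i)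
      (f g : MvPowerSeries (Fin n) k)
      (hg : (MvPowerSeries.X (prev i) - MvPowerSeries.X i) * g = actx i f - f) :
      OCross (fl k _ _ (OKLR.τ i) * fr k _ _ (Pi.single ν f))
        (fr k _ _ (Pi.single ν (actx i f)) * fl k _ _ (OKLR.τ i) + fr k _ _ (Pi.single ν g))
  | zero_ne (o : Fin n) (ho : o.1 = 0) (ν : Γ.Comp β n) (h : ν o ≠ Γ.θ (ν o))
      (f : MvPowerSeries (Fin n) k) :
      OCross (fl k _ _ (OKLR.τ o) * fr k _ _ (Pi.single ν f))
        (fr k _ _ (Pi.single (ν.s o) (actx o f)) * fl k _ _ (OKLR.τ o))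
  | zero_eq (o : Fin n) (ho : o.1 = 0) (ν : Γ.Comp β n) (h : ν o = Γ.θ (ν o))
      (f g : MvPowerSeries (Fin n) k) (hg : MvPowerSeries.X o * g = actx o f - f) :
      OCross (fl k _ _ (OKLR.τ o) * fr k _ _ (Pi.single ν f))
        (fr k _ _ (Pi.single ν (actx o f)) * fl k _ _ (OKLR.τ o) + fr k _ _ (Pi.single ν g))

/-- The completed algebra `^θR(β; λ) ⊗_{^θP_β} ^θP̂_β`. -/
abbrev OKLRhat : Type _ := ExtAlg k (OKLR k Γ β n) (Phat k Γ β n) (OGlue k Γ β n) (OCross k Γ β n)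

/-- The canonical homomorphism from `^θR(β; λ)`. -/
def OKLRhat.ofOKLR : OKLR k Γ β n →ₐ[k] OKLRhat k Γ β n := ExtAlg.inl k _ _ _ _

/-- The canonical homomorphism from `^θP̂_β`. -/
def OKLRhat.ofPhat : Phat k Γ β n →ₐ[k] OKLRhat k Γ β n := ExtAlg.inr k _ _ _ _

end EnhancedQuiver

/-! ## The affine Hecke algebra of type `C_n` -/

/-- Generators `T_i`, `X_l`, `X_l⁻¹`. -/
inductive HeckeGen (n : ℕ) : Type
  | T (i : Fin n)
  | X (l : Fin n)
  | Xinv (l : Fin n)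

section Hecke

variable {k : Type*} [Field k] (q p₀ p₁ : kˣ) (n : ℕ)

/-- The free generator `T_i`. -/
abbrev hT (k : Type*) [Field k] {n : ℕ} (i : Fin n) : FreeAlgebra k (HeckeGen n) :=
  FreeAlgebra.ι k (HeckeGen.T i)
/-- The free generator `X_{l+1}`. -/
abbrev hX (k : Type*) [Field k] {n : ℕ} (l : Fin n) : FreeAlgebra k (HeckeGen n) :=
  FreeAlgebra.ι k (HeckeGen.X l)
/-- The free generator `X_{l+1}⁻¹`. -/
abbrev hXinv (k : Type*) [Field k] {n : ℕ} (l : Fin n) : FreeAlgebra k (HeckeGen n) :=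
  FreeAlgebra.ι k (HeckeGen.Xinv l)
/-- A scalar in the free algebra. -/
abbrev hc {k : Type*} [Field k] (n : ℕ) (c : k) : FreeAlgebra k (HeckeGen n) := algebraMap k _ c

/-- Defining relations of the affine Hecke algebra of type `C_n`. The variables `X_1, …, X_n` are
numbered from `0`, while `T_0, …, T_{n-1}` keep their indices. -/
inductive HeckeRel : FreeAlgebra k (HeckeGen n) → FreeAlgebra k (HeckeGen n) → Prop
  | quad (i : Fin n) (hi : i.1 ≠ 0) :
      HeckeRel ((hT k i - hc n (q : k)) * (hT k i + hc n (q : k)⁻¹)) 0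
  | quad_zero (o : Fin n) (ho : o.1 = 0) :
      HeckeRel ((hT k o - hc n (p₀ : k)) * (hT k o + hc n (p₁ : k)⁻¹)) 0
  | braid (i j : Fin n) (hi : i.1 ≠ 0) (hj : j.1 = i.1 + 1) :
      HeckeRel (hT k i * hT k j * hT k i) (hT k j * hT k i * hT k j)
  | braid_zero (o i : Fin n) (ho : o.1 = 0) (hi : i.1 = 1) :
      HeckeRel ((hT k o * hT k i) ^ 2) ((hT k i * hT k o) ^ 2)
  | comm (i j : Fin n) (h : i.1 ≠ j.1 + 1) (h' : j.1 ≠ i.1 + 1) :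
      HeckeRel (hT k i * hT k j) (hT k j * hT k i)
  | X_X (l l' : Fin n) : HeckeRel (hX k l * hX k l') (hX k l' * hX k l)
  | X_inv (l : Fin n) : HeckeRel (hX k l * hXinv k l) 1
  | inv_X (l : Fin n) : HeckeRel (hXinv k l * hX k l) 1
  | mixed (i : Fin n) (hi : i.1 ≠ 0) : HeckeRel (hT k i * hX k (prev i) * hT k i) (hX k i)
  | mixed_zero (o : Fin n) (ho : o.1 = 0) :
      HeckeRel (hT k o * hXinv k o * hT k o)
        (hc n ((p₀ : k) * (p₁ : k)⁻¹) * hX k o + hc n ((p₀ : k) * (p₁ : k)⁻¹ - 1) * hT k o)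
  | T_X (i : Fin n) (hi : i.1 ≠ 0) (l : Fin n) (h : l ≠ prev i) (h' : l ≠ i) :
      HeckeRel (hT k i * hX k l) (hX k l * hT k i)
  | T_X_zero (o : Fin n) (ho : o.1 = 0) (l : Fin n) (h : l ≠ o) :
      HeckeRel (hT k o * hX k l) (hX k l * hT k o)

/-- The affine Hecke algebra of type `C_n` with parameters `q`, `p₀`, `p₁`. -/
def HeckeC : Type _ := RingQuot (HeckeRel q p₀ p₁ n)

instance : Ring (HeckeC q p₀ p₁ n) := inferInstanceAs (Ring (RingQuot (HeckeRel q p₀ p₁ n)))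
instance : Algebra k (HeckeC q p₀ p₁ n) :=
  inferInstanceAs (Algebra k (RingQuot (HeckeRel q p₀ p₁ n)))

variable {n}

/-- The generator `T_i`. -/
def HeckeC.T (i : Fin n) : HeckeC q p₀ p₁ n := RingQuot.mkAlgHom k (HeckeRel q p₀ p₁ n) (hT k i)
/-- The generator `X_{l+1}`. -/
def HeckeC.X (l : Fin n) : HeckeC q p₀ p₁ n := RingQuot.mkAlgHom k (HeckeRel q p₀ p₁ n) (hX k l)
/-- The generator `X_{l+1}⁻¹`. -/
def HeckeC.Xinv (l : Fin n) : HeckeC q p₀ p₁ n :=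
  RingQuot.mkAlgHom k (HeckeRel q p₀ p₁ n) (hXinv k l)

end Hecke

/-! ## Parameters, the quiver, and the completed affine Hecke algebra -/

/-- Parameters `q`, `ξ`, `p₀`, `p₁` in `k^×` such that the order of `q` is infinite or at least `3`
(Mathlib's `orderOf` is `0` for elements of infinite order) and `p₀, p₁ ≠ ±1`. -/
structure BKRParam (k : Type*) [Field k] where
  q : kˣ
  ξ : kˣ
  p₀ : kˣ
  p₁ : kˣ
  order_q : orderOf q = 0 ∨ 3 ≤ orderOf q
  p₀_ne_one : p₀ ≠ 1
  p₀_ne_neg_one : p₀ ≠ -1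
  p₁_ne_one : p₁ ≠ 1
  p₁_ne_neg_one : p₁ ≠ -1

namespace BKRParam

variable {k : Type*} [Field k] (D : BKRParam k)

/-- The vertex set `J = {ξ^{±1} q^{2m} | m ∈ ℤ}`. -/
def J : Type _ := {i : kˣ // ∃ m : ℤ, i = D.ξ * D.q ^ (2 * m) ∨ i = D.ξ⁻¹ * D.q ^ (2 * m)}

/-- The function `X : J → k^×`, the inclusion. -/
def X (i : D.J) : kˣ := i.1

lemma q_sq_ne_one : D.q ^ 2 ≠ 1 := by
  intro h
  have h1 := orderOf_dvd_of_pow_eq_one h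
  have h2 := Nat.le_of_dvd two_pos h1
  rcases D.order_q with h0 | h0
  · rw [h0, zero_dvd_iff] at h1
    exact two_ne_zero h1
  · omega

open Classical in
/-- The enhanced quiver with vertices `J`, one arrow `i → q² i` for each `i`, the involution
`θ(i) = i⁻¹`, and the framing `λ(i) = δ_{i = p₁} + δ_{i = -p₀}`. -/
def quiver : EnhancedQuiver D.J where
  arr i j := if j.1 = D.q ^ 2 * i.1 then 1 else 0
  arr_self i := if_neg fun h => D.q_sq_ne_one (mul_eq_right.mp h.symm)
  θ i := ⟨i.1⁻¹, by
    obtain ⟨m, h | h⟩ := i.2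
    · exact ⟨-m, Or.inr (by rw [h, mul_inv, ← zpow_neg, mul_neg])⟩
    · exact ⟨-m, Or.inl (by rw [h, mul_inv, inv_inv, ← zpow_neg, mul_neg])⟩⟩
  θ_invol i := Subtype.ext (inv_inv i.1)
  arr_θ i j := by
    refine if_congr ?_ rfl rfl
    change i.1⁻¹ = D.q ^ 2 * j.1⁻¹ ↔ _
    rw [eq_mul_inv_iff_mul_eq, inv_mul_eq_iff_eq_mul, mul_comm]
  lam i := (if i.1 = D.p₁ then 1 else 0) + (if i.1 = -D.p₀ then 1 else 0)
  lam_fixed i h := by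
    have h' : i.1⁻¹ = i.1 := congrArg Subtype.val h
    have h2 : (i.1 : k) * i.1 = 1 := by
      rw [← Units.val_mul, ← Units.val_one]
      exact congrArg Units.val (by rw [← inv_mul_cancel i.1, h'])
    have h3 : i.1 = 1 ∨ i.1 = -1 := by
      rcases mul_self_eq_one_iff.mp h2 with h | h
      · exact Or.inl (Units.ext h)
      · exact Or.inr (Units.ext h)
    have := D.p₀_ne_one
    have := D.p₀_ne_neg_one
    have := D.p₁_ne_one
    have := D.p₁_ne_neg_one
    rcases h3 with h3 | h3
    · rw [h3, if_neg (Ne.symm D.p₁_ne_one), if_neg]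
      intro h4
      exact D.p₀_ne_neg_one (by rw [h4, neg_neg])
    · rw [h3, if_neg (Ne.symm D.p₁_ne_neg_one), if_neg]
      intro h4
      exact D.p₀_ne_one (neg_injective h4.symm)

variable (β : D.J →₀ ℕ) (n : ℕ)

/-- The isotropic compositions of `β`. -/
abbrev Comp : Type _ := D.quiver.Comp β n

/-- `^θÔ_β = ⨁_ν k[[X_1 - X(ν_1), …, X_n - X(ν_n)]] e(ν)`. The variable `MvPowerSeries.X l` of the
summand `ν` stands for `X_{l+1} - X(ν_{l+1})`. -/
abbrev Ohat : Type _ := D.Comp β n → MvPowerSeries (Fin n) k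

variable {n β}

/-- The element `X_{l+1}` of `^θÔ_β`. -/
def oX (l : Fin n) : D.Ohat β n :=
  fun ν => MvPowerSeries.C (D.X (ν l) : k) + MvPowerSeries.X l

/-- A scalar in `^θÔ_β`. -/
def oC (c : k) : D.Ohat β n := algebraMap k _ c

open Classical in
/-- The element `f e(ν)` of `^θÔ_β`, for `f` in `^θÔ_β`. -/
def oe (ν : D.Comp β n) (f : D.Ohat β n) : D.Ohat β n := Pi.single ν (f ν)

/-- The action of the simple reflection `s_i` on `^θÔ_β`. It sends the summand `s_i ν` to the
summand `ν`; for `i ≠ 0` it exchanges `X_i` and `X_{i+1}`, and `s_0` sends `X_1` to `X_1⁻¹`, that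
is, `X_1 - X(ν_1)⁻¹` to `X_1⁻¹ - X(ν_1)⁻¹`. -/
def actX (i : Fin n) (F : D.Ohat β n) : D.Ohat β n := fun ν =>
  MvPowerSeries.subst (fun l : Fin n =>
    if i.1 = 0 then
      (if l = i then (D.oX l ν)⁻¹ - MvPowerSeries.C ((D.X (ν l) : k)⁻¹) else MvPowerSeries.X l)
    else (MvPowerSeries.X (Equiv.swap (prev i) i l) : MvPowerSeries (Fin n) k)) (F (ν.s i))

variable (n)

/-- The affine Hecke algebra with the given parameters. -/
abbrev H : Type _ := HeckeC D.q D.p₀ D.p₁ n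

variable (β)

/-- The two copies of the generators `X_l^{±1}` of the Laurent polynomial ring `O`. -/
inductive HGlue : D.H n → D.Ohat β n → Prop
  | X (l : Fin n) : HGlue (HeckeC.X D.q D.p₀ D.p₁ l) (D.oX l)
  | Xinv (l : Fin n) : HGlue (HeckeC.Xinv D.q D.p₀ D.p₁ l) (D.oX l)⁻¹

/-- The Bernstein–Lusztig rules for moving `F ∈ ^θÔ_β` past `T_i`:
`T_i F = s_i(F) T_i - (q - q⁻¹) X_{i+1} (F - s_i(F)) / (X_i - X_{i+1})` for `i ≠ 0`, and
`T_0 F = s_0(F) T_0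
  + ((p₀ - p₁⁻¹) X_1² - (p₀ p₁⁻¹ - 1) X_1) (F - s_0(F)) / (X_1² - 1)`. -/
inductive HCross : FreeAlgebra k (D.H n ⊕ D.Ohat β n) → FreeAlgebra k (D.H n ⊕ D.Ohat β n) → Prop
  | pos (i : Fin n) (hi : i.1 ≠ 0) (F G : D.Ohat β n)
      (hG : (D.oX (prev i) - D.oX i) * G = F - D.actX i F) :
      HCross (fl k _ _ (HeckeC.T D.q D.p₀ D.p₁ i) * fr k _ _ F)
        (fr k _ _ (D.actX i F) * fl k _ _ (HeckeC.T D.q D.p₀ D.p₁ i)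
          - fr k _ _ (D.oC ((D.q : k) - (D.q : k)⁻¹) * D.oX i * G))
  | zero (o : Fin n) (ho : o.1 = 0) (F G : D.Ohat β n)
      (hG : (D.oX o ^ 2 - 1) * G = F - D.actX o F) :
      HCross (fl k _ _ (HeckeC.T D.q D.p₀ D.p₁ o) * fr k _ _ F)
        (fr k _ _ (D.actX o F) * fl k _ _ (HeckeC.T D.q D.p₀ D.p₁ o)
          + fr k _ _ ((D.oC ((D.p₀ : k) - (D.p₁ : k)⁻¹) * D.oX o ^ 2
              - D.oC ((D.p₀ : k) * (D.p₁ : k)⁻¹ - 1) * D.oX o) * G))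

/-- The completed algebra `H_{C_n}(p₀, p₁) ⊗_O ^θÔ_β`. -/
def Hhat : Type _ := ExtAlg k (D.H n) (D.Ohat β n) (D.HGlue β n) (D.HCross β n)

instance : Ring (D.Hhat β n) :=
  inferInstanceAs (Ring (ExtAlg k (D.H n) (D.Ohat β n) (D.HGlue β n) (D.HCross β n)))
instance : Algebra k (D.Hhat β n) :=
  inferInstanceAs (Algebra k (ExtAlg k (D.H n) (D.Ohat β n) (D.HGlue β n) (D.HCross β n)))

/-- The canonical homomorphism from the affine Hecke algebra. -/
def ofH : D.H n →ₐ[k] D.Hhat β n := ExtAlg.inl k _ _ (D.HGlue β n) (D.HCross β n)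

/-- The canonical homomorphism from `^θÔ_β`. -/
def ofO : D.Ohat β n →ₐ[k] D.Hhat β n := ExtAlg.inr k _ _ (D.HGlue β n) (D.HCross β n)

/-- The canonical map `H_{C_n}(p₀, p₁) ⊗_O ^θÔ_β → Hhat`, `h ⊗ f ↦ h f`. -/
def tensorToHhat : ((D.H n ⊗[k] D.Ohat β n) ⧸ balanced (k := k) (D.HGlue β n)) →ₗ[k] D.Hhat β n :=
  tensorToExt k (D.HGlue β n) (D.HCross β n)

/-- The completed algebra is a left `^θÔ_β`-module. -/
instance : Module (D.Ohat β n) (D.Hhat β n) := Module.compHom _ (D.ofO β n).toRingHom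

/-! ## Localization and intertwiners -/

/-- `^θK̂_β = ⨁_ν k((X_1 - X(ν_1), …, X_n - X(ν_n))) e(ν)`, the product of the fraction fields of
the factors of `^θÔ_β`. -/
abbrev Khat : Type _ := D.Comp β n → FractionRing (MvPowerSeries (Fin n) k)

/-- The localization `^θK̂_β ⊗_{^θÔ_β} Hhat`, a left vector space over `^θK̂_β`. -/
abbrev Hloc : Type _ := D.Khat β n ⊗[D.Ohat β n] D.Hhat β n

variable {n β}

/-- The canonical map from the completed algebra to its localization. -/
def toLoc (z : D.Hhat β n) : D.Hloc β n := (1 : D.Khat β n) ⊗ₜ[D.Ohat β n] z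

/-- The element `X_{l+1}` of `^θK̂_β`. -/
def kX (l : Fin n) : D.Khat β n := fun ν => algebraMap _ _ (D.oX l ν)

/-- A scalar in `^θK̂_β`. -/
def kC (c : k) : D.Khat β n := fun _ => algebraMap (MvPowerSeries (Fin n) k) _ (MvPowerSeries.C c)

/-- The element `T_i` of the completed algebra. -/
def hatT (i : Fin n) : D.Hhat β n := D.ofH β n (HeckeC.T D.q D.p₀ D.p₁ i)

/-- The product `Φ_i z` of the intertwiner `Φ_i`, `i ≠ 0`, with `z`, where
`Φ_i = 1 + (X_i - X_{i+1}) / (q X_i - q⁻¹ X_{i+1}) (T_i - q)`. -/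
def Φ (i : Fin n) (z : D.Hhat β n) : D.Hloc β n :=
  D.toLoc z +
    ((D.kX (prev i) - D.kX i) /
        (D.kC (D.q : k) * D.kX (prev i) - D.kC (D.q : k)⁻¹ * D.kX i) : D.Khat β n) •
      D.toLoc ((D.hatT i - algebraMap k _ (D.q : k)) * z)

/-- The product `Φ_0 z` of the intertwiner `Φ_0` with `z`, where
`Φ_0 = 1 + p₁ (X_1² - 1) / ((X_1 + p₀) (X_1 - p₁)) (T_0 - p₀)`; the argument `o` is the index
`0`. -/
def Φ₀ (o : Fin n) (z : D.Hhat β n) : D.Hloc β n :=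
  D.toLoc z +
    (D.kC (D.p₁ : k) * (D.kX o ^ 2 - 1) /
        ((D.kX o + D.kC (D.p₀ : k)) * (D.kX o - D.kC (D.p₁ : k))) : D.Khat β n) •
      D.toLoc ((D.hatT o - algebraMap k _ (D.p₀ : k)) * z)

end BKRParam

end

set_option linter.unusedSectionVars false

noncomputable section

/-! Both completed algebras are realised as one and the same algebra of operators on the product,
over all ν, of the fraction field of k[[x_1, …, x_n]]. Let σ_i be the operator that applies the
simple reflection s_i to the variables and to ν at once. Then τ_i acts as Aσ_i + B with rational
coefficients: as a divided difference where s_i fixes ν, and as a polynomial multiple of σ_i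
elsewhere. On the Hecke side put X_l = ν_l t(x_l), where t has constant term 1 and t⁻¹ - t = x_l;
this inverts the change of variables. Then T_i acts by a Demazure–Lusztig operator, T_i - c = A(σ_i
- 1) with c = q or c = p_0. To see that these are representations one compares the coefficients of
Weyl group elements in rank two, which leaves identities between rational functions in at most three
variables (`τop_braid`, `τop_braid_zero`, `Top_braid`, `Top_braid_zero`).

Faithfulness and the tensor product description are proved for both algebras by one argument.
Spanning: a normal form in the braid monoid of type B (`exists_normal`) shows that an algebra whose
generators satisfy the braid relations up to shorter words is spanned by 2^n n! normal words over
the subalgebra of coefficients (`Straightening.exists_sum_nword`). Independence: normal words in the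
σ_i give distinct field automorphisms, so Dedekind's theorem applies (`σop_independent`). If every
coefficient A is nowhere zero, the normal words in the Aσ_i + B and those in the σ_i generate the
same right module over the functions; as the two families have the same finite size, independence
passes from one to the other (`independent_of_mutual_span`). It follows that the map from the tensor
product to the presented algebra is bijective and that the representation is faithful
(`tensorToExt_bijective`).

The images agree because the coefficients of T_i and τ_i are comparable (`comparable`): A_T = u A_τ
and B_T = u B_τ + g with power series u, g and u a unit. Near the point ν the zeros and poles of the
Hecke coefficients are those prescribed by the quiver. Where ν_m = ν_{m+1} the numerator qX_m -
q⁻¹X_{m+1} is a unit since q² ≠ 1; where they differ it vanishes at ν exactly if there is an arrow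
ν_m → ν_{m+1}. The numerator (X_1 + p_0)(X_1 - p_1) contributes x_1 to the power λ(ν_1), and p_0,
p_1 ≠ ±1 keep this apart from the poles at the fixed points of θ. Hence both representations have
the same image (`range_eq`), and the isomorphism is one representation followed by the inverse of
the other.

For the formulas, the localization also acts faithfully (`locRep_injective`), and Φ_i acts as σ_i
because its coefficient is A⁻¹. Each formula then compares τ_i = Aσ_i + B with an expression in σ_i.
Where s_i moves ν, the factor A is carried to the right of σ_i, which is why the arrow ν_{m+1} → ν_m
and the framing at θ(ν_1) appear. -/

/-! ## Words in the generators of the Weyl group of type `B` -/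

/-- The braid relations of type `B`. -/
inductive BraidRel : FreeMonoid ℕ → FreeMonoid ℕ → Prop
  | comm (i j : ℕ) (h : i + 1 < j) :
      BraidRel (FreeMonoid.of i * FreeMonoid.of j) (FreeMonoid.of j * FreeMonoid.of i)
  | braid (i : ℕ) (hi : i ≠ 0) :
      BraidRel (FreeMonoid.of i * FreeMonoid.of (i + 1) * FreeMonoid.of i)
        (FreeMonoid.of (i + 1) * FreeMonoid.of i * FreeMonoid.of (i + 1))
  | braid_zero :
      BraidRel (FreeMonoid.of 0 * FreeMonoid.of 1 * FreeMonoid.of 0 * FreeMonoid.of 1)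
        (FreeMonoid.of 1 * FreeMonoid.of 0 * FreeMonoid.of 1 * FreeMonoid.of 0)

/-- The braid monoid of type `B` in infinitely many generators. -/
abbrev BraidMonoid : Type := (conGen BraidRel).Quotient

namespace BraidMonoid

/-- The class of a word. -/
def mk : FreeMonoid ℕ →* BraidMonoid := (conGen BraidRel).mk'

/-- The generators. -/
def g (i : ℕ) : BraidMonoid := mk (FreeMonoid.of i)

lemma mk_eq_of_rel {u v : FreeMonoid ℕ} (h : BraidRel u v) : mk u = mk v :=
  (Con.eq _).2 (ConGen.Rel.of _ _ h)

lemma mk_eq_iff {u v : FreeMonoid ℕ} : mk u = mk v ↔ conGen BraidRel u v := Con.eq _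

lemma g_comm {i j : ℕ} (h : i + 1 < j ∨ j + 1 < i) : g i * g j = g j * g i := by
  rcases h with h | h
  · simpa [g] using mk_eq_of_rel (BraidRel.comm i j h)
  · simpa [g] using (mk_eq_of_rel (BraidRel.comm j i h)).symm

lemma g_braid {i : ℕ} (hi : i ≠ 0) : g i * g (i + 1) * g i = g (i + 1) * g i * g (i + 1) := by
  simpa [g] using mk_eq_of_rel (BraidRel.braid i hi)

lemma g_braid_zero : g 0 * g 1 * g 0 * g 1 = g 1 * g 0 * g 1 * g 0 := by
  simpa [g] using mk_eq_of_rel BraidRel.braid_zero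

end BraidMonoid

/-- The letters of the word `m, m - 1, …, 1, 0, 1, …, m`. -/
def chainLetter (m j : ℕ) : ℕ := if j ≤ m then m - j else j - m

/-- The prefixes of the word `m, m - 1, …, 1, 0, 1, …, m`. -/
def chain (m : ℕ) : ℕ → FreeMonoid ℕ
  | 0 => 1
  | j + 1 => chain m j * FreeMonoid.of (chainLetter m j)

open BraidMonoid in
-- A letter that neither extends nor shortens the prefix either commutes with its last letter or
-- equals the letter just before it. In the second case a braid relation turns it into a letter
-- standing further to the left, and induction on the length of the prefix applies. It emerges on
-- the left as a letter of the group of smaller rank.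
lemma chain_mul_g (m j : ℕ) (hj : j ≤ 2 * m + 1) (i : ℕ) (hi : i ≤ m)
    (h₁ : j ≤ 2 * m → i ≠ chainLetter m j)
    (h₂ : ∀ j', j = j' + 1 → i ≠ chainLetter m j') :
    ∃ i' < m, mk (chain m j) * g i = g i' * mk (chain m j) := by
  induction j using Nat.strong_induction_on generalizing i with
  | _ j ih =>
    match j, hj, h₁, h₂, ih with
    | 0, hj, h₁, h₂, ih =>
      refine ⟨i, ?_, by simp [chain]⟩
      have := h₁ (by omega)
      simp [chainLetter] at this
      omega
    | j + 1, hj, h₁, h₂, ih =>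
      have h2 := h₂ j rfl
      by_cases hfar : i + 1 < chainLetter m j ∨ chainLetter m j + 1 < i
      · obtain ⟨i', hi', e⟩ := ih j (by omega) (by omega) i hi (fun _ => h2) (by
          rintro j' rfl
          simp only [chainLetter] at hfar ⊢
          split_ifs at hfar ⊢ <;> omega)
        refine ⟨i', hi', ?_⟩
        rw [chain, map_mul, mul_assoc]
        change _ * (g _ * g i) = _ * (_ * g _)
        rw [← g_comm hfar, ← mul_assoc, e, mul_assoc]
      · have hadj : chainLetter m j = i + 1 ∨ i = chainLetter m j + 1 := by omega
        have hj1 : 1 ≤ j := by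
          rcases Nat.eq_zero_or_pos j with rfl | h
          · exfalso
            have := h₁
            simp only [chainLetter] at *
            split_ifs at * <;> omega
          · exact h
        obtain ⟨j, rfl⟩ : ∃ j', j = j' + 1 := ⟨j - 1, by omega⟩
        -- The next letter is excluded, so on either slope of the word the only neighbour of the
        -- last letter that remains is the letter before it.
        have hlp : i = chainLetter m j := by
          simp only [chainLetter] at *
          split_ifs at * <;> omega
        by_cases h0 : i ≠ 0 ∧ chainLetter m (j + 1) ≠ 0
        · obtain ⟨i', hi', e⟩ := ih j (by omega) (by omega) (chainLetter m (j + 1))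
            (by simp only [chainLetter]; split_ifs <;> omega)
            (fun _ => by omega) (by
            rintro j' rfl
            simp only [chainLetter] at *
            split_ifs at * <;> omega)
          refine ⟨i', hi', ?_⟩
          have hb : g i * g (chainLetter m (j + 1)) * g i =
              g (chainLetter m (j + 1)) * g i * g (chainLetter m (j + 1)) := by
            rcases hadj with h | h
            · rw [h]; exact g_braid h0.1
            · rw [h]; exact (g_braid h0.2).symm
          simp only [chain, map_mul]
          change mk (chain m j) * g _ * g _ * g i = g i' * (_ * g _ * g _)
          rw [← hlp, mul_assoc, mul_assoc, ← mul_assoc (g i), hb, ← mul_assoc, ← mul_assoc, e]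
          simp only [mul_assoc]
        -- What remains is a prefix ending in 1, 0, 1 followed by 0; here the relation of length
        -- four is needed.
        · have h00 : i = 0 ∧ chainLetter m (j + 1) = 1 ∧ 1 ≤ j := by
            simp only [chainLetter] at *
            split_ifs at * <;> omega
          obtain ⟨j, rfl⟩ : ∃ j', j = j' + 1 := ⟨j - 1, by omega⟩
          obtain ⟨i', hi', e⟩ := ih j (by omega) (by omega) 0 (by omega)
            (fun _ => by
              simp only [chainLetter] at *
              split_ifs at * <;> omega) (by
              rintro j' rfl
              simp only [chainLetter] at *
              split_ifs at * <;> omega)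
          have hl : chainLetter m j = 1 := by
            simp only [chainLetter] at *
            split_ifs at * <;> omega
          refine ⟨i', hi', ?_⟩
          simp only [chain, map_mul]
          change mk (chain m j) * g _ * g _ * g _ * g i = g i' * (_ * g _ * g _ * g _)
          rw [← hlp, h00.1, h00.2.1, hl]
          have hb : mk (chain m j) * g 1 * g 0 * g 1 * g 0 =
              mk (chain m j) * (g 0 * g 1 * g 0 * g 1) := by
            rw [g_braid_zero]; simp only [mul_assoc]
          rw [hb]
          simp only [← mul_assoc]
          rw [e]

/-- The index set of the normal words in the letters `0, …, m - 1`. -/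
def NIdx : ℕ → Type
  | 0 => Unit
  | m + 1 => NIdx m × Fin (2 * m + 2)

instance NIdx.fintype : (m : ℕ) → Fintype (NIdx m)
  | 0 => inferInstanceAs (Fintype Unit)
  | m + 1 =>
    letI := NIdx.fintype m
    inferInstanceAs (Fintype (NIdx m × Fin (2 * m + 2)))

/-- The normal words in the letters `0, …, m - 1`, one for each element of the Weyl group. -/
def nword : (m : ℕ) → NIdx m → FreeMonoid ℕ
  | 0, _ => 1
  | m + 1, w => nword m w.1 * chain m w.2

lemma exists_nword_eq_one : ∀ m, ∃ w, nword m w = 1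
  | 0 => ⟨(), rfl⟩
  | m + 1 => by
    obtain ⟨w, hw⟩ := exists_nword_eq_one m
    exact ⟨(w, 0), by simp [nword, hw, chain]⟩

open BraidMonoid in
-- The new letter either lengthens the last prefix, or repeats its final letter, or passes through
-- it and becomes a letter of the group of smaller rank.
lemma nword_mul_g (m : ℕ) (u : NIdx m) (i : ℕ) (hi : i < m) :
    (∃ v, mk (nword m u) * g i = mk (nword m v)) ∨
      ∃ a b l, mk (nword m u) * g i =
        mk (a * FreeMonoid.of l * FreeMonoid.of l * b) := by
  induction m generalizing i with
  | zero => omega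
  | succ m ih =>
    obtain ⟨u, j, hj⟩ := u
    by_cases h₁ : j ≤ 2 * m ∧ i = chainLetter m j
    · left
      refine ⟨(u, ⟨j + 1, by omega⟩), ?_⟩
      simp only [nword, chain, h₁.2, map_mul, g, mul_assoc]
    by_cases h₂ : ∃ j', j = j' + 1 ∧ i = chainLetter m j'
    · right
      obtain ⟨j', rfl, rfl⟩ := h₂
      refine ⟨nword m u * chain m j', 1, chainLetter m j', ?_⟩
      simp only [nword, chain, map_mul, g, mul_assoc, mul_one]
    push Not at h₁ h₂
    obtain ⟨i', hi', e⟩ := chain_mul_g m j (by omega) i (by omega) h₁ h₂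
    have e2 : mk (nword (m + 1) (u, ⟨j, hj⟩)) * g i =
        mk (nword m u) * g i' * mk (chain m j) := by
      simp only [nword, map_mul, mul_assoc, e]
    rw [e2]
    rcases ih u i' hi' with ⟨v, hv⟩ | ⟨a, b, l, h⟩
    · left
      exact ⟨(v, ⟨j, hj⟩), by rw [hv]; simp [nword]⟩
    · right
      exact ⟨a, b * chain m j, l, by rw [h]; simp [mul_assoc]⟩

open BraidMonoid in
/-- Every word is braid equivalent to a normal word, or to a word with a repeated letter. -/
lemma exists_normal (m : ℕ) (w : FreeMonoid ℕ) (hw : ∀ i ∈ w.toList, i < m) :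
    (∃ v, mk w = mk (nword m v)) ∨
      ∃ a b l, mk w = mk (a * FreeMonoid.of l * FreeMonoid.of l * b) := by
  obtain ⟨l, rfl⟩ := FreeMonoid.ofList.surjective w
  induction l using List.reverseRecOn with
  | nil =>
    left
    obtain ⟨v, hv⟩ := exists_nword_eq_one m
    exact ⟨v, by rw [hv]; rfl⟩
  | append_singleton l i ih =>
    have e : mk (FreeMonoid.ofList (l ++ [i])) = mk (FreeMonoid.ofList l) * g i := by
      rw [FreeMonoid.ofList_append, map_mul]; rfl
    rw [e]
    rcases ih (fun j hj => hw j (by simpa using Or.inl hj)) with ⟨v, hv⟩ | ⟨a, b, c, h⟩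
    · rw [hv]
      exact nword_mul_g m v i (hw i (by simp))
    · right
      exact ⟨a, b * FreeMonoid.of i, c, by rw [h]; simp [g, mul_assoc]⟩

lemma chain_letters (m j : ℕ) (hj : j ≤ 2 * m + 1) : ∀ i ∈ (chain m j).toList, i ≤ m := by
  induction j with
  | zero => simp [chain]
  | succ j ih =>
    intro i hi
    simp only [chain, FreeMonoid.toList_mul, List.mem_append, FreeMonoid.toList_of,
      List.mem_singleton] at hi
    rcases hi with hi | rfl
    · exact ih (by omega) i hi
    · simp only [chainLetter]; split_ifs <;> omega

lemma nword_letters : ∀ (m : ℕ) (w : NIdx m), ∀ i ∈ (nword m w).toList, i < m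
  | 0, w => by simp [nword]
  | m + 1, ⟨w, j⟩ => by
    intro i hi
    simp only [nword, FreeMonoid.toList_mul, List.mem_append] at hi
    rcases hi with hi | hi
    · exact (nword_letters m w i hi).trans (Nat.lt_succ_self m)
    · exact Nat.lt_succ_of_le (chain_letters m j (by omega) i hi)

/-! ## Straightening -/

section Straight

variable {k A : Type*} [CommRing k] [Ring A] [Algebra k A] (S : Subalgebra k A) (t : ℕ → A)

/-- The span of the elements `t_w s` with `w` a word of length less than `l` and `s ∈ S`. -/
def wordSpan (l : ℕ) : Submodule k A :=
  Submodule.span k {a | ∃ w : FreeMonoid ℕ, ∃ s ∈ S, w.length < l ∧ a = FreeMonoid.lift t w * s}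

/-- Conditions on a family `t` and a subalgebra `S` under which the elements of the algebra
generated by `t` and `S` can be straightened: the `t_i` satisfy the braid relations up to shorter
words, the square of `t_i` is shorter, and elements of `S` can be moved to the right. -/
structure Straightening : Prop where
  move : ∀ s ∈ S, ∀ i, ∃ r ∈ S, ∃ r' ∈ S, s * t i = t i * r + r'
  sq : ∀ i, ∃ r ∈ S, ∃ r' ∈ S, t i * t i = t i * r + r'
  comm : ∀ i j, i + 1 < j → t i * t j = t j * t i
  braid : ∀ i, i ≠ 0 → t i * t (i + 1) * t i - t (i + 1) * t i * t (i + 1) ∈ wordSpan S t 3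
  braid_zero : t 0 * t 1 * t 0 * t 1 - t 1 * t 0 * t 1 * t 0 ∈ wordSpan S t 4

variable {S t}

lemma wordSpan_mono {l m : ℕ} (h : l ≤ m) : wordSpan S t l ≤ wordSpan S t m :=
  Submodule.span_mono fun _ ⟨w, s, hs, hw, e⟩ => ⟨w, s, hs, hw.trans_le h, e⟩

lemma mem_wordSpan {l : ℕ} (w : FreeMonoid ℕ) {s : A} (hs : s ∈ S) (hw : w.length < l) :
    FreeMonoid.lift t w * s ∈ wordSpan S t l :=
  Submodule.subset_span ⟨w, s, hs, hw, rfl⟩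

lemma word_mem_wordSpan {l : ℕ} (w : FreeMonoid ℕ) (hw : w.length < l) :
    FreeMonoid.lift t w ∈ wordSpan S t l := by
  simpa using mem_wordSpan w S.one_mem hw

lemma wordSpan_mul_mem {l : ℕ} {a s : A} (ha : a ∈ wordSpan S t l) (hs : s ∈ S) :
    a * s ∈ wordSpan S t l := by
  induction ha using Submodule.span_induction with
  | mem a h =>
    obtain ⟨w, r, hr, hw, rfl⟩ := h
    rw [mul_assoc]
    exact mem_wordSpan w (S.mul_mem hr hs) hw
  | zero => simp
  | add a b _ _ ha hb => rw [add_mul]; exact add_mem ha hb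
  | smul c a _ ha => rw [smul_mul_assoc]; exact Submodule.smul_mem _ _ ha

lemma t_mul_wordSpan {l : ℕ} (i : ℕ) {a : A} (ha : a ∈ wordSpan S t l) :
    t i * a ∈ wordSpan S t (l + 1) := by
  induction ha using Submodule.span_induction with
  | mem a h =>
    obtain ⟨w, r, hr, hw, rfl⟩ := h
    have := mem_wordSpan (t := t) (l := l + 1) (FreeMonoid.of i * w) hr (by
      rw [FreeMonoid.length_mul, FreeMonoid.length_of]; omega)
    simpa [mul_assoc] using this
  | zero => simp
  | add a b _ _ ha hb => rw [mul_add]; exact add_mem ha hb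
  | smul c a _ ha => rw [mul_smul_comm]; exact Submodule.smul_mem _ _ ha

namespace Straightening

variable (h : Straightening S t)
include h

lemma S_mul_word (w : FreeMonoid ℕ) {s : A} (hs : s ∈ S) :
    s * FreeMonoid.lift t w ∈ wordSpan S t (w.length + 1) := by
  induction w using FreeMonoid.inductionOn' generalizing s with
  | one => simpa using mem_wordSpan (t := t) 1 hs (by simp)
  | of_mul i w ih =>
    obtain ⟨r, hr, r', hr', e⟩ := h.move s hs i
    rw [map_mul, FreeMonoid.lift_eval_of, ← mul_assoc, e, add_mul, mul_assoc,
      FreeMonoid.length_mul, FreeMonoid.length_of, add_comm 1]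
    exact add_mem (t_mul_wordSpan i (ih hr)) (wordSpan_mono (Nat.le_succ _) (ih hr'))

/-- The filtration by word length is multiplicative: lengths below l and at most m add up to less
than l + m, and moving S to the right creates no longer words. -/
lemma mul_mem_wordSpan {l m : ℕ} {a b : A} (ha : a ∈ wordSpan S t l)
    (hb : b ∈ wordSpan S t (m + 1)) : a * b ∈ wordSpan S t (l + m) := by
  induction ha using Submodule.span_induction with
  | zero => simp
  | add a b _ _ ha hb => rw [add_mul]; exact add_mem ha hb
  | smul c a _ ha => rw [smul_mul_assoc]; exact Submodule.smul_mem _ _ ha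
  | mem a ha =>
    obtain ⟨w, s, hs, hw, rfl⟩ := ha
    induction hb using Submodule.span_induction with
    | zero => simp
    | add a b _ _ ha hb => rw [mul_add]; exact add_mem ha hb
    | smul c a _ ha => rw [mul_smul_comm]; exact Submodule.smul_mem _ _ ha
    | mem b hb =>
      obtain ⟨v, r, hr, hv, rfl⟩ := hb
      rw [mul_assoc, ← mul_assoc s]
      have h1 := wordSpan_mul_mem (h.S_mul_word v hs) hr
      have : ∀ (w : FreeMonoid ℕ) {x : A} {p : ℕ}, x ∈ wordSpan S t p →
          FreeMonoid.lift t w * x ∈ wordSpan S t (w.length + p) := by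
        intro w
        induction w using FreeMonoid.inductionOn' with
        | one => intro x p hx; simpa using hx
        | of_mul i w ih =>
          intro x p hx
          have := t_mul_wordSpan i (ih hx)
          rw [map_mul, FreeMonoid.lift_eval_of, mul_assoc, FreeMonoid.length_mul,
            FreeMonoid.length_of]
          exact wordSpan_mono (by omega) this
      exact wordSpan_mono (by omega) (this w h1)

/-- Each defining braid relation holds up to shorter words, and multiplicativity of the filtration
carries the error through products. Braid relations preserve length, so both words obey the same
bound. -/
lemma sub_mem_of_rel {u v : FreeMonoid ℕ} (huv : conGen BraidRel u v) :
    u.length = v.length ∧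
      FreeMonoid.lift t u - FreeMonoid.lift t v ∈ wordSpan S t u.length := by
  induction huv with
  | of u v huv =>
    cases huv with
    | comm i j hij => simp [h.comm i j hij, FreeMonoid.length_mul]
    | braid i hi =>
      refine ⟨by simp [FreeMonoid.length_mul], ?_⟩
      simpa [FreeMonoid.length_mul] using h.braid i hi
    | braid_zero =>
      refine ⟨by simp [FreeMonoid.length_mul], ?_⟩
      simpa [FreeMonoid.length_mul] using h.braid_zero
  | refl u => simp
  | symm _ ih => exact ⟨ih.1.symm, by rw [← neg_sub, ← ih.1]; exact neg_mem ih.2⟩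
  | trans _ _ h₁ h₂ =>
    refine ⟨h₁.1.trans h₂.1, ?_⟩
    rw [← sub_add_sub_cancel]
    exact add_mem h₁.2 (h₁.1 ▸ h₂.2)
  | mul _ _ h₁ h₂ =>
    rename_i w x y z _ _
    refine ⟨by simp [FreeMonoid.length_mul, h₁.1, h₂.1], ?_⟩
    have e : FreeMonoid.lift t (w * y) - FreeMonoid.lift t (x * z) =
      (FreeMonoid.lift t w - FreeMonoid.lift t x) * FreeMonoid.lift t y +
        FreeMonoid.lift t x * (FreeMonoid.lift t y - FreeMonoid.lift t z) := by
      simp only [map_mul]; noncomm_ring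
    rw [e, FreeMonoid.length_mul]
    refine add_mem (h.mul_mem_wordSpan h₁.2 (word_mem_wordSpan y (Nat.lt_succ_self _))) ?_
    -- For an empty word the error lies in the span of no words and is zero; this case is apart
    -- because the product bound needs a positive length on the right.
    rcases hy : y.length with _ | p
    · have : FreeMonoid.lift t y - FreeMonoid.lift t z = 0 := by
        have := h₂.2
        rw [hy] at this
        simpa [wordSpan] using this
      rw [this, mul_zero]; exact zero_mem _
    · have := h.mul_mem_wordSpan (word_mem_wordSpan (S := S) (t := t) x (Nat.lt_succ_self _))
        (hy ▸ h₂.2)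
      exact wordSpan_mono (by omega) this

/-- Words straighten to normal words. -/
lemma wordSpan_le (n : ℕ) (ht : ∀ i, n ≤ i → t i = 0) (l : ℕ) :
    wordSpan S t l ≤
      Submodule.span k {a | ∃ w : NIdx n, ∃ s ∈ S, a = FreeMonoid.lift t (nword n w) * s} := by
  induction l with
  | zero => simp [wordSpan]
  | succ l ih =>
    rw [wordSpan, Submodule.span_le]
    rintro _ ⟨w, s, hs, hw, rfl⟩
    by_cases hwn : ∀ i ∈ w.toList, i < n
    · rcases exists_normal n w hwn with ⟨v, hv⟩ | ⟨a, b, c, hv⟩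
      · have h1 := (h.sub_mem_of_rel (BraidMonoid.mk_eq_iff.1 hv)).2
        have h2 := ih (wordSpan_mono (Nat.le_of_lt_succ hw) (wordSpan_mul_mem h1 hs))
        rw [sub_mul] at h2
        simpa using add_mem h2 (Submodule.subset_span ⟨v, s, hs, rfl⟩)
      · have h1 := h.sub_mem_of_rel (BraidMonoid.mk_eq_iff.1 hv)
        have h2 : FreeMonoid.lift t (a * FreeMonoid.of c * FreeMonoid.of c * b) ∈
            wordSpan S t w.length := by
          obtain ⟨r, hr, r', hr', e⟩ := h.sq c
          -- A doubled letter counts as a word of length at most one, so the whole word drops to a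
          -- lower step of the filtration.
          have e1 : t c * t c ∈ wordSpan S t 2 := by
            rw [e]
            refine add_mem ?_ ?_
            · simpa using mem_wordSpan (t := t) (l := 2) (FreeMonoid.of c) hr (by simp)
            · simpa using mem_wordSpan (t := t) (l := 2) 1 hr' (by simp)
          have := h.mul_mem_wordSpan (h.mul_mem_wordSpan
            (word_mem_wordSpan (S := S) (t := t) a (Nat.lt_succ_self _)) e1)
              (word_mem_wordSpan (S := S) (t := t) b (Nat.lt_succ_self _))
          rw [h1.1]
          simp only [map_mul, FreeMonoid.lift_eval_of, FreeMonoid.length_mul, FreeMonoid.length_of]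
          rw [mul_assoc (FreeMonoid.lift t a)]
          exact wordSpan_mono (by omega) this
        have h3 := add_mem h1.2 h2
        rw [sub_add_cancel] at h3
        exact ih (wordSpan_mono (Nat.le_of_lt_succ hw) (wordSpan_mul_mem h3 hs))
    -- Letters from n on act as zero.
    · push Not at hwn
      obtain ⟨i, hi, hin⟩ := hwn
      have : FreeMonoid.lift t w = 0 := by
        rw [FreeMonoid.lift_apply]
        exact List.prod_eq_zero (List.mem_map.2 ⟨i, hi, ht i hin⟩)
      rw [this, zero_mul]
      exact zero_mem _

/-- Every element of the algebra generated by `t` and `S` is a combination of normal words. -/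
lemma exists_sum_nword (n : ℕ) (ht : ∀ i, n ≤ i → t i = 0) {a : A}
    (ha : a ∈ Algebra.adjoin k (Set.range t ∪ S)) :
    ∃ c : NIdx n → A, (∀ w, c w ∈ S) ∧ a = ∑ w, FreeMonoid.lift t (nword n w) * c w := by
  have h1 : ∃ l, a ∈ wordSpan S t l := by
    induction ha using Algebra.adjoin_induction with
    | mem a ha =>
      rcases ha with ⟨i, rfl⟩ | ha
      · have := word_mem_wordSpan (S := S) (t := t) (l := 2) (FreeMonoid.of i) (by simp)
        exact ⟨2, by simpa using this⟩
      · exact ⟨1, by simpa using mem_wordSpan (t := t) (l := 1) 1 ha (by simp)⟩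
    | algebraMap r =>
      exact ⟨1, by simpa using mem_wordSpan (t := t) (l := 1) 1 (S.algebraMap_mem r) (by simp)⟩
    | add a b _ _ ha hb =>
      obtain ⟨l, hl⟩ := ha
      obtain ⟨m, hm⟩ := hb
      exact ⟨l + m, add_mem (wordSpan_mono (by omega) hl) (wordSpan_mono (by omega) hm)⟩
    | mul a b _ _ ha hb =>
      obtain ⟨l, hl⟩ := ha
      obtain ⟨m, hm⟩ := hb
      exact ⟨l + m, h.mul_mem_wordSpan hl (wordSpan_mono (Nat.le_succ m) hm)⟩
  obtain ⟨l, hl⟩ := h1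
  have h2 := h.wordSpan_le n ht l hl
  clear hl ha
  classical
  induction h2 using Submodule.span_induction with
  | mem a ha =>
    obtain ⟨w, s, hs, rfl⟩ := ha
    refine ⟨Pi.single w s, fun v => ?_, ?_⟩
    · by_cases hv : v = w
      · subst hv; simpa using hs
      · rw [Pi.single_eq_of_ne hv]; exact S.zero_mem
    · rw [Finset.sum_eq_single w (fun v _ hv => by rw [Pi.single_eq_of_ne hv, mul_zero])
        (by simp), Pi.single_eq_same]
  | zero => exact ⟨0, fun _ => S.zero_mem, by simp⟩
  | add a b _ _ ha hb =>
    obtain ⟨c, hc, rfl⟩ := ha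
    obtain ⟨d, hd, rfl⟩ := hb
    exact ⟨c + d, fun w => S.add_mem (hc w) (hd w), by
      simp [mul_add, Finset.sum_add_distrib]⟩
  | smul r a _ ha =>
    obtain ⟨c, hc, rfl⟩ := ha
    exact ⟨r • c, fun w => S.smul_mem (hc w) r, by simp [Finset.smul_sum]⟩

omit h in
-- The elements of S that can be moved past every generator are closed under sums and products,
-- because the coefficients produced on the way stay in S.
lemma move_of_generators {s₀ : Set A} (hS : S = Algebra.adjoin k s₀)
    (hm : ∀ s ∈ s₀, ∀ i, ∃ r ∈ S, ∃ r' ∈ S, s * t i = t i * r + r') :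
    ∀ s ∈ S, ∀ i, ∃ r ∈ S, ∃ r' ∈ S, s * t i = t i * r + r' := by
  intro s hs
  rw [hS] at hs
  induction hs using Algebra.adjoin_induction with
  | mem s hs => exact hm s hs
  | algebraMap c =>
    exact fun i => ⟨_, S.algebraMap_mem c, 0, S.zero_mem, by rw [Algebra.commutes, add_zero]⟩
  | add a b _ _ ha hb =>
    intro i
    obtain ⟨r, hr, r', hr', e⟩ := ha i
    obtain ⟨p, hp, p', hp', e'⟩ := hb i
    exact ⟨r + p, S.add_mem hr hp, r' + p', S.add_mem hr' hp', by
      rw [add_mul, e, e', mul_add]; abel⟩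
  | mul a b ha _ ha' hb =>
    intro i
    obtain ⟨p, hp, p', hp', e'⟩ := hb i
    obtain ⟨r, hr, r', hr', e⟩ := ha' i
    refine ⟨r * p, S.mul_mem hr hp, r' * p + a * p', S.add_mem (S.mul_mem hr' hp)
      (S.mul_mem (hS ▸ ha) hp'), ?_⟩
    rw [mul_assoc, e', mul_add, ← mul_assoc, e]
    noncomm_ring

/-- Transport along a homomorphism. -/
lemma map {B : Type*} [Ring B] [Algebra k B] (f : A →ₐ[k] B) (S' : Subalgebra k B)
    (hS : S.map f ≤ S')
    (hm : ∀ s ∈ S', ∀ i, ∃ r ∈ S', ∃ r' ∈ S', s * f (t i) = f (t i) * r + r') :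
    Straightening S' (fun i => f (t i)) := by
  have hf : ∀ {a : A} {l : ℕ}, a ∈ wordSpan S t l → f a ∈ wordSpan S' (fun i => f (t i)) l := by
    intro a l ha
    induction ha using Submodule.span_induction with
    | mem a ha =>
      obtain ⟨w, s, hs, hw, rfl⟩ := ha
      have := mem_wordSpan (t := fun i => f (t i)) w (hS ⟨s, hs, rfl⟩) hw
      have e : FreeMonoid.lift (fun i => f (t i)) w = f (FreeMonoid.lift t w) := by
        simp only [FreeMonoid.lift_apply, map_list_prod, List.map_map]; rfl
      rw [e] at this
      simpa using this
    | zero => simp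
    | add a b _ _ ha hb => rw [map_add]; exact add_mem ha hb
    | smul r a _ ha => rw [map_smul]; exact Submodule.smul_mem _ _ ha
  refine ⟨hm, fun i => ?_, fun i j hij => ?_, fun i hi => ?_, ?_⟩
  · obtain ⟨r, hr, r', hr', e⟩ := h.sq i
    exact ⟨f r, hS ⟨r, hr, rfl⟩, f r', hS ⟨r', hr', rfl⟩, by simp [← map_mul, ← map_add, e]⟩
  · simp only [← map_mul, h.comm i j hij]
  · simpa using hf (h.braid i hi)
  · simpa using hf h.braid_zero

end Straightening

end Straight

/-! ## Linear independence and extension of scalars -/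

/-- Two finite families of the same size that generate the same right module over a commutative
ring are simultaneously independent. -/
lemma independent_of_mutual_span {V E I : Type*} [CommRing V] [Ring E] [Fintype I]
    (ι : V →+* E) (σ τ : I → E)
    (hσ : ∀ f : I → V, ∑ w, σ w * ι (f w) = 0 → f = 0)
    (hτσ : ∀ w, ∃ a : I → V, τ w = ∑ v, σ v * ι (a v))
    (hστ : ∀ w, ∃ b : I → V, σ w = ∑ v, τ v * ι (b v))
    (f : I → V) (hf : ∑ w, τ w * ι (f w) = 0) : f = 0 := by
  classical
  choose a ha using hτσ
  choose b hb using hστ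
  let M : Matrix I I V := Matrix.of fun v w => a w v
  let N : Matrix I I V := Matrix.of fun v w => b w v
  have comb : ∀ f : I → V, ∑ w, τ w * ι (f w) = ∑ v, σ v * ι (M.mulVec f v) := by
    intro f
    simp only [ha, Finset.sum_mul, Matrix.mulVec, dotProduct, map_sum, Finset.mul_sum, M,
      Matrix.of_apply, map_mul, mul_assoc]
    exact Finset.sum_comm
  -- Inserting one expansion into the other writes each σ_w in terms of the σ_v, and independence of
  -- the latter forces MN = 1. For square matrices over a commutative ring also NM = 1, so that M
  -- has trivial kernel.
  have h1 : M * N = 1 := by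
    ext v w
    have h2 := hσ (fun v => (M.mulVec fun u => N u w) v - if v = w then 1 else 0) (by
      simp only [map_sub, mul_sub, Finset.sum_sub_distrib]
      rw [← comb]
      simp only [N, Matrix.of_apply]
      rw [← hb w, sub_eq_zero]
      rw [Finset.sum_eq_single w] <;> simp +contextual)
    have h3 := congrFun h2 v
    simp only [Pi.zero_apply, sub_eq_zero] at h3
    rw [Matrix.one_apply, ← h3]
    rfl
  have h2 : N * M = 1 := mul_eq_one_comm.1 h1
  have h3 := hσ _ ((comb f).symm.trans hf)
  have h4 : (N * M).mulVec f = 0 := by rw [← Matrix.mulVec_mulVec, h3, Matrix.mulVec_zero]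
  rwa [h2, Matrix.one_mulVec] at h4

section

variable {k A B : Type*} [Field k] [Ring A] [Algebra k A] [Ring B] [Algebra k B]
  {glue : A → B → Prop} {cross : FreeAlgebra k (A ⊕ B) → FreeAlgebra k (A ⊕ B) → Prop}

lemma ExtAlg.inl_eq_inr {a : A} {b : B} (h : glue a b) :
    ExtAlg.inl k A B glue cross a = ExtAlg.inr k A B glue cross b :=
  ExtAlg.mk_rel (ExtRel.glue a b h)

lemma ExtAlg.cross_eq {u v : FreeAlgebra k (A ⊕ B)} (h : cross u v) :
    ExtAlg.mk k A B glue cross u = ExtAlg.mk k A B glue cross v :=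
  ExtAlg.mk_rel (ExtRel.cross u v h)

/-- The algebra `ExtAlg` is generated by the images of `A` and `B`. -/
lemma ExtAlg.induction {p : ExtAlg k A B glue cross → Prop}
    (hl : ∀ a, p (ExtAlg.inl k A B glue cross a)) (hr : ∀ b, p (ExtAlg.inr k A B glue cross b))
    (hadd : ∀ x y, p x → p y → p (x + y)) (hmul : ∀ x y, p x → p y → p (x * y))
    (z : ExtAlg k A B glue cross) : p z := by
  obtain ⟨z, rfl⟩ : ∃ w, ExtAlg.mk k A B glue cross w = z :=
    RingQuot.mkAlgHom_surjective k (ExtRel k A B glue cross) z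
  induction z using FreeAlgebra.induction with
  | grade0 r =>
    have := hl (algebraMap k A r)
    rwa [AlgHom.commutes] at this ⊢
  | grade1 x =>
    rcases x with a | b
    · exact hl a
    · exact hr b
  | mul a b ha hb => rw [map_mul]; exact hmul _ _ ha hb
  | add a b ha hb => rw [map_add]; exact hadd _ _ ha hb

/-- A homomorphism out of `ExtAlg`. -/
def ExtAlg.lift {E : Type*} [Ring E] [Algebra k E] (f : A →ₐ[k] E) (g : B →ₐ[k] E)
    (hglue : ∀ a b, glue a b → f a = g b)
    (hcross : ∀ u v, cross u v →
      FreeAlgebra.lift k (Sum.elim f g) u = FreeAlgebra.lift k (Sum.elim f g) v) :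
    ExtAlg k A B glue cross →ₐ[k] E :=
  RingQuot.liftAlgHom k ⟨FreeAlgebra.lift k (Sum.elim f g), by
    intro u v h
    cases h with
    | glue a b h => simpa using hglue a b h
    | cross u v h => exact hcross u v h
    | _ => simp⟩

@[simp] lemma ExtAlg.lift_inl {E : Type*} [Ring E] [Algebra k E] (f : A →ₐ[k] E) (g : B →ₐ[k] E)
    (hglue : ∀ a b, glue a b → f a = g b)
    (hcross : ∀ u v, cross u v →
      FreeAlgebra.lift k (Sum.elim f g) u = FreeAlgebra.lift k (Sum.elim f g) v) (a : A) :
    ExtAlg.lift f g hglue hcross (ExtAlg.inl k A B glue cross a) = f a := by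
  change RingQuot.liftAlgHom k _ (RingQuot.mkAlgHom k _ _) = _
  rw [RingQuot.liftAlgHom_mkAlgHom_apply]
  simp

@[simp] lemma ExtAlg.lift_inr {E : Type*} [Ring E] [Algebra k E] (f : A →ₐ[k] E) (g : B →ₐ[k] E)
    (hglue : ∀ a b, glue a b → f a = g b)
    (hcross : ∀ u v, cross u v →
      FreeAlgebra.lift k (Sum.elim f g) u = FreeAlgebra.lift k (Sum.elim f g) v) (b : B) :
    ExtAlg.lift f g hglue hcross (ExtAlg.inr k A B glue cross b) = g b := by
  change RingQuot.liftAlgHom k _ (RingQuot.mkAlgHom k _ _) = _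
  rw [RingQuot.liftAlgHom_mkAlgHom_apply]
  simp

lemma tensorToExt_mk (a : A) (b : B) :
    tensorToExt k glue cross (Submodule.Quotient.mk (a ⊗ₜ b)) =
      ExtAlg.inl k A B glue cross a * ExtAlg.inr k A B glue cross b := by
  rw [tensorToExt]
  erw [Submodule.liftQ_apply]
  simp

/-- Only generators may cross the tensor sign by definition; crossing is compatible with sums and
products, hence the whole subalgebra may cross. -/
lemma exists_balanced {s : A} (hs : s ∈ Algebra.adjoin k {a | ∃ b, glue a b}) :
    ∃ t : B, ∀ (a : A) (b : B),
      (a * s) ⊗ₜ[k] b - a ⊗ₜ[k] (t * b) ∈ balanced (k := k) glue := by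
  induction hs using Algebra.adjoin_induction with
  | mem s hs =>
    obtain ⟨t, h⟩ := hs
    exact ⟨t, fun a b => Submodule.subset_span ⟨a, s, t, b, h, rfl⟩⟩
  | algebraMap r =>
    refine ⟨algebraMap k B r, fun a b => ?_⟩
    rw [← Algebra.commutes, ← Algebra.smul_def, ← Algebra.smul_def, TensorProduct.smul_tmul,
      sub_self]
    exact zero_mem _
  | add s s' _ _ h h' =>
    obtain ⟨t, ht⟩ := h
    obtain ⟨t', ht'⟩ := h'
    refine ⟨t + t', fun a b => ?_⟩
    rw [mul_add, add_mul, TensorProduct.add_tmul, TensorProduct.tmul_add, add_sub_add_comm]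
    exact add_mem (ht a b) (ht' a b)
  | mul s s' _ _ h h' =>
    obtain ⟨t, ht⟩ := h
    obtain ⟨t', ht'⟩ := h'
    refine ⟨t * t', fun a b => ?_⟩
    have := add_mem (ht' (a * s) b) (ht a (t' * b))
    rwa [sub_add_sub_cancel, mul_assoc, ← mul_assoc t] at this

variable {E I J : Type*} [Ring E] [Algebra k E] [Fintype I]

/-- The coefficients over the glued subalgebra are absorbed into the right factor, which leaves just
the finite family on the left. -/
lemma exists_sum_tmul (b : I → A)
    (hA : ∀ a, ∃ c : I → A, (∀ w, c w ∈ Algebra.adjoin k {a | ∃ b, glue a b}) ∧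
      a = ∑ w, b w * c w)
    (z : (A ⊗[k] B) ⧸ balanced (k := k) glue) :
    ∃ f : I → B, z = ∑ w, Submodule.Quotient.mk (b w ⊗ₜ f w) := by
  obtain ⟨z, rfl⟩ := Submodule.Quotient.mk_surjective _ z
  induction z using TensorProduct.induction_on with
  | zero => exact ⟨0, by simp⟩
  | add x y hx hy =>
    obtain ⟨f, hf⟩ := hx
    obtain ⟨g, hg⟩ := hy
    refine ⟨f + g, ?_⟩
    rw [Submodule.Quotient.mk_add, hf, hg, ← Finset.sum_add_distrib]
    simp [TensorProduct.tmul_add]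
  | tmul a x =>
    obtain ⟨c, hc, rfl⟩ := hA a
    choose t ht using fun w => exists_balanced (hc w)
    refine ⟨fun w => t w * x, ?_⟩
    rw [TensorProduct.sum_tmul, ← Submodule.mkQ_apply, map_sum]
    exact Finset.sum_congr rfl fun w _ => (Submodule.Quotient.eq _).2 (ht w _ _)

/-- If `A` is spanned over the glued subalgebra by a finite family that is independent over `B` in
a representation, then `A ⊗ B → ExtAlg` is bijective and the representation is faithful. -/
theorem tensorToExt_bijective (t : J → A) (b : I → A)
    (hA : ∀ a, ∃ c : I → A, (∀ w, c w ∈ Algebra.adjoin k {a | ∃ b, glue a b}) ∧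
      a = ∑ w, b w * c w)
    (hgen : ∀ a, a ∈ Algebra.adjoin k (Set.range t ∪ {a | ∃ b, glue a b}))
    (hmove : ∀ f i, ∃ g g', ExtAlg.inr k A B glue cross f * ExtAlg.inl k A B glue cross (t i) =
      ExtAlg.inl k A B glue cross (t i) * ExtAlg.inr k A B glue cross g +
        ExtAlg.inr k A B glue cross g')
    (ρ : ExtAlg k A B glue cross →ₐ[k] E)
    (hρ : ∀ f : I → B, ∑ w, ρ (ExtAlg.inl k A B glue cross (b w)) *
      ρ (ExtAlg.inr k A B glue cross (f w)) = 0 → f = 0) :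
    Function.Bijective (tensorToExt k glue cross) ∧ Function.Injective ρ := by
  -- The range is the span of the products ab. It contains 1, and it is a left ideal: the rule for
  -- moving B past the generators of A extends to all of A by multiplicativity.
  have hsurj : Function.Surjective (tensorToExt k glue cross) := by
    rw [← LinearMap.range_eq_top, eq_top_iff]
    rintro z -
    set R := LinearMap.range (tensorToExt k glue cross) with hR
    have hlr : ∀ a b, ExtAlg.inl k A B glue cross a * ExtAlg.inr k A B glue cross b ∈ R :=
      fun a b => ⟨_, tensorToExt_mk a b⟩
    have hind : ∀ {p : ExtAlg k A B glue cross → Prop},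
        (∀ a b, p (ExtAlg.inl k A B glue cross a * ExtAlg.inr k A B glue cross b)) → p 0 →
        (∀ x y, p x → p y → p (x + y)) → ∀ z ∈ R, p z := by
      rintro p h h0 hadd _ ⟨z, rfl⟩
      obtain ⟨z, rfl⟩ := Submodule.Quotient.mk_surjective _ z
      induction z using TensorProduct.induction_on with
      | zero => simpa using h0
      | tmul a b => rw [tensorToExt_mk]; exact h a b
      | add x y hx hy => rw [Submodule.Quotient.mk_add, map_add]; exact hadd _ _ hx hy
    have hl : ∀ a, ∀ z ∈ R, ExtAlg.inl k A B glue cross a * z ∈ R := fun a =>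
      hind (fun a' b => by rw [← mul_assoc, ← map_mul]; exact hlr _ _) (by simp)
        (fun x y hx hy => by rw [mul_add]; exact add_mem hx hy)
    have hr0 : ∀ b, ExtAlg.inr k A B glue cross b ∈ R := fun b => by
      simpa using hlr 1 b
    have hrr : ∀ b, ∀ z ∈ R, z * ExtAlg.inr k A B glue cross b ∈ R := fun b =>
      hind (fun a' b' => by rw [mul_assoc, ← map_mul]; exact hlr _ _) (by simp)
        (fun x y hx hy => by rw [add_mul]; exact add_mem hx hy)
    have hrl : ∀ a b, ExtAlg.inr k A B glue cross b * ExtAlg.inl k A B glue cross a ∈ R := by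
      intro a
      induction hgen a using Algebra.adjoin_induction with
      | mem a ha =>
        intro b
        rcases ha with ⟨i, rfl⟩ | ⟨c, hc⟩
        · obtain ⟨g, g', e⟩ := hmove b i
          rw [e]
          exact add_mem (hlr _ _) (hr0 _)
        · rw [ExtAlg.inl_eq_inr hc, ← map_mul]
          exact hr0 _
      | algebraMap r =>
        intro b
        rw [AlgHom.commutes, ← Algebra.commutes, ← Algebra.smul_def]
        exact Submodule.smul_mem _ _ (hr0 b)
      | add a a' _ _ h h' =>
        intro b
        rw [map_add, mul_add]
        exact add_mem (h b) (h' b)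
      | mul a a' _ _ h h' =>
        intro b
        rw [map_mul, ← mul_assoc]
        refine hind (p := fun z => z * ExtAlg.inl k A B glue cross a' ∈ R) (fun x y => ?_)
          (by simp) (fun x y hx hy => by rw [add_mul]; exact add_mem hx hy) _ (h b)
        rw [mul_assoc]
        exact hl _ _ (h' y)
    have hr : ∀ b, ∀ z ∈ R, ExtAlg.inr k A B glue cross b * z ∈ R := fun b =>
      hind (fun a' b' => by rw [← mul_assoc]; exact hrr _ _ (hrl _ _)) (by simp)
        (fun x y hx hy => by rw [mul_add]; exact add_mem hx hy)
    have hall : ∀ z, ∀ y ∈ R, z * y ∈ R := fun z => ExtAlg.induction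
      (p := fun z => ∀ y ∈ R, z * y ∈ R) hl hr
      (fun x y hx hy w hw => by rw [add_mul]; exact add_mem (hx w hw) (hy w hw))
      (fun x y hx hy w hw => by rw [mul_assoc]; exact hx _ (hy w hw)) z
    simpa using hall z 1 (by simpa using hlr 1 1)
  -- A tensor is a sum of b_w ⊗ f_w, and ρ kills its image only if all f_w vanish. This gives
  -- injectivity of the map, and together with surjectivity it gives faithfulness of ρ.
  have key : ∀ z, ρ (tensorToExt k glue cross z) = 0 → z = 0 := by
    intro z hz
    obtain ⟨f, rfl⟩ := exists_sum_tmul b hA z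
    have := hρ f (by simpa [tensorToExt_mk] using hz)
    subst this
    simp
  refine ⟨⟨?_, hsurj⟩, ?_⟩
  · rw [← LinearMap.ker_eq_bot, LinearMap.ker_eq_bot']
    intro z hz
    exact key z (by rw [hz, map_zero])
  · rw [injective_iff_map_eq_zero]
    intro z hz
    obtain ⟨z, rfl⟩ := hsurj z
    rw [key z hz, map_zero]

end

/-! ## Substitutions in power series -/

section PowerSeries

open MvPowerSeries

variable {k : Type*} [Field k] {n : ℕ}

/-- An endomorphism of the algebra of power series that is given by substitution of power series
without constant terms. -/
def IsSubst (f : MvPowerSeries (Fin n) k →ₐ[k] MvPowerSeries (Fin n) k) : Prop :=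
  ∃ a : Fin n → MvPowerSeries (Fin n) k, (∀ l, constantCoeff (a l) = 0) ∧ ∀ g, f g = subst a g

/-- Substitution of power series without constant terms. -/
def mkSubst (a : Fin n → MvPowerSeries (Fin n) k) (ha : ∀ l, constantCoeff (a l) = 0) :
    MvPowerSeries (Fin n) k →ₐ[k] MvPowerSeries (Fin n) k :=
  substAlgHom (hasSubst_of_constantCoeff_zero ha)

lemma mkSubst_apply (a : Fin n → MvPowerSeries (Fin n) k) (ha : ∀ l, constantCoeff (a l) = 0)
    (g : MvPowerSeries (Fin n) k) : mkSubst a ha g = subst a g := substAlgHom_apply _ _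

@[simp] lemma mkSubst_X (a : Fin n → MvPowerSeries (Fin n) k)
    (ha : ∀ l, constantCoeff (a l) = 0) (l : Fin n) : mkSubst a ha (X l) = a l :=
  substAlgHom_X _ _

lemma isSubst_mkSubst (a : Fin n → MvPowerSeries (Fin n) k)
    (ha : ∀ l, constantCoeff (a l) = 0) : IsSubst (mkSubst a ha) :=
  ⟨a, ha, mkSubst_apply a ha⟩

lemma algHom_C (f : MvPowerSeries (Fin n) k →ₐ[k] MvPowerSeries (Fin n) k) (r : k) :
    f (C r) = C r := by
  have := f.commutes r
  rwa [MvPowerSeries.algebraMap_apply, Algebra.algebraMap_self_apply] at this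

namespace IsSubst

variable {f g : MvPowerSeries (Fin n) k →ₐ[k] MvPowerSeries (Fin n) k}

/-- This reduces every identity between compositions of substitutions below to a check on the
variables. -/
lemma ext (hf : IsSubst f) (hg : IsSubst g) (h : ∀ l, f (X l) = g (X l)) : f = g := by
  obtain ⟨a, ha, hf⟩ := hf
  obtain ⟨b, hb, hg⟩ := hg
  have : a = b := funext fun l => by
    have := h l
    rwa [hf, hg, subst_X (hasSubst_of_constantCoeff_zero ha),
      subst_X (hasSubst_of_constantCoeff_zero hb)] at this
  subst this
  exact AlgHom.ext fun x => by rw [hf, hg]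

lemma constantCoeff_map (hf : IsSubst f) (x : MvPowerSeries (Fin n) k) :
    constantCoeff (f x) = constantCoeff x := by
  obtain ⟨a, ha, hf⟩ := hf
  have h1 : constantCoeff (f (x - algebraMap k _ (constantCoeff x))) = 0 := by
    rw [hf]
    exact constantCoeff_subst_eq_zero (hasSubst_of_constantCoeff_zero ha) ha (by
      simp [MvPowerSeries.algebraMap_apply])
  rw [map_sub, AlgHom.commutes, map_sub, sub_eq_zero] at h1
  simpa [MvPowerSeries.algebraMap_apply] using h1

lemma comp (hf : IsSubst f) (hg : IsSubst g) : IsSubst (f.comp g) := by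
  have hf' := hf
  obtain ⟨a, ha, hf⟩ := hf
  obtain ⟨b, hb, hg⟩ := hg
  refine ⟨fun l => f (b l), fun l => by rw [hf'.constantCoeff_map, hb], fun x => ?_⟩
  rw [AlgHom.comp_apply, hf, hg, subst_comp_subst_apply (hasSubst_of_constantCoeff_zero hb)
    (hasSubst_of_constantCoeff_zero ha)]
  simp only [hf]

lemma id : IsSubst (AlgHom.id k (MvPowerSeries (Fin n) k)) :=
  ⟨X, fun l => constantCoeff_X l, fun g => by rw [subst_self]; rfl⟩

lemma map_inv (hf : IsSubst f) (x : MvPowerSeries (Fin n) k) : f x⁻¹ = (f x)⁻¹ := by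
  by_cases h : constantCoeff x = 0
  -- A power series without constant term has inverse 0 by convention, and substitutions preserve
  -- constant terms.
  · rw [MvPowerSeries.inv_eq_zero.2 h, map_zero,
      MvPowerSeries.inv_eq_zero.2 (by rw [hf.constantCoeff_map, h])]
  · symm
    rw [MvPowerSeries.inv_eq_iff_mul_eq_one (by rwa [hf.constantCoeff_map]), ← map_mul,
      MvPowerSeries.inv_mul_cancel _ h, map_one]

end IsSubst

/-- A power series is divisible by `X_l` if it vanishes for `X_l = 0`. -/
lemma X_dvd_of_subst_eq_zero (l : Fin n) (f : MvPowerSeries (Fin n) k)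
    (h : mkSubst (fun j => if j = l then 0 else X j) (fun j => by split_ifs <;> simp) f = 0) :
    X l ∣ f := by
  classical
  rw [X_dvd_iff]
  intro m hm
  have h1 := congrArg (coeff m) h
  -- Monomials without x_l are left unchanged and the others become zero, so only the monomial m
  -- contributes to the coefficient of m.
  rw [mkSubst_apply, coeff_subst (hasSubst_of_constantCoeff_zero
    (fun j => by split_ifs <;> simp)), finsum_eq_single _ m] at h1
  · have h2 : (m.prod fun j e => (if j = l then (0 : MvPowerSeries (Fin n) k) else X j) ^ e) =
        monomial m 1 := by
      rw [monomial_one_eq]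
      refine Finsupp.prod_congr fun j hj => ?_
      rw [if_neg]
      rintro rfl
      exact (Finsupp.mem_support_iff.1 hj) hm
    rw [h2, coeff_monomial_same] at h1
    simpa using h1
  · intro d hd
    by_cases hdl : d l = 0
    · have h2 : (d.prod fun j e => (if j = l then (0 : MvPowerSeries (Fin n) k) else X j) ^ e) =
          monomial d 1 := by
        rw [monomial_one_eq]
        refine Finsupp.prod_congr fun j hj => ?_
        rw [if_neg]
        rintro rfl
        exact (Finsupp.mem_support_iff.1 hj) hdl
      rw [h2, coeff_monomial_ne (Ne.symm hd), smul_zero]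
    · rw [Finsupp.prod, Finset.prod_eq_zero (Finsupp.mem_support_iff.2 hdl) (by simp [hdl])]
      simp

/-- The linear change x_a ↦ x_a + x_b turns the hyperplane x_a = x_b into x_a = 0, where
divisibility is seen by setting a variable to zero. Two substitutions that agree on the hyperplane
need only be compared there on variables. -/
lemma X_sub_X_dvd {a b : Fin n} (hab : a ≠ b)
    {f g : MvPowerSeries (Fin n) k →ₐ[k] MvPowerSeries (Fin n) k} (hf : IsSubst f)
    (hg : IsSubst g)
    (h : ∀ l, mkSubst (fun j => if j = a then X b else X j) (fun j => by split_ifs <;> simp)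
      (f (X l)) = mkSubst (fun j => if j = a then X b else X j) (fun j => by split_ifs <;> simp)
      (g (X l))) (x : MvPowerSeries (Fin n) k) : X a - X b ∣ f x - g x := by
  set L : MvPowerSeries (Fin n) k →ₐ[k] _ :=
    mkSubst (fun j => if j = a then X a - X b else X j) (fun j => by split_ifs <;> simp)
  set L' : MvPowerSeries (Fin n) k →ₐ[k] _ :=
    mkSubst (fun j => if j = a then X a + X b else X j) (fun j => by split_ifs <;> simp)
  set Z : MvPowerSeries (Fin n) k →ₐ[k] _ :=
    mkSubst (fun j => if j = a then 0 else X j) (fun j => by split_ifs <;> simp)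
  set D : MvPowerSeries (Fin n) k →ₐ[k] _ :=
    mkSubst (fun j => if j = a then X b else X j) (fun j => by split_ifs <;> simp)
  have hLL : L.comp L' = AlgHom.id k _ := by
    refine ((isSubst_mkSubst _ _).comp (isSubst_mkSubst _ _)).ext IsSubst.id fun l => ?_
    by_cases hl : l = a <;> simp_all [L, L', hab.symm]
  have hZL : Z.comp L' = D := by
    refine ((isSubst_mkSubst _ _).comp (isSubst_mkSubst _ _)).ext (isSubst_mkSubst _ _)
      fun l => ?_
    by_cases hl : l = a <;> simp_all [Z, L', D, hab.symm]
  have hD : D.comp f = D.comp g :=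
    ((isSubst_mkSubst _ _).comp hf).ext ((isSubst_mkSubst _ _).comp hg) h
  have h1 : Z (L' (f x - g x)) = 0 := by
    have e1 := DFunLike.congr_fun hZL (f x - g x)
    have e2 := DFunLike.congr_fun hD x
    simp only [AlgHom.comp_apply] at e1 e2
    rw [e1, map_sub, e2, sub_self]
  obtain ⟨y, hy⟩ := X_dvd_of_subst_eq_zero a _ h1
  have h2 := congrArg L hy
  rw [map_mul] at h2
  have e3 := DFunLike.congr_fun hLL (f x - g x)
  simp only [AlgHom.comp_apply, AlgHom.id_apply] at e3
  rw [e3] at h2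
  exact ⟨L y, by rw [h2]; simp [L]⟩

/-! ## The simple reflections on power series -/

open EnhancedQuiver (actx)

/-- The images of the variables under a simple reflection. -/
def reflVar (i l : Fin n) : MvPowerSeries (Fin n) k :=
  if i.1 = 0 then (if l = i then -X l else X l) else X (Equiv.swap (prev i) i l)

lemma constantCoeff_reflVar (i l : Fin n) :
    constantCoeff (reflVar i l : MvPowerSeries (Fin n) k) = 0 := by
  unfold reflVar; split_ifs <;> simp

/-- The simple reflections as homomorphisms. -/
def reflHom (i : Fin n) : MvPowerSeries (Fin n) k →ₐ[k] MvPowerSeries (Fin n) k :=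
  mkSubst (reflVar i) (constantCoeff_reflVar i)

lemma isSubst_reflHom (i : Fin n) : IsSubst (reflHom (k := k) i) := isSubst_mkSubst _ _

lemma reflHom_apply (i : Fin n) (f : MvPowerSeries (Fin n) k) : reflHom i f = actx i f :=
  mkSubst_apply _ _ _

lemma reflHom_X (i l : Fin n) : reflHom i (X l : MvPowerSeries (Fin n) k) = reflVar i l :=
  mkSubst_X _ _ _

lemma reflHom_reflHom (i : Fin n) :
    (reflHom i).comp (reflHom i) = AlgHom.id k (MvPowerSeries (Fin n) k) := by
  refine ((isSubst_reflHom i).comp (isSubst_reflHom i)).ext IsSubst.id fun l => ?_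
  rw [AlgHom.comp_apply, reflHom_X]
  unfold reflVar
  split_ifs with h h'
  · simp [reflHom_X, reflVar, h, h']
  · simp [reflHom_X, reflVar, h, h']
  · simp [reflHom_X, reflVar, h]

/-- The simple reflections as automorphisms. -/
def simpleRefl (i : Fin n) : MvPowerSeries (Fin n) k ≃ₐ[k] MvPowerSeries (Fin n) k :=
  AlgEquiv.ofAlgHom (reflHom i) (reflHom i) (reflHom_reflHom i) (reflHom_reflHom i)

lemma simpleRefl_apply (i : Fin n) (f : MvPowerSeries (Fin n) k) : simpleRefl i f = reflHom i f := rfl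

lemma prev_ne {i : Fin n} (hi : i.1 ≠ 0) : prev i ≠ i := by
  intro h
  have := congrArg Fin.val h
  simp only [prev] at this
  omega

/-- The reflection and the identity agree on the hyperplane fixed by the reflection. -/
lemma dvd_simpleRefl_sub (i : Fin n) (hi : i.1 ≠ 0) (f : MvPowerSeries (Fin n) k) :
    X (prev i) - X i ∣ simpleRefl i f - f := by
  refine X_sub_X_dvd (prev_ne hi) (isSubst_reflHom i) IsSubst.id (fun l => ?_) f
  rw [reflHom_X, reflVar, if_neg hi, AlgHom.id_apply, mkSubst_X, mkSubst_X]
  rcases eq_or_ne l (prev i) with rfl | h1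
  · simp [(prev_ne hi).symm]
  rcases eq_or_ne l i with rfl | h2
  · simp [h1]
  · rw [Equiv.swap_apply_of_ne_of_ne h1 h2]

lemma dvd_simpleRefl_zero_sub (o : Fin n) (ho : o.1 = 0) (f : MvPowerSeries (Fin n) k) :
    X o ∣ simpleRefl o f - f := by
  refine X_dvd_of_subst_eq_zero _ _ ?_
  rw [map_sub, sub_eq_zero]
  set Z : MvPowerSeries (Fin n) k →ₐ[k] _ :=
    mkSubst (fun j => if j = o then 0 else X j) (fun j => by split_ifs <;> simp)
  have : Z.comp (reflHom o) = Z := by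
    refine ((isSubst_mkSubst _ _).comp (isSubst_reflHom o)).ext (isSubst_mkSubst _ _)
      fun l => ?_
    rw [AlgHom.comp_apply, reflHom_X, reflVar, if_pos ho]
    by_cases hl : l = o <;> simp [Z, hl]
  exact DFunLike.congr_fun this f

/-! ## The change of variables -/

section CharZero

variable [CharZero k]

/-- The power series `t` in `x_l` with constant term `1` and `t⁻¹ - t = x_l`. -/
def tser (k : Type*) [Field k] {n : ℕ} (l : Fin n) : MvPowerSeries (Fin n) k :=
  -- The root of t² + xt - 1 with constant term 1 is √(1 + x²/4) - x/2. The Catalan series c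
  -- satisfies √(1 - 4z) = 1 - 2z c(z); taking z = -x²/16 gives the square root 1 + (x²/8)
  -- c(-x²/16).
  1 + C (2⁻¹ : k) ^ 3 * X l ^ 2 *
    PowerSeries.subst (-(C (2⁻¹ : k) ^ 4 * X l ^ 2) : MvPowerSeries (Fin n) k)
      (PowerSeries.map (Nat.castRingHom k) PowerSeries.catalanSeries) - C (2⁻¹ : k) * X l

lemma tser_sq (l : Fin n) : tser k l ^ 2 + X l * tser k l - 1 = 0 := by
  have hs : PowerSeries.HasSubst (-(C (2⁻¹ : k) ^ 4 * X l ^ 2) : MvPowerSeries (Fin n) k) :=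
    PowerSeries.HasSubst.of_constantCoeff_zero (by simp)
  have h1 := congrArg (fun f => PowerSeries.subst
    (-(C (2⁻¹ : k) ^ 4 * X l ^ 2) : MvPowerSeries (Fin n) k)
    (PowerSeries.map (Nat.castRingHom k) f)) PowerSeries.catalanSeries_sq_mul_X_add_one
  simp only [map_add, map_mul, map_pow, map_one, PowerSeries.map_X] at h1
  rw [← PowerSeries.coe_substAlgHom hs, map_add, map_mul, map_pow, map_one,
    PowerSeries.substAlgHom_X] at h1
  rw [tser, ← PowerSeries.coe_substAlgHom hs]
  generalize PowerSeries.substAlgHom hs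
    (PowerSeries.map (Nat.castRingHom k) PowerSeries.catalanSeries) = c at *
  clear hs
  have h2 : (2 : MvPowerSeries (Fin n) k) * C (2⁻¹ : k) = 1 := by
    rw [← map_ofNat (C (σ := Fin n) (R := k)) 2, ← map_mul, mul_inv_cancel₀ two_ne_zero, map_one]
  generalize (C (2⁻¹ : k) : MvPowerSeries (Fin n) k) = h at *
  generalize (X l : MvPowerSeries (Fin n) k) = x at *
  linear_combination (-h ^ 2 * x ^ 2) * h1 +
    (h ^ 2 * x ^ 2 * c + h * x ^ 2 - x - h ^ 3 * x ^ 3 * c) * h2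

omit [CharZero k] in
lemma constantCoeff_tser (l : Fin n) : constantCoeff (tser k l) = 1 := by
  simp [tser]

/-- The difference of two solutions is annihilated by t + t' + g, whose constant term 2 is not zero.
-/
lemma tser_unique {t t' g : MvPowerSeries (Fin n) k} (h : t ^ 2 + g * t - 1 = 0)
    (h' : t' ^ 2 + g * t' - 1 = 0) (ht : constantCoeff t = 1) (ht' : constantCoeff t' = 1)
    (hg : constantCoeff g = 0) : t = t' := by
  have h1 : (t - t') * (t + t' + g) = 0 := by linear_combination h - h'
  rcases mul_eq_zero.1 h1 with h2 | h2
  · exact sub_eq_zero.1 h2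
  · have := congrArg constantCoeff h2
    rw [map_add, map_add, ht, ht', hg, map_zero] at this
    norm_num at this

omit [CharZero k] in
lemma tser_mul_inv (l : Fin n) : tser k l * (tser k l)⁻¹ = 1 :=
  MvPowerSeries.mul_inv_cancel _ (by rw [constantCoeff_tser]; exact one_ne_zero)

lemma inv_tser_sub (l : Fin n) : (tser k l)⁻¹ - tser k l = X l := by
  have h1 := tser_sq (k := k) l
  have h2 := tser_mul_inv (k := k) l
  linear_combination (-(tser k l)⁻¹) * h1 + (tser k l + X l) * h2

/-- To compute the image of t(x_l) under a substitution it suffices to exhibit a root of the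
transformed quadratic equation with constant term 1. -/
lemma IsSubst.map_tser_eq {f : MvPowerSeries (Fin n) k →ₐ[k] MvPowerSeries (Fin n) k}
    (hf : IsSubst f) (l : Fin n) {t : MvPowerSeries (Fin n) k}
    (h : t ^ 2 + f (X l) * t - 1 = 0) (ht : constantCoeff t = 1) : f (tser k l) = t := by
  refine tser_unique ?_ h ?_ ht (by rw [hf.constantCoeff_map, constantCoeff_X])
  · rw [← map_pow, ← map_mul, ← map_add, ← map_one f, ← map_sub, tser_sq, map_zero]
  · rw [hf.constantCoeff_map, constantCoeff_tser]

lemma simpleRefl_tser (i : Fin n) (hi : i.1 ≠ 0) (l : Fin n) :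
    simpleRefl i (tser k l) = tser k (Equiv.swap (prev i) i l) := by
  refine (isSubst_reflHom i).map_tser_eq l ?_ (constantCoeff_tser _)
  rw [reflHom_X, reflVar, if_neg hi, tser_sq]

lemma simpleRefl_zero_tser (o : Fin n) (ho : o.1 = 0) : simpleRefl o (tser k o) = (tser k o)⁻¹ := by
  refine (isSubst_reflHom o).map_tser_eq o ?_ (by
    rw [constantCoeff_inv, constantCoeff_tser]; exact inv_one)
  rw [reflHom_X, reflVar, if_pos ho, if_pos rfl]
  have h1 := tser_sq (k := k) o
  have h2 := tser_mul_inv (k := k) o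
  linear_combination (-(tser k o)⁻¹ ^ 2) * h1 +
    (tser k o * (tser k o)⁻¹ + 1 + X o * (tser k o)⁻¹) * h2

lemma simpleRefl_zero_tser_ne (o : Fin n) (ho : o.1 = 0) (l : Fin n) (hl : l ≠ o) :
    simpleRefl o (tser k l) = tser k l := by
  refine (isSubst_reflHom o).map_tser_eq l ?_ (constantCoeff_tser _)
  rw [reflHom_X, reflVar, if_pos ho, if_neg hl, tser_sq]

/-- The variable `X_l = c_l + Y_l` near the point `c`. -/
def nearVar (c : Fin n → kˣ) (l : Fin n) : MvPowerSeries (Fin n) k := C (c l : k) + X l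

omit [CharZero k] in
lemma constantCoeff_nearVar (c : Fin n → kˣ) (l : Fin n) :
    constantCoeff (nearVar c l) = c l := by simp [nearVar]

omit [CharZero k] in
lemma nearVar_mul_inv (c : Fin n → kˣ) (l : Fin n) : nearVar c l * (nearVar c l)⁻¹ = 1 :=
  MvPowerSeries.mul_inv_cancel _ (by rw [constantCoeff_nearVar]; exact (c l).ne_zero)

omit [CharZero k] in
lemma C_mul_C_inv (c : kˣ) : (C (c : k) * C (c : k)⁻¹ : MvPowerSeries (Fin n) k) = 1 := by
  rw [← map_mul, mul_inv_cancel₀ c.ne_zero, map_one]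

/-- The substitution `x_l ↦ c_l / X_l - X_l / c_l`. -/
def toNear (c : Fin n → kˣ) : MvPowerSeries (Fin n) k →ₐ[k] MvPowerSeries (Fin n) k :=
  mkSubst (fun l => C (c l : k) * (nearVar c l)⁻¹ - nearVar c l * C (c l : k)⁻¹) (fun l => by
    simp [constantCoeff_nearVar])

/-- The substitution `X_l ↦ c_l t(x_l)`. -/
def ofNear (c : Fin n → kˣ) : MvPowerSeries (Fin n) k →ₐ[k] MvPowerSeries (Fin n) k :=
  -- The variable of the source stands for X_l - c_l, hence the subtraction of 1.
  mkSubst (fun l => C (c l : k) * (tser k l - 1)) (fun l => by simp [constantCoeff_tser])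

omit [CharZero k] in
lemma ofNear_nearVar (c : Fin n → kˣ) (l : Fin n) :
    ofNear c (nearVar c l) = C (c l : k) * tser k l := by
  rw [nearVar, map_add, algHom_C, ofNear, mkSubst_X]
  ring

omit [CharZero k] in
lemma isSubst_ofNear (c : Fin n → kˣ) : IsSubst (ofNear c) := isSubst_mkSubst _ _

omit [CharZero k] in
lemma isSubst_toNear (c : Fin n → kˣ) : IsSubst (toNear c) := isSubst_mkSubst _ _

lemma toNear_tser (c : Fin n → kˣ) (l : Fin n) :
    toNear c (tser k l) = C (c l : k)⁻¹ * nearVar c l := by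
  refine (isSubst_toNear c).map_tser_eq l ?_ (by simp [constantCoeff_nearVar])
  rw [toNear, mkSubst_X]
  have h1 := nearVar_mul_inv c l
  have h2 := C_mul_C_inv (n := n) (c l)
  linear_combination C (c l : k) * C (c l : k)⁻¹ * h1 + h2

omit [CharZero k] in
lemma C_mul_inv (c : kˣ) (f : MvPowerSeries (Fin n) k) :
    (C (c : k) * f)⁻¹ = C (c : k)⁻¹ * f⁻¹ := by
  rw [MvPowerSeries.mul_inv_rev, C_inv, mul_comm]

lemma ofNear_toNear (c : Fin n → kˣ) :
    (ofNear c).comp (toNear c) = AlgHom.id k (MvPowerSeries (Fin n) k) := by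
  refine ((isSubst_ofNear c).comp (isSubst_toNear c)).ext IsSubst.id fun l => ?_
  rw [AlgHom.comp_apply, toNear, mkSubst_X, map_sub, map_mul, map_mul,
    (isSubst_ofNear c).map_inv, ofNear_nearVar, algHom_C, algHom_C, C_mul_inv, AlgHom.id_apply,
    ← inv_tser_sub]
  have h2 := C_mul_C_inv (n := n) (c l)
  linear_combination ((tser k l)⁻¹ - tser k l) * h2

lemma toNear_ofNear (c : Fin n → kˣ) :
    (toNear c).comp (ofNear c) = AlgHom.id k (MvPowerSeries (Fin n) k) := by
  refine ((isSubst_toNear c).comp (isSubst_ofNear c)).ext IsSubst.id fun l => ?_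
  rw [AlgHom.comp_apply, ofNear, mkSubst_X, map_mul, map_sub, map_one, toNear_tser, algHom_C,
    AlgHom.id_apply]
  have h2 := C_mul_C_inv (n := n) (c l)
  rw [nearVar]
  linear_combination (C (c l : k) + X l) * h2

/-- The change of variables `x_l ↦ c_l / X_l - X_l / c_l` as an isomorphism from the power series
in the `x_l` to the power series in the `X_l - c_l`. -/
def near (c : Fin n → kˣ) : MvPowerSeries (Fin n) k ≃ₐ[k] MvPowerSeries (Fin n) k :=
  AlgEquiv.ofAlgHom (toNear c) (ofNear c) (toNear_ofNear c) (ofNear_toNear c)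

end CharZero

end PowerSeries

namespace EnhancedQuiver

/-! ## Isotropic compositions -/

section Comp

variable {J : Type*} {Γ : EnhancedQuiver J} {β : J →₀ ℕ} {n : ℕ}

lemma Comp.s_apply {i : Fin n} (hi : i.1 ≠ 0) (ν : Γ.Comp β n) (l : Fin n) :
    (ν.s i) l = ν (Equiv.swap (prev i) i l) := by
  change Γ.weylSeq i ν l = _
  rw [weylSeq, if_neg hi]

lemma Comp.s_apply_zero {o : Fin n} (ho : o.1 = 0) (ν : Γ.Comp β n) :
    (ν.s o) o = Γ.θ (ν o) := by
  change Γ.weylSeq o ν o = _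
  rw [weylSeq, if_pos ho, Function.update_self]

lemma Comp.s_apply_zero_ne {o : Fin n} (ho : o.1 = 0) (ν : Γ.Comp β n) {l : Fin n} (hl : l ≠ o) :
    (ν.s o) l = ν l := by
  change Γ.weylSeq o ν l = _
  rw [weylSeq, if_pos ho, Function.update_of_ne hl]

lemma Comp.ext' {ν μ : Γ.Comp β n} (h : ∀ l, ν l = μ l) : ν = μ := Subtype.ext (funext h)

@[simp] lemma Comp.s_s (i : Fin n) (ν : Γ.Comp β n) : (ν.s i).s i = ν := by
  refine Comp.ext' fun l => ?_
  by_cases hi : i.1 = 0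
  · by_cases hl : l = i
    · subst hl
      rw [Comp.s_apply_zero hi, Comp.s_apply_zero hi, Γ.θ_invol]
    · rw [Comp.s_apply_zero_ne hi _ hl, Comp.s_apply_zero_ne hi _ hl]
  · rw [Comp.s_apply hi, Comp.s_apply hi, Equiv.swap_apply_self]

lemma swap_swap_comm {i j : Fin n} (h : i.1 + 1 < j.1) (l : Fin n) :
    Equiv.swap (prev i) i (Equiv.swap (prev j) j l) =
      Equiv.swap (prev j) j (Equiv.swap (prev i) i l) := by
  have : Commute (Equiv.swap (prev i) i) (Equiv.swap (prev j) j) := by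
    refine (Equiv.Perm.disjoint_iff_disjoint_support.2 ?_).commute
    rw [Finset.disjoint_left]
    intro a ha hb
    have ha' := Equiv.Perm.mem_support.1 ha
    have hb' := Equiv.Perm.mem_support.1 hb
    have h1 : a = prev i ∨ a = i := by
      by_contra hc
      push Not at hc
      exact ha' (Equiv.swap_apply_of_ne_of_ne hc.1 hc.2)
    have h2 : a = prev j ∨ a = j := by
      by_contra hc
      push Not at hc
      exact hb' (Equiv.swap_apply_of_ne_of_ne hc.1 hc.2)
    have hi1 : (prev i).1 = i.1 - 1 := rfl
    have hj1 : (prev j).1 = j.1 - 1 := rfl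
    rcases h1 with h1 | h1 <;> rcases h2 with h2 | h2 <;>
    · have := congrArg Fin.val (h1.symm.trans h2)
      omega
  exact DFunLike.congr_fun this l

lemma swap_swap_braid {i j : Fin n} (hi : i.1 ≠ 0) (hj : j.1 = i.1 + 1) (l : Fin n) :
    Equiv.swap (prev i) i (Equiv.swap (prev j) j (Equiv.swap (prev i) i l)) =
      Equiv.swap (prev j) j (Equiv.swap (prev i) i (Equiv.swap (prev j) j l)) := by
  have hp : prev j = i := Fin.ext (by simp [prev, hj])
  have h1 : prev i ≠ i := prev_ne hi
  have h2 : i ≠ j := fun h => by have := congrArg Fin.val h; omega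
  have h3 : prev i ≠ j := fun h => by
    have := congrArg Fin.val h; simp only [prev] at this; omega
  rw [hp]
  have e1 := Equiv.swap_mul_swap_mul_swap (x := prev i) (y := i) (z := j) h1 h3
  have e2 := Equiv.swap_mul_swap_mul_swap (x := j) (y := i) (z := prev i) h2.symm h3.symm
  have e3 := e2.trans (Equiv.swap_comm _ _)
  simp only [Equiv.swap_comm j i, Equiv.swap_comm i (prev i)] at *
  exact (DFunLike.congr_fun (e1.trans e3.symm) l).symm

lemma Comp.s_comm {i j : Fin n} (h : i.1 + 1 < j.1) (ν : Γ.Comp β n) :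
    (ν.s i).s j = (ν.s j).s i := by
  have hj : j.1 ≠ 0 := by omega
  refine Comp.ext' fun l => ?_
  by_cases hi : i.1 = 0
  · have hji : j ≠ i := fun h' => by have := congrArg Fin.val h'; omega
    have hpi : prev j ≠ i := fun h' => by
      have := congrArg Fin.val h'; simp only [prev] at this; omega
    rw [Comp.s_apply hj]
    by_cases hl : l = i
    · subst hl
      rw [Equiv.swap_apply_of_ne_of_ne hpi.symm hji.symm, Comp.s_apply_zero hi,
        Comp.s_apply_zero hi, Comp.s_apply hj, Equiv.swap_apply_of_ne_of_ne hpi.symm hji.symm]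
    · rw [Comp.s_apply_zero_ne hi _ hl, Comp.s_apply hj, Comp.s_apply_zero_ne hi]
      intro hc
      apply hl
      rw [← Equiv.swap_apply_self (prev j) j l, hc,
        Equiv.swap_apply_of_ne_of_ne hpi.symm hji.symm]
  · simp only [Comp.s_apply hi, Comp.s_apply hj, swap_swap_comm h]

lemma Comp.s_braid {i j : Fin n} (hi : i.1 ≠ 0) (hj : j.1 = i.1 + 1) (ν : Γ.Comp β n) :
    ((ν.s i).s j).s i = ((ν.s j).s i).s j := by
  have hj0 : j.1 ≠ 0 := by omega
  refine Comp.ext' fun l => ?_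
  simp only [Comp.s_apply hi, Comp.s_apply hj0, swap_swap_braid hi hj]

lemma prev_eq_of_one {o i : Fin n} (ho : o.1 = 0) (hi : i.1 = 1) : prev i = o :=
  Fin.ext (by simp [prev, ho, hi])

lemma ne_of_one {o i : Fin n} (ho : o.1 = 0) (hi : i.1 = 1) : i ≠ o := fun h => by
  have := congrArg Fin.val h; omega

lemma Comp.s_braid_zero {o i : Fin n} (ho : o.1 = 0) (hi : i.1 = 1) (ν : Γ.Comp β n) :
    (((ν.s o).s i).s o).s i = (((ν.s i).s o).s i).s o := by
  have hi0 : i.1 ≠ 0 := by omega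
  have hp := prev_eq_of_one ho hi
  have hio := ne_of_one ho hi
  refine Comp.ext' fun l => ?_
  by_cases hlo : l = o
  · subst hlo
    simp [Comp.s_apply hi0, hp, Comp.s_apply_zero ho, Comp.s_apply_zero_ne ho _ hio]
  by_cases hli : l = i
  · subst hli
    simp [Comp.s_apply hi0, hp, Comp.s_apply_zero ho, Comp.s_apply_zero_ne ho _ hio]
  · simp [Comp.s_apply hi0, hp, Comp.s_apply_zero_ne ho _ hlo,
      Equiv.swap_apply_of_ne_of_ne hlo hli]

end Comp

/-! ## The action of the Weyl group on the field of fractions -/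

section Field

variable (k : Type*) [Field k] (n : ℕ)

/-- The field of fractions of `k[[x_1, …, x_n]]`. -/
def PSField : Type _ := FractionRing (MvPowerSeries (Fin n) k)

instance : Field (PSField k n) := inferInstanceAs (Field (FractionRing (MvPowerSeries (Fin n) k)))
instance : Algebra (MvPowerSeries (Fin n) k) (PSField k n) :=
  inferInstanceAs (Algebra (MvPowerSeries (Fin n) k) (FractionRing (MvPowerSeries (Fin n) k)))
instance : Algebra k (PSField k n) :=
  inferInstanceAs (Algebra k (FractionRing (MvPowerSeries (Fin n) k)))
instance : IsScalarTower k (MvPowerSeries (Fin n) k) (PSField k n) :=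
  inferInstanceAs (IsScalarTower k (MvPowerSeries (Fin n) k)
    (FractionRing (MvPowerSeries (Fin n) k)))
instance : IsFractionRing (MvPowerSeries (Fin n) k) (PSField k n) :=
  inferInstanceAs (IsFractionRing (MvPowerSeries (Fin n) k)
    (FractionRing (MvPowerSeries (Fin n) k)))

variable {k n}

/-- The variables. -/
def fieldX (l : Fin n) : PSField k n := algebraMap (MvPowerSeries (Fin n) k) _ (MvPowerSeries.X l)

/-- The simple reflections. -/
def sK (i : Fin n) : PSField k n ≃ₐ[k] PSField k n :=
  IsFractionRing.algEquivOfAlgEquiv (simpleRefl i)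

lemma sK_algebraMap (i : Fin n) (f : MvPowerSeries (Fin n) k) :
    sK i (algebraMap (MvPowerSeries (Fin n) k) (PSField k n) f) =
      algebraMap _ _ (simpleRefl i f) := by
  have := IsFractionRing.algEquivOfAlgEquiv_algebraMap (K := PSField k n) (L := PSField k n)
    (simpleRefl (k := k) i) f
  exact this

lemma sK_fieldX {i : Fin n} (hi : i.1 ≠ 0) (l : Fin n) :
    sK i (fieldX l : PSField k n) = fieldX (Equiv.swap (prev i) i l) := by
  rw [fieldX, sK_algebraMap, simpleRefl_apply, reflHom_X, reflVar, if_neg hi, fieldX]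

lemma sK_zero_fieldX {o : Fin n} (ho : o.1 = 0) :
    sK o (fieldX o : PSField k n) = - fieldX o := by
  rw [fieldX, sK_algebraMap, simpleRefl_apply, reflHom_X, reflVar, if_pos ho, if_pos rfl, map_neg]

lemma sK_zero_fieldX_ne {o : Fin n} (ho : o.1 = 0) {l : Fin n} (hl : l ≠ o) :
    sK o (fieldX l : PSField k n) = fieldX l := by
  rw [fieldX, sK_algebraMap, simpleRefl_apply, reflHom_X, reflVar, if_pos ho, if_neg hl]

lemma field_ext {f g : PSField k n →+* PSField k n}
    (h : ∀ x, f (algebraMap (MvPowerSeries (Fin n) k) _ x) = g (algebraMap _ _ x)) : f = g := by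
  ext x
  obtain ⟨a, b, -, rfl⟩ := IsFractionRing.div_surjective (MvPowerSeries (Fin n) k) x
  simp [h]

@[simp] lemma sK_sK (i : Fin n) (x : PSField k n) : sK i (sK i x) = x := by
  have : ((sK i : PSField k n ≃ₐ[k] PSField k n) : PSField k n →+* PSField k n).comp
      ((sK i : PSField k n ≃ₐ[k] PSField k n) : PSField k n →+* PSField k n) = RingHom.id _ := by
    refine field_ext fun x => ?_
    change sK i (sK i _) = _
    rw [sK_algebraMap, sK_algebraMap]
    exact congrArg _ (DFunLike.congr_fun (reflHom_reflHom i) x)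
  exact DFunLike.congr_fun this x

/-- The homomorphism attached to a word in the simple reflections. -/
def reflWord : List (Fin n) → MvPowerSeries (Fin n) k →ₐ[k] MvPowerSeries (Fin n) k
  | [] => AlgHom.id k _
  | i :: w => (reflHom i).comp (reflWord w)

lemma isSubst_reflWord : ∀ w : List (Fin n), IsSubst (reflWord (k := k) w)
  | [] => IsSubst.id
  | i :: w => (isSubst_reflHom i).comp (isSubst_reflWord w)

/-- The automorphism attached to a word in the simple reflections. -/
def sKWord : List (Fin n) → PSField k n → PSField k n
  | [], x => x
  | i :: w, x => sK i (sKWord w x)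

lemma sKWord_algebraMap (w : List (Fin n)) (x : MvPowerSeries (Fin n) k) :
    sKWord w (algebraMap _ (PSField k n) x) = algebraMap _ _ (reflWord w x) := by
  induction w with
  | nil => rfl
  | cons i w ih => rw [sKWord, ih, sK_algebraMap]; rfl

lemma sKWord_div (w : List (Fin n)) (x y : PSField k n) :
    sKWord w (x / y) = sKWord w x / sKWord w y := by
  induction w with
  | nil => rfl
  | cons i w ih => simp only [sKWord, ih, map_div₀]

/-- On power series both words act by substitutions, which are determined by the variables;
fractions follow. -/
lemma sKWord_ext {w w' : List (Fin n)}
    (h : ∀ l, sKWord w (fieldX l : PSField k n) = sKWord w' (fieldX l)) (x : PSField k n) :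
    sKWord w x = sKWord w' x := by
  have : reflWord (k := k) w = reflWord w' := by
    refine (isSubst_reflWord w).ext (isSubst_reflWord w') fun l => ?_
    have := h l
    rw [fieldX, sKWord_algebraMap, sKWord_algebraMap] at this
    exact IsFractionRing.injective _ _ this
  obtain ⟨a, b, -, rfl⟩ := IsFractionRing.div_surjective (MvPowerSeries (Fin n) k) x
  simp only [sKWord_div, sKWord_algebraMap, this]

lemma sK_comm {i j : Fin n} (h : i.1 + 1 < j.1) (x : PSField k n) :
    sK i (sK j x) = sK j (sK i x) := by
  refine sKWord_ext (w := [i, j]) (w' := [j, i]) (fun l => ?_) x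
  have hj : j.1 ≠ 0 := by omega
  simp only [sKWord]
  by_cases hi : i.1 = 0
  · have hji : j ≠ i := fun h' => by have := congrArg Fin.val h'; omega
    have hpi : prev j ≠ i := fun h' => by
      have := congrArg Fin.val h'; simp only [prev] at this; omega
    by_cases hl : l = i
    · subst hl
      rw [sK_fieldX hj, Equiv.swap_apply_of_ne_of_ne hpi.symm hji.symm, sK_zero_fieldX hi,
        map_neg, sK_fieldX hj, Equiv.swap_apply_of_ne_of_ne hpi.symm hji.symm]
    · rw [sK_zero_fieldX_ne hi hl, sK_fieldX hj, sK_zero_fieldX_ne hi]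
      intro hc
      apply hl
      rw [← Equiv.swap_apply_self (prev j) j l, hc,
        Equiv.swap_apply_of_ne_of_ne hpi.symm hji.symm]
  · rw [sK_fieldX hj, sK_fieldX hi, sK_fieldX hi, sK_fieldX hj, swap_swap_comm h]

lemma sK_braid {i j : Fin n} (hi : i.1 ≠ 0) (hj : j.1 = i.1 + 1) (x : PSField k n) :
    sK i (sK j (sK i x)) = sK j (sK i (sK j x)) := by
  refine sKWord_ext (w := [i, j, i]) (w' := [j, i, j]) (fun l => ?_) x
  have hj0 : j.1 ≠ 0 := by omega
  simp only [sKWord, sK_fieldX hi, sK_fieldX hj0, swap_swap_braid hi hj]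

lemma sK_braid_zero {o i : Fin n} (ho : o.1 = 0) (hi : i.1 = 1) (x : PSField k n) :
    sK o (sK i (sK o (sK i x))) = sK i (sK o (sK i (sK o x))) := by
  refine sKWord_ext (w := [o, i, o, i]) (w' := [i, o, i, o]) (fun l => ?_) x
  have hi0 : i.1 ≠ 0 := by omega
  have hp := prev_eq_of_one ho hi
  have hio := ne_of_one ho hi
  by_cases hlo : l = o
  · subst hlo
    simp [sKWord, sK_fieldX hi0, hp, sK_zero_fieldX ho, sK_zero_fieldX_ne ho hio]
  by_cases hli : l = i
  · subst hli
    simp [sKWord, sK_fieldX hi0, hp, sK_zero_fieldX ho, sK_zero_fieldX_ne ho hio]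
  · simp [sKWord, sK_fieldX hi0, hp, sK_zero_fieldX_ne ho hlo,
      Equiv.swap_apply_of_ne_of_ne hlo hli]

lemma fieldX_ne_zero (l : Fin n) : (fieldX l : PSField k n) ≠ 0 := by
  rw [fieldX, Ne, IsFractionRing.to_map_eq_zero_iff]
  intro h
  have := congrArg (MvPowerSeries.coeff (Finsupp.single l 1)) h
  simp [MvPowerSeries.coeff_X] at this

lemma fieldX_add_ne_zero {l m : Fin n} (h : l ≠ m) (c : k) :
    (fieldX l + algebraMap k _ c * fieldX m : PSField k n) ≠ 0 := by
  rw [IsScalarTower.algebraMap_apply k (MvPowerSeries (Fin n) k), fieldX, fieldX, ← map_mul,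
    ← map_add, Ne, IsFractionRing.to_map_eq_zero_iff]
  intro h'
  have := congrArg (MvPowerSeries.coeff (Finsupp.single l 1)) h'
  rw [← Algebra.smul_def] at this
  simp [MvPowerSeries.coeff_X, Finsupp.single_left_inj, h] at this

lemma fieldX_sub_ne_zero {l m : Fin n} (h : l ≠ m) : (fieldX l - fieldX m : PSField k n) ≠ 0 := by
  simpa [sub_eq_add_neg] using fieldX_add_ne_zero (k := k) h (-1)

lemma fieldX_add_ne_zero' {l m : Fin n} (h : l ≠ m) : (fieldX l + fieldX m : PSField k n) ≠ 0 := by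
  simpa using fieldX_add_ne_zero (k := k) h 1

end Field

end EnhancedQuiver

namespace EnhancedQuiver

/-! ## Operators -/

section Op

variable (k : Type*) [Field k] {J : Type*} (Γ : EnhancedQuiver J) (β : J →₀ ℕ) (n : ℕ)

/-- The product of the fields of fractions over all isotropic compositions. -/
abbrev RatSpace : Type _ := Γ.Comp β n → PSField k n

variable {k Γ β n}

/-- The operator `A σ_i + B`. -/
def op (i : Fin n) (A B : RatSpace k Γ β n) : Module.End k (RatSpace k Γ β n) where
  toFun F ν := A ν * sK i (F (ν.s i)) + B ν * F ν
  map_add' F G := by ext ν; simp only [Pi.add_apply, map_add]; ring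
  map_smul' c F := by
    ext ν
    simp only [Pi.smul_apply, map_smul, RingHom.id_apply, smul_add, mul_smul_comm]

/-- Multiplication operators. -/
abbrev mulOp : RatSpace k Γ β n →ₐ[k] Module.End k (RatSpace k Γ β n) :=
  Algebra.lmul k (RatSpace k Γ β n)

/-- The action of `σ_i` on functions. -/
def sV (i : Fin n) (F : RatSpace k Γ β n) : RatSpace k Γ β n := fun ν => sK i (F (ν.s i))

lemma op_apply (i : Fin n) (A B F : RatSpace k Γ β n) : op i A B F = A * sV i F + B * F := rfl

lemma sV_mul (i : Fin n) (F G : RatSpace k Γ β n) : sV i (F * G) = sV i F * sV i G := by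
  ext ν; simp [sV]

@[simp] lemma sV_sV (i : Fin n) (F : RatSpace k Γ β n) : sV i (sV i F) = F := by
  ext ν; simp [sV]

/-- The twisted Leibniz rule: σ_i is multiplicative, so only the identity part B leaves a remainder.
-/
lemma op_mul_mulOp (i : Fin n) (A B F : RatSpace k Γ β n) :
    op i A B * mulOp F = mulOp (sV i F) * op i A B + mulOp (B * (F - sV i F)) := by
  refine LinearMap.ext fun G => ?_
  simp only [Module.End.mul_apply, LinearMap.add_apply, Algebra.coe_lmul_eq_mul,
    LinearMap.mul_apply', op_apply, sV_mul]
  ring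

lemma mulOp_mul_op (i : Fin n) (A B F : RatSpace k Γ β n) :
    mulOp F * op i A B = op i A B * mulOp (sV i F) + mulOp (B * (F - sV i F)) := by
  rw [op_mul_mulOp, sV_sV, add_assoc, ← map_add]
  simp only [← mul_add, sub_add_sub_cancel, sub_self, mul_zero, map_zero, add_zero]

open Classical in
-- As σ_i carries the summand ν to s_iν, its coefficient is read off at the target s_iν, and that of
-- the identity at ν.
lemma op_single (i : Fin n) (A B : RatSpace k Γ β n) (ν : Γ.Comp β n) (f : PSField k n) :
    op i A B (Pi.single ν f) =
      Pi.single (ν.s i) (A (ν.s i) * sK i f) + Pi.single ν (B ν * f) := by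
  ext μ
  simp only [op_apply, sV, Pi.add_apply, Pi.mul_apply]
  congr 1
  · by_cases h : μ = ν.s i
    · subst h; simp
    · rw [Pi.single_eq_of_ne h, Pi.single_eq_of_ne, map_zero, mul_zero]
      rintro rfl
      exact h (Comp.s_s i μ).symm
  · by_cases h : μ = ν
    · subst h; simp
    · rw [Pi.single_eq_of_ne h, Pi.single_eq_of_ne h, mul_zero]

open Classical in
lemma mulOp_single (F : RatSpace k Γ β n) (ν : Γ.Comp β n) (f : PSField k n) :
    mulOp F (Pi.single ν f) = Pi.single ν (F ν * f) := by
  ext μ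
  simp only [Algebra.coe_lmul_eq_mul, LinearMap.mul_apply', Pi.mul_apply]
  by_cases h : μ = ν
  · subst h; simp
  · rw [Pi.single_eq_of_ne h, Pi.single_eq_of_ne h, mul_zero]

open Classical in
lemma End_ext {X Y : Module.End k (RatSpace k Γ β n)}
    (h : ∀ ν f, X (Pi.single ν f) = Y (Pi.single ν f)) : X = Y :=
  LinearMap.pi_ext h

open Classical in
-- Relations that carry an idempotent e(ν) may be tested on functions supported at ν.
lemma mul_idem_eq {X Y : Module.End k (RatSpace k Γ β n)} (ν : Γ.Comp β n)
    (h : ∀ f, X (Pi.single ν f) = Y (Pi.single ν f)) :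
    X * mulOp (Pi.single ν 1) = Y * mulOp (Pi.single ν 1) := by
  refine End_ext fun μ f => ?_
  simp only [Module.End.mul_apply, mulOp_single]
  by_cases hμ : μ = ν
  · subst hμ
    exact h _
  · rw [Pi.single_eq_of_ne hμ, zero_mul, Pi.single_zero, map_zero, map_zero]

open Classical in
lemma op_comm {i j : Fin n} (hij : i.1 + 1 < j.1) (A B A' B' : RatSpace k Γ β n)
    (h : ∀ ν : Γ.Comp β n, sK i (A' (ν.s j)) = A' ((ν.s j).s i) ∧ sK i (B' ν) = B' (ν.s i) ∧
      sK j (A (ν.s i)) = A ((ν.s j).s i) ∧ sK j (B ν) = B (ν.s j)) :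
    op i A B * op j A' B' = op j A' B' * op i A B := by
  refine End_ext fun ν f => ?_
  obtain ⟨h1, h2, h3, h4⟩ := h ν
  simp only [Module.End.mul_apply, op_single, map_add, map_mul, h1, h2, h3, h4,
    Comp.s_comm hij, sK_comm hij]
  have e : ∀ a b c : PSField k n, a * (b * c) = b * (a * c) := fun a b c => by ring
  rw [e (A' ((ν.s j).s i)), e (A' (ν.s j)), e (B' (ν.s i)), e (B' ν)]
  abel

open Classical in
lemma op_op_op (i j : Fin n) (A B A' B' : RatSpace k Γ β n) (ν : Γ.Comp β n) (f : PSField k n) :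
    (op i A B * op j A' B' * op i A B) (Pi.single ν f) =
      Pi.single (((ν.s i).s j).s i) (A (((ν.s i).s j).s i) * sK i (A' ((ν.s i).s j)) *
        sK i (sK j (A (ν.s i))) * sK i (sK j (sK i f))) +
      Pi.single ((ν.s j).s i) (A ((ν.s j).s i) * sK i (A' (ν.s j)) * sK i (sK j (B ν)) *
        sK i (sK j f)) +
      Pi.single ((ν.s i).s j) (B ((ν.s i).s j) * A' ((ν.s i).s j) * sK j (A (ν.s i)) *
        sK j (sK i f)) +
      Pi.single (ν.s j) (B (ν.s j) * A' (ν.s j) * sK j (B ν) * sK j f) +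
      Pi.single (ν.s i) ((A (ν.s i) * sK i (B' ν) * sK i (B ν) +
        B (ν.s i) * B' (ν.s i) * A (ν.s i)) * sK i f) +
      Pi.single ν ((A ν * sK i (B' (ν.s i)) * sK i (A (ν.s i)) + B ν * B' ν * B ν) * f) := by
  simp only [Module.End.mul_apply, op_single, map_add, map_mul, Comp.s_s, sK_sK, add_mul,
    Pi.single_add, mul_assoc]
  abel

open Classical in
-- Both triple products expand along the six elements of the group generated by the two reflections.
-- The hypotheses compare these coefficients one by one; an error is permitted only at the identity.
lemma op_braid {i j : Fin n} (hi : i.1 ≠ 0) (hj : j.1 = i.1 + 1)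
    (A B A' B' : RatSpace k Γ β n) (ν : Γ.Comp β n) (g : PSField k n)
    (h : A' (((ν.s i).s j).s i) * sK j (A ((ν.s j).s i)) * sK j (sK i (A' (ν.s j))) =
      A (((ν.s i).s j).s i) * sK i (A' ((ν.s i).s j)) * sK i (sK j (A (ν.s i))))
    (h_ij : A ((ν.s j).s i) * sK i (A' (ν.s j)) * sK i (sK j (B ν)) =
      B' ((ν.s j).s i) * A ((ν.s j).s i) * sK i (A' (ν.s j)))
    (h_ji : A' ((ν.s i).s j) * sK j (A (ν.s i)) * sK j (sK i (B' ν)) =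
      B ((ν.s i).s j) * A' ((ν.s i).s j) * sK j (A (ν.s i)))
    (h_i : B' (ν.s i) * A (ν.s i) * sK i (B' ν) = A (ν.s i) * sK i (B' ν) * sK i (B ν) +
        B (ν.s i) * B' (ν.s i) * A (ν.s i))
    (h_j : B (ν.s j) * A' (ν.s j) * sK j (B ν) = A' (ν.s j) * sK j (B ν) * sK j (B' ν) +
        B' (ν.s j) * B (ν.s j) * A' (ν.s j))
    (h_one : A' ν * sK j (B (ν.s j)) * sK j (A' (ν.s j)) + B' ν * B ν * B' ν =
      A ν * sK i (B' (ν.s i)) * sK i (A (ν.s i)) + B ν * B' ν * B ν + g) (f : PSField k n) :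
    (op j A' B' * op i A B * op j A' B' - op i A B * op j A' B' * op i A B) (Pi.single ν f) =
      Pi.single ν (g * f) := by
  rw [LinearMap.sub_apply, op_op_op, op_op_op, ← Comp.s_braid hi hj, ← sK_braid hi hj, h, h_ij,
    h_ji, h_i, h_j, h_one, add_mul _ g, Pi.single_add]
  abel

open Classical in
lemma op_op_op_op (i j : Fin n) (A B A' B' : RatSpace k Γ β n) (ν : Γ.Comp β n)
    (f : PSField k n) :
    (op i A B * op j A' B' * op i A B * op j A' B') (Pi.single ν f) =
      Pi.single ((((ν.s j).s i).s j).s i) (A ((((ν.s j).s i).s j).s i) *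
        sK i (A' (((ν.s j).s i).s j)) * sK i (sK j (A ((ν.s j).s i))) *
        sK i (sK j (sK i (A' (ν.s j)))) * sK i (sK j (sK i (sK j f)))) +
      Pi.single (((ν.s i).s j).s i) (A (((ν.s i).s j).s i) * sK i (A' ((ν.s i).s j)) *
        sK i (sK j (A (ν.s i))) * sK i (sK j (sK i (B' ν))) * sK i (sK j (sK i f))) +
      Pi.single (((ν.s j).s i).s j) (B (((ν.s j).s i).s j) * A' (((ν.s j).s i).s j) *
        sK j (A ((ν.s j).s i)) * sK j (sK i (A' (ν.s j))) * sK j (sK i (sK j f))) +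
      Pi.single ((ν.s j).s i) ((A ((ν.s j).s i) * sK i (A' (ν.s j)) * sK i (sK j (B ν)) *
          sK i (sK j (B' ν)) + B ((ν.s j).s i) * B' ((ν.s j).s i) * A ((ν.s j).s i) *
          sK i (A' (ν.s j)) + A ((ν.s j).s i) * sK i (B' (ν.s j)) * sK i (B (ν.s j)) *
          sK i (A' (ν.s j))) * sK i (sK j f)) +
      Pi.single ((ν.s i).s j) (B ((ν.s i).s j) * A' ((ν.s i).s j) * sK j (A (ν.s i)) *
        sK j (sK i (B' ν)) * sK j (sK i f)) +
      Pi.single (ν.s i) ((A (ν.s i) * sK i (A' ν) * sK i (sK j (B (ν.s j))) *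
          sK i (sK j (A' (ν.s j))) + A (ν.s i) * sK i (B' ν) * sK i (B ν) * sK i (B' ν) +
          B (ν.s i) * B' (ν.s i) * A (ν.s i) * sK i (B' ν)) * sK i f) +
      Pi.single (ν.s j) ((A (ν.s j) * sK i (B' ((ν.s j).s i)) * sK i (A ((ν.s j).s i)) *
          A' (ν.s j) + B (ν.s j) * A' (ν.s j) * sK j (B ν) * sK j (B' ν) +
          B (ν.s j) * B' (ν.s j) * B (ν.s j) * A' (ν.s j)) * sK j f) +
      Pi.single ν ((A ν * sK i (B' (ν.s i)) * sK i (A (ν.s i)) * B' ν +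
          B ν * A' ν * sK j (B (ν.s j)) * sK j (A' (ν.s j)) + B ν * B' ν * B ν * B' ν) * f) := by
  simp only [Module.End.mul_apply, op_single, map_add, map_mul, Comp.s_s, sK_sK, add_mul,
    Pi.single_add, mul_assoc]
  abel

open Classical in
/-- The braid relation of type `B_2` for operators, with error terms. -/
lemma op_braid_zero {o i : Fin n} (ho : o.1 = 0) (hi : i.1 = 1)
    (A₀ B₀ A B : RatSpace k Γ β n) (ν : Γ.Comp β n) (g g₀ g₁ : PSField k n)
    (h : A ((((ν.s o).s i).s o).s i) * sK i (A₀ (((ν.s o).s i).s o)) *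
        sK i (sK o (A ((ν.s o).s i))) * sK i (sK o (sK i (A₀ (ν.s o)))) =
      A₀ ((((ν.s o).s i).s o).s i) * sK o (A (((ν.s i).s o).s i)) *
        sK o (sK i (A₀ ((ν.s i).s o))) * sK o (sK i (sK o (A (ν.s i)))))
    (h_ioi : A (((ν.s i).s o).s i) * sK i (A₀ ((ν.s i).s o)) * sK i (sK o (A (ν.s i))) *
        sK i (sK o (sK i (B₀ ν))) =
      B₀ (((ν.s i).s o).s i) * A (((ν.s i).s o).s i) * sK i (A₀ ((ν.s i).s o)) *
        sK i (sK o (A (ν.s i))))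
    (h_oio : B (((ν.s o).s i).s o) * A₀ (((ν.s o).s i).s o) * sK o (A ((ν.s o).s i)) *
        sK o (sK i (A₀ (ν.s o))) =
      A₀ (((ν.s o).s i).s o) * sK o (A ((ν.s o).s i)) * sK o (sK i (A₀ (ν.s o))) *
        sK o (sK i (sK o (B ν))))
    (h_io : A ((ν.s o).s i) * sK i (A₀ (ν.s o)) * sK i (sK o (B ν)) * sK i (sK o (B₀ ν)) +
        B ((ν.s o).s i) * B₀ ((ν.s o).s i) * A ((ν.s o).s i) * sK i (A₀ (ν.s o)) +
        A ((ν.s o).s i) * sK i (B₀ (ν.s o)) * sK i (B (ν.s o)) * sK i (A₀ (ν.s o)) =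
      B₀ ((ν.s o).s i) * A ((ν.s o).s i) * sK i (A₀ (ν.s o)) * sK i (sK o (B ν)))
    (h_oi : B ((ν.s i).s o) * A₀ ((ν.s i).s o) * sK o (A (ν.s i)) * sK o (sK i (B₀ ν)) =
      A₀ ((ν.s i).s o) * sK o (A (ν.s i)) * sK o (sK i (B₀ ν)) * sK o (sK i (B ν)) +
        B₀ ((ν.s i).s o) * B ((ν.s i).s o) * A₀ ((ν.s i).s o) * sK o (A (ν.s i)) +
        A₀ ((ν.s i).s o) * sK o (B (ν.s i)) * sK o (B₀ (ν.s i)) * sK o (A (ν.s i)))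
    (h_i : A (ν.s i) * sK i (A₀ ν) * sK i (sK o (B (ν.s o))) * sK i (sK o (A₀ (ν.s o))) +
        A (ν.s i) * sK i (B₀ ν) * sK i (B ν) * sK i (B₀ ν) +
        B (ν.s i) * B₀ (ν.s i) * A (ν.s i) * sK i (B₀ ν) =
      A₀ (ν.s i) * sK o (B ((ν.s i).s o)) * sK o (A₀ ((ν.s i).s o)) * A (ν.s i) +
        B₀ (ν.s i) * A (ν.s i) * sK i (B₀ ν) * sK i (B ν) +
        B₀ (ν.s i) * B (ν.s i) * B₀ (ν.s i) * A (ν.s i) + g₁)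
    (h_o : A (ν.s o) * sK i (B₀ ((ν.s o).s i)) * sK i (A ((ν.s o).s i)) * A₀ (ν.s o) +
        B (ν.s o) * A₀ (ν.s o) * sK o (B ν) * sK o (B₀ ν) +
        B (ν.s o) * B₀ (ν.s o) * B (ν.s o) * A₀ (ν.s o) =
      A₀ (ν.s o) * sK o (A ν) * sK o (sK i (B₀ (ν.s i))) * sK o (sK i (A (ν.s i))) +
        A₀ (ν.s o) * sK o (B ν) * sK o (B₀ ν) * sK o (B ν) +
        B₀ (ν.s o) * B (ν.s o) * A₀ (ν.s o) * sK o (B ν) + g₀)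
    (h_one : A ν * sK i (B₀ (ν.s i)) * sK i (A (ν.s i)) * B₀ ν +
        B ν * A₀ ν * sK o (B (ν.s o)) * sK o (A₀ (ν.s o)) + B ν * B₀ ν * B ν * B₀ ν =
      A₀ ν * sK o (B (ν.s o)) * sK o (A₀ (ν.s o)) * B ν +
        B₀ ν * A ν * sK i (B₀ (ν.s i)) * sK i (A (ν.s i)) + B₀ ν * B ν * B₀ ν * B ν + g)
    (f : PSField k n) :
    ((op i A B * op o A₀ B₀) ^ 2 - (op o A₀ B₀ * op i A B) ^ 2) (Pi.single ν f) =
      Pi.single ν (g * f) + Pi.single (ν.s o) (g₀ * sK o f) +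
        Pi.single (ν.s i) (g₁ * sK i f) := by
  rw [pow_two, pow_two, ← mul_assoc, ← mul_assoc, LinearMap.sub_apply, op_op_op_op, op_op_op_op,
    ← Comp.s_braid_zero ho hi, sK_braid_zero ho hi, h, h_ioi, h_oio, h_io, h_oi, h_i, h_o, h_one,
    add_mul _ g, add_mul _ g₀, add_mul _ g₁, Pi.single_add, Pi.single_add, Pi.single_add]
  abel

end Op

end EnhancedQuiver

namespace EnhancedQuiver

/-! ## The polynomial representation of the orientifold KLR algebra -/

section Coeff

variable {J : Type*} (Γ : EnhancedQuiver J) {K : Type*} [Field K]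

open Classical in
/-- The coefficient of `σ_i` in `τ_i`, `i ≠ 0`. -/
def cA (a b : J) (u v : K) : K := if a = b then (u - v)⁻¹ else (u - v) ^ Γ.arr a b

open Classical in
/-- The coefficient of the identity in `τ_i`, `i ≠ 0`. -/
def cB (a b : J) (u v : K) : K := if a = b then -(u - v)⁻¹ else 0

open Classical in
/-- The coefficient of `σ_0` in `τ_0`. -/
def cA₀ (a : J) (u : K) : K := if a = Γ.θ a then u⁻¹ else u ^ Γ.lam a

open Classical in
/-- The coefficient of the identity in `τ_0`. -/
def cB₀ (a : J) (u : K) : K := if a = Γ.θ a then -u⁻¹ else 0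

lemma map_P {A B : Type*} [CommRing A] [CommRing B] (f : A →+* B) (i j : J) (u v : A) :
    f (Γ.P i j u v) = Γ.P i j (f u) (f v) := by
  unfold P; split_ifs <;> simp

lemma map_P' {A B : Type*} [CommRing A] [CommRing B] (f : A →+* B) (i : J) (u : A) :
    f (Γ.P' i u) = Γ.P' i (f u) := by
  unfold P'; split_ifs <;> simp

lemma map_Q {A B : Type*} [CommRing A] [CommRing B] (f : A →+* B) (i j : J) (u v : A) :
    f (Γ.Q i j u v) = Γ.Q i j (f u) (f v) := by
  rw [Q, map_mul, map_P, map_P, Q]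

lemma map_Q' {A B : Type*} [CommRing A] [CommRing B] (f : A →+* B) (i : J) (u : A) :
    f (Γ.Q' i u) = Γ.Q' i (f u) := by
  rw [Q', map_mul, map_P', map_P', map_neg, Q']

variable {u v w : K}

/-- Coefficient of σ_i in the braid relation. Unless a = b = c every product contains a vanishing
factor `cB`; in that case it is an identity between the inverse differences of the variables. -/
lemma coeff_braid (a b c : J) (huv : u - v ≠ 0) (hvw : v - w ≠ 0) (huw : u - w ≠ 0) :
    cB a c v w * Γ.cA b a u v * cB b c u w =
      Γ.cA b a u v * cB b c u w * cB a b v u + cB b a u v * cB a c v w * Γ.cA b a u v := by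
  have hvu : v - u ≠ 0 := by rwa [← neg_sub, neg_ne_zero]
  by_cases h1 : a = b
  · subst h1
    by_cases h2 : a = c
    · subst h2
      simp only [cA, cB, if_true]
      field_simp
      ring
    · simp [cA, cB, h2]
  · by_cases h2 : b = c
    · subst h2
      simp [cB, h1]
    · simp [cB, h1, h2, Ne.symm h1]

lemma coeff_braid' (a b c : J) (huv : u - v ≠ 0) (hvw : v - w ≠ 0) (huw : u - w ≠ 0) :
    cB a c u v * Γ.cA c b v w * cB a b u w =
      Γ.cA c b v w * cB a b u w * cB b c w v + cB c b v w * cB a c u v * Γ.cA c b v w := by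
  have hwv : w - v ≠ 0 := by rwa [← neg_sub, neg_ne_zero]
  by_cases h1 : b = c
  · subst h1
    by_cases h2 : a = b
    · subst h2
      simp only [cA, cB, if_true]
      field_simp
      ring
    · simp [cA, cB, h2]
  · by_cases h2 : a = b
    · subst h2
      simp [cB, h1, Ne.symm h1]
    · simp [cB, h1, h2, Ne.symm h1]

/-- Coefficient of the identity. For a = c the outer coefficients multiply to the two values of Q
and the middle one supplies the denominator u - w, which produces the difference quotient in the
deformed braid relation. -/
lemma coeff_braid_one (a b c : J) {g : K} (huv : u - v ≠ 0) (hvw : v - w ≠ 0) (huw : u - w ≠ 0)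
    (hg : a ≠ c ∧ g = 0 ∨ a = c ∧ (u - w) * g = Γ.Q a b v u - Γ.Q a b v w) :
    Γ.cA b c v w * cB a c u w * Γ.cA c b w v + cB b c v w * cB a b u v * cB b c v w =
      Γ.cA a b u v * cB a c u w * Γ.cA b a v u + cB a b u v * cB b c v w * cB a b u v + g := by
  have hvu : v - u ≠ 0 := by rwa [← neg_sub, neg_ne_zero]
  have hwv : w - v ≠ 0 := by rwa [← neg_sub, neg_ne_zero]
  rcases hg with ⟨h, rfl⟩ | ⟨rfl, hg⟩
  · by_cases h1 : a = b
    · subst h1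
      simp [cB, h]
    · simp [cB, h, h1]
  · have hg' : g = (Γ.Q a b v u - Γ.Q a b v w) / (u - w) := by
      rw [← hg]; field_simp
    rw [hg']
    by_cases h1 : a = b
    · subst h1
      simp only [cA, cB, if_true, Q, P]
      field_simp
      ring
    · simp only [cA, cB, Q, P, if_true, h1, Ne.symm h1, if_false]
      field_simp
      ring

/-- Contravariance of θ: arrows are reversed, and the sign change of the variables compensates for
their exchange. -/
lemma cA_θ (a b : J) (u v : K) : Γ.cA (Γ.θ a) (Γ.θ b) u v = Γ.cA b a (-v) (-u) := by
  have e : -v - -u = u - v := by ring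
  by_cases h : a = b
  · simp [cA, h, e]
  · simp [cA, Ne.symm h, Γ.θ_invol.injective.ne h, Γ.arr_θ, e]

lemma cB_θ (a b : J) (u v : K) : cB (Γ.θ a) (Γ.θ b) u v = cB b a (-v) (-u) := by
  have e : -v - -u = u - v := by ring
  by_cases h : a = b
  · simp [cB, h, e]
  · simp [cB, Ne.symm h, Γ.θ_invol.injective.ne h]

/-- The error terms in the braid relation of type `B_2`. -/
inductive BraidError (a b : J) (u v : K) : K → K → K → Prop
  -- The three indices are the coefficients of the identity, of σ_0 and of σ_1 in the operator on
  -- the right-hand side of the relation, with its generator τ_1 or τ_0 expanded.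
  | conj (h₁ : a ≠ b) (h₂ : b = Γ.θ a) (G : K) (hG : (u + v) * G = Γ.Q' b v - Γ.Q' a u) :
      BraidError a b u v (G * cB a b u v) 0 (G * Γ.cA b a u v)
  | snd (h₁ : a ≠ Γ.θ a) (h₂ : b = Γ.θ b) (G : K)
      (hG : v * G = Γ.Q a b v (-u) - Γ.Q a b (-v) (-u)) :
      BraidError a b u v (G * Γ.cB₀ a u) (G * Γ.cA₀ (Γ.θ a) u) 0
  | both (h₁ : a = Γ.θ a) (h₂ : a ≠ b) (h₃ : b = Γ.θ b) (G : K)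
      (hG : u * v * G = Γ.Q a b v (-u) - Γ.Q a b v u) :
      BraidError a b u v (G * (u * Γ.cB₀ a u + 1)) (G * (u * Γ.cA₀ (Γ.θ a) u)) 0
  | none (h₁ : ¬(a ≠ b ∧ b = Γ.θ a)) (h₂ : ¬(a ≠ Γ.θ a ∧ b = Γ.θ b))
      (h₃ : ¬(a = Γ.θ a ∧ a ≠ b ∧ b = Γ.θ b)) : BraidError a b u v 0 0 0

/-- The case distinction for the braid relation of type `B_2`. -/
lemma BraidError.rec' {a b : J} {u v : K} {p : K → K → K → Prop} {g g₀ g₁ : K}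
    (h : Γ.BraidError a b u v g g₀ g₁)
    (h_conj : a ≠ Γ.θ a → b = Γ.θ a → ∀ G : K, (u + v) * G = Γ.Q' b v - Γ.Q' a u →
      p 0 0 (G * (u - v) ^ Γ.arr b a))
    (h_snd : a ≠ Γ.θ a → b = Γ.θ b → a ≠ b → a ≠ Γ.θ b → ∀ G : K,
      v * G = Γ.Q a b v (-u) - Γ.Q a b (-v) (-u) → p 0 (G * u ^ Γ.lam (Γ.θ a)) 0)
    (h_both : a = Γ.θ a → b = Γ.θ b → a ≠ b → ∀ G : K,
      u * v * G = Γ.Q a b v (-u) - Γ.Q a b v u → p (G * (u * -u⁻¹ + 1)) (G * (u * u⁻¹)) 0)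
    (h_eq : a = Γ.θ a → b = a → p 0 0 0)
    (h_fst : a = Γ.θ a → b ≠ Γ.θ b → p 0 0 0)
    (h_same : a ≠ Γ.θ a → b = a → p 0 0 0)
    (h_gen : a ≠ Γ.θ a → b ≠ Γ.θ b → a ≠ b → a ≠ Γ.θ b → p 0 0 0) : p g g₀ g₁ := by
  have hθ := Γ.θ_invol
  rcases h with ⟨h₁, h₂, G, hG⟩ | ⟨h₁, h₂, G, hG⟩ | ⟨h₁, h₂, h₃, G, hG⟩ | ⟨h₁, h₂, h₃⟩
  · have := h_conj (h₂ ▸ h₁) h₂ G hG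
    rwa [cB, if_neg h₁, mul_zero, cA, if_neg (Ne.symm h₁)]
  · have e : a ≠ b := by rintro rfl; exact h₁ h₂
    have := h_snd h₁ h₂ e (h₂ ▸ e) G hG
    rwa [cB₀, if_neg h₁, cA₀, hθ a, if_neg (Ne.symm h₁), mul_zero]
  · have := h_both h₁ h₃ h₂ G hG
    rwa [cB₀, if_pos h₁, cA₀, hθ a, if_pos h₁.symm]
  · by_cases fa : a = Γ.θ a
    · by_cases e : b = a
      · exact h_eq fa e
      · exact h_fst fa fun h => h₃ ⟨fa, Ne.symm e, h⟩
    · by_cases e : b = a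
      · exact h_same fa e
      · have fb : b ≠ Γ.θ b := fun h => h₂ ⟨fa, h⟩
        refine h_gen fa fb (Ne.symm e) ?_
        rintro rfl
        exact h₁ ⟨Ne.symm e, (hθ b).symm⟩

section

variable {a b : J} {g g₀ g₁ : K}

/-- Coefficient of σ_1σ_0. There is something to compute only if both entries equal the same fixed
point of θ; otherwise identity coefficients vanish in every product. -/
lemma coeff_braid_zero_io (hw : u ≠ 0) (hx : v ≠ 0) (hu : u - v ≠ 0) (hv : u + v ≠ 0)
    (h : Γ.BraidError a b u v g g₀ g₁) :
    Γ.cA b (Γ.θ a) u v * Γ.cA₀ (Γ.θ a) v * cB a b (-v) u * Γ.cB₀ a (-v) +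
        cB b (Γ.θ a) u v * Γ.cB₀ b u * Γ.cA b (Γ.θ a) u v * Γ.cA₀ (Γ.θ a) v +
      Γ.cA b (Γ.θ a) u v * Γ.cB₀ (Γ.θ a) v * cB (Γ.θ a) b v u * Γ.cA₀ (Γ.θ a) v =
    Γ.cB₀ b u * Γ.cA b (Γ.θ a) u v * Γ.cA₀ (Γ.θ a) v * cB a b (-v) u := by
  have hθ := Γ.θ_invol
  have hu' : v - u ≠ 0 := by rwa [← neg_sub, neg_ne_zero]
  have hv' : -v - u ≠ 0 := by rw [← neg_add', neg_ne_zero, add_comm]; exact hv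
  refine BraidError.rec' Γ h (p := fun _ _ _ => _) ?_ ?_ ?_ ?_ ?_ ?_ ?_
  · rintro h₁ rfl G _
    simp [cB, cB₀, h₁, h₁.symm, hθ a]
  · intro h₁ h₂ h₃ h₄ G _
    simp [cB, cB₀, h₁, h₃, hθ a, h₂.symm, Ne.symm h₁]
    rintro rfl; exact absurd (h₂.trans (hθ a)) (Ne.symm h₁)
  · intro h₁ h₂ h₃ G _
    simp [cB, cB₀, h₁.symm, h₂.symm, h₃, Ne.symm h₃]
  · rintro h₁ rfl
    simp only [cA, cA₀, cB, cB₀, ← h₁, if_true]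
    field_simp
    ring
  · intro h₁ h₂
    have h₃ : a ≠ b := by rintro rfl; exact h₂ h₁
    simp [cB, ← h₁, h₃, Ne.symm h₃]
  · rintro h₁ rfl
    simp [cB, cB₀, h₁, Ne.symm h₁, hθ b]
  · intro h₁ h₂ h₃ h₄
    simp [cB, cB₀, h₁, h₂, h₃, hθ a, Ne.symm h₁]

/-- Coefficient of σ_0σ_1, with the same dichotomy. -/
lemma coeff_braid_zero_oi (hw : u ≠ 0) (hx : v ≠ 0) (hu : u - v ≠ 0) (hv : u + v ≠ 0)
    (h : Γ.BraidError a b u v g g₀ g₁) :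
    cB (Γ.θ b) a u v * Γ.cA₀ (Γ.θ b) u * Γ.cA b a (-u) v * Γ.cB₀ a v =
      Γ.cA₀ (Γ.θ b) u * Γ.cA b a (-u) v * Γ.cB₀ a v * cB a b v (-u) +
        Γ.cB₀ (Γ.θ b) u * cB (Γ.θ b) a u v * Γ.cA₀ (Γ.θ b) u * Γ.cA b a (-u) v +
      Γ.cA₀ (Γ.θ b) u * cB b a (-u) v * Γ.cB₀ b (-u) * Γ.cA b a (-u) v := by
  have hθ := Γ.θ_invol
  have hu' : v - u ≠ 0 := by rwa [← neg_sub, neg_ne_zero]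
  have e1 : -u - v = -(u + v) := by ring
  have e2 : v - -u = u + v := by ring
  refine BraidError.rec' Γ h (p := fun _ _ _ => _) ?_ ?_ ?_ ?_ ?_ ?_ ?_
  · rintro h₁ rfl G _
    simp [cB, cB₀, h₁, h₁.symm, hθ a]
  · intro h₁ h₂ h₃ h₄ G _
    simp [cB, cB₀, h₁, h₃.symm, hθ b, h₄.symm]
  · intro h₁ h₂ h₃ G _
    simp [cB, cB₀, h₁.symm, h₂.symm, h₃, Ne.symm h₃]
  · rintro h₁ rfl
    simp only [cA, cA₀, cB, cB₀, ← h₁, if_true, e1, e2]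
    field_simp
    ring
  · intro h₁ h₂
    have h₃ : a ≠ b := by rintro rfl; exact h₂ h₁
    have h₄ : Γ.θ b ≠ a := by rintro rfl; exact h₂ ((hθ b).symm.trans h₁.symm)
    simp [cB, h₃, Ne.symm h₃, h₄]
  · rintro h₁ rfl
    simp [cB, cB₀, h₁, Ne.symm h₁, hθ b]
  · intro h₁ h₂ h₃ h₄
    simp [cB, cB₀, h₁, h₂, h₃, hθ b, h₄.symm]

/-- Coefficient of σ_1. Besides the case of two equal fixed points, the case b = θ(a) contributes:
there the two products of framing factors form the difference quotient of Q'. -/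
lemma coeff_braid_zero_i (hw : u ≠ 0) (hx : v ≠ 0) (hu : u - v ≠ 0) (hv : u + v ≠ 0)
    (h : Γ.BraidError a b u v g g₀ g₁) :
    Γ.cA b a u v * Γ.cA₀ a v * cB (Γ.θ a) b (-v) u * Γ.cA₀ (Γ.θ a) (-v) +
        Γ.cA b a u v * Γ.cB₀ a v * cB a b v u * Γ.cB₀ a v +
      cB b a u v * Γ.cB₀ b u * Γ.cA b a u v * Γ.cB₀ a v =
    Γ.cA₀ b u * cB (Γ.θ b) a (-u) v * Γ.cA₀ (Γ.θ b) (-u) * Γ.cA b a u v +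
          Γ.cB₀ b u * Γ.cA b a u v * Γ.cB₀ a v * cB a b v u +
        Γ.cB₀ b u * cB b a u v * Γ.cB₀ b u * Γ.cA b a u v +
      g₁ := by
  have hθ := Γ.θ_invol
  have hu' : v - u ≠ 0 := by rwa [← neg_sub, neg_ne_zero]
  have e1 : -u - v = -(u + v) := by ring
  have e2 : -v - u = -(u + v) := by ring
  refine BraidError.rec' Γ h (p := fun g g₀ g₁ => _ = _ + g₁) ?_ ?_ ?_ ?_ ?_ ?_ ?_
  · intro h₁ h₂ G hG
    have h₃ : Γ.θ b = a := by rw [h₂, hθ a]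
    have f1 : ¬ b = Γ.θ b := by rw [h₃, h₂]; exact h₁.symm
    rw [← h₂] at h₁ ⊢
    rw [Q', Q', ← h₂, h₃] at hG
    have f2 : ¬ a = Γ.θ a := by rw [← h₂]; exact h₁
    rw [h₃]
    simp only [P', if_neg f1, if_neg f2, neg_neg] at hG
    simp only [cA, cA₀, cB, cB₀, if_neg f1, if_neg f2, if_neg h₁.symm, if_true, e1, e2]
    generalize v ^ Γ.lam a = z₁ at *
    generalize u ^ Γ.lam _ = z₂ at *
    generalize (-v) ^ Γ.lam _ = z₃ at *
    generalize (-u) ^ Γ.lam _ = z₄ at *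
    field_simp
    linear_combination -hG
  · intro h₁ h₂ h₃ h₄ G _
    have h₅ : Γ.θ a ≠ b := by rintro rfl; exact h₃ (h₂.trans (hθ a)).symm
    simp [cB, cB₀, h₁, h₃, h₃.symm, h₅, h₄.symm]
  · intro h₁ h₂ h₃ G _
    simp [cB, cB₀, h₁.symm, h₂.symm, h₃, Ne.symm h₃]
  · rintro h₁ rfl
    simp only [cA, cA₀, cB, cB₀, ← h₁, if_true, e1, e2]
    field_simp
    ring
  · intro h₁ h₂
    have h₃ : a ≠ b := by rintro rfl; exact h₂ h₁
    have h₄ : Γ.θ b ≠ a := by rintro rfl; exact h₂ ((hθ b).symm.trans h₁.symm)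
    simp [cB, h₃, Ne.symm h₃, h₄, ← h₁]
  · rintro h₁ rfl
    simp [cB, cB₀, h₁, Ne.symm h₁]
  · intro h₁ h₂ h₃ h₄
    have h₅ : Γ.θ a ≠ b := by rintro rfl; exact h₄ (hθ a).symm
    simp [cB, cB₀, h₁, h₂, h₃, h₅, h₄.symm]

/-- Coefficient of σ_0. A fixed entry b different from a produces the difference of the two values
of Q; its denominator is v, or uv if a is fixed as well, the factor 1/u being then the coefficient
of σ_0 in τ_0. -/
lemma coeff_braid_zero_o (hw : u ≠ 0) (hx : v ≠ 0) (hu : u - v ≠ 0) (hv : u + v ≠ 0)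
    (h : Γ.BraidError a b u v g g₀ g₁) :
    Γ.cA (Γ.θ a) b u v * Γ.cB₀ b v * Γ.cA b (Γ.θ a) v u * Γ.cA₀ (Γ.θ a) u +
        cB (Γ.θ a) b u v * Γ.cA₀ (Γ.θ a) u * cB a b (-u) v * Γ.cB₀ a (-u) +
      cB (Γ.θ a) b u v * Γ.cB₀ (Γ.θ a) u * cB (Γ.θ a) b u v * Γ.cA₀ (Γ.θ a) u =
    Γ.cA₀ (Γ.θ a) u * Γ.cA a b (-u) v * Γ.cB₀ b v * Γ.cA b a v (-u) +
          Γ.cA₀ (Γ.θ a) u * cB a b (-u) v * Γ.cB₀ a (-u) * cB a b (-u) v +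
        Γ.cB₀ (Γ.θ a) u * cB (Γ.θ a) b u v * Γ.cA₀ (Γ.θ a) u * cB a b (-u) v +
      g₀ := by
  have hθ := Γ.θ_invol
  have hu' : v - u ≠ 0 := by rwa [← neg_sub, neg_ne_zero]
  have e1 : -u - v = -(u + v) := by ring
  have e2 : v - -u = u + v := by ring
  refine BraidError.rec' Γ h (p := fun g g₀ g₁ => _ = _ + g₀) ?_ ?_ ?_ ?_ ?_ ?_ ?_
  · rintro h₁ rfl G hG
    simp [cB, cB₀, h₁, h₁.symm, hθ a]
  · intro h₁ h₂ h₃ h₄ G hG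
    have h₅ : Γ.θ a ≠ b := by rintro rfl; exact h₃ (h₂.trans (hθ a)).symm
    have f1 : Γ.cA (Γ.θ a) b u v = (u - v) ^ Γ.arr b a := by
      rw [h₂, cA_θ, ← h₂, cA, if_neg h₃.symm]; congr 1; ring
    have f2 : Γ.cA b (Γ.θ a) v u = (v - u) ^ Γ.arr a b := by
      rw [h₂, cA_θ, ← h₂, cA, if_neg h₃]; congr 1; ring
    simp only [Q, P, if_neg h₃, if_neg h₃.symm, sub_neg_eq_add, e1, e2,
      show -u - -v = v - u by ring, show -v + u = u - v by ring] at hG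
    have f3 : ¬ Γ.θ a = Γ.θ (Γ.θ a) := by rw [hθ a]; exact h₁.symm
    rw [f1, f2]
    simp only [cB, cB₀, cA, cA₀, if_neg f3, if_pos h₂, if_neg h₃, if_neg h₃.symm, if_neg h₅, e1,
      e2]
    generalize u ^ Γ.lam _ = z₁ at *
    generalize (u - v) ^ _ = z₂ at *
    generalize (v - u) ^ _ = z₃ at *
    generalize (-(u + v)) ^ _ = z₄ at *
    generalize (u + v) ^ _ = z₅ at *
    field_simp
    linear_combination -z₁ * hG
  · intro h₁ h₂ h₃ G hG
    simp only [Q, P, if_neg h₃, if_neg h₃.symm, e1, e2] at hG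
    rw [← h₁]
    simp only [cB, cB₀, cA, cA₀, if_pos h₁, if_pos h₂, if_neg h₃, if_neg h₃.symm, e1, e2]
    generalize (u - v) ^ _ = z₂ at *
    generalize (v - u) ^ _ = z₃ at *
    generalize (-(u + v)) ^ _ = z₄ at *
    generalize (u + v) ^ _ = z₅ at *
    rw [mul_inv_cancel₀ hw, mul_one]
    field_simp
    linear_combination -u * hG
  · rintro h₁ rfl
    simp only [cA, cA₀, cB, cB₀, ← h₁, if_true, e1, e2]
    field_simp
    ring
  · intro h₁ h₂
    have h₃ : a ≠ b := by rintro rfl; exact h₂ h₁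
    simp [cB, cB₀, h₂, h₃, ← h₁]
  · rintro h₁ rfl
    simp [cB, cB₀, h₁, Ne.symm h₁, hθ b]
  · intro h₁ h₂ h₃ h₄
    have h₅ : Γ.θ a ≠ b := by rintro rfl; exact h₄ (hθ a).symm
    simp [cB, cB₀, h₁, h₂, h₃, h₅]

/-- Both sides consist of the same products in a different order, so there can be no error at the
identity. For two distinct fixed points this is the role of the summand 1 in x_1τ_0 + 1: it cancels
the identity part of x_1τ_0. -/
lemma coeff_braid_zero_one (hw : u ≠ 0)
    (h : Γ.BraidError a b u v g g₀ g₁) :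
    Γ.cA a b u v * Γ.cB₀ b v * Γ.cA b a v u * Γ.cB₀ a u +
        cB a b u v * Γ.cA₀ a u * cB (Γ.θ a) b (-u) v * Γ.cA₀ (Γ.θ a) (-u) +
      cB a b u v * Γ.cB₀ a u * cB a b u v * Γ.cB₀ a u =
    Γ.cA₀ a u * cB (Γ.θ a) b (-u) v * Γ.cA₀ (Γ.θ a) (-u) * cB a b u v +
          Γ.cB₀ a u * Γ.cA a b u v * Γ.cB₀ b v * Γ.cA b a v u +
        Γ.cB₀ a u * cB a b u v * Γ.cB₀ a u * cB a b u v +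
      g := by
  have hθ := Γ.θ_invol
  refine BraidError.rec' Γ h (p := fun g g₀ g₁ => _ = _ + g) ?_ ?_ ?_ ?_ ?_ ?_ ?_
  · rintro h₁ rfl G hG
    simp [cB, cB₀, h₁, h₁.symm, hθ a]
  · intro h₁ h₂ h₃ h₄ G hG
    simp [cB, cB₀, h₁, h₃]
  · intro h₁ h₂ h₃ G hG
    simp only [cB, if_neg h₃, mul_neg, mul_inv_cancel₀ hw]
    ring
  all_goals intros; ring

end

end Coeff


end EnhancedQuiver

namespace EnhancedQuiver

/-! ### Operators for the generators τ_i and their braid relations -/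

section Rep

variable (k : Type*) [Field k] {J : Type*} (Γ : EnhancedQuiver J) (β : J →₀ ℕ) (n : ℕ)

variable {k n} in
lemma sK_cA (i : Fin n) (a b : J) (u v : PSField k n) :
    sK i (Γ.cA a b u v) = Γ.cA a b (sK i u) (sK i v) := by
  unfold cA; split_ifs <;> simp

variable {k n} in
lemma sK_cB (i : Fin n) (a b : J) (u v : PSField k n) :
    sK i (cB a b u v) = cB a b (sK i u) (sK i v) := by
  unfold cB; split_ifs <;> simp

variable {k n} in
lemma sK_cA₀ (i : Fin n) (a : J) (u : PSField k n) :
    sK i (Γ.cA₀ a u) = Γ.cA₀ a (sK i u) := by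
  unfold cA₀; split_ifs <;> simp

variable {k n} in
lemma sK_cB₀ (i : Fin n) (a : J) (u : PSField k n) :
    sK i (Γ.cB₀ a u) = Γ.cB₀ a (sK i u) := by
  unfold cB₀; split_ifs <;> simp

variable {n} in
/-- The coefficient of `σ_i` in `τ_i`. -/
def τA (i : Fin n) : RatSpace k Γ β n := fun ν =>
  if i.1 = 0 then Γ.cA₀ (ν i) (fieldX i)
  else Γ.cA (ν (prev i)) (ν i) (fieldX (prev i)) (fieldX i)

variable {n} in
/-- The coefficient of the identity in `τ_i`. -/
def τB (i : Fin n) : RatSpace k Γ β n := fun ν =>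
  if i.1 = 0 then Γ.cB₀ (ν i) (fieldX i)
  else cB (ν (prev i)) (ν i) (fieldX (prev i)) (fieldX i)

variable {n} in
/-- The operator by which `τ_i` acts. -/
def τop (i : Fin n) : Module.End k (RatSpace k Γ β n) := op i (τA k Γ β i) (τB k Γ β i)

variable {k Γ β n}

open Classical in
-- Once the action of the reflections on the three positions is made explicit, the coefficient
-- conditions involve only three entries of ν and three variables; those for words of length at
-- least two hold formally.
lemma τop_braid {i j : Fin n} (hi : i.1 ≠ 0) (hj : j.1 = i.1 + 1) (ν : Γ.Comp β n)
    (g : PSField k n)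
    (hg : ν (prev i) ≠ ν j ∧ g = 0 ∨ ν (prev i) = ν j ∧
      (fieldX (prev i) - fieldX j) * g = Γ.Q (ν (prev i)) (ν i) (fieldX i) (fieldX (prev i)) -
        Γ.Q (ν (prev i)) (ν i) (fieldX i) (fieldX j)) (f : PSField k n) :
    (τop k Γ β j * τop k Γ β i * τop k Γ β j - τop k Γ β i * τop k Γ β j * τop k Γ β i)
      (Pi.single ν f) = Pi.single ν (g * f) := by
  have hj0 : j.1 ≠ 0 := by omega
  have hp : prev j = i := Fin.ext (by simp [prev, hj])
  have h1 : prev i ≠ i := prev_ne hi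
  have h2 : i ≠ j := fun h => by have := congrArg Fin.val h; omega
  have h3 : prev i ≠ j := fun h => by
    have := congrArg Fin.val h; simp only [prev] at this; omega
  have hu := fieldX_sub_ne_zero (k := k) h1
  have hv := fieldX_sub_ne_zero (k := k) h2
  have hw := fieldX_sub_ne_zero (k := k) h3
  have a1 : ∀ μ : Γ.Comp β n, (μ.s i) (prev i) = μ i := fun μ => by
    rw [Comp.s_apply hi, Equiv.swap_apply_left]
  have a2 : ∀ μ : Γ.Comp β n, (μ.s i) i = μ (prev i) := fun μ => by
    rw [Comp.s_apply hi, Equiv.swap_apply_right]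
  have a3 : ∀ μ : Γ.Comp β n, (μ.s i) j = μ j := fun μ => by
    rw [Comp.s_apply hi, Equiv.swap_apply_of_ne_of_ne h3.symm h2.symm]
  have a4 : ∀ μ : Γ.Comp β n, (μ.s j) (prev i) = μ (prev i) := fun μ => by
    rw [Comp.s_apply hj0, hp, Equiv.swap_apply_of_ne_of_ne h1 h3]
  have a5 : ∀ μ : Γ.Comp β n, (μ.s j) i = μ j := fun μ => by
    rw [Comp.s_apply hj0, hp, Equiv.swap_apply_left]
  have a6 : ∀ μ : Γ.Comp β n, (μ.s j) j = μ i := fun μ => by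
    rw [Comp.s_apply hj0, hp, Equiv.swap_apply_right]
  have b1 : sK i (fieldX (prev i) : PSField k n) = fieldX i := by
    rw [sK_fieldX hi, Equiv.swap_apply_left]
  have b2 : sK i (fieldX i : PSField k n) = fieldX (prev i) := by
    rw [sK_fieldX hi, Equiv.swap_apply_right]
  have b3 : sK i (fieldX j : PSField k n) = fieldX j := by
    rw [sK_fieldX hi, Equiv.swap_apply_of_ne_of_ne h3.symm h2.symm]
  have b4 : sK j (fieldX (prev i) : PSField k n) = fieldX (prev i) := by
    rw [sK_fieldX hj0, hp, Equiv.swap_apply_of_ne_of_ne h1 h3]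
  have b5 : sK j (fieldX i : PSField k n) = fieldX j := by
    rw [sK_fieldX hj0, hp, Equiv.swap_apply_left]
  have b6 : sK j (fieldX j : PSField k n) = fieldX i := by
    rw [sK_fieldX hj0, hp, Equiv.swap_apply_right]
  refine op_braid hi hj _ _ _ _ ν g ?_ ?_ ?_ ?_ ?_ ?_ f <;>
    simp only [τA, τB, if_neg hi, if_neg hj0, hp, a1, a2, a3, a4, a5, a6, sK_cA, sK_cB,
      b1, b2, b3, b4, b5, b6] <;>
    clear a1 a2 a3 a4 a5 a6 b1 b2 b3 b4 b5 b6 <;>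
    generalize (fieldX (prev i) : PSField k n) = u at * <;>
    generalize (fieldX i : PSField k n) = v at * <;>
    generalize (fieldX j : PSField k n) = w at * <;>
    generalize ν (prev i) = a at * <;> generalize ν i = b at * <;> generalize ν j = c at *
  · ring
  · ring
  · ring
  · exact Γ.coeff_braid a b c hu hv hw
  · have := Γ.coeff_braid' a b c hu hv hw
    exact this
  · exact Γ.coeff_braid_one a b c hu hv hw hg


open Classical in
-- The same reduction to two entries and two variables. The longest word and one word of length
-- three also need the compatibility of the coefficients with θ.
lemma τop_braid_zero {o i : Fin n} (ho : o.1 = 0) (hi : i.1 = 1) (ν : Γ.Comp β n)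
    (g g₀ g₁ : PSField k n)
    (hg : Γ.BraidError (ν o) (ν i) (fieldX o) (fieldX i) g g₀ g₁) (f : PSField k n) :
    ((τop k Γ β i * τop k Γ β o) ^ 2 - (τop k Γ β o * τop k Γ β i) ^ 2) (Pi.single ν f) =
      Pi.single ν (g * f) + Pi.single (ν.s o) (g₀ * sK o f) +
        Pi.single (ν.s i) (g₁ * sK i f) := by
  have hi0 : i.1 ≠ 0 := by omega
  have hp : prev i = o := prev_eq_of_one ho hi
  have hio : i ≠ o := ne_of_one ho hi
  have hu := fieldX_sub_ne_zero (k := k) hio.symm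
  have hv := fieldX_add_ne_zero' (k := k) hio.symm
  have hw := fieldX_ne_zero (k := k) o
  have hx := fieldX_ne_zero (k := k) i
  have a1 : ∀ μ : Γ.Comp β n, (μ.s i) o = μ i := fun μ => by
    rw [Comp.s_apply hi0, hp, Equiv.swap_apply_left]
  have a2 : ∀ μ : Γ.Comp β n, (μ.s i) i = μ o := fun μ => by
    rw [Comp.s_apply hi0, hp, Equiv.swap_apply_right]
  have a3 : ∀ μ : Γ.Comp β n, (μ.s o) o = Γ.θ (μ o) := fun μ => Comp.s_apply_zero ho μ
  have a4 : ∀ μ : Γ.Comp β n, (μ.s o) i = μ i := fun μ => Comp.s_apply_zero_ne ho μ hio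
  have b1 : sK i (fieldX o : PSField k n) = fieldX i := by
    rw [sK_fieldX hi0, hp, Equiv.swap_apply_left]
  have b2 : sK i (fieldX i : PSField k n) = fieldX o := by
    rw [sK_fieldX hi0, hp, Equiv.swap_apply_right]
  have b3 : sK o (fieldX o : PSField k n) = -fieldX o := sK_zero_fieldX ho
  have b4 : sK o (fieldX i : PSField k n) = fieldX i := sK_zero_fieldX_ne ho hio
  refine op_braid_zero ho hi _ _ _ _ ν g g₀ g₁ ?_ ?_ ?_ ?_ ?_ ?_ ?_ ?_ f <;>
    simp only [τA, τB, if_neg hi0, if_pos ho, hp, a1, a2, a3, a4, sK_cA, sK_cB, sK_cA₀, sK_cB₀,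
      b1, b2, b3, b4, map_neg] <;>
    clear a1 a2 a3 a4 b1 b2 b3 b4 <;>
    generalize (fieldX o : PSField k n) = u at * <;>
    generalize (fieldX i : PSField k n) = v at * <;>
    generalize ν o = a at * <;> generalize ν i = b at *
  · have e := Γ.cA_θ (Γ.θ a) b (-u) v
    rw [Γ.θ_invol a, neg_neg] at e
    rw [cA_θ, e]
    ring
  · ring
  · rw [cB_θ]
    ring
  · exact Γ.coeff_braid_zero_io hw hx hu hv hg
  · exact Γ.coeff_braid_zero_oi hw hx hu hv hg
  · exact Γ.coeff_braid_zero_i hw hx hu hv hg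
  · exact Γ.coeff_braid_zero_o hw hx hu hv hg
  · exact Γ.coeff_braid_zero_one hw hg

end Rep

end EnhancedQuiver

lemma orderedEval_map {k A B : Type*} [CommRing k] [Ring A] [Algebra k A] [CommRing B]
    [Algebra k B] {n : ℕ} (f : B →ₐ[k] A) (y : Fin n → B) (g : MvPolynomial (Fin n) k) :
    orderedEval (fun l => f (y l)) g = f (MvPolynomial.aeval y g) := by
  rw [MvPolynomial.aeval_def, MvPolynomial.eval₂_eq', map_sum, orderedEval]
  refine Finset.sum_congr rfl fun m _ => ?_
  rw [← Algebra.smul_def, map_smul, ← List.prod_ofFn, map_list_prod, List.map_ofFn]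
  congr 3
  ext l
  simp

lemma map_orderedEval {k A B : Type*} [CommRing k] [Ring A] [Algebra k A] [Ring B]
    [Algebra k B] {n : ℕ} (f : A →ₐ[k] B) (x : Fin n → A) (g : MvPolynomial (Fin n) k) :
    f (orderedEval x g) = orderedEval (fun l => f (x l)) g := by
  rw [orderedEval, map_sum, orderedEval]
  refine Finset.sum_congr rfl fun m _ => ?_
  rw [map_smul, map_list_prod, List.map_ofFn]
  congr 3
  ext l
  simp

namespace EnhancedQuiver

/-! ### The remaining relations of the orientifold KLR algebra -/

section Rep

variable {k : Type*} [Field k] {J : Type*} {Γ : EnhancedQuiver J} {β : J →₀ ℕ} {n : ℕ}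

lemma Comp.s_apply_of_ne {i l : Fin n} (h : l ≠ i) (h' : l ≠ prev i) (ν : Γ.Comp β n) :
    (ν.s i) l = ν l := by
  by_cases hi : i.1 = 0
  · exact Comp.s_apply_zero_ne hi ν h
  · rw [Comp.s_apply hi, Equiv.swap_apply_of_ne_of_ne h' h]

lemma sK_fieldX_of_ne {i l : Fin n} (h : l ≠ i) (h' : l ≠ prev i) :
    sK i (fieldX l : PSField k n) = fieldX l := by
  by_cases hi : i.1 = 0
  · exact sK_zero_fieldX_ne hi h
  · rw [sK_fieldX hi, Equiv.swap_apply_of_ne_of_ne h' h]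

lemma sK_τA_of_ne {i j : Fin n} (h : j ≠ i) (h₁ : j ≠ prev i) (h₂ : prev j ≠ i)
    (h₃ : prev j ≠ prev i) (ν : Γ.Comp β n) :
    sK i (τA k Γ β j ν) = τA k Γ β j (ν.s i) := by
  unfold τA
  split_ifs with hj
  · rw [sK_cA₀, sK_fieldX_of_ne h h₁, Comp.s_apply_of_ne h h₁]
  · rw [sK_cA, sK_fieldX_of_ne h h₁, Comp.s_apply_of_ne h h₁, sK_fieldX_of_ne h₂ h₃,
      Comp.s_apply_of_ne h₂ h₃]

lemma sK_τB_of_ne {i j : Fin n} (h : j ≠ i) (h₁ : j ≠ prev i) (h₂ : prev j ≠ i)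
    (h₃ : prev j ≠ prev i) (ν : Γ.Comp β n) :
    sK i (τB k Γ β j ν) = τB k Γ β j (ν.s i) := by
  unfold τB
  split_ifs with hj
  · rw [sK_cB₀, sK_fieldX_of_ne h h₁, Comp.s_apply_of_ne h h₁]
  · rw [sK_cB, sK_fieldX_of_ne h h₁, Comp.s_apply_of_ne h h₁, sK_fieldX_of_ne h₂ h₃,
      Comp.s_apply_of_ne h₂ h₃]

lemma τop_comm {i j : Fin n} (h : i.1 + 1 < j.1) :
    τop k Γ β i * τop k Γ β j = τop k Γ β j * τop k Γ β i := by
  have e : ∀ {a b : Fin n}, a.1 ≠ b.1 → a ≠ b := fun h h' => h (congrArg Fin.val h')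
  have h1 : j ≠ i := e (by omega)
  have h2 : j ≠ prev i := e (by simp only [prev]; omega)
  have h3 : prev j ≠ i := e (by simp only [prev]; omega)
  have h4 : prev j ≠ prev i := e (by simp only [prev]; omega)
  refine op_comm h _ _ _ _ fun ν => ⟨?_, ?_, ?_, ?_⟩
  · exact sK_τA_of_ne h1 h2 h3 h4 _
  · exact sK_τB_of_ne h1 h2 h3 h4 _
  · rw [sK_τA_of_ne h1.symm h3.symm h2.symm h4.symm, Comp.s_comm h]
  · exact sK_τB_of_ne h1.symm h3.symm h2.symm h4.symm _

open Classical in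
lemma op_sq_single (i : Fin n) (A B : RatSpace k Γ β n) (ν : Γ.Comp β n) (f : PSField k n) :
    (op i A B * op i A B) (Pi.single ν f) =
      Pi.single ν ((A ν * sK i (A (ν.s i)) + B ν * B ν) * f) +
      Pi.single (ν.s i) (A (ν.s i) * (sK i (B ν) + B (ν.s i)) * sK i f) := by
  simp only [Module.End.mul_apply, op_single, map_add, map_mul, Comp.s_s, sK_sK, add_mul,
    mul_add, Pi.single_add, mul_assoc]
  rw [mul_left_comm (B (ν.s i))]
  abel

open Classical in
lemma τop_sq {i : Fin n} (hi : i.1 ≠ 0) (ν : Γ.Comp β n) (f : PSField k n) :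
    (τop k Γ β i * τop k Γ β i) (Pi.single ν f) =
      Pi.single ν (Γ.Q (ν (prev i)) (ν i) (fieldX i) (fieldX (prev i)) * f) := by
  have hu := fieldX_sub_ne_zero (k := k) (prev_ne hi)
  rw [τop, op_sq_single]
  simp only [τA, τB, if_neg hi, sK_cA, sK_cB, Comp.s_apply hi, sK_fieldX hi,
    Equiv.swap_apply_left, Equiv.swap_apply_right]
  generalize (fieldX (prev i) : PSField k n) = u at *
  generalize (fieldX i : PSField k n) = v at *
  generalize ν (prev i) = a
  generalize ν i = b
  have hu' : v - u ≠ 0 := by rwa [← neg_sub, neg_ne_zero]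
  have e1 : Γ.cA a b u v * Γ.cA b a v u + cB a b u v * cB a b u v = Γ.Q a b v u := by
    by_cases h : a = b
    · subst h
      simp only [cA, cB, Q, P, if_true]
      field_simp
      ring
    · simp [cA, cB, Q, P, h, Ne.symm h]
  have e2 : cB a b v u + cB b a u v = 0 := by
    by_cases h : a = b
    · subst h
      simp only [cB, if_true]
      field_simp
      ring
    · simp [cB, h, Ne.symm h]
  rw [e1, e2, mul_zero, zero_mul, Pi.single_zero, add_zero]

open Classical in
lemma τop_sq_zero {o : Fin n} (ho : o.1 = 0) (ν : Γ.Comp β n) (f : PSField k n) :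
    (τop k Γ β o * τop k Γ β o) (Pi.single ν f) =
      Pi.single ν (Γ.Q' (ν o) (-fieldX o) * f) := by
  have hu := fieldX_ne_zero (k := k) o
  rw [τop, op_sq_single]
  simp only [τA, τB, if_pos ho, sK_cA₀, sK_cB₀, Comp.s_apply_zero ho, sK_zero_fieldX ho]
  generalize (fieldX o : PSField k n) = u at *
  generalize ν o = a
  have e1 : Γ.cA₀ a u * Γ.cA₀ (Γ.θ a) (-u) + Γ.cB₀ a u * Γ.cB₀ a u = Γ.Q' a (-u) := by
    by_cases h : a = Γ.θ a
    · have h' := h.symm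
      simp only [Q', P', cA₀, cB₀, h', if_true]
      field_simp
      ring
    · simp [cA₀, cB₀, Q', P', h, Ne.symm h, Γ.θ_invol a]
  have e2 : Γ.cB₀ a (-u) + Γ.cB₀ (Γ.θ a) u = 0 := by
    by_cases h : a = Γ.θ a
    · have h' := h.symm
      simp only [cB₀, h', if_true]
      field_simp
      ring
    · simp [cB₀, h, Ne.symm h, Γ.θ_invol a]
  rw [e1, e2, mul_zero, zero_mul, Pi.single_zero, add_zero]

lemma Comp.s_eq_self {i : Fin n} (hi : i.1 ≠ 0) {ν : Γ.Comp β n} (h : ν (prev i) = ν i) :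
    ν.s i = ν := by
  refine Comp.ext' fun l => ?_
  rw [Comp.s_apply hi]
  by_cases h1 : l = i
  · rw [h1, Equiv.swap_apply_right, h]
  · by_cases h2 : l = prev i
    · rw [h2, Equiv.swap_apply_left, h]
    · rw [Equiv.swap_apply_of_ne_of_ne h2 h1]

lemma Comp.s_zero_eq_self {o : Fin n} (ho : o.1 = 0) {ν : Γ.Comp β n} (h : ν o = Γ.θ (ν o)) :
    ν.s o = ν := by
  refine Comp.ext' fun l => ?_
  by_cases h1 : l = o
  · rw [h1, Comp.s_apply_zero ho, ← h]
  · rw [Comp.s_apply_zero_ne ho ν h1]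

lemma τB_eq_zero {i : Fin n} {ν : Γ.Comp β n} (h : ν.s i ≠ ν) : τB k Γ β i ν = 0 := by
  unfold τB
  split_ifs with hi
  · rw [cB₀, if_neg fun h' => h (Comp.s_zero_eq_self hi h')]
  · rw [cB, if_neg fun h' => h (Comp.s_eq_self hi h')]

open Classical in
lemma pi_single_mul_of_ne {ν μ : Γ.Comp β n} (h : ν ≠ μ) :
    (Pi.single ν 1 * Pi.single μ 1 : RatSpace k Γ β n) = 0 := by
  rw [← Pi.single_mul_left, Pi.single_eq_of_ne h, mul_zero, Pi.single_zero]

open Classical in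
lemma sV_single (i : Fin n) (ν : Γ.Comp β n) (f : PSField k n) :
    sV i (Pi.single ν f) = Pi.single (ν.s i) (sK i f) := by
  have := op_single i 1 0 ν f
  rw [op_apply, one_mul, zero_mul, add_zero] at this
  simpa using this

open Classical in
-- Either s_i fixes ν or the identity coefficient vanishes at both ν and s_iν. For the operators
-- this yields τ_i e(ν) = e(s_iν) τ_i.
lemma τB_mul_single (i : Fin n) (ν : Γ.Comp β n) (f : PSField k n) :
    τB k Γ β i * Pi.single (ν.s i) f = τB k Γ β i * Pi.single ν f := by
  by_cases h : ν.s i = ν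
  · rw [h]
  · rw [← Pi.single_mul_right, ← Pi.single_mul_right, τB_eq_zero h, τB_eq_zero, zero_mul,
      Pi.single_zero, Pi.single_zero]
    rw [Comp.s_s]
    exact Ne.symm h

variable (k Γ β n) in
/-- Multiplication by a single rational function. -/
def constOp : PSField k n →ₐ[k] Module.End k (RatSpace k Γ β n) :=
  mulOp.comp (Pi.constAlgHom k (Γ.Comp β n) (PSField k n))

open Classical in
lemma constOp_single (g : PSField k n) (ν : Γ.Comp β n) (f : PSField k n) :
    constOp k Γ β n g (Pi.single ν f) = Pi.single ν (g * f) :=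
  mulOp_single _ _ _

open Classical in
lemma op_constOp_add_single (i : Fin n) (A B : RatSpace k Γ β n) (g : PSField k n)
    (hg : sK i g = -g) (ν : Γ.Comp β n) (f : PSField k n) :
    (op i A B * constOp k Γ β n g + constOp k Γ β n g * op i A B) (Pi.single ν f) =
      Pi.single ν (B ν * (g + g) * f) := by
  simp only [LinearMap.add_apply, Module.End.mul_apply, constOp_single, op_single, map_mul,
    map_add, hg]
  simp only [mul_add, add_mul, Pi.single_add, mul_assoc, neg_mul, mul_neg, Pi.single_neg]
  rw [mul_left_comm g, mul_left_comm g (B ν)]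
  abel

open Classical in
lemma op_constOp_single (i : Fin n) (A B : RatSpace k Γ β n) (g g' : PSField k n)
    (hg : sK i g = g') (ν : Γ.Comp β n) (f : PSField k n) :
    (op i A B * constOp k Γ β n g - constOp k Γ β n g' * op i A B) (Pi.single ν f) =
      Pi.single ν (B ν * (g - g') * f) := by
  subst hg
  simp only [LinearMap.sub_apply, Module.End.mul_apply, constOp_single, op_single, map_mul, map_add]
  simp only [mul_sub, sub_mul, Pi.single_sub, mul_assoc]
  rw [mul_left_comm (sK i g), mul_left_comm (sK i g) (B ν)]
  abel

variable (k Γ β n) in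
open Classical in
/-- The operators by which the generators act. -/
def genOp : Γ.OGen β n → Module.End k (RatSpace k Γ β n)
  | .e ν => mulOp (Pi.single ν 1)
  | .x l => constOp k Γ β n (fieldX l)
  | .τ i => τop k Γ β i

variable (k Γ β n) in
/-- The action of the free algebra. -/
abbrev freeOp : FreeAlgebra k (Γ.OGen β n) →ₐ[k] Module.End k (RatSpace k Γ β n) :=
  FreeAlgebra.lift k (genOp k Γ β n)

lemma freeOp_fpoly (g : MvPolynomial (Fin n) k) :
    freeOp k Γ β n (fpoly k Γ β n g) = constOp k Γ β n (MvPolynomial.aeval fieldX g) := by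
  rw [map_orderedEval, ← orderedEval_map]
  simp [genOp]

open Classical in
lemma freeOp_fe (ν : Γ.Comp β n) : freeOp k Γ β n (fe k Γ β n ν) = mulOp (Pi.single ν 1) := by
  rw [FreeAlgebra.lift_ι_apply, genOp]

lemma freeOp_fx (l : Fin n) : freeOp k Γ β n (fx k Γ β n l) = constOp k Γ β n (fieldX l) :=
  FreeAlgebra.lift_ι_apply _ _

lemma freeOp_fτ (i : Fin n) : freeOp k Γ β n (fτ k Γ β n i) = τop k Γ β i :=
  FreeAlgebra.lift_ι_apply _ _

open Classical in
-- Relations carrying e(ν) are tested on functions supported at ν. The polynomial g of a relation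
-- enters only through the equation that defines it, which persists after evaluation in the field of
-- fractions.
lemma freeOp_rel {a b : FreeAlgebra k (Γ.OGen β n)} (h : ORel k Γ β n a b) :
    freeOp k Γ β n a = freeOp k Γ β n b := by
  have ax : ∀ l, MvPolynomial.aeval (fieldX : Fin n → PSField k n) 
      (MvPolynomial.X l : MvPolynomial (Fin n) k) = fieldX l := fun l => MvPolynomial.aeval_X _ _
  have aQ : ∀ i j (u v : MvPolynomial (Fin n) k),
      MvPolynomial.aeval (fieldX : Fin n → PSField k n) (Γ.Q i j u v) =
      Γ.Q i j (MvPolynomial.aeval fieldX u) (MvPolynomial.aeval fieldX v) := fun i j u v =>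
    Γ.map_Q (MvPolynomial.aeval (fieldX : Fin n → PSField k n)).toRingHom i j u v
  have aQ' : ∀ i (u : MvPolynomial (Fin n) k),
      MvPolynomial.aeval (fieldX : Fin n → PSField k n) (Γ.Q' i u) =
      Γ.Q' i (MvPolynomial.aeval fieldX u) := fun i u =>
    Γ.map_Q' (MvPolynomial.aeval (fieldX : Fin n → PSField k n)).toRingHom i u
  induction h with
  | e_sum =>
    simp only [map_sum, freeOp_fe, map_one]
    rw [← map_sum, Finset.univ_sum_single, ← map_one (mulOp (k := k) (Γ := Γ) (β := β) (n := n))]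
    rfl
  | e_mul_self ν =>
    rw [map_mul, freeOp_fe, ← map_mul, ← Pi.single_mul, one_mul]
  | e_mul_ne ν μ h =>
    rw [map_mul, freeOp_fe, freeOp_fe, ← map_mul, pi_single_mul_of_ne h, map_zero, map_zero]
  | x_e l ν =>
    rw [map_mul, map_mul, freeOp_fe, freeOp_fx, constOp, AlgHom.comp_apply, ← map_mul, ← map_mul,
      mul_comm]
  | τ_e i ν =>
    rw [map_mul, map_mul, freeOp_fe, freeOp_fe, freeOp_fτ, τop, op_mul_mulOp]
    rw [sV_single, mul_sub, map_one, τB_mul_single, sub_self, map_zero, add_zero]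
  | x_x l l' =>
    rw [map_mul, map_mul, freeOp_fx, freeOp_fx, ← map_mul, ← map_mul, mul_comm]
  | τ_sq i hi ν =>
    simp only [map_mul, freeOp_fe, freeOp_fτ, freeOp_fpoly]
    refine mul_idem_eq ν fun f => ?_
    rw [τop_sq hi, constOp_single, aQ, ax, ax]
  | τ_sq_zero i hi ν =>
    simp only [map_mul, freeOp_fe, freeOp_fτ, freeOp_fpoly]
    refine mul_idem_eq ν fun f => ?_
    rw [τop_sq_zero hi, constOp_single, aQ', map_neg, ax]
  | τ_comm i j h h' =>
    simp only [map_mul, freeOp_fτ]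
    rcases lt_trichotomy i.1 j.1 with hij | hij | hij
    · exact τop_comm (by omega)
    · rw [Fin.ext hij]
    · exact (τop_comm (by omega)).symm
  | braid_ne i j hi hj ν hν =>
    simp only [map_mul, map_sub, freeOp_fe, freeOp_fτ, map_zero]
    rw [← zero_mul (mulOp (Pi.single ν 1))]
    refine mul_idem_eq ν fun f => ?_
    rw [τop_braid hi hj ν 0 (Or.inl ⟨hν, rfl⟩), zero_mul, Pi.single_zero, LinearMap.zero_apply]
  | braid_eq i j hi hj ν hν g hg =>
    simp only [map_mul, map_sub, freeOp_fe, freeOp_fτ, freeOp_fpoly]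
    refine mul_idem_eq ν fun f => ?_
    rw [τop_braid hi hj ν (MvPolynomial.aeval fieldX g) (Or.inr ⟨hν, ?_⟩), constOp_single]
    have := congrArg (MvPolynomial.aeval (fieldX : Fin n → PSField k n)) hg
    simpa only [map_mul, map_sub, ax, aQ] using this
  | braid_zero_a o i ho hi ν h₁ h₂ g hg =>
    simp only [map_mul, map_sub, map_pow, freeOp_fe, freeOp_fτ, freeOp_fpoly]
    have hi0 : i.1 ≠ 0 := by omega
    refine mul_idem_eq ν fun f => ?_
    have := congrArg (MvPolynomial.aeval (fieldX : Fin n → PSField k n)) hg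
    simp only [map_mul, map_sub, map_add, ax, aQ'] at this
    rw [τop_braid_zero ho hi ν _ _ _ (BraidError.conj h₁ h₂ _ this), Module.End.mul_apply, τop,
      op_single, map_add, constOp_single, constOp_single]
    simp only [τA, τB, if_neg hi0, prev_eq_of_one ho hi, Comp.s_apply hi0, Equiv.swap_apply_left,
      Equiv.swap_apply_right, zero_mul, Pi.single_zero, add_zero, mul_assoc]
    rw [add_comm]
  | braid_zero_b o i ho hi ν h₁ h₂ g hg =>
    simp only [map_mul, map_sub, map_pow, freeOp_fe, freeOp_fτ, freeOp_fpoly]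
    refine mul_idem_eq ν fun f => ?_
    have := congrArg (MvPolynomial.aeval (fieldX : Fin n → PSField k n)) hg
    simp only [map_mul, map_sub, map_neg, ax, aQ] at this
    rw [τop_braid_zero ho hi ν _ _ _ (BraidError.snd h₁ h₂ _ this), Module.End.mul_apply, τop,
      op_single, map_add, constOp_single, constOp_single]
    simp only [τA, τB, if_pos ho, Comp.s_apply_zero ho, zero_mul, Pi.single_zero, add_zero,
      mul_assoc]
    rw [add_comm]
  | braid_zero_c o i ho hi ν h₁ h₂ h₃ g hg =>
    simp only [map_mul, map_sub, map_add, map_one, map_pow, freeOp_fe, freeOp_fτ, freeOp_fpoly,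
      freeOp_fx]
    refine mul_idem_eq ν fun f => ?_
    have := congrArg (MvPolynomial.aeval (fieldX : Fin n → PSField k n)) hg
    simp only [map_mul, map_sub, map_neg, ax, aQ] at this
    rw [τop_braid_zero ho hi ν _ _ _ (BraidError.both h₁ h₂ h₃ _ this), Module.End.mul_apply,
      LinearMap.add_apply, Module.End.mul_apply, Module.End.one_apply, τop,
      op_single, map_add, map_add, map_add, constOp_single, constOp_single, constOp_single,
      constOp_single, constOp_single]
    simp only [τA, τB, if_pos ho, Comp.s_apply_zero ho, zero_mul, Pi.single_zero, add_zero,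
      mul_assoc, mul_add, add_mul, one_mul, Pi.single_add]
    abel
  | braid_zero_d o i ho hi ν ha hb hc =>
    simp only [map_mul, map_sub, map_pow, freeOp_fe, freeOp_fτ, map_zero]
    rw [← zero_mul (mulOp (Pi.single ν 1))]
    refine mul_idem_eq ν fun f => ?_
    rw [τop_braid_zero ho hi ν _ _ _ (BraidError.none ha hb hc)]
    simp
  | mixed_ne i hi l ν h =>
    simp only [map_mul, map_sub, freeOp_fe, freeOp_fτ, freeOp_fx, map_zero]
    rw [← zero_mul (mulOp (Pi.single ν 1))]
    refine mul_idem_eq ν fun f => ?_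
    rw [τop, op_constOp_single _ _ _ _ _ (sK_fieldX hi _)]
    rcases h with h | ⟨h, h'⟩
    · simp [τB, hi, cB, h]
    · simp [Equiv.swap_apply_of_ne_of_ne h h']
  | mixed_left i hi ν h =>
    simp only [map_mul, map_sub, freeOp_fe, freeOp_fτ, freeOp_fx, map_neg]
    rw [← neg_one_mul (mulOp (k := k) (Pi.single ν 1))]
    refine mul_idem_eq ν fun f => ?_
    have hu := fieldX_sub_ne_zero (k := k) (prev_ne hi)
    rw [τop, op_constOp_single _ _ _ _ (fieldX i)
      (by rw [sK_fieldX hi, Equiv.swap_apply_left]), τB, if_neg hi, cB, if_pos h, neg_mul,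
      inv_mul_cancel₀ hu, neg_one_mul, Pi.single_neg]
    simp
  | mixed_right i hi ν h =>
    simp only [map_mul, map_sub, freeOp_fe, freeOp_fτ, freeOp_fx]
    rw [← one_mul (mulOp (Pi.single ν 1)), ← mul_assoc, mul_one]
    refine mul_idem_eq ν fun f => ?_
    have hu := fieldX_sub_ne_zero (k := k) (prev_ne hi)
    rw [τop, op_constOp_single _ _ _ _ (fieldX (prev i))
      (by rw [sK_fieldX hi, Equiv.swap_apply_right]), τB, if_neg hi, cB, if_pos h,
      ← neg_sub (fieldX (prev i)), neg_mul_neg, inv_mul_cancel₀ hu, one_mul, Module.End.one_apply]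
  | mixed_zero_ne o ho ν h =>
    simp only [map_mul, map_add, freeOp_fe, freeOp_fτ, freeOp_fx, map_zero]
    rw [← zero_mul (mulOp (Pi.single ν 1))]
    refine mul_idem_eq ν fun f => ?_
    rw [τop, op_constOp_add_single _ _ _ _ (sK_zero_fieldX ho), τB, if_pos ho, cB₀, if_neg h]
    simp
  | mixed_zero_eq o ho ν h =>
    simp only [map_mul, map_add, freeOp_fe, freeOp_fτ, freeOp_fx, map_neg, map_ofNat]
    refine mul_idem_eq ν fun f => ?_
    have hu := fieldX_ne_zero (k := k) o
    rw [τop, op_constOp_add_single _ _ _ _ (sK_zero_fieldX ho), τB, if_pos ho, cB₀, if_pos h,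
      show -(fieldX o : PSField k n)⁻¹ * (fieldX o + fieldX o) * f = - f - f by
        field_simp; ring, Pi.single_sub, Pi.single_neg]
    have e : (-2 : Module.End k (RatSpace k Γ β n)) = -1 - 1 := by norm_num
    rw [e]
    simp
  | mixed_zero_comm o ho l hl =>
    simp only [map_mul, freeOp_fτ, freeOp_fx]
    rw [← sub_eq_zero]
    refine End_ext fun ν f => ?_
    rw [τop, op_constOp_single _ _ _ _ _ (sK_zero_fieldX_ne ho hl)]
    simp

end Rep

end EnhancedQuiver

/-! ### Straightening for finitely many generators -/

/-- Extension by zero of a finite family. -/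
def finExt {A : Type*} [Zero A] {n : ℕ} (t : Fin n → A) (i : ℕ) : A :=
  if h : i < n then t ⟨i, h⟩ else 0

lemma finExt_val {A : Type*} [Zero A] {n : ℕ} (t : Fin n → A) (i : Fin n) :
    finExt t i = t i := dif_pos i.2

lemma finExt_of_le {A : Type*} [Zero A] {n : ℕ} (t : Fin n → A) {i : ℕ} (h : n ≤ i) :
    finExt t i = 0 := dif_neg (by omega)

lemma range_finExt_subset {k A : Type*} [CommRing k] [Ring A] [Algebra k A] {n : ℕ}
    (t : Fin n → A) (S : Subalgebra k A) (h : ∀ i, t i ∈ S) (i : ℕ) : finExt t i ∈ S := by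
  unfold finExt; split_ifs
  · exact h _
  · exact S.zero_mem

/-- Letters out of range are sent to zero, so that the relations in which they occur hold trivially.
-/
lemma Straightening.of_fin {k A : Type*} [CommRing k] [Ring A] [Algebra k A] {n : ℕ}
    {S : Subalgebra k A} {t : Fin n → A}
    (move : ∀ s ∈ S, ∀ i, ∃ r ∈ S, ∃ r' ∈ S, s * t i = t i * r + r')
    (sq : ∀ i, ∃ r ∈ S, ∃ r' ∈ S, t i * t i = t i * r + r')
    (comm : ∀ i j : Fin n, i.1 + 1 < j.1 → t i * t j = t j * t i)
    (braid : ∀ i j : Fin n, i.1 ≠ 0 → j.1 = i.1 + 1 →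
      t i * t j * t i - t j * t i * t j ∈ wordSpan S (finExt t) 3)
    (braid_zero : ∀ o i : Fin n, o.1 = 0 → i.1 = 1 →
      t o * t i * t o * t i - t i * t o * t i * t o ∈ wordSpan S (finExt t) 4) :
    Straightening S (finExt t) := by
  refine ⟨fun s hs i => ?_, fun i => ?_, fun i j hij => ?_, fun i hi => ?_, ?_⟩
  · by_cases h : i < n
    · simpa only [finExt, dif_pos h] using move s hs ⟨i, h⟩
    · exact ⟨0, S.zero_mem, 0, S.zero_mem, by simp [finExt, dif_neg h]⟩
  · by_cases h : i < n
    · simpa only [finExt, dif_pos h] using sq ⟨i, h⟩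
    · exact ⟨0, S.zero_mem, 0, S.zero_mem, by simp [finExt, dif_neg h]⟩
  · by_cases h : j < n
    · have h' : i < n := by omega
      simpa only [finExt, dif_pos h, dif_pos h'] using comm ⟨i, h'⟩ ⟨j, h⟩ hij
    · rw [finExt_of_le t (not_lt.1 h), mul_zero, zero_mul]
  · by_cases h : i + 1 < n
    · have h' : i < n := by omega
      have := braid ⟨i, h'⟩ ⟨i + 1, h⟩ hi rfl
      rw [← finExt_val t ⟨i, h'⟩, ← finExt_val t ⟨i + 1, h⟩] at this
      exact this
    · rw [finExt_of_le t (not_lt.1 h)]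
      simp
  · by_cases h : 1 < n
    · have h' : 0 < n := by omega
      have := braid_zero ⟨0, h'⟩ ⟨1, h⟩ rfl rfl
      rw [← finExt_val t ⟨0, h'⟩, ← finExt_val t ⟨1, h⟩] at this
      exact this
    · rw [finExt_of_le t (not_lt.1 h)]
      simp

namespace EnhancedQuiver

/-! ## Independence of normal words -/

section Weyl

variable {k : Type*} [Field k] {n : ℕ}

variable (k n) in
/-- The automorphism `s_i`, the identity for `i` out of range. -/
def natSK (i : ℕ) : PSField k n ≃ₐ[k] PSField k n := if h : i < n then sK ⟨i, h⟩ else 1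

variable (k n) in
/-- The action of words on rational functions. -/
def wordSK : FreeMonoid ℕ →* (PSField k n ≃ₐ[k] PSField k n) := FreeMonoid.lift (natSK k n)

variable (k n) in
/-- The variable with a given index, zero if the index is out of range. -/
def natX (l : ℕ) : PSField k n := if h : l < n then fieldX ⟨l, h⟩ else 0

lemma natSK_natSK (i : ℕ) (x : PSField k n) : natSK k n i (natSK k n i x) = x := by
  unfold natSK; split_ifs
  · exact sK_sK _ _
  · rfl

lemma natSK_inv (i : ℕ) : (natSK k n i)⁻¹ = natSK k n i := by
  rw [inv_eq_iff_mul_eq_one]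
  exact AlgEquiv.ext fun x => natSK_natSK i x

lemma natSK_natX_of_lt {i l : ℕ} (h : i < l) (hl : l < n) : natSK k n i (natX k n l) = natX k n l := by
  have hi : i < n := by omega
  simp only [natSK, natX, dif_pos hi, dif_pos hl]
  refine sK_fieldX_of_ne (fun e => ?_) (fun e => ?_)
  · have := congrArg Fin.val e; simp only at this; omega
  · have := congrArg Fin.val e; simp only [prev] at this; omega

lemma natSK_natX_self {i : ℕ} (h : i + 1 < n) :
    natSK k n (i + 1) (natX k n (i + 1)) = natX k n i := by
  have hi : i < n := by omega
  simp only [natSK, natX, dif_pos hi, dif_pos h]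
  rw [sK_fieldX (by simp), Equiv.swap_apply_right]
  rfl

lemma natSK_natX_pred {i : ℕ} (h : i + 1 < n) :
    natSK k n (i + 1) (natX k n i) = natX k n (i + 1) := by
  rw [← natSK_natX_self h, natSK_natSK]

lemma natSK_zero_natX (h : 0 < n) : natSK k n 0 (natX k n 0) = -natX k n 0 := by
  simp only [natSK, natX, dif_pos h]
  exact sK_zero_fieldX rfl

lemma wordSK_natX_of_lt {l : ℕ} (hl : l < n) (w : FreeMonoid ℕ) (hw : ∀ i ∈ w.toList, i < l) :
    wordSK k n w (natX k n l) = natX k n l := by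
  induction w using FreeMonoid.inductionOn' with
  | one => simp
  | of_mul i w ih =>
    simp only [FreeMonoid.toList_mul, FreeMonoid.toList_of, List.mem_append, List.mem_singleton]
      at hw
    rw [map_mul, AlgEquiv.mul_apply, ih fun j hj => hw j (Or.inr hj), wordSK,
      FreeMonoid.lift_eval_of, natSK_natX_of_lt (hw i (Or.inl rfl)) hl]

/-- The inverses of the 2m + 2 prefixes send the variable x_m to the distinct elements x_m, …, x_0,
-x_0, …, -x_m. Thus the image of x_m tells which prefix was used. -/
lemma wordSK_chain_inv {m : ℕ} (hm : m < n) (j : ℕ) (hj : j ≤ 2 * m + 1) :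
    (wordSK k n (chain m j))⁻¹ (natX k n m) =
      if j ≤ m then natX k n (m - j) else -natX k n (j - m - 1) := by
  induction j with
  | zero => simp [chain]
  | succ j ih =>
    rw [chain, map_mul, mul_inv_rev, AlgEquiv.mul_apply, ih (by omega), wordSK,
      FreeMonoid.lift_eval_of, natSK_inv]
    rcases lt_trichotomy j m with h | h | h
    · obtain ⟨d, rfl⟩ : ∃ d, m = j + 1 + d := ⟨m - j - 1, by omega⟩
      rw [chainLetter, if_pos (by omega), if_pos (by omega), if_pos (by omega),
        show j + 1 + d - j = d + 1 by omega, natSK_natX_self (by omega)]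
      congr 1; omega
    · subst h
      rw [chainLetter, if_pos le_rfl, if_pos le_rfl, if_neg (by omega), Nat.sub_self,
        natSK_zero_natX (by omega)]
      congr 2; omega
    · obtain ⟨d, rfl⟩ : ∃ d, j = m + 1 + d := ⟨j - m - 1, by omega⟩
      rw [chainLetter, if_neg (by omega), if_neg (by omega), if_neg (by omega),
        show m + 1 + d - m = d + 1 by omega, show d + 1 - 1 = d by omega, map_neg,
        natSK_natX_pred (by omega)]
      congr 2; omega

variable [CharZero k]

omit [CharZero k] in
lemma natX_eq_iff {l m : ℕ} (hl : l < n) (hm : m < n) : natX k n l = natX k n m ↔ l = m := by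
  refine ⟨fun h => ?_, fun h => by rw [h]⟩
  by_contra hne
  simp only [natX, dif_pos hl, dif_pos hm] at h
  refine fieldX_sub_ne_zero (k := k) (l := ⟨l, hl⟩) (m := ⟨m, hm⟩) (fun e => hne ?_)
    (sub_eq_zero.2 h)
  exact congrArg Fin.val e

lemma natX_ne_neg {l m : ℕ} (hl : l < n) (hm : m < n) : natX k n l ≠ -natX k n m := by
  have : CharZero (PSField k n) :=
    charZero_of_injective_algebraMap (algebraMap k (PSField k n)).injective
  intro h
  by_cases hne : l = m
  · subst hne
    simp only [natX, dif_pos hl] at h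
    exact fieldX_ne_zero (k := k) ⟨l, hl⟩ (self_eq_neg.1 h)
  · simp only [natX, dif_pos hl, dif_pos hm] at h
    refine fieldX_add_ne_zero' (k := k) (l := ⟨l, hl⟩) (m := ⟨m, hm⟩) (fun e => hne ?_)
      (eq_neg_iff_add_eq_zero.1 h)
    exact congrArg Fin.val e

/-- The factor from the smaller group fixes x_m, so the action of the inverse on x_m determines the
last prefix; cancel it and induct. -/
lemma wordSK_nword_injective {m : ℕ} (hm : m ≤ n) :
    Function.Injective fun w : NIdx m => wordSK k n (nword m w) := by
  induction m with
  | zero => intro a b _; rfl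
  | succ m ih =>
    rintro ⟨u, c⟩ ⟨u', c'⟩ h
    have hm' : m < n := hm
    simp only [nword, map_mul] at h
    have h1 := congrArg (fun s => s⁻¹ (natX k n m)) h
    have h2 : ∀ v : NIdx m, (wordSK k n (nword m v))⁻¹ (natX k n m) = natX k n m := fun v =>
      (AlgEquiv.symm_apply_eq _).2
        (wordSK_natX_of_lt hm' _ fun i hi => nword_letters m v i hi).symm
    have hc := c.2
    have hc' := c'.2
    simp only [mul_inv_rev, AlgEquiv.mul_apply, h2] at h1
    rw [wordSK_chain_inv hm' c (by omega), wordSK_chain_inv hm' c' (by omega)] at h1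
    have e : c = c' := by
      apply Fin.ext
      split_ifs at h1 with h3 h4 h4
      · have := (natX_eq_iff (by omega) (by omega)).1 h1
        omega
      · exact absurd h1 (natX_ne_neg (by omega) (by omega))
      · exact absurd h1.symm (natX_ne_neg (by omega) (by omega))
      · have := (natX_eq_iff (by omega) (by omega)).1 (neg_injective h1)
        omega
    subst e
    rw [mul_left_inj] at h
    exact Prod.ext (ih (by omega) h) rfl

variable {J : Type*} {Γ : EnhancedQuiver J} {β : J →₀ ℕ}

/-- The operator `σ_i`. -/
abbrev σop (k : Type*) [Field k] {J : Type*} (Γ : EnhancedQuiver J) (β : J →₀ ℕ) {n : ℕ}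
    (i : Fin n) : Module.End k (RatSpace k Γ β n) := op i 1 0

open Classical in
omit [CharZero k] in
lemma lift_σop_single (w : FreeMonoid ℕ) (hw : ∀ i ∈ w.toList, i < n) (ν : Γ.Comp β n)
    (f : PSField k n) :
    ∃ μ, FreeMonoid.lift (finExt (σop k Γ β)) w (Pi.single ν f) =
      Pi.single μ (wordSK k n w f) := by
  induction w using FreeMonoid.inductionOn' with
  | one => exact ⟨ν, by simp⟩
  | of_mul i w ih =>
    simp only [FreeMonoid.toList_mul, FreeMonoid.toList_of, List.mem_append, List.mem_singleton]
      at hw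
    obtain ⟨μ, h⟩ := ih fun j hj => hw j (Or.inr hj)
    have hi := hw i (Or.inl rfl)
    refine ⟨μ.s ⟨i, hi⟩, ?_⟩
    rw [map_mul, map_mul, Module.End.mul_apply, h, FreeMonoid.lift_eval_of, finExt, dif_pos hi,
      op_single, wordSK, AlgEquiv.mul_apply, FreeMonoid.lift_eval_of, natSK, dif_pos hi]
    simp

/-- Dedekind's independence of characters, applied to the distinct automorphisms given by normal
words. -/
lemma σop_independent (f : NIdx n → RatSpace k Γ β n)
    (hf : ∑ w, FreeMonoid.lift (finExt (σop k Γ β)) (nword n w) * mulOp (f w) = 0) : f = 0 := by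
  classical
  have hli := (linearIndependent_monoidHom (PSField k n) (PSField k n)).comp
    (fun w : NIdx n => (wordSK k n (nword n w) : PSField k n →* PSField k n)) (by
      intro a b h
      exact wordSK_nword_injective le_rfl (AlgEquiv.ext fun x => DFunLike.congr_fun h x))
  rw [Fintype.linearIndependent_iff] at hli
  ext w ν
  have h := hli (fun w => wordSK k n (nword n w) (f w ν)) (by
    ext g
    -- Each word carries a function supported at ν to one supported at a single μ. Summing over all
    -- components forgets μ and leaves a linear relation between automorphisms of the field.
    have h1 := congrArg (fun X : Module.End k (RatSpace k Γ β n) => ∑ μ, X (Pi.single ν g) μ) hf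
    simp only [LinearMap.sum_apply, Module.End.mul_apply, mulOp_single, LinearMap.zero_apply,
      Finset.sum_apply, Pi.zero_apply, Finset.sum_const_zero] at h1
    rw [Finset.sum_comm] at h1
    rw [Finset.sum_apply, Pi.zero_apply, ← h1]
    refine Finset.sum_congr rfl fun w _ => ?_
    obtain ⟨μ, h⟩ := lift_σop_single (nword n w) (nword_letters n w) ν (f w ν * g)
    rw [h, Finset.sum_pi_single']
    simp) w
  simpa using h

end Weyl

end EnhancedQuiver

/-! ### Independence of normal words in operators Aσ_i + B -/

namespace EnhancedQuiver

variable {k : Type*} [Field k] [CharZero k] {J : Type*} {Γ : EnhancedQuiver J} {β : J →₀ ℕ} {n : ℕ}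

omit [CharZero k] in
lemma mulOp_move (A B : Fin n → RatSpace k Γ β n) :
    ∀ s ∈ (mulOp (k := k) (Γ := Γ) (β := β) (n := n)).range, ∀ i : ℕ,
      ∃ r ∈ (mulOp (k := k) (Γ := Γ) (β := β) (n := n)).range,
      ∃ r' ∈ (mulOp (k := k) (Γ := Γ) (β := β) (n := n)).range,
      s * finExt (fun i => op i (A i) (B i)) i = finExt (fun i => op i (A i) (B i)) i * r + r' := by
  rintro _ ⟨F, rfl⟩ i
  by_cases h : i < n
  · simp only [finExt, dif_pos h]
    exact ⟨_, ⟨_, rfl⟩, _, ⟨_, rfl⟩, mulOp_mul_op _ _ _ _⟩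
  · exact ⟨_, ⟨0, rfl⟩, _, ⟨0, rfl⟩, by simp [finExt, h]⟩

omit [CharZero k] in
lemma σop_straightening :
    Straightening (mulOp (k := k) (Γ := Γ) (β := β) (n := n)).range (finExt (σop k Γ β)) := by
  classical
  refine Straightening.of_fin (fun s hs i => ?_) (fun i => ?_) (fun i j hij => ?_)
    (fun i j hi hj => ?_) (fun o i ho hi => ?_)
  · have := mulOp_move (fun _ => 1) (fun _ => 0) s hs i
    simpa only [finExt_val] using this
  · refine ⟨0, Subalgebra.zero_mem _, 1, Subalgebra.one_mem _, End_ext fun ν f => ?_⟩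
    rw [op_sq_single]
    simp
  · exact op_comm hij _ _ _ _ fun ν => by simp
  · have : σop k Γ β i * σop k Γ β j * σop k Γ β i - σop k Γ β j * σop k Γ β i * σop k Γ β j =
        0 := by
      rw [← neg_sub, neg_eq_zero]
      refine End_ext fun ν f => ?_
      rw [op_braid hi hj _ _ _ _ ν 0 (by simp) (by simp) (by simp) (by simp) (by simp) (by simp)]
      simp
    rw [this]
    exact zero_mem _
  · have : σop k Γ β o * σop k Γ β i * σop k Γ β o * σop k Γ β i -
        σop k Γ β i * σop k Γ β o * σop k Γ β i * σop k Γ β o = 0 := by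
      rw [← neg_sub, neg_eq_zero, mul_assoc (_ * _), mul_assoc (σop k Γ β o * _), ← pow_two,
        ← pow_two]
      refine End_ext fun ν f => ?_
      rw [op_braid_zero ho hi _ _ _ _ ν 0 0 0 (by simp) (by simp) (by simp) (by simp) (by simp)
        (by simp) (by simp) (by simp)]
      simp
    rw [this]
    exact zero_mem _

omit [CharZero k] in
lemma op_eq_σop (i : Fin n) (A B : RatSpace k Γ β n) :
    op i A B = mulOp A * σop k Γ β i + mulOp B := by
  refine LinearMap.ext fun F => ?_
  simp [op_apply]

omit [CharZero k] in
-- A nowhere vanishing coefficient can be divided out, so the σ_i lie in the algebra generated by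
-- the operators and the functions.
lemma σop_eq_op (i : Fin n) {A B : RatSpace k Γ β n} (hA : ∀ ν, A ν ≠ 0) :
    σop k Γ β i = mulOp A⁻¹ * (op i A B - mulOp B) := by
  have h : A⁻¹ * A = 1 := by ext ν; simp [inv_mul_cancel₀ (hA ν)]
  rw [op_eq_σop, add_sub_cancel_right, ← mul_assoc, ← map_mul, h, map_one, one_mul]

omit [CharZero k] in
lemma word_mem_adjoin {A : Type*} [Ring A] [Algebra k A] (t : Fin n → A) (S : Subalgebra k A)
    (h : ∀ i, t i ∈ S) (w : FreeMonoid ℕ) : FreeMonoid.lift (finExt t) w ∈ S := by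
  rw [FreeMonoid.lift_apply]
  refine S.list_prod_mem fun x hx => ?_
  obtain ⟨i, -, rfl⟩ := List.mem_map.1 hx
  exact range_finExt_subset t S h i

/-- Both families straighten over the functions and each lies in the algebra generated by the other.
Their normal words therefore span each other, and independence is transported from the σ_i. -/
theorem op_independent {A B : Fin n → RatSpace k Γ β n} (hA : ∀ i ν, A i ν ≠ 0)
    (h : Straightening (mulOp (k := k) (Γ := Γ) (β := β) (n := n)).range
      (finExt fun i => op i (A i) (B i))) (f : NIdx n → RatSpace k Γ β n)
    (hf : ∑ w, FreeMonoid.lift (finExt fun i => op i (A i) (B i)) (nword n w) * mulOp (f w) = 0) :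
    f = 0 := by
  have key : ∀ {t t' : Fin n → Module.End k (RatSpace k Γ β n)},
      Straightening (mulOp (k := k) (Γ := Γ) (β := β) (n := n)).range (finExt t) →
      (∀ i, t' i ∈ Algebra.adjoin k (Set.range (finExt t) ∪
        (mulOp (k := k) (Γ := Γ) (β := β) (n := n)).range)) → ∀ w : NIdx n,
      ∃ a : NIdx n → RatSpace k Γ β n, FreeMonoid.lift (finExt t') (nword n w) =
        ∑ v, FreeMonoid.lift (finExt t) (nword n v) * mulOp (a v) := by
    intro t t' ht ht' w
    obtain ⟨c, hc, e⟩ := ht.exists_sum_nword n (fun i => finExt_of_le t)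
      (word_mem_adjoin t' _ ht' (nword n w))
    choose a ha using hc
    exact ⟨a, by rw [e]; exact Finset.sum_congr rfl fun v _ => by rw [← ha v]; rfl⟩
  have hM : ∀ (t : Fin n → Module.End k (RatSpace k Γ β n)) F,
      mulOp F ∈ Algebra.adjoin k (Set.range (finExt t) ∪
        (mulOp (k := k) (Γ := Γ) (β := β) (n := n)).range) := fun t F =>
    Algebra.subset_adjoin (Or.inr ⟨F, rfl⟩)
  have hT : ∀ (t : Fin n → Module.End k (RatSpace k Γ β n)) i,
      t i ∈ Algebra.adjoin k (Set.range (finExt t) ∪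
        (mulOp (k := k) (Γ := Γ) (β := β) (n := n)).range) := fun t i =>
    Algebra.subset_adjoin (Or.inl ⟨i, finExt_val t i⟩)
  refine independent_of_mutual_span (mulOp (k := k) (Γ := Γ) (β := β) (n := n)).toRingHom
    _ _ σop_independent (key σop_straightening fun i => ?_) (key h fun i => ?_) f hf
  · rw [op_eq_σop]
    exact add_mem (mul_mem (hM _ _) (hT _ i)) (hM _ _)
  · rw [σop_eq_op i (B := B i) (hA i)]
    exact mul_mem (hM _ _) (sub_mem (hT (fun i => op i (A i) (B i)) i) (hM _ _))

/-- A completed algebra acting faithfully by operators has a basis of normal words. -/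
theorem tensorToExt_bijective_of_op {A B : Type*} [Ring A] [Algebra k A] [CommRing B]
    [Algebra k B] {glue : A → B → Prop} {cross : FreeAlgebra k (A ⊕ B) → FreeAlgebra k (A ⊕ B) → Prop}
    (t : Fin n → A)
    (hs : Straightening (Algebra.adjoin k {a | ∃ b, glue a b}) (finExt t))
    (hgen : ∀ a, a ∈ Algebra.adjoin k (Set.range t ∪ {a | ∃ b, glue a b}))
    (hmove : ∀ f i, ∃ g g', ExtAlg.inr k A B glue cross f * ExtAlg.inl k A B glue cross (t i) =
      ExtAlg.inl k A B glue cross (t i) * ExtAlg.inr k A B glue cross g +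
        ExtAlg.inr k A B glue cross g')
    (ρ : ExtAlg k A B glue cross →ₐ[k] Module.End k (RatSpace k Γ β n))
    {c : B →ₐ[k] RatSpace k Γ β n} (hc : Function.Injective c)
    (hρ : ∀ b, ρ (ExtAlg.inr k A B glue cross b) = mulOp (c b))
    {F G : Fin n → RatSpace k Γ β n} (hF : ∀ i ν, F i ν ≠ 0)
    (ht : ∀ i, ρ (ExtAlg.inl k A B glue cross (t i)) = op i (F i) (G i)) :
    Function.Bijective (tensorToExt k glue cross) ∧ Function.Injective ρ := by
  have hte : ∀ i, ρ (ExtAlg.inl k A B glue cross (finExt t i)) =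
      finExt (fun i => op i (F i) (G i)) i := by
    intro i
    unfold finExt
    split_ifs
    · exact ht _
    · rw [map_zero, map_zero]
  have hst : Straightening (mulOp (k := k) (Γ := Γ) (β := β) (n := n)).range
      (finExt fun i => op i (F i) (G i)) := by
    have := hs.map (ρ.comp (ExtAlg.inl k A B glue cross))
      (mulOp (k := k) (Γ := Γ) (β := β) (n := n)).range (by
        rw [AlgHom.map_adjoin, Algebra.adjoin_le_iff]
        rintro _ ⟨a, ⟨b, hab⟩, rfl⟩
        exact ⟨c b, by
          rw [AlgHom.comp_apply, ExtAlg.inl_eq_inr hab, hρ]; rfl⟩) (by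
        intro s hs i
        rw [AlgHom.comp_apply, hte]
        exact mulOp_move F G s hs i)
    simpa only [AlgHom.comp_apply, hte] using this
  refine tensorToExt_bijective t (fun w => FreeMonoid.lift (finExt t) (nword n w)) (fun a => ?_)
    hgen hmove ρ fun f hf => ?_
  · refine hs.exists_sum_nword n (fun i => finExt_of_le t) (Algebra.adjoin_mono ?_ (hgen a))
    refine Set.union_subset_union ?_ Algebra.subset_adjoin
    rintro _ ⟨i, rfl⟩
    exact ⟨i, finExt_val t i⟩
  -- Independence over all rational functions implies independence over B, which embeds into them.
  · have h0 := op_independent hF hst (fun w => c (f w)) (by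
      rw [← hf]
      refine Finset.sum_congr rfl fun w _ => ?_
      rw [hρ]
      congr 1
      simp only [FreeMonoid.lift_apply, map_list_prod, List.map_map]
      congr 2
      funext i
      exact (hte i).symm)
    ext1 w
    exact hc (by rw [congrFun h0 w, Pi.zero_apply, Pi.zero_apply, map_zero])

end EnhancedQuiver

namespace EnhancedQuiver

/-! ## Straightening in the orientifold KLR algebra -/

section Divisibility

variable {J : Type*} (Γ : EnhancedQuiver J) {A : Type*} [CommRing A]

/-- The relations take the quotient g as a parameter, so they can be used only once a quotient is
known to exist. Modulo d the two arguments agree, hence so do the values of Q. -/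
lemma dvd_Q_sub_Q (i j : J) {d u v u' v' : A} (hu : d ∣ u - u') (hv : d ∣ v - v') :
    d ∣ Γ.Q i j u v - Γ.Q i j u' v' := by
  rw [← Ideal.mem_span_singleton, ← Ideal.Quotient.eq] at *
  rw [map_Q, map_Q, hu, hv]

/-- Modulo u + v one has v = -u, and Q' is unchanged when θ is applied to the index and the sign of
the argument is reversed. -/
lemma dvd_Q'_sub_Q' (a : J) (u v : A) : u + v ∣ Γ.Q' (Γ.θ a) v - Γ.Q' a u := by
  have h : u + v ∣ v - -u := by rw [sub_neg_eq_add, add_comm]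
  rw [← Ideal.mem_span_singleton, ← Ideal.Quotient.eq] at *
  rw [map_Q', map_Q', h, map_neg, Q', Q', Γ.θ_invol, neg_neg, mul_comm]

/-- Between fixed points the numbers of arrows in both directions agree, so the two values of Q are
equal powers of -(u + v)² and -(u - v)², whose difference is -4uv. -/
lemma dvd_Q_sub_Q_of_fixed {a b : J} (ha : a = Γ.θ a) (hb : b = Γ.θ b) (hab : a ≠ b) (u v : A) :
    u * v ∣ Γ.Q a b v (-u) - Γ.Q a b v u := by
  have h : Γ.arr b a = Γ.arr a b := by
    have := Γ.arr_θ a b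
    rwa [← ha, ← hb] at this
  simp only [Q, P, if_neg hab, if_neg hab.symm, h, ← mul_pow]
  exact Dvd.dvd.trans ⟨-4, by ring⟩ (sub_dvd_pow_sub_pow _ _ _)

end Divisibility

namespace OKLR

variable {k : Type*} [Field k] {J : Type*} {Γ : EnhancedQuiver J} {β : J →₀ ℕ} {n : ℕ}

variable (k Γ β n) in
/-- The quotient map from the free algebra. -/
def mk : FreeAlgebra k (Γ.OGen β n) →ₐ[k] OKLR k Γ β n := RingQuot.mkAlgHom k (ORel k Γ β n)

lemma mk_rel {a b : FreeAlgebra k (Γ.OGen β n)} (h : ORel k Γ β n a b) :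
    mk k Γ β n a = mk k Γ β n b := RingQuot.mkAlgHom_rel k h

lemma mk_fe (ν : Γ.Comp β n) : mk k Γ β n (fe k Γ β n ν) = e ν := rfl
lemma mk_fx (l : Fin n) : mk k Γ β n (fx k Γ β n l) = x l := rfl
lemma mk_fτ (i : Fin n) : mk k Γ β n (fτ k Γ β n i) = τ i := rfl

lemma sum_e : ∑ ν, (e ν : OKLR k Γ β n) = 1 := by
  simpa only [map_sum, map_one, mk_fe] using mk_rel (ORel.e_sum (k := k) (Γ := Γ) (β := β) (n := n))

variable (k Γ β n) in
/-- The subalgebra generated by the elements `e(ν)` and `x_l`. -/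
def poly : Subalgebra k (OKLR k Γ β n) := Algebra.adjoin k {a | ∃ b, OGlue k Γ β n a b}

lemma e_mem (ν : Γ.Comp β n) : (e ν : OKLR k Γ β n) ∈ poly k Γ β n :=
  Algebra.subset_adjoin ⟨_, OGlue.e ν⟩

lemma x_mem (l : Fin n) : (x l : OKLR k Γ β n) ∈ poly k Γ β n :=
  Algebra.subset_adjoin ⟨_, OGlue.x l⟩

lemma fpoly_mem (g : MvPolynomial (Fin n) k) : mk k Γ β n (fpoly k Γ β n g) ∈ poly k Γ β n := by
  rw [map_orderedEval]
  refine Subalgebra.sum_mem _ fun m _ => Subalgebra.smul_mem _ (Subalgebra.list_prod_mem _ ?_) _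
  intro a ha
  obtain ⟨l, rfl⟩ := (List.mem_ofFn' _ _).1 ha
  exact Subalgebra.pow_mem _ (x_mem l) _

/-- The idempotents sum to 1, so relations known only after multiplication by each e(ν) suffice for
membership. -/
lemma mem_of_mul_e {M : Submodule k (OKLR k Γ β n)} {a : OKLR k Γ β n} (h : ∀ ν, a * e ν ∈ M) :
    a ∈ M := by
  rw [← mul_one a, ← sum_e, Finset.mul_sum]
  exact M.sum_mem fun ν _ => h ν

lemma mem_poly_of_mul_e {a : OKLR k Γ β n} (h : ∀ ν, a * e ν ∈ poly k Γ β n) :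
    a ∈ poly k Γ β n :=
  mem_of_mul_e (M := Subalgebra.toSubmodule (poly k Γ β n)) h

lemma τ_x_sub_mem {i : Fin n} (hi : i.1 ≠ 0) (l : Fin n) :
    (τ i * x l - x (Equiv.swap (prev i) i l) * τ i : OKLR k Γ β n) ∈ poly k Γ β n := by
  refine mem_poly_of_mul_e fun ν => ?_
  by_cases h : ν (prev i) ≠ ν i ∨ (l ≠ prev i ∧ l ≠ i)
  · have := mk_rel (ORel.mixed_ne (k := k) i hi l ν h)
    simp only [map_mul, map_sub, mk_fe, mk_fx, mk_fτ, map_zero] at this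
    rw [this]
    exact zero_mem _
  · push Not at h
    by_cases hl : l = prev i
    · have := mk_rel (ORel.mixed_left (k := k) i hi ν h.1)
      simp only [map_mul, map_sub, mk_fe, mk_fx, mk_fτ, map_neg] at this
      rw [hl, Equiv.swap_apply_left, this]
      exact neg_mem (e_mem ν)
    · have := mk_rel (ORel.mixed_right (k := k) i hi ν h.1)
      simp only [map_mul, map_sub, mk_fe, mk_fx, mk_fτ] at this
      rw [h.2 hl, Equiv.swap_apply_right, this]
      exact e_mem ν

lemma τ_x_add_mem {o : Fin n} (ho : o.1 = 0) :
    (τ o * x o + x o * τ o : OKLR k Γ β n) ∈ poly k Γ β n := by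
  refine mem_poly_of_mul_e fun ν => ?_
  by_cases h : ν o = Γ.θ (ν o)
  · have := mk_rel (ORel.mixed_zero_eq (k := k) o ho ν h)
    simp only [map_mul, map_add, mk_fe, mk_fx, mk_fτ, map_neg, map_ofNat] at this
    rw [this]
    exact mul_mem (neg_mem (ofNat_mem _ 2)) (e_mem ν)
  · have := mk_rel (ORel.mixed_zero_ne (k := k) o ho ν h)
    simp only [map_mul, map_add, mk_fe, mk_fx, mk_fτ, map_zero] at this
    rw [this]
    exact zero_mem _

lemma e_mul_τ (i : Fin n) (ν : Γ.Comp β n) :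
    (e ν * τ i : OKLR k Γ β n) = τ i * e (ν.s i) := by
  have := mk_rel (ORel.τ_e (k := k) i (ν.s i))
  simp only [map_mul, mk_fe, mk_fτ, Comp.s_s] at this
  exact this.symm

lemma poly_move : ∀ s ∈ poly k Γ β n, ∀ i : Fin n, ∃ r ∈ poly k Γ β n, ∃ r' ∈ poly k Γ β n,
    s * τ i = τ i * r + r' := by
  have h := Straightening.move_of_generators (S := poly k Γ β n)
    (t := finExt (τ : Fin n → OKLR k Γ β n)) rfl ?_
  · intro s hs i
    simpa only [finExt_val] using h s hs i
  rintro _ ⟨b, h⟩ i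
  by_cases hi : i < n
  swap
  · exact ⟨0, zero_mem _, 0, zero_mem _, by simp [finExt, hi]⟩
  simp only [finExt, dif_pos hi]
  generalize (⟨i, hi⟩ : Fin n) = i
  cases h with
  | e ν => exact ⟨_, e_mem (ν.s i), 0, zero_mem _, by rw [e_mul_τ, add_zero]⟩
  | x l =>
    by_cases hi : i.1 = 0
    · by_cases hl : l = i
      · subst hl
        exact ⟨_, neg_mem (x_mem l), _, τ_x_add_mem hi, by rw [mul_neg, neg_add_cancel_left]⟩
      · have := mk_rel (ORel.mixed_zero_comm (k := k) (Γ := Γ) (β := β) i hi l hl)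
        simp only [map_mul, mk_fx, mk_fτ] at this
        exact ⟨_, x_mem l, 0, zero_mem _, by rw [this, add_zero]⟩
    · refine ⟨_, x_mem (Equiv.swap (prev i) i l), _,
        neg_mem (τ_x_sub_mem hi (Equiv.swap (prev i) i l)), ?_⟩
      rw [Equiv.swap_apply_self]
      abel

lemma poly_mul_τ_mul_mem {l : ℕ} (hl : 2 ≤ l) {s s' : OKLR k Γ β n} (hs : s ∈ poly k Γ β n)
    (i : Fin n) (hs' : s' ∈ poly k Γ β n) : s * τ i * s' ∈ wordSpan (poly k Γ β n) (finExt τ) l := by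
  obtain ⟨r, hr, r', hr', e⟩ := poly_move s hs i
  rw [e, add_mul, mul_assoc]
  refine add_mem ?_ ?_
  · have := mem_wordSpan (t := finExt (τ : Fin n → OKLR k Γ β n)) (l := l) (FreeMonoid.of i.1)
      (mul_mem hr hs') (by rw [FreeMonoid.length_of]; omega)
    simpa [finExt_val] using this
  · have := mem_wordSpan (t := finExt (τ : Fin n → OKLR k Γ β n)) (l := l) 1
      (mul_mem hr' hs') (by rw [FreeMonoid.length_one]; omega)
    simpa using this

lemma poly_mem_wordSpan {l : ℕ} (hl : 1 ≤ l) {s : OKLR k Γ β n} (hs : s ∈ poly k Γ β n) :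
    s ∈ wordSpan (poly k Γ β n) (finExt τ) l := by
  have := mem_wordSpan (t := finExt (τ : Fin n → OKLR k Γ β n)) (l := l) 1
    hs (by rw [FreeMonoid.length_one]; omega)
  simpa using this

/-- The error terms of the deformed braid relations contain at most one generator τ_i, with
polynomial factors around it, so they are shorter than the words being compared. -/
theorem straightening :
    Straightening (poly k Γ β n) (finExt (τ : Fin n → OKLR k Γ β n)) := by
  refine Straightening.of_fin poly_move (fun i => ⟨0, zero_mem _, τ i * τ i, ?_, by simp⟩)
    (fun i j hij => ?_) (fun i j hi hj => ?_) (fun o i ho hi => ?_)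
  · refine mem_poly_of_mul_e fun ν => ?_
    by_cases hi : i.1 = 0
    · have := mk_rel (ORel.τ_sq_zero (k := k) i hi ν)
      simp only [map_mul, mk_fe, mk_fτ] at this
      rw [this]
      exact mul_mem (fpoly_mem _) (e_mem ν)
    · have := mk_rel (ORel.τ_sq (k := k) i hi ν)
      simp only [map_mul, mk_fe, mk_fτ] at this
      rw [this]
      exact mul_mem (fpoly_mem _) (e_mem ν)
  · have := mk_rel (ORel.τ_comm (k := k) (Γ := Γ) (β := β) i j (by omega) (by omega))
    simpa only [map_mul, mk_fτ] using this
  · rw [← neg_sub]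
    refine neg_mem (mem_of_mul_e fun ν => ?_)
    by_cases h : ν (prev i) = ν j
    -- Divisibility provides the quotient g that the relation asks for.
    · obtain ⟨g, hg⟩ := Γ.dvd_Q_sub_Q (A := MvPolynomial (Fin n) k) (ν (prev i)) (ν i)
        (d := MvPolynomial.X (prev i) - MvPolynomial.X j)
        (u := MvPolynomial.X i) (u' := MvPolynomial.X i) (by simp) dvd_rfl
      have := mk_rel (ORel.braid_eq (k := k) i j hi hj ν h g hg.symm)
      simp only [map_mul, map_sub, mk_fe, mk_fτ] at this
      rw [this]
      exact poly_mem_wordSpan (by norm_num) (mul_mem (fpoly_mem _) (e_mem ν))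
    · have := mk_rel (ORel.braid_ne (k := k) i j hi hj ν h)
      simp only [map_mul, map_sub, mk_fe, mk_fτ, map_zero] at this
      rw [this]
      exact zero_mem _
  · rw [← neg_sub, mul_assoc (_ * _), mul_assoc (τ o * _), ← pow_two, ← pow_two]
    refine neg_mem (mem_of_mul_e fun ν => ?_)
    by_cases ha : ν o ≠ ν i ∧ ν i = Γ.θ (ν o)
    · obtain ⟨g, hg⟩ := Γ.dvd_Q'_sub_Q' (ν o) (MvPolynomial.X o : MvPolynomial (Fin n) k)
        (MvPolynomial.X i)
      rw [← ha.2] at hg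
      have := mk_rel (ORel.braid_zero_a (k := k) o i ho hi ν ha.1 ha.2 g hg.symm)
      simp only [map_mul, map_sub, map_pow, mk_fe, mk_fτ] at this
      rw [this]
      exact poly_mul_τ_mul_mem (by norm_num) (fpoly_mem _) i (e_mem ν)
    by_cases hb : ν o ≠ Γ.θ (ν o) ∧ ν i = Γ.θ (ν i)
    · obtain ⟨g, hg⟩ := Γ.dvd_Q_sub_Q (A := MvPolynomial (Fin n) k) (ν o) (ν i)
        (d := MvPolynomial.X i) (u := MvPolynomial.X i) (u' := -MvPolynomial.X i)
        (v := -MvPolynomial.X o) (v' := -MvPolynomial.X o)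
        (by rw [sub_neg_eq_add]; exact dvd_add dvd_rfl dvd_rfl) (by simp)
      have := mk_rel (ORel.braid_zero_b (k := k) o i ho hi ν hb.1 hb.2 g hg.symm)
      simp only [map_mul, map_sub, map_pow, mk_fe, mk_fτ] at this
      rw [this]
      exact poly_mul_τ_mul_mem (by norm_num) (fpoly_mem _) o (e_mem ν)
    by_cases hc : ν o = Γ.θ (ν o) ∧ ν o ≠ ν i ∧ ν i = Γ.θ (ν i)
    · obtain ⟨g, hg⟩ := Γ.dvd_Q_sub_Q_of_fixed hc.1 hc.2.2 hc.2.1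
        (MvPolynomial.X o : MvPolynomial (Fin n) k) (MvPolynomial.X i)
      have := mk_rel (ORel.braid_zero_c (k := k) o i ho hi ν hc.1 hc.2.1 hc.2.2 g hg.symm)
      simp only [map_mul, map_sub, map_pow, map_add, map_one, mk_fe, mk_fτ, mk_fx] at this
      rw [this, mul_add, add_mul, mul_one, ← mul_assoc]
      exact add_mem (poly_mul_τ_mul_mem (by norm_num) (mul_mem (fpoly_mem _) (x_mem o)) o (e_mem ν))
        (poly_mem_wordSpan (by norm_num) (mul_mem (fpoly_mem _) (e_mem ν)))
    · have := mk_rel (ORel.braid_zero_d (k := k) o i ho hi ν ha hb hc)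
      simp only [map_mul, map_sub, map_pow, mk_fe, mk_fτ, map_zero] at this
      rw [this]
      exact zero_mem _

lemma mem_adjoin (a : OKLR k Γ β n) :
    a ∈ Algebra.adjoin k (Set.range τ ∪ {a | ∃ b, OGlue k Γ β n a b}) := by
  obtain ⟨a, rfl⟩ : ∃ b, mk k Γ β n b = a := RingQuot.mkAlgHom_surjective k (ORel k Γ β n) a
  induction a using FreeAlgebra.induction with
  | grade0 r => rw [AlgHom.commutes]; exact Subalgebra.algebraMap_mem _ _
  | grade1 g =>
    refine Algebra.subset_adjoin ?_
    cases g with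
    | e ν => exact Or.inr ⟨_, OGlue.e ν⟩
    | x l => exact Or.inr ⟨_, OGlue.x l⟩
    | τ i => exact Or.inl ⟨i, rfl⟩
  | mul a b ha hb => rw [map_mul]; exact mul_mem ha hb
  | add a b ha hb => rw [map_add]; exact add_mem ha hb

variable (k Γ β n) in
/-- The representation of the orientifold KLR algebra on rational functions. -/
def rep : OKLR k Γ β n →ₐ[k] Module.End k (RatSpace k Γ β n) :=
  RingQuot.liftAlgHom k ⟨freeOp k Γ β n, fun _ _ h => freeOp_rel h⟩

lemma rep_mk (a : FreeAlgebra k (Γ.OGen β n)) : rep k Γ β n (mk k Γ β n a) = freeOp k Γ β n a :=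
  RingQuot.liftAlgHom_mkAlgHom_apply _ _ _ _

lemma rep_τ (i : Fin n) : rep k Γ β n (τ i) = τop k Γ β i := by
  rw [← mk_fτ, rep_mk, freeOp_fτ]

lemma rep_x (l : Fin n) : rep k Γ β n (x l) = constOp k Γ β n (fieldX l) := by
  rw [← mk_fx, rep_mk, freeOp_fx]

open Classical in
lemma rep_e (ν : Γ.Comp β n) : rep k Γ β n (e ν) = mulOp (Pi.single ν 1) := by
  rw [← mk_fe, rep_mk, freeOp_fe]

end OKLR

end EnhancedQuiver

namespace EnhancedQuiver

/-! ## The completed orientifold KLR algebra -/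

variable {k : Type*} [Field k] {J : Type*} {Γ : EnhancedQuiver J} {β : J →₀ ℕ} {n : ℕ}

lemma actx_eq (i : Fin n) (f : MvPowerSeries (Fin n) k) : actx i f = simpleRefl i f :=
  (reflHom_apply i f).symm

lemma simpleRefl_simpleRefl (i : Fin n) (f : MvPowerSeries (Fin n) k) :
    simpleRefl i (simpleRefl i f) = f :=
  DFunLike.congr_fun (reflHom_reflHom i) f

variable (k Γ β n) in
/-- Power series as rational functions. -/
def serMap : Phat k Γ β n →ₐ[k] RatSpace k Γ β n :=
  AlgHom.pi fun ν => (IsScalarTower.toAlgHom k (MvPowerSeries (Fin n) k) (PSField k n)).comp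
    (Pi.evalAlgHom k _ ν)

lemma serMap_apply (F : Phat k Γ β n) (ν : Γ.Comp β n) :
    serMap k Γ β n F ν = algebraMap _ (PSField k n) (F ν) := rfl

lemma serMap_injective : Function.Injective (serMap k Γ β n) := fun _ _ h =>
  funext fun ν => IsFractionRing.injective (MvPowerSeries (Fin n) k) (PSField k n) (congrFun h ν)

open Classical in
lemma serMap_single (ν : Γ.Comp β n) (f : MvPowerSeries (Fin n) k) :
    serMap k Γ β n (Pi.single ν f) = Pi.single ν (algebraMap _ (PSField k n) f) := by
  ext μ
  rw [serMap_apply]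
  by_cases h : μ = ν
  · subst h; simp
  · rw [Pi.single_eq_of_ne h, Pi.single_eq_of_ne h, map_zero]

open Classical in
lemma τop_mul_single (i : Fin n) (ν : Γ.Comp β n) (f : PSField k n) :
    τop k Γ β i * mulOp (Pi.single ν f) =
      mulOp (Pi.single (ν.s i) (sK i f)) * τop k Γ β i +
        mulOp (Pi.single ν (τB k Γ β i ν * (f - sK i f))) := by
  rw [τop, op_mul_mulOp, sV_single, mul_sub, τB_mul_single, ← mul_sub, ← Pi.single_sub,
    Pi.single_mul_right]

open Classical in
lemma τop_mul_single_eq {i : Fin n} (hi : i.1 ≠ 0) {ν : Γ.Comp β n} (h : ν (prev i) = ν i)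
    {f g : PSField k n} (hg : (fieldX (prev i) - fieldX i) * g = sK i f - f) :
    τop k Γ β i * mulOp (Pi.single ν f) =
      mulOp (Pi.single ν (sK i f)) * τop k Γ β i + mulOp (Pi.single ν g) := by
  have hu := fieldX_sub_ne_zero (k := k) (prev_ne hi)
  rw [τop_mul_single, Comp.s_eq_self hi h, τB, if_neg hi, cB, if_pos h,
    show -(fieldX (prev i) - fieldX i)⁻¹ * (f - sK i f) = g by
      rw [← neg_sub (sK _ f), ← hg]; field_simp]

open Classical in
lemma τop_mul_single_zero_eq {o : Fin n} (ho : o.1 = 0) {ν : Γ.Comp β n} (h : ν o = Γ.θ (ν o))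
    {f g : PSField k n} (hg : fieldX o * g = sK o f - f) :
    τop k Γ β o * mulOp (Pi.single ν f) =
      mulOp (Pi.single ν (sK o f)) * τop k Γ β o + mulOp (Pi.single ν g) := by
  have hu := fieldX_ne_zero (k := k) o
  rw [τop_mul_single, Comp.s_zero_eq_self ho h, τB, if_pos ho, cB₀, if_pos h,
    show -(fieldX o)⁻¹ * (f - sK o f) = g by rw [← neg_sub (sK _ f), ← hg]; field_simp]

namespace OKLRhat

lemma rep_glue {a : OKLR k Γ β n} {b : Phat k Γ β n} (h : OGlue k Γ β n a b) :
    OKLR.rep k Γ β n a = (mulOp.comp (serMap k Γ β n)) b := by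
  classical
  cases h with
  | e ν =>
    rw [OKLR.rep_e, AlgHom.comp_apply]
    rw [← map_one (algebraMap (MvPowerSeries (Fin n) k) (PSField k n)), ← serMap_single]
  | x l => rw [OKLR.rep_x]; rfl

lemma rep_cross {u v : FreeAlgebra k (OKLR k Γ β n ⊕ Phat k Γ β n)} (h : OCross k Γ β n u v) :
    FreeAlgebra.lift k (Sum.elim (OKLR.rep k Γ β n) (mulOp.comp (serMap k Γ β n))) u =
    FreeAlgebra.lift k (Sum.elim (OKLR.rep k Γ β n) (mulOp.comp (serMap k Γ β n))) v := by
  classical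
  cases h with
  | ne i hi ν h f =>
    simp only [map_mul, FreeAlgebra.lift_ι_apply, Sum.elim_inl, Sum.elim_inr, OKLR.rep_τ,
      AlgHom.comp_apply, serMap_single, actx_eq, ← sK_algebraMap]
    rw [τop_mul_single, τB, if_neg hi, cB, if_neg h, zero_mul, Pi.single_zero, map_zero, add_zero]
  | eq i hi ν h f g hg =>
    simp only [map_mul, map_add, FreeAlgebra.lift_ι_apply, Sum.elim_inl, Sum.elim_inr, OKLR.rep_τ,
      AlgHom.comp_apply, serMap_single, actx_eq, ← sK_algebraMap]
    refine τop_mul_single_eq hi h ?_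
    rw [sK_algebraMap, ← actx_eq, ← map_sub, ← hg, map_mul, map_sub]
    rfl
  | zero_ne o ho ν h f =>
    simp only [map_mul, FreeAlgebra.lift_ι_apply, Sum.elim_inl, Sum.elim_inr, OKLR.rep_τ,
      AlgHom.comp_apply, serMap_single, actx_eq, ← sK_algebraMap]
    rw [τop_mul_single, τB, if_pos ho, cB₀, if_neg h, zero_mul, Pi.single_zero, map_zero, add_zero]
  | zero_eq o ho ν h f g hg =>
    simp only [map_mul, map_add, FreeAlgebra.lift_ι_apply, Sum.elim_inl, Sum.elim_inr, OKLR.rep_τ,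
      AlgHom.comp_apply, serMap_single, actx_eq, ← sK_algebraMap]
    refine τop_mul_single_zero_eq ho h ?_
    rw [sK_algebraMap, ← actx_eq, ← map_sub, ← hg, map_mul]
    rfl

variable (k Γ β n) in
/-- The representation of the completed orientifold KLR algebra on rational functions. -/
def rep : OKLRhat k Γ β n →ₐ[k] Module.End k (RatSpace k Γ β n) :=
  ExtAlg.lift (OKLR.rep k Γ β n) (mulOp.comp (serMap k Γ β n)) (fun _ _ => rep_glue)
    (fun _ _ => rep_cross)

lemma rep_ofOKLR (a : OKLR k Γ β n) :
    rep k Γ β n (ofOKLR k Γ β n a) = OKLR.rep k Γ β n a := ExtAlg.lift_inl _ _ _ _ _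

lemma rep_ofPhat (F : Phat k Γ β n) :
    rep k Γ β n (ofPhat k Γ β n F) = mulOp (serMap k Γ β n F) := ExtAlg.lift_inr _ _ _ _ _

open Classical in
-- Uniform version of the crossing rules: the divided difference always exists because a reflection
-- is trivial on its hyperplane, and no correction occurs where s_i moves ν.
lemma ofOKLR_τ_mul_single (i : Fin n) (ν : Γ.Comp β n) (f : MvPowerSeries (Fin n) k) :
    ∃ g, ofOKLR k Γ β n (OKLR.τ i) * ofPhat k Γ β n (Pi.single ν f) =
      ofPhat k Γ β n (Pi.single (ν.s i) (simpleRefl i f)) * ofOKLR k Γ β n (OKLR.τ i) +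
        ofPhat k Γ β n (Pi.single ν g) := by
  have key : ∀ {u v}, OCross k Γ β n u v → ExtAlg.mk k _ _ (OGlue k Γ β n) (OCross k Γ β n) u =
    ExtAlg.mk k _ _ (OGlue k Γ β n) (OCross k Γ β n) v := fun h => ExtAlg.cross_eq h
  by_cases hi : i.1 = 0
  · by_cases h : ν i = Γ.θ (ν i)
    · obtain ⟨g, hg⟩ := dvd_simpleRefl_zero_sub i hi f
      rw [← actx_eq] at hg
      have := key (OCross.zero_eq i hi ν h f g hg.symm)
      rw [map_mul, map_add, map_mul] at this
      refine ⟨g, ?_⟩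
      rw [Comp.s_zero_eq_self hi h, ← actx_eq]
      exact this
    · have := key (OCross.zero_ne i hi ν h f)
      rw [map_mul, map_mul] at this
      refine ⟨0, ?_⟩
      rw [Pi.single_zero, map_zero, add_zero, ← actx_eq]
      exact this
  · by_cases h : ν (prev i) = ν i
    · obtain ⟨g, hg⟩ := dvd_simpleRefl_sub i hi f
      rw [← actx_eq] at hg
      have := key (OCross.eq i hi ν h f g hg.symm)
      rw [map_mul, map_add, map_mul] at this
      refine ⟨g, ?_⟩
      rw [Comp.s_eq_self hi h, ← actx_eq]
      exact this
    · have := key (OCross.ne i hi ν h f)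
      rw [map_mul, map_mul] at this
      refine ⟨0, ?_⟩
      rw [Pi.single_zero, map_zero, add_zero, ← actx_eq]
      exact this

/-- The crossing rule for the reflected series at s_iν, read from right to left, followed by
summation over ν. -/
lemma ofPhat_mul_τ (f : Phat k Γ β n) (i : Fin n) :
    ∃ g g', ofPhat k Γ β n f * ofOKLR k Γ β n (OKLR.τ i) =
      ofOKLR k Γ β n (OKLR.τ i) * ofPhat k Γ β n g + ofPhat k Γ β n g' := by
  classical
  have key : ∀ ν : Γ.Comp β n, ∃ g g', ofPhat k Γ β n (Pi.single ν (f ν)) *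
      ofOKLR k Γ β n (OKLR.τ i) = ofOKLR k Γ β n (OKLR.τ i) * ofPhat k Γ β n g +
        ofPhat k Γ β n g' := by
    intro ν
    obtain ⟨g, hg⟩ := ofOKLR_τ_mul_single (k := k) i (ν.s i) (simpleRefl i (f ν))
    rw [Comp.s_s, simpleRefl_simpleRefl] at hg
    exact ⟨_, -Pi.single (ν.s i) g, by rw [hg, map_neg]; abel⟩
  choose g g' h using key
  refine ⟨∑ ν, g ν, ∑ ν, g' ν, ?_⟩
  conv_lhs => rw [← Finset.univ_sum_single f]
  simp only [map_sum, Finset.sum_mul, Finset.mul_sum, h, Finset.sum_add_distrib]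

lemma τA_ne_zero (i : Fin n) (ν : Γ.Comp β n) : τA k Γ β i ν ≠ 0 := by
  unfold τA cA₀ cA
  split_ifs with hi h h
  · exact inv_ne_zero (fieldX_ne_zero _)
  · exact pow_ne_zero _ (fieldX_ne_zero _)
  · exact inv_ne_zero (fieldX_sub_ne_zero (prev_ne hi))
  · exact pow_ne_zero _ (fieldX_sub_ne_zero (prev_ne hi))

theorem bijective_and_faithful [CharZero k] :
    Function.Bijective (tensorToExt k (OGlue k Γ β n) (OCross k Γ β n)) ∧
      Function.Injective (rep k Γ β n) := by
  refine tensorToExt_bijective_of_op (F := τA k Γ β) (G := τB k Γ β) (c := serMap k Γ β n)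
    OKLR.τ OKLR.straightening OKLR.mem_adjoin ?_ (rep k Γ β n) serMap_injective ?_ τA_ne_zero ?_
  · exact ofPhat_mul_τ
  · exact rep_ofPhat
  · intro i
    exact (rep_ofOKLR _).trans (OKLR.rep_τ i)

end OKLRhat

end EnhancedQuiver

namespace EnhancedQuiver

/-! ### The series t(x_l) in the field of fractions -/

section FieldT

variable {k : Type*} [Field k] [CharZero k] {n : ℕ}

variable (k) in
/-- The series `t(x_l)` with `t⁻¹ - t = x_l` as a rational function. -/
def fieldT (l : Fin n) : PSField k n := algebraMap (MvPowerSeries (Fin n) k) _ (tser k l)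

lemma fieldT_ne_zero (l : Fin n) : fieldT k l ≠ 0 := by
  rw [fieldT, Ne, IsFractionRing.to_map_eq_zero_iff]
  intro h
  have := constantCoeff_tser (k := k) l
  rw [h, map_zero] at this
  exact zero_ne_one this

omit [CharZero k] in
lemma algebraMap_inv_of_ne {f : MvPowerSeries (Fin n) k} (h : MvPowerSeries.constantCoeff f ≠ 0) :
    algebraMap (MvPowerSeries (Fin n) k) (PSField k n) f⁻¹ = (algebraMap _ _ f)⁻¹ := by
  refine eq_inv_of_mul_eq_one_left ?_
  rw [← map_mul, MvPowerSeries.inv_mul_cancel _ h, map_one]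

lemma algebraMap_inv_tser (l : Fin n) :
    algebraMap (MvPowerSeries (Fin n) k) (PSField k n) (tser k l)⁻¹ = (fieldT k l)⁻¹ :=
  algebraMap_inv_of_ne (by rw [constantCoeff_tser]; exact one_ne_zero)

lemma inv_fieldT_sub (l : Fin n) : (fieldT k l)⁻¹ - fieldT k l = fieldX l := by
  rw [← algebraMap_inv_tser, fieldT, ← map_sub, inv_tser_sub, fieldX]

lemma sK_fieldT {i : Fin n} (hi : i.1 ≠ 0) (l : Fin n) :
    sK i (fieldT k l) = fieldT k (Equiv.swap (prev i) i l) := by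
  rw [fieldT, sK_algebraMap, simpleRefl_tser i hi, fieldT]

lemma sK_zero_fieldT {o : Fin n} (ho : o.1 = 0) : sK o (fieldT k o) = (fieldT k o)⁻¹ := by
  rw [fieldT, sK_algebraMap, simpleRefl_zero_tser o ho, algebraMap_inv_tser, fieldT]

lemma sK_zero_fieldT_ne {o : Fin n} (ho : o.1 = 0) {l : Fin n} (hl : l ≠ o) :
    sK o (fieldT k l) = fieldT k l := by
  rw [fieldT, sK_algebraMap, simpleRefl_zero_tser_ne o ho l hl]

variable (k) in
/-- The constant functions. -/
abbrev fieldC (n : ℕ) (c : k) : PSField k n := algebraMap k _ c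

omit [CharZero k] in
lemma fieldC_ne_zero {c : k} (hc : c ≠ 0) : fieldC k n c ≠ 0 := by
  rwa [Ne, map_eq_zero]

/-- If a t = b t' for two variables, the reflection gives a t' = b t, whence t² = t'². Then t = ±t'
and the variables x, x' are equal or opposite, a contradiction. -/
lemma fieldT_sub_ne_zero {i : Fin n} (hi : i.1 ≠ 0) {a b : k} (ha : a ≠ 0) :
    fieldC k n a * fieldT k (prev i) - fieldC k n b * fieldT k i ≠ 0 := by
  intro h
  have h' := congrArg (sK i) h
  simp only [map_sub, map_mul, map_zero, AlgEquiv.commutes, sK_fieldT hi, Equiv.swap_apply_left,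
    Equiv.swap_apply_right] at h'
  change fieldC k n a * fieldT k i - fieldC k n b * fieldT k (prev i) = 0 at h'
  have hu := fieldT_ne_zero (k := k) (prev i)
  have hv := fieldT_ne_zero (k := k) i
  have hx := inv_fieldT_sub (k := k) (prev i)
  have hy := inv_fieldT_sub (k := k) i
  have h1 := fieldX_sub_ne_zero (k := k) (prev_ne hi)
  have h2 := fieldX_add_ne_zero' (k := k) (prev_ne hi)
  have hA := fieldC_ne_zero (n := n) ha
  generalize fieldT k (prev i) = u at *
  generalize fieldT k i = v at *
  generalize fieldC k n a = A at *
  generalize fieldC k n b = B at *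
  have e : (A * u) * (u - v) * (u + v) = 0 := by linear_combination (u ^ 2) * h - v * u * h'
  rcases mul_eq_zero.1 e with e | e
  · rcases mul_eq_zero.1 e with e | e
    · exact mul_ne_zero hA hu e
    · apply h1
      rw [← hx, ← hy, sub_eq_zero.1 e, sub_self]
  · apply h2
    rw [← hx, ← hy, eq_neg_of_add_eq_zero_left e, inv_neg]
    ring

/-- If a t = b, the reflection gives a t⁻¹ = b; subtracting yields a x = 0. -/
lemma fieldT_zero_sub_ne_zero {o : Fin n} (ho : o.1 = 0) {a b : k} (ha : a ≠ 0) :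
    fieldC k n a * fieldT k o - fieldC k n b ≠ 0 := by
  intro h
  have h' := congrArg (sK o) h
  simp only [map_sub, map_mul, map_zero, AlgEquiv.commutes, sK_zero_fieldT ho] at h'
  have hx := inv_fieldT_sub (k := k) o
  refine fieldX_ne_zero (k := k) o (mul_left_cancel₀ (fieldC_ne_zero (n := n) ha) ?_)
  rw [← hx]
  linear_combination h' - h

end FieldT

end EnhancedQuiver

/-! ### The elements X_l as rational functions and the Demazure–Lusztig coefficients -/

namespace BKRParam

open EnhancedQuiver

section

variable {k : Type*} [Field k] [CharZero k] (D : BKRParam k) {β : D.J →₀ ℕ} {n : ℕ}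

/-- The element `X_l` as a rational function. -/
def ratX (l : Fin n) : RatSpace k D.quiver β n := fun ν => fieldC k n (D.X (ν l)) * fieldT k l

lemma ratX_ne_zero (l : Fin n) (ν : D.Comp β n) : D.ratX l ν ≠ 0 :=
  mul_ne_zero (fieldC_ne_zero (Units.ne_zero _)) (fieldT_ne_zero l)

lemma sK_ratX {i : Fin n} (hi : i.1 ≠ 0) (l : Fin n) (ν : D.Comp β n) :
    sK i (D.ratX l ν) = D.ratX (Equiv.swap (prev i) i l) (ν.s i) := by
  rw [ratX, ratX, map_mul, AlgEquiv.commutes, sK_fieldT hi, Comp.s_apply hi,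
    Equiv.swap_apply_self]

/-- The sign change x ↦ -x inverts t, and θ inverts ν_1; together they invert X_1 = ν_1 t(x_1). -/
lemma sK_zero_ratX {o : Fin n} (ho : o.1 = 0) (ν : D.Comp β n) :
    sK o (D.ratX o ν) = (D.ratX o (ν.s o))⁻¹ := by
  have h : (D.X (D.quiver.θ (ν o)) : k) = (D.X (ν o) : k)⁻¹ := Units.val_inv_eq_inv_val _
  rw [ratX, ratX, map_mul, AlgEquiv.commutes, sK_zero_fieldT ho, Comp.s_apply_zero ho, h,
    mul_inv, ← map_inv₀, inv_inv]

lemma sK_zero_ratX_ne {o : Fin n} (ho : o.1 = 0) {l : Fin n} (hl : l ≠ o) (ν : D.Comp β n) :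
    sK o (D.ratX l ν) = D.ratX l (ν.s o) := by
  rw [ratX, ratX, map_mul, AlgEquiv.commutes, sK_zero_fieldT_ne ho hl,
    Comp.s_apply_zero_ne ho ν hl]

lemma sK_ratX_of_ne {i l : Fin n} (h : l ≠ i) (h' : l ≠ prev i) (ν : D.Comp β n) :
    sK i (D.ratX l ν) = D.ratX l (ν.s i) := by
  by_cases hi : i.1 = 0
  · exact D.sK_zero_ratX_ne hi h ν
  · rw [D.sK_ratX hi, Equiv.swap_apply_of_ne_of_ne h' h]

lemma mul_ratX_sub_ne_zero {i : Fin n} (hi : i.1 ≠ 0) (ν : D.Comp β n) {a b : k} (ha : a ≠ 0) :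
    fieldC k n a * D.ratX (prev i) ν - fieldC k n b * D.ratX i ν ≠ 0 := by
  rw [ratX, ratX, ← mul_assoc, ← mul_assoc, ← map_mul, ← map_mul]
  exact fieldT_sub_ne_zero hi (mul_ne_zero ha (Units.ne_zero _))

lemma ratX_sub_ne_zero {i : Fin n} (hi : i.1 ≠ 0) (ν : D.Comp β n) :
    D.ratX (prev i) ν - D.ratX i ν ≠ 0 := by
  simpa using D.mul_ratX_sub_ne_zero hi ν (one_ne_zero (α := k)) (b := 1)

lemma ratX_zero_sub_ne_zero {o : Fin n} (ho : o.1 = 0) (ν : D.Comp β n) (b : k) :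
    D.ratX o ν - fieldC k n b ≠ 0 :=
  fieldT_zero_sub_ne_zero ho (Units.ne_zero _)

lemma ratX_zero_sq_sub_ne_zero {o : Fin n} (ho : o.1 = 0) (ν : D.Comp β n) :
    D.ratX o ν ^ 2 - 1 ≠ 0 := by
  have h1 := D.ratX_zero_sub_ne_zero ho ν 1
  have h2 := D.ratX_zero_sub_ne_zero ho ν (-1)
  simp only [fieldC, map_neg, map_one, sub_neg_eq_add] at h1 h2
  rw [show D.ratX o ν ^ 2 - 1 = (D.ratX o ν - 1) * (D.ratX o ν + 1) by ring]
  exact mul_ne_zero h1 h2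

end

/-- The coefficient of `σ_i - 1` in `T_i - q`, `i ≠ 0`. -/
def cH {K : Type*} [Field K] (q u v : K) : K := (q * u - q⁻¹ * v) / (u - v)

/-- The coefficient of `σ_0 - 1` in `T_0 - p₀`. -/
def cH₀ {K : Type*} [Field K] (p₀ p₁ u : K) : K := (u + p₀) * (u - p₁) / (p₁ * (u ^ 2 - 1))

lemma map_cH {K L : Type*} [Field K] [Field L] (f : K →+* L) (q u v : K) :
    f (cH q u v) = cH (f q) (f u) (f v) := by simp [cH]

lemma map_cH₀ {K L : Type*} [Field K] [Field L] (f : K →+* L) (p₀ p₁ u : K) :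
    f (cH₀ p₀ p₁ u) = cH₀ (f p₀) (f p₁) (f u) := by simp [cH₀]

section Coeff

variable {K : Type*} [Field K] {q p₀ p₁ u v w : K}

/-- The coefficient plus its reflection is a constant, the sum of the two parameters. This gives the
quadratic relation. -/
lemma cH_add_cH (h : u - v ≠ 0) : cH q u v + cH q v u = q + q⁻¹ := by
  have h' : v - u ≠ 0 := by rwa [← neg_sub, neg_ne_zero]
  unfold cH
  rw [← neg_sub u v, div_neg, ← sub_eq_add_neg, div_sub_div_same, div_eq_iff h]
  ring

lemma cH₀_add_cH₀ (hp : p₁ ≠ 0) (hu : u ≠ 0) (h : u ^ 2 - 1 ≠ 0) :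
    cH₀ p₀ p₁ u + cH₀ p₀ p₁ u⁻¹ = p₀ + p₁⁻¹ := by
  have h' : 1 - u ^ 2 ≠ 0 := by rwa [← neg_sub, neg_ne_zero]
  unfold cH₀
  field_simp
  ring

lemma cH_inv (hu : u ≠ 0) (hv : v ≠ 0) : cH q u⁻¹ v⁻¹ = cH q v u := by
  unfold cH
  by_cases h : u = v
  · subst h; simp
  have h1 : u - v ≠ 0 := sub_ne_zero.2 h
  have h2 : v - u ≠ 0 := sub_ne_zero.2 (Ne.symm h)
  by_cases hq : q = 0
  · simp [hq]
  field_simp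

/-- Coefficient of the identity in the braid relation; `cH_braid'` and `cH_braid_j` are those of σ_i
and σ_j with a common factor removed. -/
lemma cH_braid (hq : q ≠ 0) (huv : u - v ≠ 0) (hvw : v - w ≠ 0) (huw : u - w ≠ 0) :
    cH q v w * (q - cH q u w) * cH q w v + (q - cH q v w) * (q - cH q u v) * (q - cH q v w) =
    cH q u v * (q - cH q u w) * cH q v u + (q - cH q u v) * (q - cH q v w) * (q - cH q u v) := by
  have hvu : v - u ≠ 0 := by rwa [← neg_sub, neg_ne_zero]
  have hwv : w - v ≠ 0 := by rwa [← neg_sub, neg_ne_zero]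
  unfold cH
  field_simp
  ring

lemma cH_braid' (hq : q ≠ 0) (huv : u - v ≠ 0) (hvw : v - w ≠ 0) (huw : u - w ≠ 0) :
    (q - cH q v w) * (q - cH q u w) =
     (q - cH q u w) * (q - cH q v u) + (q - cH q u v) * (q - cH q v w) := by
  have hvu : v - u ≠ 0 := by rwa [← neg_sub, neg_ne_zero]
  have hwv : w - v ≠ 0 := by rwa [← neg_sub, neg_ne_zero]
  unfold cH
  field_simp
  ring

lemma sub_cH (h : u - v ≠ 0) : q - cH q u v = -((q - q⁻¹) * v) / (u - v) := by
  unfold cH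
  rw [eq_div_iff h, sub_mul, div_mul_cancel₀ _ h]
  ring

lemma sub_cH₀ (hp : p₁ ≠ 0) (h : u ^ 2 - 1 ≠ 0) :
    p₀ - cH₀ p₀ p₁ u = ((p₀ - p₁⁻¹) * u ^ 2 - (p₀ * p₁⁻¹ - 1) * u) / (u ^ 2 - 1) := by
  unfold cH₀
  field_simp
  ring

lemma sub_cH₀_inv (hp : p₁ ≠ 0) (hu : u ≠ 0) (h : u ^ 2 - 1 ≠ 0) :
    p₀ - cH₀ p₀ p₁ u⁻¹ = -((p₀ - p₁⁻¹) - (p₀ * p₁⁻¹ - 1) * u) / (u ^ 2 - 1) := by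
  have h' : 1 - u ^ 2 ≠ 0 := by rwa [← neg_sub, neg_ne_zero]
  unfold cH₀
  field_simp
  ring

lemma cH₀_inv (hp : p₁ ≠ 0) (hu : u ≠ 0) (h : u ^ 2 - 1 ≠ 0) :
    cH₀ p₀ p₁ u⁻¹ = -((1 + p₀ * u) * (1 - p₁ * u)) / (p₁ * (u ^ 2 - 1)) := by
  have h' : 1 - u ^ 2 ≠ 0 := by rwa [← neg_sub, neg_ne_zero]
  unfold cH₀
  field_simp
  ring

lemma sub_cH_inv_left (hq : q ≠ 0) (hu : u ≠ 0) (h : u * v - 1 ≠ 0) :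
    q - cH q u⁻¹ v = ((q - q⁻¹) * (u * v)) / (u * v - 1) := by
  have h' : 1 - u * v ≠ 0 := by rwa [← neg_sub, neg_ne_zero]
  unfold cH
  field_simp
  ring

lemma sub_cH_inv_right (hq : q ≠ 0) (hu : u ≠ 0) (h : u * v - 1 ≠ 0) :
    q - cH q v u⁻¹ = -(q - q⁻¹) / (u * v - 1) := by
  have h' : v * u - 1 ≠ 0 := by rwa [mul_comm]
  unfold cH
  rw [mul_comm u v]
  field_simp
  ring

section

variable (hq : q ≠ 0) (hp : p₁ ≠ 0) (hu : u ≠ 0) (hv : v ≠ 0) (huv : u - v ≠ 0)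
  (h : u * v - 1 ≠ 0) (hu2 : u ^ 2 - 1 ≠ 0) (hv2 : v ^ 2 - 1 ≠ 0)
include hq hp hu hv huv h hu2 hv2

/-- Coefficient of σ_1σ_0 in the relation of length four, divided by the factors of the reflections.
The next three lemmas treat σ_0σ_1, σ_1 and σ_0 in the same way. -/
lemma cH_braid_zero_io :
    (q - cH q v⁻¹ u) * (p₀ - cH₀ p₀ p₁ v⁻¹) + (q - cH q u v) * (p₀ - cH₀ p₀ p₁ u) +
      (p₀ - cH₀ p₀ p₁ v) * (q - cH q v u) = (p₀ - cH₀ p₀ p₁ u) * (q - cH q v⁻¹ u) := by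
  have h' : v * u - 1 ≠ 0 := by rwa [mul_comm]
  have hvu : v - u ≠ 0 := by rwa [← neg_sub, neg_ne_zero]
  rw [sub_cH_inv_left hq hv h', sub_cH₀_inv hp hv hv2, sub_cH huv, sub_cH₀ hp hu2,
    sub_cH₀ hp hv2, sub_cH hvu, mul_comm v u]
  -- The identity holds with q - q⁻¹, p₀ - p₁⁻¹ and p₀p₁⁻¹ - 1 as independent parameters, so the
  -- inverses of q and p₁ need not be cleared.
  generalize q - q⁻¹ = a
  generalize p₀ - p₁⁻¹ = b
  generalize p₀ * p₁⁻¹ - 1 = c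
  field_simp
  ring

lemma cH_braid_zero_oi :
    (q - cH q u v) * (p₀ - cH₀ p₀ p₁ v) = (p₀ - cH₀ p₀ p₁ v) * (q - cH q v u⁻¹) +
      (p₀ - cH₀ p₀ p₁ u) * (q - cH q u v) + (q - cH q u⁻¹ v) * (p₀ - cH₀ p₀ p₁ u⁻¹) := by
  rw [sub_cH_inv_left hq hu h, sub_cH_inv_right hq hu h, sub_cH₀_inv hp hu hu2, sub_cH huv,
    sub_cH₀ hp hu2, sub_cH₀ hp hv2]
  generalize q - q⁻¹ = a
  generalize p₀ - p₁⁻¹ = b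
  generalize p₀ * p₁⁻¹ - 1 = c
  obtain ⟨d, hd⟩ : ∃ d, d = u * v - 1 := ⟨_, rfl⟩
  rw [← hd] at h ⊢
  field_simp
  rw [hd]
  ring

lemma cH_braid_zero_i :
    cH₀ p₀ p₁ v * (q - cH q v⁻¹ u) * cH₀ p₀ p₁ v⁻¹ +
        (p₀ - cH₀ p₀ p₁ v) * (q - cH q v u) * (p₀ - cH₀ p₀ p₁ v) +
      (q - cH q u v) * (p₀ - cH₀ p₀ p₁ u) * (p₀ - cH₀ p₀ p₁ v) =
    cH₀ p₀ p₁ u * (q - cH q u⁻¹ v) * cH₀ p₀ p₁ u⁻¹ +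
        (p₀ - cH₀ p₀ p₁ u) * (p₀ - cH₀ p₀ p₁ v) * (q - cH q v u) +
      (p₀ - cH₀ p₀ p₁ u) * (q - cH q u v) * (p₀ - cH₀ p₀ p₁ u) := by
  have h' : v * u - 1 ≠ 0 := by rwa [mul_comm]
  have hvu : v - u ≠ 0 := by rwa [← neg_sub, neg_ne_zero]
  rw [sub_cH_inv_left hq hv h', sub_cH_inv_left hq hu h, cH₀_inv hp hu hu2, cH₀_inv hp hv hv2,
    sub_cH huv, sub_cH hvu, mul_comm v u]
  generalize q - q⁻¹ = a
  unfold cH₀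
  field_simp
  ring

lemma cH_braid_zero_o :
    cH q u v * (p₀ - cH₀ p₀ p₁ v) * cH q v u +
        (q - cH q u v) * (q - cH q u⁻¹ v) * (p₀ - cH₀ p₀ p₁ u⁻¹) +
      (q - cH q u v) * (p₀ - cH₀ p₀ p₁ u) * (q - cH q u v) =
    cH q u⁻¹ v * (p₀ - cH₀ p₀ p₁ v) * cH q v u⁻¹ +
        (q - cH q u⁻¹ v) * (p₀ - cH₀ p₀ p₁ u⁻¹) * (q - cH q u⁻¹ v) +
      (p₀ - cH₀ p₀ p₁ u) * (q - cH q u v) * (q - cH q u⁻¹ v) := by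
  -- The products of two coefficients of σ_1 are first rewritten through (q - q⁻¹)², after which the
  -- parameters become independent again.
  have hvu : v - u ≠ 0 := by rwa [← neg_sub, neg_ne_zero]
  have e1 : cH q u⁻¹ v * cH q v u⁻¹ = 1 - (q - q⁻¹) ^ 2 * (u * v) / (u * v - 1) ^ 2 := by
    have h' : 1 - u * v ≠ 0 := by rwa [← neg_sub, neg_ne_zero]
    unfold cH
    field_simp
    ring
  have e2 : cH q u v * cH q v u = 1 - (q - q⁻¹) ^ 2 * (u * v) / (u - v) ^ 2 := by
    unfold cH
    field_simp
    ring
  rw [mul_right_comm, e2, mul_right_comm (cH q u⁻¹ v), e1, sub_cH_inv_left hq hu h,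
    sub_cH₀_inv hp hu hu2, sub_cH huv, sub_cH₀ hp hu2, sub_cH₀ hp hv2]
  generalize q - q⁻¹ = a
  generalize p₀ - p₁⁻¹ = b
  generalize p₀ * p₁⁻¹ - 1 = c
  field_simp
  ring

end

lemma cH_braid_j (hq : q ≠ 0) (huv : u - v ≠ 0) (hvw : v - w ≠ 0) (huw : u - w ≠ 0) :
    (q - cH q u v) * (q - cH q u w) =
     (q - cH q u w) * (q - cH q w v) + (q - cH q v w) * (q - cH q u v) := by
  have hwv : w - v ≠ 0 := by rwa [← neg_sub, neg_ne_zero]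
  unfold cH
  field_simp
  ring

end Coeff

end BKRParam

/-! ### Operators for the generators T_i and their braid relations -/

namespace BKRParam

open EnhancedQuiver

variable {k : Type*} [Field k] [CharZero k] (D : BKRParam k) {β : D.J →₀ ℕ} {n : ℕ}

/-- The coefficient of `σ_i` in `T_i`. -/
def TA (i : Fin n) : RatSpace k D.quiver β n := fun ν =>
  if i.1 = 0 then cH₀ (fieldC k n D.p₀) (fieldC k n D.p₁) (D.ratX i ν)
  else cH (fieldC k n D.q) (D.ratX (prev i) ν) (D.ratX i ν)

/-- The first parameter of `T_i`. -/
def par (i : Fin n) : k := if i.1 = 0 then D.p₀ else D.q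

/-- The coefficient of the identity in `T_i`. -/
def TB (i : Fin n) : RatSpace k D.quiver β n := fun ν => fieldC k n (D.par i) - D.TA i ν

/-- The operator by which `T_i` acts. -/
def Top (β : D.J →₀ ℕ) {n : ℕ} (i : Fin n) : Module.End k (RatSpace k D.quiver β n) :=
  op i (D.TA i) (D.TB i)

lemma TA_of_ne {i : Fin n} (hi : i.1 ≠ 0) (ν : D.Comp β n) :
    D.TA i ν = cH (fieldC k n D.q) (D.ratX (prev i) ν) (D.ratX i ν) := if_neg hi

lemma TA_of_eq {o : Fin n} (ho : o.1 = 0) (ν : D.Comp β n) :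
    D.TA o ν = cH₀ (fieldC k n D.p₀) (fieldC k n D.p₁) (D.ratX o ν) := if_pos ho

lemma TB_of_ne {i : Fin n} (hi : i.1 ≠ 0) (ν : D.Comp β n) :
    D.TB i ν = fieldC k n D.q - cH (fieldC k n D.q) (D.ratX (prev i) ν) (D.ratX i ν) := by
  rw [TB, par, if_neg hi, TA_of_ne D hi]

lemma TB_of_eq {o : Fin n} (ho : o.1 = 0) (ν : D.Comp β n) :
    D.TB o ν = fieldC k n D.p₀ - cH₀ (fieldC k n D.p₀) (fieldC k n D.p₁) (D.ratX o ν) := by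
  rw [TB, par, if_pos ho, TA_of_eq D ho]

lemma TA_ne_zero (i : Fin n) (ν : D.Comp β n) : D.TA i ν ≠ 0 := by
  by_cases hi : i.1 = 0
  · rw [TA_of_eq D hi]
    have h1 := D.ratX_zero_sub_ne_zero hi ν (-D.p₀)
    simp only [fieldC, map_neg, sub_neg_eq_add] at h1
    exact div_ne_zero (mul_ne_zero h1 (D.ratX_zero_sub_ne_zero hi ν D.p₁))
      (mul_ne_zero (fieldC_ne_zero (Units.ne_zero _)) (D.ratX_zero_sq_sub_ne_zero hi ν))
  · rw [TA_of_ne D hi]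
    have h1 := D.mul_ratX_sub_ne_zero hi ν (D.q.ne_zero) (b := (D.q : k)⁻¹)
    rw [fieldC, fieldC, map_inv₀] at h1
    exact div_ne_zero h1 (D.ratX_sub_ne_zero hi ν)

lemma sK_cH (i : Fin n) (c : k) (u v : PSField k n) :
    sK i (cH (fieldC k n c) u v) = cH (fieldC k n c) (sK i u) (sK i v) := by
  have := map_cH (sK (k := k) i).toAlgHom.toRingHom (fieldC k n c) u v
  simpa using this

lemma sK_cH₀ (i : Fin n) (c d : k) (u : PSField k n) :
    sK i (cH₀ (fieldC k n c) (fieldC k n d) u) = cH₀ (fieldC k n c) (fieldC k n d) (sK i u) := by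
  have := map_cH₀ (sK (k := k) i).toAlgHom.toRingHom (fieldC k n c) (fieldC k n d) u
  simpa using this

lemma sK_TA_of_ne {i j : Fin n} (h : j ≠ i) (h₁ : j ≠ prev i) (h₂ : prev j ≠ i)
    (h₃ : prev j ≠ prev i) (ν : D.Comp β n) :
    sK i (D.TA j ν) = D.TA j (ν.s i) := by
  by_cases hj : j.1 = 0
  · rw [TA_of_eq D hj, TA_of_eq D hj, sK_cH₀, D.sK_ratX_of_ne h h₁]
  · rw [TA_of_ne D hj, TA_of_ne D hj, sK_cH, D.sK_ratX_of_ne h h₁, D.sK_ratX_of_ne h₂ h₃]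

lemma sK_TB_of_ne {i j : Fin n} (h : j ≠ i) (h₁ : j ≠ prev i) (h₂ : prev j ≠ i)
    (h₃ : prev j ≠ prev i) (ν : D.Comp β n) :
    sK i (D.TB j ν) = D.TB j (ν.s i) := by
  rw [TB, TB, map_sub, AlgEquiv.commutes, D.sK_TA_of_ne h h₁ h₂ h₃]

lemma Top_comm {i j : Fin n} (h : i.1 + 1 < j.1) :
    D.Top β i * D.Top β j = D.Top β j * D.Top β i := by
  have e : ∀ {a b : Fin n}, a.1 ≠ b.1 → a ≠ b := fun h h' => h (congrArg Fin.val h')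
  have h1 : j ≠ i := e (by omega)
  have h2 : j ≠ prev i := e (by simp only [prev]; omega)
  have h3 : prev j ≠ i := e (by simp only [prev]; omega)
  have h4 : prev j ≠ prev i := e (by simp only [prev]; omega)
  refine op_comm h _ _ _ _ fun ν => ⟨?_, ?_, ?_, ?_⟩
  · exact D.sK_TA_of_ne h1 h2 h3 h4 _
  · exact D.sK_TB_of_ne h1 h2 h3 h4 _
  · rw [D.sK_TA_of_ne h1.symm h3.symm h2.symm h4.symm, Comp.s_comm h]
  · exact D.sK_TB_of_ne h1.symm h3.symm h2.symm h4.symm _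

/-- The coefficients of words of length two and three match because the reflections permute the
arguments; those of σ_i, σ_j and the identity are rational identities in three variables. -/
lemma Top_braid {i j : Fin n} (hi : i.1 ≠ 0) (hj : j.1 = i.1 + 1) :
    D.Top β i * D.Top β j * D.Top β i = D.Top β j * D.Top β i * D.Top β j := by
  classical
  rw [eq_comm, ← sub_eq_zero]
  refine End_ext fun ν f => ?_
  have hj0 : j.1 ≠ 0 := by omega
  have hp : prev j = i := Fin.ext (by simp [prev, hj])
  have h1 : prev i ≠ i := prev_ne hi
  have h2 : i ≠ j := fun h => by have := congrArg Fin.val h; omega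
  have h3 : prev i ≠ j := fun h => by
    have := congrArg Fin.val h; simp only [prev] at this; omega
  have hu : ∀ ν : D.Comp β n, D.ratX (prev i) ν - D.ratX i ν ≠ 0 := D.ratX_sub_ne_zero hi
  have hv : ∀ ν : D.Comp β n, D.ratX i ν - D.ratX j ν ≠ 0 := hp ▸ D.ratX_sub_ne_zero hj0
  have b1 : ∀ ν : D.Comp β n, sK i (D.ratX (prev i) ν) = D.ratX i (ν.s i) := fun ν => by
    rw [D.sK_ratX hi, Equiv.swap_apply_left]
  have b2 : ∀ ν : D.Comp β n, sK i (D.ratX i ν) = D.ratX (prev i) (ν.s i) := fun ν => by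
    rw [D.sK_ratX hi, Equiv.swap_apply_right]
  have b3 : ∀ ν : D.Comp β n, sK i (D.ratX j ν) = D.ratX j (ν.s i) := fun ν => by
    rw [D.sK_ratX hi, Equiv.swap_apply_of_ne_of_ne h3.symm h2.symm]
  have b4 : ∀ ν : D.Comp β n, sK j (D.ratX (prev i) ν) = D.ratX (prev i) (ν.s j) := fun ν => by
    rw [D.sK_ratX hj0, hp, Equiv.swap_apply_of_ne_of_ne h1 h3]
  have b5 : ∀ ν : D.Comp β n, sK j (D.ratX i ν) = D.ratX j (ν.s j) := fun ν => by
    rw [D.sK_ratX hj0, hp, Equiv.swap_apply_left]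
  have b6 : ∀ ν : D.Comp β n, sK j (D.ratX j ν) = D.ratX i (ν.s j) := fun ν => by
    rw [D.sK_ratX hj0, hp, Equiv.swap_apply_right]
  have hw : ∀ ν : D.Comp β n, D.ratX (prev i) ν - D.ratX j ν ≠ 0 := fun ν => by
    have := (map_ne_zero (sK (k := k) j)).2 (hu (ν.s j))
    rwa [map_sub, b4, b5, Comp.s_s] at this
  have hq : fieldC k n D.q ≠ 0 := fieldC_ne_zero D.q.ne_zero
  rw [Top, Top, op_braid hi hj _ _ _ _ ν 0 ?_ ?_ ?_ ?_ ?_ ?_ f, zero_mul, Pi.single_zero,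
    LinearMap.zero_apply] <;>
    simp only [D.TA_of_ne hi, D.TA_of_ne hj0, D.TB_of_ne hi, D.TB_of_ne hj0, hp, map_sub,
      AlgEquiv.commutes, sK_cH, b1, b2, b3, b4, b5, b6, Comp.s_s, Comp.s_braid hi hj] <;>
    clear b1 b2 b3 b4 b5 b6
  · ring
  · ring
  · ring
  · linear_combination cH (fieldC k n D.q) (D.ratX (prev i) (ν.s i)) (D.ratX i (ν.s i)) *
      cH_braid' hq (hu (ν.s i)) (hv (ν.s i)) (hw (ν.s i))
  · linear_combination cH (fieldC k n D.q) (D.ratX i (ν.s j)) (D.ratX j (ν.s j)) *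
      cH_braid_j hq (hu (ν.s j)) (hv (ν.s j)) (hw (ν.s j))
  · have := cH_braid hq (hu ν) (hv ν) (hw ν)
    linear_combination this

/-- The longest words and those of length three match by transport of the arguments, using that
inverting both arguments of `cH` exchanges them. The identity coefficient is formal, and the four
remaining ones are rational identities. -/
lemma Top_braid_zero {o i : Fin n} (ho : o.1 = 0) (hi : i.1 = 1) :
    (D.Top β o * D.Top β i) ^ 2 = (D.Top β i * D.Top β o) ^ 2 := by
  classical
  rw [eq_comm, ← sub_eq_zero]
  refine End_ext fun ν f => ?_
  have hi0 : i.1 ≠ 0 := by omega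
  have hp : prev i = o := prev_eq_of_one ho hi
  have hio : i ≠ o := ne_of_one ho hi
  have hu : ∀ ν : D.Comp β n, D.ratX o ν - D.ratX i ν ≠ 0 := hp ▸ D.ratX_sub_ne_zero hi0
  have hs : ∀ ν : D.Comp β n, D.ratX o ν ^ 2 - 1 ≠ 0 := D.ratX_zero_sq_sub_ne_zero ho
  have b1 : ∀ ν : D.Comp β n, sK i (D.ratX o ν) = D.ratX i (ν.s i) := fun ν => by
    rw [D.sK_ratX hi0, hp, Equiv.swap_apply_left]
  have b2 : ∀ ν : D.Comp β n, sK i (D.ratX i ν) = D.ratX o (ν.s i) := fun ν => by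
    rw [D.sK_ratX hi0, hp, Equiv.swap_apply_right]
  have b3 : ∀ ν : D.Comp β n, sK o (D.ratX o ν) = (D.ratX o (ν.s o))⁻¹ := D.sK_zero_ratX ho
  have b4 : ∀ ν : D.Comp β n, sK o (D.ratX i ν) = D.ratX i (ν.s o) := D.sK_zero_ratX_ne ho hio
  have hq : fieldC k n D.q ≠ 0 := fieldC_ne_zero D.q.ne_zero
  have hp₁ : fieldC k n D.p₁ ≠ 0 := fieldC_ne_zero D.p₁.ne_zero
  have hX : ∀ l (ν : D.Comp β n), D.ratX l ν ≠ 0 := D.ratX_ne_zero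
  have hs' : ∀ ν : D.Comp β n, D.ratX i ν ^ 2 - 1 ≠ 0 := fun ν => by
    have := (map_ne_zero (sK (k := k) i)).2 (hs (ν.s i))
    rwa [map_sub, map_pow, map_one, b1, Comp.s_s] at this
  -- Reflecting X_1 ≠ X_2 by s_0 gives X_1⁻¹ ≠ X_2.
  have hh : ∀ ν : D.Comp β n, D.ratX o ν * D.ratX i ν - 1 ≠ 0 := fun ν h => by
    have := (map_ne_zero (sK (k := k) o)).2 (hu (ν.s o))
    rw [map_sub, b3, b4, Comp.s_s, ← eq_inv_of_mul_eq_one_right (sub_eq_zero.1 h), sub_self] at this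
    exact this rfl
  rw [Top, Top, op_braid_zero ho hi _ _ _ _ ν 0 0 0 ?_ ?_ ?_ ?_ ?_ ?_ ?_ ?_ f, zero_mul, zero_mul,
    zero_mul, Pi.single_zero, Pi.single_zero, Pi.single_zero, LinearMap.zero_apply, add_zero,
    add_zero] <;>
    simp only [D.TA_of_ne hi0, D.TA_of_eq ho, D.TB_of_ne hi0, D.TB_of_eq ho, hp, map_sub,
      AlgEquiv.commutes, sK_cH, sK_cH₀, b1, b2, b3, b4, Comp.s_s, map_inv₀,
      ← Comp.s_braid_zero ho hi] <;>
    clear b1 b2 b3 b4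
  · have e := cH_inv (q := fieldC k n D.q) (hX i ((((ν.s o).s i).s o).s i))
      (inv_ne_zero (hX o ((((ν.s o).s i).s o).s i)))
    rw [inv_inv] at e
    rw [cH_inv (hX i _) (hX o _), e]
    ring
  · ring
  · rw [cH_inv (hX i _) (hX o _)]
    ring
  · linear_combination cH (fieldC k n D.q) (D.ratX o ((ν.s o).s i)) (D.ratX i ((ν.s o).s i)) *
      cH₀ (fieldC k n D.p₀) (fieldC k n D.p₁) (D.ratX i ((ν.s o).s i)) *
      cH_braid_zero_io (p₀ := fieldC k n D.p₀) hq hp₁ (hX o ((ν.s o).s i)) (hX i _) (hu _) (hh _)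
        (hs _) (hs' _)
  · linear_combination cH (fieldC k n D.q) (D.ratX o ((ν.s i).s o))⁻¹ (D.ratX i ((ν.s i).s o)) *
      cH₀ (fieldC k n D.p₀) (fieldC k n D.p₁) (D.ratX o ((ν.s i).s o)) *
      cH_braid_zero_oi (p₀ := fieldC k n D.p₀) hq hp₁ (hX o ((ν.s i).s o)) (hX i _) (hu _) (hh _)
        (hs _) (hs' _)
  · linear_combination cH (fieldC k n D.q) (D.ratX o (ν.s i)) (D.ratX i (ν.s i)) *
      cH_braid_zero_i (p₀ := fieldC k n D.p₀) hq hp₁ (hX o (ν.s i)) (hX i _) (hu _) (hh _)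
        (hs _) (hs' _)
  · linear_combination cH₀ (fieldC k n D.p₀) (fieldC k n D.p₁) (D.ratX o (ν.s o)) *
      cH_braid_zero_o (p₀ := fieldC k n D.p₀) hq hp₁ (hX o (ν.s o)) (hX i _) (hu _) (hh _)
        (hs _) (hs' _)
  · ring

end BKRParam

/-! ### Consequences of a quadratic relation in an arbitrary algebra -/

section Quadratic

variable {k A : Type*} [Field k] [Ring A] [Algebra k A] {T X Y Z W : A} {c r : k}

lemma left_inv_mul_of_quadratic (h : T * T = c • T + r • 1) (Z : A) :
    (T - c • 1) * (T * Z) = r • Z := by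
  rw [← mul_assoc, sub_mul, h, smul_mul_assoc, one_mul, add_sub_cancel_left, smul_mul_assoc,
    one_mul]

/-- The quadratic relation makes T - c the inverse of T. Multiplying TXT = Y by T - c on the left,
or by T on the right, solves it for XT and YT. -/
lemma mul_eq_of_mixed (h : T * T = c • T + (1 : k) • 1) (hX : T * X * T = Y) :
    X * T = T * Y - c • Y ∧ Y * T = T * X + c • Y := by
  constructor
  · have := left_inv_mul_of_quadratic h (X * T)
    rw [one_smul, ← mul_assoc T, hX, sub_mul, smul_mul_assoc, one_mul] at this
    exact this.symm
  · rw [← hX, mul_assoc (T * X), h, mul_add, mul_smul_comm, one_smul, mul_one, add_comm]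

lemma mul_inv_eq_of_mul_eq (hX : X * Z = 1) (hZ : Z * X = 1) (hY : Y * W = 1) (hW : W * Y = 1) :
    (X * T = T * Y - c • Y → Z * T = T * W + c • Z) ∧
      (Y * T = T * X + c • Y → W * T = T * Z - c • Z) := by
  constructor
  · intro h
    have e : T * W = Z * (X * T) * W := by rw [← mul_assoc, hZ, one_mul]
    rw [e, h, mul_sub, sub_mul, mul_smul_comm, smul_mul_assoc, mul_assoc Z Y, hY, mul_assoc,
      mul_assoc, hY, mul_one, mul_one, sub_add_cancel]
  · intro h
    have e : T * Z = W * (Y * T) * Z := by rw [← mul_assoc, hW, one_mul]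
    rw [e, h, mul_add, add_mul, mul_smul_comm, smul_mul_assoc, hW, one_mul, ← mul_assoc,
      mul_assoc _ X, hX, mul_one, add_sub_cancel_right]

/-- The same argument with T(T - c) = r: multiply by T - c on the left, or by T on the right, and
divide by r. -/
lemma mul_eq_of_mixed_zero (hr : r ≠ 0) (h : T * T = c • T + r • 1)
    (hX : T * Z * T = r • X + (r - 1) • T) :
    Z * T = T * X + (-(c • X) + (r - 1) • 1) ∧ X * T = T * Z + (c • X - (r - 1) • 1) := by
  constructor
  · have e := left_inv_mul_of_quadratic h (Z * T)
    have e' := left_inv_mul_of_quadratic h 1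
    rw [mul_one] at e'
    rw [← mul_assoc T, hX, mul_add, mul_smul_comm, mul_smul_comm, e', sub_mul, smul_mul_assoc,
      one_mul] at e
    have := congrArg (fun z => r⁻¹ • z) e
    simp only [smul_add, smul_smul, inv_mul_cancel₀ hr, one_smul,
      mul_comm (r - 1) r, inv_mul_cancel_left₀ hr] at this
    rw [← this]
    abel
  · have e := congrArg (fun z => z * T) hX
    simp only [mul_assoc, h, add_mul, smul_mul_assoc] at e
    simp only [mul_add, mul_smul_comm, mul_one] at e
    rw [← mul_assoc, hX] at e
    have := congrArg (fun z => r⁻¹ • z) e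
    have e2 : X * T = r⁻¹ • (r • (X * T)) := by rw [smul_smul, inv_mul_cancel₀ hr, one_smul]
    have e3 : T * Z = r⁻¹ • (r • (T * Z)) := by rw [smul_smul, inv_mul_cancel₀ hr, one_smul]
    have e4 : r • (X * T) = c • (r • X + (r - 1) • T) + r • (T * Z) -
      (r - 1) • (c • T + r • (1 : A)) := by rw [e]; abel
    have e5 : c • (r • X + (r - 1) • T) + r • (T * Z) - (r - 1) • (c • T + r • (1 : A)) =
      r • (T * Z + (c • X - (r - 1) • 1)) := by module
    rw [e2, e4, e5, smul_smul, inv_mul_cancel₀ hr, one_smul]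

lemma quadratic_of_mul {a b : k} (hab : a * b = r) (hc : a - b = c)
    (h : (T - algebraMap k A a) * (T + algebraMap k A b) = 0) : T * T = c • T + r • 1 := by
  subst hab hc
  simp only [Algebra.algebraMap_eq_smul_one, sub_mul, mul_add, smul_mul_assoc, mul_smul_comm,
    mul_one, one_mul] at h
  rw [← sub_eq_zero, ← h]
  module

end Quadratic

/-! ### The representation of the affine Hecke algebra -/

namespace BKRParam

open EnhancedQuiver

variable {k : Type*} [Field k] [CharZero k] (D : BKRParam k) {β : D.J →₀ ℕ} {n : ℕ}

/-- The second parameter of `T_i`. -/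
def par' (i : Fin n) : k := if i.1 = 0 then (D.p₁ : k)⁻¹ else (D.q : k)⁻¹

lemma sV_TA (i : Fin n) : sV i (D.TA (β := β) i) =
    algebraMap k _ (D.par i + D.par' i) - D.TA i := by
  ext ν
  rw [eq_comm, Pi.sub_apply, sub_eq_iff_eq_add', eq_comm]
  change D.TA i ν + sK i (D.TA i (ν.s i)) = algebraMap k (PSField k n) _
  by_cases hi : i.1 = 0
  · rw [TA_of_eq D hi, TA_of_eq D hi, sK_cH₀, D.sK_zero_ratX hi, Comp.s_s, par, par', if_pos hi,
      if_pos hi, map_add, map_inv₀]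
    exact cH₀_add_cH₀ (fieldC_ne_zero (Units.ne_zero _)) (D.ratX_ne_zero _ _)
      (D.ratX_zero_sq_sub_ne_zero hi ν)
  · rw [TA_of_ne D hi, TA_of_ne D hi, sK_cH, D.sK_ratX hi, D.sK_ratX hi, Comp.s_s,
      Equiv.swap_apply_left, Equiv.swap_apply_right, par, par', if_neg hi,
      if_neg hi, map_add, map_inv₀]
    exact cH_add_cH (D.ratX_sub_ne_zero hi ν)

lemma TB_eq (i : Fin n) : D.TB (β := β) i = algebraMap k _ (D.par i) - D.TA i := rfl

lemma sV_add (i : Fin n) (F G : RatSpace k D.quiver β n) : sV i (F + G) = sV i F + sV i G := by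
  ext ν; simp [sV]

/-- The second factor produces the σ_i-invariant function Aσ_i(F) + σ_i(A)F, and the first factor is
A(σ_i - 1), which annihilates invariants. -/
lemma Top_quadratic (i : Fin n) :
    (D.Top β i - algebraMap k _ (D.par i)) * (D.Top β i + algebraMap k _ (D.par' i)) = 0 := by
  refine LinearMap.ext fun F => ?_
  have key : (D.Top β i + algebraMap k _ (D.par' i)) F =
      D.TA i * sV i F + sV i (D.TA i) * F := by
    rw [sV_TA, LinearMap.add_apply, Top, op_apply, TB_eq, Module.algebraMap_end_apply,
      Algebra.smul_def, map_add]
    ring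
  rw [Module.End.mul_apply, key, LinearMap.sub_apply, Top, op_apply, TB_eq,
    Module.algebraMap_end_apply, Algebra.smul_def, sV_add, sV_mul, sV_mul, sV_sV, sV_sV,
    LinearMap.zero_apply]
  ring

lemma Top_sq (i : Fin n) : D.Top β i * D.Top β i =
    (D.par i - D.par' i) • D.Top β i + (D.par i * D.par' i) • 1 :=
  quadratic_of_mul rfl rfl (D.Top_quadratic i)

lemma sV_ratX {i : Fin n} (hi : i.1 ≠ 0) (l : Fin n) :
    sV i (D.ratX (β := β) l) = D.ratX (Equiv.swap (prev i) i l) := by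
  ext ν
  rw [sV, D.sK_ratX hi, Comp.s_s]

lemma sV_zero_ratX {o : Fin n} (ho : o.1 = 0) :
    sV o (D.ratX (β := β) o) = (D.ratX o)⁻¹ := by
  ext ν
  rw [sV, D.sK_zero_ratX ho, Comp.s_s, Pi.inv_apply]

lemma sV_ratX_of_ne {i l : Fin n} (h : l ≠ i) (h' : l ≠ prev i) :
    sV i (D.ratX (β := β) l) = D.ratX l := by
  ext ν
  rw [sV, D.sK_ratX_of_ne h h', Comp.s_s]

/-- The commutation rule reads T_iX_i = X_{i+1}(T_i - (q - q⁻¹)), and T_i - (q - q⁻¹) is the inverse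
of T_i. -/
lemma Top_mixed {i : Fin n} (hi : i.1 ≠ 0) :
    D.Top β i * mulOp (D.ratX (prev i)) * D.Top β i = mulOp (D.ratX i) := by
  have e : D.TB (β := β) i * (D.ratX (prev i) - D.ratX i) =
      (-(D.par i - D.par' i)) • D.ratX i := by
    ext ν
    rw [Pi.mul_apply, Pi.sub_apply, TB_of_ne D hi, sub_cH (D.ratX_sub_ne_zero hi ν),
      div_mul_cancel₀ _ (D.ratX_sub_ne_zero hi ν), Pi.smul_apply, Algebra.smul_def, par, par',
      if_neg hi, if_neg hi, map_neg, map_sub, map_inv₀]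
    ring
  rw [Top, op_mul_mulOp, ← Top, D.sV_ratX hi, Equiv.swap_apply_left, e, add_mul, mul_assoc,
    D.Top_sq, map_smul, smul_mul_assoc, mul_add, mul_smul_comm, mul_smul_comm, mul_one]
  have h1 : D.par i * D.par' i = 1 := by
    rw [par, par', if_neg hi, if_neg hi, mul_inv_cancel₀ (Units.ne_zero _)]
  rw [h1, one_smul]
  module

/-- Here the rule for moving X_1⁻¹ to the left also leaves the constant p₀p₁⁻¹ - 1, which becomes
the term in T_0. -/
lemma Top_mixed_zero {o : Fin n} (ho : o.1 = 0) :
    D.Top β o * mulOp (D.ratX o)⁻¹ * D.Top β o =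
      (D.par o * D.par' o) • mulOp (D.ratX o) + (D.par o * D.par' o - 1) • D.Top β o := by
  have e : D.TB (β := β) o * ((D.ratX o)⁻¹ - D.ratX o) =
      (-(D.par o - D.par' o)) • D.ratX o + (D.par o * D.par' o - 1) • 1 := by
    ext ν
    have h := D.ratX_zero_sq_sub_ne_zero ho ν
    have h' := D.ratX_ne_zero o ν
    simp only [Pi.mul_apply, Pi.sub_apply, Pi.add_apply, Pi.smul_apply, Pi.inv_apply, Pi.one_apply]
    rw [Algebra.smul_def, Algebra.smul_def, TB_of_eq D ho, sub_cH₀ (fieldC_ne_zero (Units.ne_zero _)) h, par, par',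
      if_pos ho, if_pos ho, map_neg, map_sub, map_sub, map_mul, map_inv₀, map_one]
    have e : (D.ratX o ν)⁻¹ - D.ratX o ν = -(D.ratX o ν ^ 2 - 1) * (D.ratX o ν)⁻¹ := by
      field_simp
      ring
    rw [e, div_mul_eq_mul_div, div_eq_iff h]
    field_simp
    ring
  have h1 : sV o (D.ratX (β := β) o)⁻¹ = D.ratX o := by rw [← D.sV_zero_ratX ho, sV_sV]
  rw [Top, op_mul_mulOp, ← Top, h1, e, add_mul, mul_assoc,
    D.Top_sq, map_add, map_smul, map_smul, map_one, add_mul, smul_mul_assoc, smul_mul_assoc,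
    mul_add, mul_smul_comm, mul_smul_comm, mul_one, one_mul]
  module

lemma Top_mulOp_comm {i l : Fin n} (h : l ≠ i) (h' : l ≠ prev i) :
    D.Top β i * mulOp (D.ratX l) = mulOp (D.ratX l) * D.Top β i := by
  rw [Top, op_mul_mulOp, D.sV_ratX_of_ne h h', sub_self, mul_zero, map_zero, add_zero]

variable (β n) in
/-- The operators by which the generators of the affine Hecke algebra act. -/
def freeHeckeOp : FreeAlgebra k (HeckeGen n) →ₐ[k] Module.End k (RatSpace k D.quiver β n) :=
  FreeAlgebra.lift k fun g => match g with
    | .T i => D.Top β i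
    | .X l => mulOp (D.ratX l)
    | .Xinv l => mulOp (D.ratX l)⁻¹

lemma freeHeckeOp_T (i : Fin n) : D.freeHeckeOp β n (hT k i) = D.Top β i :=
  FreeAlgebra.lift_ι_apply _ _
lemma freeHeckeOp_X (l : Fin n) : D.freeHeckeOp β n (hX k l) = mulOp (D.ratX l) :=
  FreeAlgebra.lift_ι_apply _ _
lemma freeHeckeOp_Xinv (l : Fin n) : D.freeHeckeOp β n (hXinv k l) = mulOp (D.ratX l)⁻¹ :=
  FreeAlgebra.lift_ι_apply _ _

lemma ratX_mul_inv (l : Fin n) : D.ratX (β := β) l * (D.ratX l)⁻¹ = 1 := by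
  ext ν
  exact mul_inv_cancel₀ (D.ratX_ne_zero l ν)

lemma freeHeckeOp_rel {a b : FreeAlgebra k (HeckeGen n)} (h : HeckeRel D.q D.p₀ D.p₁ n a b) :
    D.freeHeckeOp β n a = D.freeHeckeOp β n b := by
  cases h with
  | quad i hi =>
    have := D.Top_quadratic (β := β) i
    rw [par, par', if_neg hi, if_neg hi] at this
    simpa only [map_mul, map_sub, map_add, map_zero, AlgHom.commutes, freeHeckeOp_T] using this
  | quad_zero i hi =>
    have := D.Top_quadratic (β := β) i
    rw [par, par', if_pos hi, if_pos hi] at this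
    simpa only [map_mul, map_sub, map_add, map_zero, AlgHom.commutes, freeHeckeOp_T] using this
  | braid i j hi hj => simpa only [map_mul, freeHeckeOp_T] using D.Top_braid hi hj
  | braid_zero o i ho hi =>
    simpa only [map_mul, map_pow, freeHeckeOp_T] using D.Top_braid_zero ho hi
  | comm i j h h' =>
    simp only [map_mul, freeHeckeOp_T]
    rcases lt_trichotomy i.1 j.1 with hij | hij | hij
    · exact D.Top_comm (by omega)
    · rw [Fin.ext hij]
    · exact (D.Top_comm (by omega)).symm
  | X_X l l' =>
    rw [map_mul, map_mul, freeHeckeOp_X, freeHeckeOp_X, ← map_mul, ← map_mul, mul_comm]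
  | X_inv l =>
    rw [map_mul, freeHeckeOp_X, freeHeckeOp_Xinv, ← map_mul, ratX_mul_inv, map_one, map_one]
  | inv_X l =>
    rw [map_mul, freeHeckeOp_X, freeHeckeOp_Xinv, ← map_mul, mul_comm, ratX_mul_inv, map_one,
      map_one]
  | mixed i hi => simpa only [map_mul, freeHeckeOp_T, freeHeckeOp_X] using D.Top_mixed hi
  | mixed_zero o ho =>
    have := D.Top_mixed_zero (β := β) ho
    rw [par, par', if_pos ho, if_pos ho] at this
    simpa only [map_mul, map_add, AlgHom.commutes, freeHeckeOp_T, freeHeckeOp_X, freeHeckeOp_Xinv,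
      Algebra.smul_def] using this
  | T_X i hi l h h' =>
    simpa only [map_mul, freeHeckeOp_T, freeHeckeOp_X] using D.Top_mulOp_comm h' h
  | T_X_zero o ho l h =>
    have h' : l ≠ prev o := by
      intro h'
      exact h (h'.trans (Fin.ext (by simp [prev, ho])))
    simpa only [map_mul, freeHeckeOp_T, freeHeckeOp_X] using D.Top_mulOp_comm h h'

variable (β n) in
/-- The representation of the affine Hecke algebra on rational functions. -/
def repH : D.H n →ₐ[k] Module.End k (RatSpace k D.quiver β n) :=
  RingQuot.liftAlgHom k ⟨D.freeHeckeOp β n, fun _ _ h => D.freeHeckeOp_rel h⟩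

lemma repH_mk (a : FreeAlgebra k (HeckeGen n)) :
    D.repH β n (RingQuot.mkAlgHom k (HeckeRel D.q D.p₀ D.p₁ n) a) = D.freeHeckeOp β n a :=
  RingQuot.liftAlgHom_mkAlgHom_apply _ _ _ _

lemma repH_T (i : Fin n) : D.repH β n (HeckeC.T D.q D.p₀ D.p₁ i) = D.Top β i := by
  rw [HeckeC.T, repH_mk, freeHeckeOp_T]

lemma repH_X (l : Fin n) : D.repH β n (HeckeC.X D.q D.p₀ D.p₁ l) = mulOp (D.ratX l) := by
  rw [HeckeC.X, repH_mk, freeHeckeOp_X]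

lemma repH_Xinv (l : Fin n) :
    D.repH β n (HeckeC.Xinv D.q D.p₀ D.p₁ l) = mulOp (D.ratX l)⁻¹ := by
  rw [HeckeC.Xinv, repH_mk, freeHeckeOp_Xinv]

end BKRParam

/-! ### Straightening in the affine Hecke algebra -/

namespace HeckeC

variable {k : Type*} [Field k] {q p₀ p₁ : kˣ} {n : ℕ}

variable (q p₀ p₁ n) in
/-- The quotient map from the free algebra. -/
def mk : FreeAlgebra k (HeckeGen n) →ₐ[k] HeckeC q p₀ p₁ n :=
  RingQuot.mkAlgHom k (HeckeRel q p₀ p₁ n)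

lemma mk_rel {a b : FreeAlgebra k (HeckeGen n)} (h : HeckeRel q p₀ p₁ n a b) :
    mk q p₀ p₁ n a = mk q p₀ p₁ n b := RingQuot.mkAlgHom_rel k h

lemma mk_hT (i : Fin n) : mk q p₀ p₁ n (hT k i) = T q p₀ p₁ i := rfl
lemma mk_hX (l : Fin n) : mk q p₀ p₁ n (hX k l) = X q p₀ p₁ l := rfl
lemma mk_hXinv (l : Fin n) : mk q p₀ p₁ n (hXinv k l) = Xinv q p₀ p₁ l := rfl

lemma X_mul_Xinv (l : Fin n) : X q p₀ p₁ l * Xinv q p₀ p₁ l = 1 := by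
  have := mk_rel (HeckeRel.X_inv (q := q) (p₀ := p₀) (p₁ := p₁) l)
  rwa [map_mul, map_one] at this

lemma Xinv_mul_X (l : Fin n) : Xinv q p₀ p₁ l * X q p₀ p₁ l = 1 := by
  have := mk_rel (HeckeRel.inv_X (q := q) (p₀ := p₀) (p₁ := p₁) l)
  rwa [map_mul, map_one] at this

lemma T_sq {i : Fin n} (hi : i.1 ≠ 0) : T q p₀ p₁ i * T q p₀ p₁ i =
    ((q : k) - (q : k)⁻¹) • T q p₀ p₁ i + (1 : k) • 1 := by
  refine quadratic_of_mul (mul_inv_cancel₀ (Units.ne_zero q)) rfl ?_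
  have := mk_rel (HeckeRel.quad (q := q) (p₀ := p₀) (p₁ := p₁) i hi)
  simpa only [map_mul, map_sub, map_add, map_zero, AlgHom.commutes, mk_hT] using this

lemma T_sq_zero {o : Fin n} (ho : o.1 = 0) : T q p₀ p₁ o * T q p₀ p₁ o =
    ((p₀ : k) - (p₁ : k)⁻¹) • T q p₀ p₁ o + ((p₀ : k) * (p₁ : k)⁻¹) • 1 := by
  refine quadratic_of_mul rfl rfl ?_
  have := mk_rel (HeckeRel.quad_zero (q := q) (p₀ := p₀) (p₁ := p₁) o ho)
  simpa only [map_mul, map_sub, map_add, map_zero, AlgHom.commutes, mk_hT] using this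

lemma X_mul_T {i : Fin n} (hi : i.1 ≠ 0) :
    X q p₀ p₁ (prev i) * T q p₀ p₁ i =
      T q p₀ p₁ i * X q p₀ p₁ i - ((q : k) - (q : k)⁻¹) • X q p₀ p₁ i ∧
    X q p₀ p₁ i * T q p₀ p₁ i =
      T q p₀ p₁ i * X q p₀ p₁ (prev i) + ((q : k) - (q : k)⁻¹) • X q p₀ p₁ i := by
  refine mul_eq_of_mixed (T_sq hi) ?_
  have := mk_rel (HeckeRel.mixed (q := q) (p₀ := p₀) (p₁ := p₁) i hi)
  simpa only [map_mul, mk_hT, mk_hX] using this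

lemma Xinv_mul_T {i : Fin n} (hi : i.1 ≠ 0) :
    Xinv q p₀ p₁ (prev i) * T q p₀ p₁ i =
      T q p₀ p₁ i * Xinv q p₀ p₁ i + ((q : k) - (q : k)⁻¹) • Xinv q p₀ p₁ (prev i) ∧
    Xinv q p₀ p₁ i * T q p₀ p₁ i =
      T q p₀ p₁ i * Xinv q p₀ p₁ (prev i) - ((q : k) - (q : k)⁻¹) • Xinv q p₀ p₁ (prev i) := by
  have h := mul_inv_eq_of_mul_eq (T := T q p₀ p₁ i) (c := (q : k) - (q : k)⁻¹)
    (X_mul_Xinv (q := q) (p₀ := p₀) (p₁ := p₁) (prev i)) (Xinv_mul_X (prev i))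
    (X_mul_Xinv i) (Xinv_mul_X i)
  exact ⟨h.1 (X_mul_T hi).1, h.2 (X_mul_T hi).2⟩

lemma X_mul_T_zero {o : Fin n} (ho : o.1 = 0) :
    Xinv q p₀ p₁ o * T q p₀ p₁ o = T q p₀ p₁ o * X q p₀ p₁ o +
      (-(((p₀ : k) - (p₁ : k)⁻¹) • X q p₀ p₁ o) + ((p₀ : k) * (p₁ : k)⁻¹ - 1) • 1) ∧
    X q p₀ p₁ o * T q p₀ p₁ o = T q p₀ p₁ o * Xinv q p₀ p₁ o +
      (((p₀ : k) - (p₁ : k)⁻¹) • X q p₀ p₁ o - ((p₀ : k) * (p₁ : k)⁻¹ - 1) • 1) := by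
  refine mul_eq_of_mixed_zero (mul_ne_zero (Units.ne_zero _) (inv_ne_zero (Units.ne_zero _)))
    (T_sq_zero ho) ?_
  have := mk_rel (HeckeRel.mixed_zero (q := q) (p₀ := p₀) (p₁ := p₁) o ho)
  rw [map_mul, map_mul, map_add, map_mul, map_mul, AlgHom.commutes, AlgHom.commutes] at this
  rw [Algebra.smul_def, Algebra.smul_def]
  exact this

lemma T_mul_X {i l : Fin n} (h : l ≠ i) (h' : l ≠ prev i) :
    T q p₀ p₁ i * X q p₀ p₁ l = X q p₀ p₁ l * T q p₀ p₁ i := by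
  by_cases hi : i.1 = 0
  · have := mk_rel (HeckeRel.T_X_zero (q := q) (p₀ := p₀) (p₁ := p₁) i hi l h)
    simpa only [map_mul, mk_hT, mk_hX] using this
  · have := mk_rel (HeckeRel.T_X (q := q) (p₀ := p₀) (p₁ := p₁) i hi l h' h)
    simpa only [map_mul, mk_hT, mk_hX] using this

lemma Xinv_mul_T_of_ne {i l : Fin n} (h : l ≠ i) (h' : l ≠ prev i) :
    Xinv q p₀ p₁ l * T q p₀ p₁ i = T q p₀ p₁ i * Xinv q p₀ p₁ l := by
  have := congrArg (fun z => Xinv q p₀ p₁ l * z * Xinv q p₀ p₁ l)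
    (T_mul_X (q := q) (p₀ := p₀) (p₁ := p₁) h h')
  simp only [mul_assoc, X_mul_Xinv, mul_one] at this
  rw [this, ← mul_assoc, Xinv_mul_X, one_mul]

end HeckeC

namespace BKRParam

open EnhancedQuiver

variable {k : Type*} [Field k] (D : BKRParam k) {β : D.J →₀ ℕ} {n : ℕ}

variable (β n) in
/-- The subalgebra generated by the elements `X_l^{±1}`. -/
def laurent : Subalgebra k (D.H n) := Algebra.adjoin k {a | ∃ b, D.HGlue β n a b}

lemma X_mem (l : Fin n) : HeckeC.X D.q D.p₀ D.p₁ l ∈ D.laurent β n :=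
  Algebra.subset_adjoin ⟨_, HGlue.X l⟩

lemma Xinv_mem (l : Fin n) : HeckeC.Xinv D.q D.p₀ D.p₁ l ∈ D.laurent β n :=
  Algebra.subset_adjoin ⟨_, HGlue.Xinv l⟩

/-- The mixed relations, solved for the products of X_l^{±1} with T_i by means of the quadratic
relation, move the generators, and hence all Laurent polynomials, to the right. -/
lemma laurent_move : ∀ s ∈ D.laurent β n, ∀ i : Fin n, ∃ r ∈ D.laurent β n, ∃ r' ∈ D.laurent β n,
    s * HeckeC.T D.q D.p₀ D.p₁ i = HeckeC.T D.q D.p₀ D.p₁ i * r + r' := by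
  have h := Straightening.move_of_generators (S := D.laurent β n)
    (t := finExt (HeckeC.T D.q D.p₀ D.p₁ : Fin n → D.H n)) rfl ?_
  · intro s hs i
    simpa only [finExt_val] using h s hs i
  rintro _ ⟨b, h⟩ i
  by_cases hi : i < n
  swap
  · exact ⟨0, zero_mem _, 0, zero_mem _, by simp [finExt, hi]⟩
  simp only [finExt, dif_pos hi]
  generalize (⟨i, hi⟩ : Fin n) = i
  have hs : ∀ (c : k) {z : D.H n}, z ∈ D.laurent β n → c • z ∈ D.laurent β n :=
    fun c _ hz => Subalgebra.smul_mem _ hz c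
  cases h with
  | X l =>
    by_cases hl : l = i
    · subst hl
      by_cases hi : l.1 = 0
      · exact ⟨_, D.Xinv_mem l, _, sub_mem (hs _ (D.X_mem l)) (hs _ (one_mem _)),
          (HeckeC.X_mul_T_zero hi).2⟩
      · exact ⟨_, D.X_mem (prev l), _, hs _ (D.X_mem l), (HeckeC.X_mul_T hi).2⟩
    · by_cases hl' : l = prev i
      · subst hl'
        have hi : i.1 ≠ 0 := fun hi => hl (Fin.ext (by simp [prev, hi]))
        exact ⟨_, D.X_mem i, _, neg_mem (hs _ (D.X_mem i)),
          (HeckeC.X_mul_T hi).1.trans (sub_eq_add_neg _ _)⟩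
      · exact ⟨_, D.X_mem l, 0, zero_mem _, by rw [HeckeC.T_mul_X hl hl', add_zero]⟩
  | Xinv l =>
    by_cases hl : l = i
    · subst hl
      by_cases hi : l.1 = 0
      · exact ⟨_, D.X_mem l, _, add_mem (neg_mem (hs _ (D.X_mem l))) (hs _ (one_mem _)),
          (HeckeC.X_mul_T_zero hi).1⟩
      · exact ⟨_, D.Xinv_mem (prev l), _, neg_mem (hs _ (D.Xinv_mem (prev l))),
          (HeckeC.Xinv_mul_T hi).2.trans (sub_eq_add_neg _ _)⟩
    · by_cases hl' : l = prev i
      · subst hl'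
        have hi : i.1 ≠ 0 := fun hi => hl (Fin.ext (by simp [prev, hi]))
        exact ⟨_, D.Xinv_mem i, _, hs _ (D.Xinv_mem (prev i)), (HeckeC.Xinv_mul_T hi).1⟩
      · exact ⟨_, D.Xinv_mem l, 0, zero_mem _, by rw [HeckeC.Xinv_mul_T_of_ne hl hl', add_zero]⟩

theorem hecke_straightening :
    Straightening (D.laurent β n) (finExt (HeckeC.T D.q D.p₀ D.p₁ : Fin n → D.H n)) := by
  refine Straightening.of_fin D.laurent_move (fun i => ?_)
    (fun i j hij => ?_) (fun i j hi hj => ?_) (fun o i ho hi => ?_)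
  · by_cases hi : i.1 = 0
    · exact ⟨_, Subalgebra.algebraMap_mem _ _, _, Subalgebra.smul_mem _ (one_mem _) _,
        (HeckeC.T_sq_zero hi).trans (by rw [Algebra.smul_def, Algebra.commutes])⟩
    · exact ⟨_, Subalgebra.algebraMap_mem _ _, _, Subalgebra.smul_mem _ (one_mem _) _,
        (HeckeC.T_sq hi).trans (by rw [Algebra.smul_def, Algebra.commutes])⟩
  · have := HeckeC.mk_rel (HeckeRel.comm (q := D.q) (p₀ := D.p₀) (p₁ := D.p₁) i j (by omega) (by omega))
    simpa only [map_mul, HeckeC.mk_hT, HeckeC.mk_hX] using this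
  · have := HeckeC.mk_rel (HeckeRel.braid (q := D.q) (p₀ := D.p₀) (p₁ := D.p₁) i j hi hj)
    simp only [map_mul, HeckeC.mk_hT] at this
    rw [this]
    rw [sub_self]
    exact zero_mem _
  · have := HeckeC.mk_rel (HeckeRel.braid_zero (q := D.q) (p₀ := D.p₀) (p₁ := D.p₁) o i ho hi)
    simp only [pow_two, map_mul, ← mul_assoc, HeckeC.mk_hT] at this
    rw [this]
    rw [sub_self]
    exact zero_mem _

lemma hecke_mem_adjoin (a : D.H n) :
    a ∈ Algebra.adjoin k (Set.range (HeckeC.T D.q D.p₀ D.p₁) ∪ {a | ∃ b, D.HGlue β n a b}) := by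
  obtain ⟨a, rfl⟩ : ∃ b, HeckeC.mk D.q D.p₀ D.p₁ n b = a := (RingQuot.mkAlgHom_surjective k (HeckeRel D.q D.p₀ D.p₁ n)) a
  induction a using FreeAlgebra.induction with
  | grade0 r => rw [AlgHom.commutes]; exact Subalgebra.algebraMap_mem _ _
  | grade1 g =>
    refine Algebra.subset_adjoin ?_
    cases g with
    | T i => exact Or.inl ⟨i, rfl⟩
    | X l => exact Or.inr ⟨_, HGlue.X l⟩
    | Xinv l => exact Or.inr ⟨_, HGlue.Xinv l⟩
  | mul a b ha hb => rw [map_mul]; exact mul_mem ha hb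
  | add a b ha hb => rw [map_add]; exact add_mem ha hb

end BKRParam

/-! ### The completed affine Hecke algebra -/

namespace BKRParam

open EnhancedQuiver

variable {k : Type*} [Field k] [CharZero k] (D : BKRParam k) {β : D.J →₀ ℕ} {n : ℕ}

/-- The point `(ν_1, …, ν_n)`. -/
def point (ν : D.Comp β n) (l : Fin n) : kˣ := D.X (ν l)

lemma oX_apply (l : Fin n) (ν : D.Comp β n) : D.oX l ν = nearVar (D.point ν) l := rfl

variable (β n) in
/-- The change of variables `x_l ↦ ν_l / X_l - X_l / ν_l`. -/
def changeVar : Phat k D.quiver β n ≃ₐ[k] D.Ohat β n :=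
  AlgEquiv.piCongrRight fun ν => near (D.point ν)

lemma changeVar_apply (F : Phat k D.quiver β n) (ν : D.Comp β n) :
    D.changeVar β n F ν = near (D.point ν) (F ν) := rfl

variable (β n) in
/-- Power series in `X_l - ν_l` as rational functions in the `x_l`. -/
def hatMap : D.Ohat β n →ₐ[k] RatSpace k D.quiver β n :=
  (serMap k D.quiver β n).comp (D.changeVar β n).symm.toAlgHom

lemma hatMap_apply (F : D.Ohat β n) (ν : D.Comp β n) :
    D.hatMap β n F ν = algebraMap _ (PSField k n) (ofNear (D.point ν) (F ν)) := rfl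

lemma hatMap_changeVar (F : Phat k D.quiver β n) :
    D.hatMap β n (D.changeVar β n F) = serMap k D.quiver β n F :=
  congrArg (serMap k D.quiver β n) ((D.changeVar β n).symm_apply_apply F)

lemma hatMap_injective : Function.Injective (D.hatMap β n) :=
  serMap_injective.comp (D.changeVar β n).symm.injective

lemma hatMap_oX (l : Fin n) : D.hatMap β n (D.oX l) = D.ratX l := by
  ext ν
  rw [hatMap_apply, oX_apply, ofNear_nearVar, map_mul]
  rfl

lemma oX_mul_inv (l : Fin n) : D.oX (β := β) l * (D.oX l)⁻¹ = 1 := by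
  ext1 ν
  exact nearVar_mul_inv (D.point ν) l

lemma hatMap_oX_inv (l : Fin n) : D.hatMap β n (D.oX l)⁻¹ = (D.ratX l)⁻¹ := by
  have h := congrArg (D.hatMap β n) (D.oX_mul_inv (β := β) l)
  rw [map_mul, map_one, hatMap_oX] at h
  exact (eq_of_sub_eq_zero (by
    have h2 := D.ratX_mul_inv (β := β) l
    linear_combination (D.ratX l)⁻¹ * h - D.hatMap β n (D.oX l)⁻¹ * h2))

/-- The change of variables is equivariant: permuting the x_l permutes the t(x_l), and x_1 ↦ -x_1
inverts t(x_1) while θ inverts ν_1. Both sides are substitutions, so the variables suffice. -/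
lemma ofNear_actX (i : Fin n) (F : D.Ohat β n) (ν : D.Comp β n) :
    ofNear (D.point ν) (D.actX i F ν) = simpleRefl i (ofNear (D.point (ν.s i)) (F (ν.s i))) := by
  have ha : ∀ l : Fin n, MvPowerSeries.constantCoeff (if i.1 = 0 then
      (if l = i then (D.oX l ν)⁻¹ - MvPowerSeries.C ((D.X (ν l) : k)⁻¹) else MvPowerSeries.X l)
    else (MvPowerSeries.X (Equiv.swap (prev i) i l) : MvPowerSeries (Fin n) k)) = 0 := by
    intro l
    split_ifs
    · rw [oX_apply, map_sub, MvPowerSeries.constantCoeff_inv, constantCoeff_nearVar,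
        MvPowerSeries.constantCoeff_C]
      exact sub_self _
    · exact MvPowerSeries.constantCoeff_X _
    · exact MvPowerSeries.constantCoeff_X _
  have h : (ofNear (D.point ν)).comp (mkSubst _ ha) =
      (reflHom i).comp (ofNear (D.point (ν.s i))) := by
    refine ((isSubst_ofNear _).comp (isSubst_mkSubst _ _)).ext
      ((isSubst_reflHom i).comp (isSubst_ofNear _)) fun l => ?_
    rw [AlgHom.comp_apply, AlgHom.comp_apply, mkSubst_X]
    have e : ∀ l, ofNear (D.point ν) (MvPowerSeries.X l) =
        MvPowerSeries.C (D.point ν l : k) * (tser k l - 1) := fun l => mkSubst_X _ _ _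
    have e' : ofNear (D.point (ν.s i)) (MvPowerSeries.X l) =
        MvPowerSeries.C (D.point (ν.s i) l : k) * (tser k l - 1) := mkSubst_X _ _ _
    rw [e', map_mul, map_sub, map_one, algHom_C, ← simpleRefl_apply]
    by_cases hi : i.1 = 0
    · rw [if_pos hi]
      by_cases hl : l = i
      · subst hl
        have h : (D.point (ν.s l) l : k) = (D.point ν l : k)⁻¹ := by
          rw [point, Comp.s_apply_zero hi]
          exact Units.val_inv_eq_inv_val _
        rw [if_pos rfl, simpleRefl_zero_tser l hi, h, map_sub, oX_apply,
          (isSubst_ofNear _).map_inv, ofNear_nearVar, algHom_C, C_mul_inv, mul_sub, mul_one]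
        rfl
      · rw [if_neg hl, e, simpleRefl_zero_tser_ne i hi l hl, point, point,
          Comp.s_apply_zero_ne hi ν hl]
    · rw [if_neg hi, e, simpleRefl_tser i hi, point, point, Comp.s_apply hi]
  have := DFunLike.congr_fun h (F (ν.s i))
  rw [AlgHom.comp_apply, AlgHom.comp_apply, mkSubst_apply] at this
  exact this

lemma hatMap_actX (i : Fin n) (F : D.Ohat β n) :
    D.hatMap β n (D.actX i F) = sV i (D.hatMap β n F) := by
  ext ν
  rw [hatMap_apply, ofNear_actX, ← sK_algebraMap]
  rfl

lemma actX_actX (i : Fin n) (F : D.Ohat β n) : D.actX i (D.actX i F) = F :=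
  D.hatMap_injective (by rw [hatMap_actX, hatMap_actX, sV_sV])

omit [CharZero k] in
lemma actX_apply_of_ne {i : Fin n} (hi : i.1 ≠ 0) (F : D.Ohat β n) (ν : D.Comp β n) :
    D.actX i F ν = simpleRefl i (F (ν.s i)) := by
  rw [← actx_eq, actX, actx]
  simp only [if_neg hi]

omit [CharZero k] in
lemma dvd_of_constantCoeff_ne_zero {f : MvPowerSeries (Fin n) k}
    (h : MvPowerSeries.constantCoeff f ≠ 0) (g : MvPowerSeries (Fin n) k) : f ∣ g :=
  (MvPowerSeries.isUnit_iff_constantCoeff.2 (isUnit_iff_ne_zero.2 h)).dvd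

/-- If ν_i ≠ ν_{i+1} the denominator has nonzero constant term and is a unit. Otherwise s_i fixes ν
and the denominator is the difference of two variables, which divides F - s_i(F). -/
lemma exists_mul_eq_sub_actX {i : Fin n} (hi : i.1 ≠ 0) (F : D.Ohat β n) :
    ∃ G, (D.oX (prev i) - D.oX i) * G = F - D.actX i F := by
  have key : ∀ ν : D.Comp β n, D.oX (prev i) ν - D.oX i ν ∣ F ν - D.actX i F ν := by
    intro ν
    by_cases h : ν (prev i) = ν i
    · rw [D.actX_apply_of_ne hi, Comp.s_eq_self hi h, ← neg_sub (simpleRefl i _), dvd_neg, oX, oX, h,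
        add_sub_add_left_eq_sub]
      exact dvd_simpleRefl_sub i hi _
    · refine dvd_of_constantCoeff_ne_zero ?_ _
      rw [oX_apply, oX_apply, map_sub, constantCoeff_nearVar, constantCoeff_nearVar, sub_ne_zero]
      exact fun h' => h (Subtype.ext (Units.ext h'))
  choose G hG using key
  exact ⟨G, funext fun ν => (hG ν).symm⟩

lemma fixed_of_sq_eq_one {j : D.J} (h : (D.X j : k) ^ 2 = 1) : j = D.quiver.θ j := by
  refine Subtype.ext (eq_inv_of_mul_eq_one_left (Units.ext ?_))
  rw [Units.val_mul, ← pow_two]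
  exact h

lemma sq_eq_one_of_fixed {j : D.J} (h : j = D.quiver.θ j) : (D.X j : k) ^ 2 = 1 := by
  have h' : j.1 = j.1⁻¹ := congrArg Subtype.val h
  rw [pow_two, ← Units.val_mul, X]
  nth_rewrite 2 [h']
  rw [mul_inv_cancel, Units.val_one]

/-- At ν_1² = 1 one has X_1² = t², and t² - 1 = -x_1t by the defining equation. -/
lemma ofNear_oX_sq_sub {o : Fin n} {ν : D.Comp β n} (h : (D.X (ν o) : k) ^ 2 = 1) :
    ofNear (D.point ν) (D.oX o ν ^ 2 - 1) = -(MvPowerSeries.X o * tser k o) := by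
  rw [map_sub, map_pow, oX_apply, ofNear_nearVar, mul_pow, ← map_pow, point, h, map_one, map_one]
  linear_combination tser_sq (k := k) o

/-- Away from the fixed points of θ the denominator is a unit; at a fixed point it is a unit times
x_1 in the coordinates x_l, where s_0 is a sign change. -/
lemma exists_mul_eq_sub_actX_zero {o : Fin n} (ho : o.1 = 0) (F : D.Ohat β n) :
    ∃ G, (D.oX o ^ 2 - 1) * G = F - D.actX o F := by
  have key : ∀ ν : D.Comp β n, D.oX o ν ^ 2 - 1 ∣ F ν - D.actX o F ν := by
    intro ν
    by_cases h : (D.X (ν o) : k) ^ 2 = 1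
    · rw [← map_dvd_iff (near (D.point ν)).symm]
      change ofNear (D.point ν) _ ∣ ofNear (D.point ν) _
      rw [D.ofNear_oX_sq_sub h, map_sub, ofNear_actX,
        Comp.s_zero_eq_self ho (D.fixed_of_sq_eq_one h), neg_dvd, ← neg_sub, dvd_neg]
      refine (IsUnit.mul_right_dvd ?_).2 (dvd_simpleRefl_zero_sub o ho _)
      rw [MvPowerSeries.isUnit_iff_constantCoeff, constantCoeff_tser]
      exact isUnit_one
    · refine dvd_of_constantCoeff_ne_zero ?_ _
      rw [oX_apply, map_sub, map_pow, constantCoeff_nearVar, map_one, sub_ne_zero]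
      exact h
  choose G hG using key
  exact ⟨G, funext fun ν => (hG ν).symm⟩

lemma repH_glue {a : D.H n} {b : D.Ohat β n} (h : D.HGlue β n a b) :
    D.repH β n a = (mulOp.comp (D.hatMap β n)) b := by
  cases h with
  | X l => rw [repH_X, AlgHom.comp_apply, hatMap_oX]
  | Xinv l => rw [repH_Xinv, AlgHom.comp_apply, hatMap_oX_inv]

lemma hatMap_oC (c : k) : D.hatMap β n (D.oC c) = algebraMap k _ c := AlgHom.commutes _ c

lemma repH_cross {u v : FreeAlgebra k (D.H n ⊕ D.Ohat β n)} (h : D.HCross β n u v) :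
    FreeAlgebra.lift k (Sum.elim (D.repH β n) (mulOp.comp (D.hatMap β n))) u =
    FreeAlgebra.lift k (Sum.elim (D.repH β n) (mulOp.comp (D.hatMap β n))) v := by
  cases h with
  | pos i hi F G hG =>
    rw [map_mul, map_sub, map_mul]
    simp only [FreeAlgebra.lift_ι_apply, Sum.elim_inl, Sum.elim_inr, repH_T, AlgHom.comp_apply]
    have h := congrArg (D.hatMap β n) hG
    simp only [map_mul, map_sub, hatMap_oX, hatMap_actX] at h
    rw [Top, op_mul_mulOp, hatMap_actX, ← h, sub_eq_add_neg (mulOp _ * _), ← map_neg mulOp]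
    congr 2
    ext ν
    simp only [Pi.mul_apply, Pi.neg_apply, Pi.sub_apply, hatMap_oC, hatMap_oX, map_mul]
    rw [TB_of_ne D hi, sub_cH (D.ratX_sub_ne_zero hi ν), ← mul_assoc,
      div_mul_cancel₀ _ (D.ratX_sub_ne_zero hi ν), Pi.algebraMap_apply, map_sub, map_inv₀]
    ring
  | zero o ho F G hG =>
    rw [map_mul, map_add, map_mul]
    simp only [FreeAlgebra.lift_ι_apply, Sum.elim_inl, Sum.elim_inr, repH_T, AlgHom.comp_apply]
    have h := congrArg (D.hatMap β n) hG
    simp only [map_mul, map_sub, map_pow, map_one, hatMap_oX, hatMap_actX] at h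
    rw [Top, op_mul_mulOp, hatMap_actX, ← h]
    congr 2
    ext ν
    simp only [Pi.mul_apply, Pi.sub_apply, Pi.pow_apply, Pi.one_apply, map_sub, map_mul, map_pow,
      map_one, hatMap_oC, hatMap_oX]
    rw [TB_of_eq D ho, sub_cH₀ (fieldC_ne_zero (Units.ne_zero _)) (D.ratX_zero_sq_sub_ne_zero ho ν),
      ← mul_assoc, div_mul_cancel₀ _ (D.ratX_zero_sq_sub_ne_zero ho ν)]
    simp only [Pi.algebraMap_apply, map_inv₀]

variable (β n) in
/-- The representation of the completed affine Hecke algebra on rational functions. -/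
def hatRep : D.Hhat β n →ₐ[k] Module.End k (RatSpace k D.quiver β n) :=
  ExtAlg.lift (D.repH β n) (mulOp.comp (D.hatMap β n)) (fun _ _ => D.repH_glue)
    (fun _ _ => D.repH_cross)

lemma hatRep_ofH (a : D.H n) : D.hatRep β n (D.ofH β n a) = D.repH β n a :=
  ExtAlg.lift_inl _ _ _ _ _

lemma hatRep_ofO (F : D.Ohat β n) : D.hatRep β n (D.ofO β n F) = mulOp (D.hatMap β n F) :=
  ExtAlg.lift_inr _ _ _ _ _

lemma hatRep_hatT (i : Fin n) : D.hatRep β n (D.hatT i) = D.Top β i := by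
  rw [hatT, hatRep_ofH, repH_T]

/-- The Bernstein–Lusztig rule applied to the reflected series, read from right to left. -/
lemma ofO_mul_hatT (F : D.Ohat β n) (i : Fin n) :
    ∃ G G', D.ofO β n F * D.hatT i = D.hatT i * D.ofO β n G + D.ofO β n G' := by
  have key : ∀ {u v}, D.HCross β n u v → ExtAlg.mk k _ _ (D.HGlue β n) (D.HCross β n) u =
    ExtAlg.mk k _ _ (D.HGlue β n) (D.HCross β n) v := fun h => ExtAlg.cross_eq h
  refine ⟨D.actX i F, ?_⟩
  by_cases hi : i.1 = 0
  · obtain ⟨G, hG⟩ := D.exists_mul_eq_sub_actX_zero hi (D.actX i F)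
    have := key (HCross.zero i hi _ G hG)
    rw [map_mul, map_add, map_mul, actX_actX] at this
    refine ⟨-((D.oC ((D.p₀ : k) - (D.p₁ : k)⁻¹) * D.oX i ^ 2
              - D.oC ((D.p₀ : k) * (D.p₁ : k)⁻¹ - 1) * D.oX i) * G), ?_⟩
    rw [map_neg, ← sub_eq_add_neg]
    exact eq_sub_of_add_eq this.symm
  · obtain ⟨G, hG⟩ := D.exists_mul_eq_sub_actX hi (D.actX i F)
    have := key (HCross.pos i hi _ G hG)
    rw [map_mul, map_sub, map_mul, actX_actX] at this
    exact ⟨_, eq_add_of_sub_eq this.symm⟩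

theorem bijective_and_faithful :
    Function.Bijective (D.tensorToHhat β n) ∧ Function.Injective (D.hatRep β n) := by
  refine tensorToExt_bijective_of_op (F := D.TA) (G := D.TB) (c := D.hatMap β n)
    (HeckeC.T D.q D.p₀ D.p₁) D.hecke_straightening D.hecke_mem_adjoin ?_ (D.hatRep β n)
    D.hatMap_injective ?_ D.TA_ne_zero ?_
  · exact D.ofO_mul_hatT
  · exact D.hatRep_ofO
  · exact D.hatRep_hatT

end BKRParam

/-! ### Comparison of the coefficients of T_i and τ_i -/

section Coeff

variable {K : Type*} [Field K]

/-- Since (T⁻¹ - T) - (S⁻¹ - S) = -(T - S)(1 + T⁻¹S⁻¹), the pole along X_m = X_{m+1} becomes the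
pole along x_m = x_{m+1} if both variables are taken near the same point a. -/
lemma cH_eq_of_eq {q q' a T S : K} (ha : a ≠ 0) (hT : T ≠ 0) (hS : S ≠ 0) (hTS : a * T - a * S ≠ 0)
    (hx : (T⁻¹ - T) - (S⁻¹ - S) ≠ 0) :
    (q * (a * T) - q' * (a * S)) / (a * T - a * S) =
      -(q * T - q' * S) * (1 + T⁻¹ * S⁻¹) * ((T⁻¹ - T) - (S⁻¹ - S))⁻¹ := by
  rw [eq_mul_inv_iff_mul_eq₀ hx, div_mul_eq_mul_div, div_eq_iff hTS]
  field_simp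
  ring

end Coeff

namespace BKRParam

open EnhancedQuiver

variable {k : Type*} [Field k] [CharZero k] (D : BKRParam k) {β : D.J →₀ ℕ} {n : ℕ}

lemma isUnit_of_constantCoeff {f : MvPowerSeries (Fin n) k}
    (h : MvPowerSeries.constantCoeff f ≠ 0) : IsUnit f :=
  MvPowerSeries.isUnit_iff_constantCoeff.2 (isUnit_iff_ne_zero.2 h)

lemma algebraMap_C (c : k) :
    algebraMap (MvPowerSeries (Fin n) k) (PSField k n) (MvPowerSeries.C c) = fieldC k n c :=
  (IsScalarTower.algebraMap_apply k (MvPowerSeries (Fin n) k) (PSField k n) c).symm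

lemma fieldC_inv (c : k) : fieldC k n c⁻¹ = (fieldC k n c)⁻¹ := map_inv₀ _ _

lemma fieldC_mul (c c' : k) : fieldC k n (c * c') = fieldC k n c * fieldC k n c' := map_mul _ _ _

/-- The definition uses classical decidability; here any instances are permitted. -/
lemma lam_quiver (j : D.J) [Decidable (j.1 = D.p₁)] [Decidable (j.1 = -D.p₀)] :
    D.quiver.lam j = (if j.1 = D.p₁ then 1 else 0) + (if j.1 = -D.p₀ then 1 else 0) := by
  unfold quiver
  dsimp only
  congr

lemma arr_quiver (i j : D.J) [Decidable (j.1 = D.q ^ 2 * i.1)] :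
    D.quiver.arr i j = if j.1 = D.q ^ 2 * i.1 then 1 else 0 := by
  unfold quiver
  dsimp only
  congr

lemma algebraMap_tser (l : Fin n) :
    algebraMap (MvPowerSeries (Fin n) k) (PSField k n) (tser k l) = fieldT k l := rfl

lemma constantCoeff_one_add_inv (l l' : Fin n) :
    MvPowerSeries.constantCoeff (1 + (tser k l)⁻¹ * (tser k l')⁻¹) = 2 := by
  simp [constantCoeff_tser, one_add_one_eq_two]

/-- Comparison of the coefficients of `T_i` and `τ_i`. -/
def Comparable (i : Fin n) (ν : D.Comp β n) : Prop :=
  ∃ u g : MvPowerSeries (Fin n) k, IsUnit u ∧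
    D.TA i ν = algebraMap _ _ u * τA k D.quiver β i ν ∧
    D.TB i ν = algebraMap _ _ u * τB k D.quiver β i ν + algebraMap _ _ g

/-- T_i - q and τ_i are both multiples of σ_i - 1 here, so only the factor u between them matters,
and g = q. -/
lemma comparable_of_eq {i : Fin n} (hi : i.1 ≠ 0) {ν : D.Comp β n} (h : ν (prev i) = ν i) :
    D.Comparable i ν := by
  have hx := fieldX_sub_ne_zero (k := k) (prev_ne hi)
  obtain ⟨u, hu⟩ : ∃ u : MvPowerSeries (Fin n) k,
      u = -(MvPowerSeries.C (D.q : k) * tser k (prev i) - MvPowerSeries.C (D.q : k)⁻¹ * tser k i) *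
        (1 + (tser k (prev i))⁻¹ * (tser k i)⁻¹) := ⟨_, rfl⟩
  have key : D.TA i ν = algebraMap _ (PSField k n) u * (fieldX (prev i) - fieldX i)⁻¹ := by
    rw [hu]
    simp only [map_mul, map_neg, map_sub, map_add, map_one, algebraMap_C, algebraMap_inv_tser,
      algebraMap_tser]
    have h1 := D.ratX_sub_ne_zero hi ν
    rw [← inv_fieldT_sub, ← inv_fieldT_sub] at hx ⊢
    rw [TA_of_ne D hi, cH]
    simp only [ratX, ← h] at h1 ⊢
    rw [cH_eq_of_eq (fieldC_ne_zero (Units.ne_zero _)) (fieldT_ne_zero _) (fieldT_ne_zero _) h1 hx,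
      fieldC_inv]
  refine ⟨u, MvPowerSeries.C (D.q : k), isUnit_of_constantCoeff ?_, ?_, ?_⟩
  rotate_left
  · rw [key, τA, if_neg hi, cA, if_pos h]
  · rw [TB, key, τB, if_neg hi, cB, if_pos h, par, if_neg hi, algebraMap_C]
    ring
  -- The constant term of u is -2(q - q⁻¹), nonzero because q² ≠ 1.
  · rw [hu, map_mul, constantCoeff_one_add_inv]
    simp only [map_neg, map_sub, map_mul, MvPowerSeries.constantCoeff_C, constantCoeff_tser, mul_one]
    refine mul_ne_zero (neg_ne_zero.2 (sub_ne_zero.2 fun h => D.q_sq_ne_one (Units.ext ?_)))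
      two_ne_zero
    rw [Units.val_pow_eq_pow_val, pow_two, Units.val_one]
    nth_rewrite 1 [h]
    exact inv_mul_cancel₀ (Units.ne_zero _)

/-- The denominator X_m - X_{m+1} is a unit and τ_i has no identity part, so TB itself serves as g.
It remains to match the zeros of the numerator with the power of x_m - x_{m+1}. -/
lemma comparable_of_ne {i : Fin n} (hi : i.1 ≠ 0) {ν : D.Comp β n} (h : ν (prev i) ≠ ν i) :
    D.Comparable i ν := by
  classical
  have hx := fieldX_sub_ne_zero (k := k) (prev_ne hi)
  have hab : (D.X (ν (prev i)) : k) - D.X (ν i) ≠ 0 :=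
    sub_ne_zero.2 fun h' => h (Subtype.ext (Units.ext h'))
  have hd : MvPowerSeries.constantCoeff (MvPowerSeries.C (D.X (ν (prev i)) : k) * tser k (prev i) -
      MvPowerSeries.C (D.X (ν i) : k) * tser k i) ≠ 0 := by
    simpa [constantCoeff_tser] using hab
  have hq := D.q.ne_zero
  have ha := (D.X (ν (prev i))).ne_zero
  have h1 := D.ratX_sub_ne_zero hi ν
  obtain ⟨v, hv⟩ : ∃ v : MvPowerSeries (Fin n) k,
      v = (MvPowerSeries.C (D.q : k) * (MvPowerSeries.C (D.X (ν (prev i)) : k) * tser k (prev i)) -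
        MvPowerSeries.C (D.q : k)⁻¹ * (MvPowerSeries.C (D.X (ν i) : k) * tser k i)) *
        (MvPowerSeries.C (D.X (ν (prev i)) : k) * tser k (prev i) -
          MvPowerSeries.C (D.X (ν i) : k) * tser k i)⁻¹ := ⟨_, rfl⟩
  have key : D.TA i ν = algebraMap _ (PSField k n) v := by
    rw [hv, map_mul, algebraMap_inv_of_ne hd]
    simp only [map_mul, map_sub, algebraMap_C, algebraMap_tser]
    rw [TA_of_ne D hi, cH, fieldC_inv, ratX, ratX, div_eq_mul_inv]
  have hB : τB k D.quiver β i ν = 0 := by rw [τB, if_neg hi, cB, if_neg h]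
  suffices hu : ∃ u : MvPowerSeries (Fin n) k, IsUnit u ∧
      D.TA i ν = algebraMap _ _ u * τA k D.quiver β i ν by
    obtain ⟨u, hu, e⟩ := hu
    refine ⟨u, MvPowerSeries.C (D.q : k) - v, hu, e, ?_⟩
    rw [hB, mul_zero, zero_add, TB, key, par, if_neg hi, ← algebraMap_C, ← map_sub]
  -- With b = q²a the numerator is qa(t - t'), and t - t' is x_m - x_{m+1} up to a unit; without an
  -- arrow ν_m → ν_{m+1} the numerator does not vanish at ν.
  by_cases harr : (ν i).1 = D.q ^ 2 * (ν (prev i)).1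
  · have hA : τA k D.quiver β i ν = fieldX (prev i) - fieldX i := by
      rw [τA, if_neg hi, cA, if_neg h, arr_quiver, if_pos harr, pow_one]
    have hb : (D.X (ν i) : k) = D.q * (D.q * D.X (ν (prev i))) := by
      rw [X, harr, Units.val_mul, Units.val_pow_eq_pow_val, pow_two, mul_assoc]
      rfl
    have h2 : MvPowerSeries.constantCoeff (1 + (tser k (prev i))⁻¹ * (tser k i)⁻¹) ≠ 0 := by
      rw [constantCoeff_one_add_inv]
      exact two_ne_zero
    refine ⟨MvPowerSeries.C (-((D.q : k) * D.X (ν (prev i)))) *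
      ((1 + (tser k (prev i))⁻¹ * (tser k i)⁻¹)⁻¹ *
        (MvPowerSeries.C (D.X (ν (prev i)) : k) * tser k (prev i) -
          MvPowerSeries.C (D.X (ν i) : k) * tser k i)⁻¹), isUnit_of_constantCoeff ?_, ?_⟩
    · rw [map_mul, map_mul, MvPowerSeries.constantCoeff_inv, MvPowerSeries.constantCoeff_inv,
        MvPowerSeries.constantCoeff_C]
      exact mul_ne_zero (neg_ne_zero.2 (mul_ne_zero hq ha))
        (mul_ne_zero (inv_ne_zero h2) (inv_ne_zero hd))
    · have h3 : algebraMap (MvPowerSeries (Fin n) k) (PSField k n)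
          (1 + (tser k (prev i))⁻¹ * (tser k i)⁻¹) ≠ 0 := by
        intro h3
        rw [IsFractionRing.to_map_eq_zero_iff] at h3
        exact h2 (by rw [h3, map_zero])
      rw [hA, map_mul, map_mul, algebraMap_inv_of_ne hd, algebraMap_inv_of_ne h2, TA_of_ne D hi, cH]
      simp only [map_mul, map_neg, map_sub, map_add, map_one, algebraMap_C, algebraMap_inv_tser,
        algebraMap_tser, ratX] at h1 h3 ⊢
      rw [div_eq_mul_inv, ← mul_assoc _ _ (_ - _)⁻¹, mul_right_comm _ (_ - _)⁻¹]
      congr 1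
      rw [mul_right_comm, eq_mul_inv_iff_mul_eq₀ h3, ← inv_fieldT_sub, ← inv_fieldT_sub, hb,
        fieldC_mul, fieldC_mul]
      have hT := fieldT_ne_zero (k := k) (prev i)
      have hS := fieldT_ne_zero (k := k) i
      have hQ := fieldC_ne_zero (n := n) hq
      field_simp
      ring
  · have hA : τA k D.quiver β i ν = 1 := by
      rw [τA, if_neg hi, cA, if_neg h, arr_quiver, if_neg harr, pow_zero]
    refine ⟨v, isUnit_of_constantCoeff ?_, key.trans (by rw [hA, mul_one])⟩
    rw [hv, map_mul, MvPowerSeries.constantCoeff_inv]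
    refine mul_ne_zero ?_ (inv_ne_zero hd)
    simp only [map_sub, map_mul, MvPowerSeries.constantCoeff_C, constantCoeff_tser, mul_one]
    intro h'
    refine harr (Units.ext ?_)
    rw [Units.val_mul, Units.val_pow_eq_pow_val]
    change (D.X (ν i) : k) = D.q ^ 2 * D.X (ν (prev i))
    field_simp at h'
    linear_combination -h'

/-- The pole of T_0 comes from X_1² - 1 = -x_1t and is the pole 1/x_1 of τ_0. -/
lemma comparable_zero_of_eq {o : Fin n} (ho : o.1 = 0) {ν : D.Comp β n}
    (h : ν o = D.quiver.θ (ν o)) : D.Comparable o ν := by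
  classical
  have hx := fieldX_ne_zero (k := k) o
  have ha : (D.X (ν o) : k) ^ 2 = 1 := D.sq_eq_one_of_fixed h
  obtain ⟨u, hu⟩ : ∃ u : MvPowerSeries (Fin n) k,
      u = -((MvPowerSeries.C (D.X (ν o) : k) * tser k o + MvPowerSeries.C (D.p₀ : k)) *
        (MvPowerSeries.C (D.X (ν o) : k) * tser k o - MvPowerSeries.C (D.p₁ : k)) *
        MvPowerSeries.C (D.p₁ : k)⁻¹ * (tser k o)⁻¹) := ⟨_, rfl⟩
  have key : D.TA o ν = algebraMap _ (PSField k n) u * (fieldX o)⁻¹ := by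
    rw [hu]
    simp only [map_mul, map_neg, map_sub, map_add, algebraMap_C, algebraMap_inv_tser,
      algebraMap_tser]
    have h1 := D.ratX_zero_sq_sub_ne_zero ho ν
    have e : D.ratX o ν ^ 2 = fieldT k o ^ 2 := by rw [ratX, mul_pow, ← map_pow, ha, map_one, one_mul]
    rw [TA_of_eq D ho, cH₀, e]
    rw [e] at h1
    have hT := fieldT_ne_zero (k := k) o
    have hp := fieldC_ne_zero (n := n) D.p₁.ne_zero
    rw [← inv_fieldT_sub] at hx ⊢
    rw [eq_mul_inv_iff_mul_eq₀ hx, div_mul_eq_mul_div, div_eq_iff (mul_ne_zero hp h1), fieldC_inv,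
      ratX]
    field_simp
    ring
  refine ⟨u, MvPowerSeries.C (D.p₀ : k), isUnit_of_constantCoeff ?_, ?_, ?_⟩
  rotate_left
  · rw [key, τA, if_pos ho, cA₀, if_pos h]
  · rw [TB, key, τB, if_pos ho, cB₀, if_pos h, par, if_pos ho, algebraMap_C]
    ring
  -- The framing vanishes at fixed points, so ν_1 is neither -p₀ nor p₁ and the numerator is a unit.
  · have hl := D.quiver.lam_fixed _ h.symm
    rw [lam_quiver] at hl
    rw [hu]
    simp only [map_neg, map_sub, map_mul, map_add, MvPowerSeries.constantCoeff_C,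
      constantCoeff_tser, mul_one, MvPowerSeries.constantCoeff_inv, inv_one]
    refine neg_ne_zero.2 (mul_ne_zero (mul_ne_zero ?_ ?_) (inv_ne_zero (Units.ne_zero _)))
    · intro h0
      have : (ν o).1 = -D.p₀ := Units.ext (eq_neg_of_add_eq_zero_left h0)
      rw [if_pos this] at hl
      omega
    · intro h0
      have : (ν o).1 = D.p₁ := Units.ext (sub_eq_zero.1 h0)
      rw [if_pos this] at hl
      omega

open Classical in
-- If c = a the expression is a(t - 1), and (t - 1)(t + 1) = -x t with t + 1 a unit; otherwise the
-- constant term a - c is nonzero.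
lemma exists_unit_mul_X (o : Fin n) (a : kˣ) (c : k) :
    ∃ w : MvPowerSeries (Fin n) k, IsUnit w ∧
      MvPowerSeries.C (a : k) * tser k o - MvPowerSeries.C c =
        w * MvPowerSeries.X o ^ (if (a : k) = c then 1 else 0) := by
  by_cases h : (a : k) = c
  · have h1 : MvPowerSeries.constantCoeff (1 + tser k o) ≠ 0 := by
      rw [map_add, map_one, constantCoeff_tser, one_add_one_eq_two]
      exact two_ne_zero
    refine ⟨-(MvPowerSeries.C (a : k) * tser k o * (1 + tser k o)⁻¹), isUnit_of_constantCoeff ?_, ?_⟩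
    · rw [map_neg, map_mul, map_mul, MvPowerSeries.constantCoeff_inv, constantCoeff_tser, mul_one,
        MvPowerSeries.constantCoeff_C]
      exact neg_ne_zero.2 (mul_ne_zero a.ne_zero (inv_ne_zero h1))
    · rw [if_pos h, pow_one, ← h]
      have h2 := MvPowerSeries.mul_inv_cancel _ h1
      have h3 := tser_sq (k := k) o
      linear_combination MvPowerSeries.C (a : k) * (1 + tser k o)⁻¹ * h3 -
        MvPowerSeries.C (a : k) * (tser k o - 1) * h2
  · refine ⟨_, isUnit_of_constantCoeff ?_, by rw [if_neg h, pow_zero, mul_one]⟩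
    simpa [constantCoeff_tser, sub_eq_zero] using h

/-- The two numerator factors contribute x_1 to the powers δ_{ν_1 = -p₀} and δ_{ν_1 = p₁}, whose sum
is λ(ν_1), while the denominator is a unit. -/
lemma comparable_zero_of_ne {o : Fin n} (ho : o.1 = 0) {ν : D.Comp β n}
    (h : ν o ≠ D.quiver.θ (ν o)) : D.Comparable o ν := by
  classical
  have hd : MvPowerSeries.constantCoeff (MvPowerSeries.C (D.p₁ : k) *
      ((MvPowerSeries.C (D.X (ν o) : k) * tser k o) ^ 2 - 1)) ≠ 0 := by
    simp only [map_mul, map_sub, map_pow, map_one, MvPowerSeries.constantCoeff_C,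
      constantCoeff_tser, mul_one]
    exact mul_ne_zero D.p₁.ne_zero (sub_ne_zero.2 fun h' => h (D.fixed_of_sq_eq_one h'))
  obtain ⟨v, hv⟩ : ∃ v : MvPowerSeries (Fin n) k,
      v = (MvPowerSeries.C (D.X (ν o) : k) * tser k o - MvPowerSeries.C (-D.p₀ : k)) *
        (MvPowerSeries.C (D.X (ν o) : k) * tser k o - MvPowerSeries.C (D.p₁ : k)) *
        (MvPowerSeries.C (D.p₁ : k) *
          ((MvPowerSeries.C (D.X (ν o) : k) * tser k o) ^ 2 - 1))⁻¹ := ⟨_, rfl⟩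
  have key : D.TA o ν = algebraMap _ (PSField k n) v := by
    rw [hv, map_mul, algebraMap_inv_of_ne hd]
    simp only [map_mul, map_neg, map_sub, map_add, map_pow, map_one, algebraMap_C, algebraMap_tser,
      sub_neg_eq_add]
    rw [TA_of_eq D ho, cH₀, ratX, div_eq_mul_inv]
  obtain ⟨w₀, hw₀, e₀⟩ := exists_unit_mul_X o (D.X (ν o)) (-D.p₀ : k)
  obtain ⟨w₁, hw₁, e₁⟩ := exists_unit_mul_X o (D.X (ν o)) (D.p₁ : k)
  have hl : D.quiver.lam (ν o) = (if (D.X (ν o) : k) = (D.p₁ : k) then 1 else 0) +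
      (if (D.X (ν o) : k) = (-D.p₀ : k) then 1 else 0) := by
    rw [lam_quiver, ← Units.val_neg]
    simp only [Units.val_inj]
    rfl
  refine ⟨w₀ * w₁ * (MvPowerSeries.C (D.p₁ : k) *
          ((MvPowerSeries.C (D.X (ν o) : k) * tser k o) ^ 2 - 1))⁻¹, MvPowerSeries.C (D.p₀ : k) - v,
    (hw₀.mul hw₁).mul (isUnit_of_constantCoeff ?_), ?_, ?_⟩
  rotate_left 2
  · rw [τB, if_pos ho, cB₀, if_neg h, mul_zero, zero_add, TB, key, par, if_pos ho, ← algebraMap_C,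
      ← map_sub]
  · rw [MvPowerSeries.constantCoeff_inv]
    exact inv_ne_zero hd
  · rw [key, hv, τA, if_pos ho, cA₀, if_neg h, hl, e₀, e₁, fieldX, ← map_pow, ← map_mul]
    congr 1
    ring

lemma comparable (i : Fin n) (ν : D.Comp β n) : D.Comparable i ν := by
  by_cases hi : i.1 = 0
  · by_cases h : ν i = D.quiver.θ (ν i)
    · exact D.comparable_zero_of_eq hi h
    · exact D.comparable_zero_of_ne hi h
  · by_cases h : ν (prev i) = ν i
    · exact D.comparable_of_eq hi h
    · exact D.comparable_of_ne hi h

end BKRParam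

lemma ExtAlg.range_le {k A B E ι : Type*} [Field k] [Ring A] [Algebra k A] [Ring B] [Algebra k B]
    [Ring E] [Algebra k E] {glue : A → B → Prop}
    {cross : FreeAlgebra k (A ⊕ B) → FreeAlgebra k (A ⊕ B) → Prop}
    (ρ : ExtAlg k A B glue cross →ₐ[k] E) {t : ι → A}
    (hgen : ∀ a, a ∈ Algebra.adjoin k (Set.range t ∪ {a | ∃ b, glue a b})) {S : Subalgebra k E}
    (hr : ∀ b, ρ (ExtAlg.inr k A B glue cross b) ∈ S)
    (ht : ∀ i, ρ (ExtAlg.inl k A B glue cross (t i)) ∈ S) : ρ.range ≤ S := by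
  rintro _ ⟨z, rfl⟩
  refine ExtAlg.induction (p := fun z => ρ z ∈ S) (fun a => ?_) hr
    (fun x y hx hy => ?_) (fun x y hx hy => ?_) z
  · have : Algebra.adjoin k (Set.range t ∪ {a | ∃ b, glue a b}) ≤
        S.comap (ρ.comp (ExtAlg.inl k A B glue cross)) := by
      rw [Algebra.adjoin_le_iff]
      rintro _ (⟨i, rfl⟩ | ⟨b, h⟩)
      · exact ht i
      · change ρ (ExtAlg.inl k A B glue cross _) ∈ S
        rw [ExtAlg.inl_eq_inr h]
        exact hr b
    exact this (hgen a)
  · rw [map_add]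
    exact add_mem hx hy
  · rw [map_mul]
    exact mul_mem hx hy

/-! ### The isomorphism of the completed algebras -/

namespace BKRParam

open EnhancedQuiver

variable {k : Type*} [Field k] [CharZero k] (D : BKRParam k) {β : D.J →₀ ℕ} {n : ℕ}

/-- The comparison over all ν at once: T_i = Uτ_i + G as operators, with U invertible among the
power series. -/
lemma Top_eq (i : Fin n) : ∃ U U' G : Phat k D.quiver β n, U' * U = 1 ∧
    D.Top β i = mulOp (serMap k D.quiver β n U) * τop k D.quiver β i +
      mulOp (serMap k D.quiver β n G) := by
  choose u g hu hA hB using D.comparable (β := β) i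
  refine ⟨u, fun ν => ↑(hu ν).unit⁻¹, g, funext fun ν => (hu ν).val_inv_mul, ?_⟩
  have e : ∀ F A B : RatSpace k D.quiver β n, mulOp F * op i A B = op i (F * A) (F * B) := by
    intro F A B
    refine LinearMap.ext fun G => ?_
    simp only [Module.End.mul_apply, Algebra.coe_lmul_eq_mul, LinearMap.mul_apply', op_apply]
    ring
  have e' : ∀ F A B : RatSpace k D.quiver β n, op i A B + mulOp F = op i A (B + F) := by
    intro F A B
    refine LinearMap.ext fun G => ?_
    simp only [LinearMap.add_apply, Algebra.coe_lmul_eq_mul, LinearMap.mul_apply', op_apply]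
    ring
  rw [Top, τop, e, e']
  congr 1
  · exact funext hA
  · exact funext hB

/-- Both images are generated by the multiplications with power series, which the change of
variables identifies, together with the τ_i or the T_i; these are expressed through each other with
power series coefficients. -/
theorem range_eq : (OKLRhat.rep k D.quiver β n).range = (D.hatRep β n).range := by
  have hser : ∀ F, mulOp (serMap k D.quiver β n F) ∈ (D.hatRep β n).range := fun F =>
    ⟨D.ofO β n (D.changeVar β n F), by
      change D.hatRep β n _ = _
      rw [hatRep_ofO, hatMap_changeVar]⟩
  have hT : ∀ i, D.Top β i ∈ (D.hatRep β n).range := fun i => ⟨_, D.hatRep_hatT i⟩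
  have hser' : ∀ F, mulOp (serMap k D.quiver β n F) ∈ (OKLRhat.rep k D.quiver β n).range :=
    fun F => ⟨_, OKLRhat.rep_ofPhat F⟩
  have hτ : ∀ i, τop k D.quiver β i ∈ (OKLRhat.rep k D.quiver β n).range := fun i =>
    ⟨_, (OKLRhat.rep_ofOKLR _).trans (OKLR.rep_τ i)⟩
  refine le_antisymm (ExtAlg.range_le _ OKLR.mem_adjoin ?_ fun i => ?_)
    (ExtAlg.range_le _ D.hecke_mem_adjoin ?_ fun i => ?_)
  · intro F
    change OKLRhat.rep k D.quiver β n (OKLRhat.ofPhat k D.quiver β n F) ∈ _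
    rw [OKLRhat.rep_ofPhat]
    exact hser F
  · change OKLRhat.rep k D.quiver β n (OKLRhat.ofOKLR k D.quiver β n (OKLR.τ i)) ∈ _
    rw [OKLRhat.rep_ofOKLR, OKLR.rep_τ]
    obtain ⟨U, U', G, hU, e⟩ := D.Top_eq (β := β) i
    have : τop k D.quiver β i = mulOp (serMap k D.quiver β n U') *
        (D.Top β i - mulOp (serMap k D.quiver β n G)) := by
      rw [e, add_sub_cancel_right, ← mul_assoc, ← map_mul, ← map_mul, hU, map_one, map_one, one_mul]
    rw [this]
    exact mul_mem (hser _) (sub_mem (hT i) (hser _))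
  · intro F
    change D.hatRep β n (D.ofO β n F) ∈ _
    rw [hatRep_ofO]
    exact hser' _
  · change D.hatRep β n (D.hatT i) ∈ _
    rw [hatRep_hatT]
    obtain ⟨U, U', G, hU, e⟩ := D.Top_eq (β := β) i
    rw [e]
    exact add_mem (mul_mem (hser' _) (hτ i)) (hser' _)

variable (β n) in
/-- The isomorphism of the completed algebras. -/
def completedEquiv : OKLRhat k D.quiver β n ≃ₐ[k] D.Hhat β n :=
  (AlgEquiv.ofInjective (OKLRhat.rep k D.quiver β n) OKLRhat.bijective_and_faithful.2).trans
    ((Subalgebra.equivOfEq _ _ D.range_eq).trans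
      (AlgEquiv.ofInjective (D.hatRep β n) D.bijective_and_faithful.2).symm)

lemma hatRep_completedEquiv (z : OKLRhat k D.quiver β n) :
    D.hatRep β n (D.completedEquiv β n z) = OKLRhat.rep k D.quiver β n z := by
  rw [completedEquiv]
  exact congrArg Subtype.val ((AlgEquiv.ofInjective (D.hatRep β n)
    D.bijective_and_faithful.2).apply_symm_apply _)

lemma completedEquiv_ofPhat (F : Phat k D.quiver β n) :
    D.completedEquiv β n (OKLRhat.ofPhat k D.quiver β n F) = D.ofO β n (D.changeVar β n F) :=
  D.bijective_and_faithful.2 (by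
    rw [hatRep_completedEquiv, OKLRhat.rep_ofPhat, hatRep_ofO, hatMap_changeVar])

/-! ## The localization -/

variable (β n) in
/-- Fractions of power series in `X_l - ν_l` as rational functions in the `x_l`. -/
def fracMap : D.Khat β n →+* RatSpace k D.quiver β n :=
  RingHom.pi fun ν => (IsFractionRing.algEquivOfAlgEquiv (R := k)
    (K := FractionRing (MvPowerSeries (Fin n) k)) (L := PSField k n)
    (near (D.point ν)).symm).toRingEquiv.toRingHom.comp (Pi.evalRingHom _ ν)

lemma fracMap_algebraMap (F : D.Ohat β n) :
    D.fracMap β n (fun ν => algebraMap _ _ (F ν)) = D.hatMap β n F := by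
  ext ν
  exact IsFractionRing.algEquivOfAlgEquiv_algebraMap (R := k)
    (K := FractionRing (MvPowerSeries (Fin n) k)) (L := PSField k n)
    (near (D.point ν)).symm (F ν)

variable (β n) in
/-- The operators on rational functions given by the elements of the localization. -/
def locRep : D.Hloc β n →+ Module.End k (RatSpace k D.quiver β n) :=
  TensorProduct.liftAddHom
    ((AddMonoidHom.mul (R := Module.End k (RatSpace k D.quiver β n))).compl₂
      (D.hatRep β n).toRingHom.toAddMonoidHom |>.comp
      ((mulOp (k := k) (Γ := D.quiver) (β := β) (n := n)).toRingHom.comp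
        (D.fracMap β n)).toAddMonoidHom)
    (by
      intro F κ z
      change mulOp (D.fracMap β n (F • κ)) * D.hatRep β n z =
        mulOp (D.fracMap β n κ) * D.hatRep β n (D.ofO β n F * z)
      have e : F • κ = κ * (fun ν => algebraMap _ _ (F ν)) := by
        ext1 ν
        change F ν • κ ν = _
        rw [Algebra.smul_def, mul_comm]
        rfl
      rw [e, map_mul, map_mul, map_mul, fracMap_algebraMap, hatRep_ofO, mul_assoc])

lemma locRep_tmul (κ : D.Khat β n) (z : D.Hhat β n) :
    D.locRep β n (κ ⊗ₜ z) = mulOp (D.fracMap β n κ) * D.hatRep β n z := rfl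

lemma locRep_toLoc (z : D.Hhat β n) : D.locRep β n (D.toLoc z) = D.hatRep β n z := by
  rw [toLoc, locRep_tmul, map_one, map_one, one_mul]

lemma locRep_smul (κ : D.Khat β n) (w : D.Hloc β n) :
    D.locRep β n (κ • w) = mulOp (D.fracMap β n κ) * D.locRep β n w := by
  induction w using TensorProduct.induction_on with
  | zero => simp
  | tmul κ' z =>
    rw [TensorProduct.smul_tmul', locRep_tmul, locRep_tmul, smul_eq_mul, map_mul, map_mul, mul_assoc]
  | add x y hx hy => rw [smul_add, map_add, hx, hy, map_add, mul_add]

lemma toLoc_injective : Function.Injective (D.toLoc (β := β) (n := n)) := fun x y h =>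
  D.bijective_and_faithful.2 (by rw [← locRep_toLoc, h, locRep_toLoc])

/-- A pure tensor has the denominators of its components, and for a sum one multiplies denominators.
This reduces the localization to the completed algebra. -/
lemma exists_denominator (w : D.Hloc β n) : ∃ (d : D.Ohat β n) (z : D.Hhat β n),
    (∀ ν, d ν ≠ 0) ∧ (fun ν => algebraMap _ _ (d ν) : D.Khat β n) • w = D.toLoc z := by
  have e : ∀ (d : D.Ohat β n) (z : D.Hhat β n),
      (fun ν => algebraMap _ _ (d ν) : D.Khat β n) • D.toLoc z = D.toLoc (D.ofO β n d * z) := by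
    intro d z
    have h : (fun ν => algebraMap _ _ (d ν) : D.Khat β n) = d • (1 : D.Khat β n) := by
      ext1 ν
      change _ = d ν • (1 : FractionRing (MvPowerSeries (Fin n) k))
      rw [Algebra.smul_def, mul_one]
    rw [toLoc, TensorProduct.smul_tmul', smul_eq_mul, mul_one, h, TensorProduct.smul_tmul]
    rfl
  induction w using TensorProduct.induction_on with
  | zero => exact ⟨1, 0, fun ν => one_ne_zero, by rw [smul_zero, toLoc, TensorProduct.tmul_zero]⟩
  | tmul κ z =>
    choose a b hb using fun ν => IsFractionRing.div_surjective (A := MvPowerSeries (Fin n) k) (κ ν)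
    refine ⟨b, D.ofO β n a * z, fun ν => nonZeroDivisors.ne_zero (hb ν).1, ?_⟩
    rw [← e, toLoc, TensorProduct.smul_tmul', TensorProduct.smul_tmul']
    congr 1
    ext1 ν
    change algebraMap _ _ (b ν) * κ ν = algebraMap _ _ (a ν) * 1
    rw [← (hb ν).2, mul_one, mul_div_cancel₀]
    rw [Ne, IsFractionRing.to_map_eq_zero_iff]
    exact nonZeroDivisors.ne_zero (hb ν).1
  | add x y hx hy =>
    obtain ⟨d, z, hd, hx⟩ := hx
    obtain ⟨d', z', hd', hy⟩ := hy
    refine ⟨d * d', D.ofO β n d' * z + D.ofO β n d * z', fun ν => mul_ne_zero (hd ν) (hd' ν), ?_⟩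
    have h : (fun ν => algebraMap _ _ ((d * d') ν) : D.Khat β n) =
        (fun ν => algebraMap _ _ (d ν)) * (fun ν => algebraMap _ _ (d' ν)) := by
      ext1 ν
      exact map_mul _ _ _
    rw [toLoc, TensorProduct.tmul_add, ← toLoc, ← toLoc, ← e, ← e, ← hx, ← hy, h, smul_add,
      smul_smul, smul_smul, mul_comm]

/-- Clear denominators and use that the completed algebra acts faithfully; nowhere zero denominators
are invertible in the localization. -/
lemma locRep_injective : Function.Injective (D.locRep β n) := by
  rw [injective_iff_map_eq_zero]
  intro w hw
  obtain ⟨d, z, hd, e⟩ := D.exists_denominator w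
  have h := congrArg (D.locRep β n) e
  rw [locRep_smul, hw, mul_zero, locRep_toLoc] at h
  have hz : z = 0 := D.bijective_and_faithful.2 (by rw [← h, map_zero])
  have h1 : (fun ν => (algebraMap _ _ (d ν))⁻¹ : D.Khat β n) *
      (fun ν => algebraMap _ _ (d ν) : D.Khat β n) = 1 := by
    ext1 ν
    refine inv_mul_cancel₀ ?_
    rw [Ne, IsFractionRing.to_map_eq_zero_iff]
    exact hd ν
  rw [← one_smul (D.Khat β n) w, ← h1, mul_smul, e, hz, toLoc, TensorProduct.tmul_zero, smul_zero]

end BKRParam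

/-! ### The images of the generators τ_i -/

namespace BKRParam

open EnhancedQuiver

variable {k : Type*} [Field k] [CharZero k] (D : BKRParam k) {β : D.J →₀ ℕ} {n : ℕ}

lemma fracMap_div (κ κ' : D.Khat β n) :
    D.fracMap β n (κ / κ') = D.fracMap β n κ / D.fracMap β n κ' := by
  ext ν
  exact map_div₀ (IsFractionRing.algEquivOfAlgEquiv (R := k)
    (K := FractionRing (MvPowerSeries (Fin n) k)) (L := PSField k n)
    (near (D.point ν)).symm) (κ ν) (κ' ν)

lemma fracMap_inv (κ : D.Khat β n) : D.fracMap β n κ⁻¹ = (D.fracMap β n κ)⁻¹ := by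
  ext ν
  exact map_inv₀ (IsFractionRing.algEquivOfAlgEquiv (R := k)
    (K := FractionRing (MvPowerSeries (Fin n) k)) (L := PSField k n)
    (near (D.point ν)).symm) (κ ν)

lemma fracMap_kX (l : Fin n) : D.fracMap β n (D.kX l) = D.ratX l :=
  (D.fracMap_algebraMap (D.oX l)).trans (D.hatMap_oX l)

lemma fracMap_kC (c : k) : D.fracMap β n (D.kC c) = algebraMap k _ c := by
  rw [← hatMap_oC, ← fracMap_algebraMap]
  rfl

/-- As T_i minus its first parameter is A(σ_i - 1), the coefficient A⁻¹ turns it into σ_i - 1. Hence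
the intertwiners act as σ_i. -/
lemma hatRep_add_smul {i : Fin n} {K : RatSpace k D.quiver β n} (hK : K * D.TA i = 1)
    (z : D.Hhat β n) :
    D.hatRep β n z + mulOp K *
        D.hatRep β n ((D.hatT i - algebraMap k _ (D.par i)) * z) =
      σop k D.quiver β i * D.hatRep β n z := by
  have e : mulOp K * (D.Top β i - algebraMap k _ (D.par i)) = σop k D.quiver β i - 1 := by
    have h : D.Top β i - algebraMap k _ (D.par i) =
        mulOp (D.TA i) * (σop k D.quiver β i - 1) := by
      rw [Top, op_eq_σop, TB_eq, map_sub, AlgHom.commutes, mul_sub, mul_one]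
      abel
    rw [h, ← mul_assoc, ← map_mul, hK, map_one, one_mul]
  rw [map_mul, map_sub, hatRep_hatT, AlgHom.commutes, ← mul_assoc, e, sub_mul, one_mul]
  abel

lemma locRep_Φ {i : Fin n} (hi : i.1 ≠ 0) (z : D.Hhat β n) :
    D.locRep β n (D.Φ i z) = σop k D.quiver β i * D.hatRep β n z := by
  rw [Φ, map_add, locRep_smul, locRep_toLoc, locRep_toLoc, ← hatRep_add_smul, par, if_neg hi]
  ext1 ν
  have h1 := D.ratX_sub_ne_zero hi ν
  have h2 := D.mul_ratX_sub_ne_zero hi ν D.q.ne_zero (b := (D.q : k)⁻¹)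
  simp only [fracMap_div, map_sub, map_mul, fracMap_kX, fracMap_kC, Pi.mul_apply, Pi.div_apply,
    Pi.sub_apply, Pi.algebraMap_apply, Pi.one_apply]
  rw [TA_of_ne D hi, cH, ← fieldC_inv]
  rw [← inv_div]
  exact inv_mul_cancel₀ (div_ne_zero h2 h1)

lemma locRep_Φ₀ {o : Fin n} (ho : o.1 = 0) (z : D.Hhat β n) :
    D.locRep β n (D.Φ₀ o z) = σop k D.quiver β o * D.hatRep β n z := by
  rw [Φ₀, map_add, locRep_smul, locRep_toLoc, locRep_toLoc, ← hatRep_add_smul, par, if_pos ho]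
  ext1 ν
  have h1 := mul_ne_zero (fieldC_ne_zero (n := n) D.p₁.ne_zero) (D.ratX_zero_sq_sub_ne_zero ho ν)
  have h2 := mul_ne_zero (D.ratX_zero_sub_ne_zero ho ν (-D.p₀)) (D.ratX_zero_sub_ne_zero ho ν D.p₁)
  rw [fieldC, map_neg, sub_neg_eq_add] at h2
  simp only [fracMap_div, map_sub, map_add, map_mul, map_pow, map_one, fracMap_kX, fracMap_kC,
    Pi.mul_apply, Pi.div_apply, Pi.sub_apply, Pi.add_apply, Pi.pow_apply, Pi.algebraMap_apply,
    Pi.one_apply]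
  rw [TA_of_eq D ho, cH₀]
  rw [← inv_div]
  exact inv_mul_cancel₀ (div_ne_zero h2 h1)

open Classical in
lemma hatMap_oe (ν : D.Comp β n) (F : D.Ohat β n) :
    D.hatMap β n (D.oe ν F) = D.hatMap β n F * Pi.single ν 1 := by
  ext μ
  rw [Pi.mul_apply, hatMap_apply, hatMap_apply, oe]
  by_cases h : μ = ν
  · subst h
    rw [Pi.single_eq_same, Pi.single_eq_same, mul_one]
  · rw [Pi.single_eq_of_ne h, Pi.single_eq_of_ne h, map_zero, map_zero, mul_zero]

open Classical in
lemma rep_τ_e (i : Fin n) (ν : D.Comp β n) :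
    D.locRep β n (D.toLoc (D.completedEquiv β n
      (OKLRhat.ofOKLR k D.quiver β n (OKLR.τ i * OKLR.e ν)))) =
    τop k D.quiver β i * mulOp (Pi.single ν 1) := by
  rw [locRep_toLoc, hatRep_completedEquiv, OKLRhat.rep_ofOKLR, map_mul, OKLR.rep_τ, OKLR.rep_e]

open Classical in
-- Where s_i fixes ν, τ_i is a divided difference, a left multiple of σ_i - 1, and only the value of
-- the factor at ν matters.
lemma τop_mul_of_fixed {i : Fin n} {ν : D.Comp β n} (h : ν.s i = ν)
    (hB : τB k D.quiver β i ν = -τA k D.quiver β i ν) {K : RatSpace k D.quiver β n}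
    (hK : K ν = τA k D.quiver β i ν) :
    τop k D.quiver β i * mulOp (Pi.single ν 1) =
      mulOp K * (σop k D.quiver β i * mulOp (D.hatMap β n (D.oe ν 1)) -
        mulOp (D.hatMap β n (D.oe ν 1))) := by
  rw [hatMap_oe, map_one, one_mul, ← sub_one_mul, ← mul_assoc]
  refine mul_idem_eq ν fun f => ?_
  simp only [Module.End.mul_apply, LinearMap.sub_apply, Module.End.one_apply, τop, σop, op_single,
    h, hB, map_sub, mulOp_single, hK, Pi.one_apply, Pi.zero_apply, one_mul, zero_mul,
    Pi.single_zero, add_zero]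
  rw [← Pi.single_add, ← Pi.single_sub]
  congr 1
  ring

open Classical in
-- The factor stands to the right of σ_i, so it is the reflection of the coefficient of τ_i at s_iν
-- rather than the coefficient at ν.
lemma τop_mul_of_moved {i : Fin n} {ν : D.Comp β n} (hB : τB k D.quiver β i ν = 0)
    {F : D.Ohat β n} (hF : sK i (D.hatMap β n F ν) = τA k D.quiver β i (ν.s i)) :
    τop k D.quiver β i * mulOp (Pi.single ν 1) =
      σop k D.quiver β i * mulOp (D.hatMap β n (D.oe ν F)) := by
  rw [hatMap_oe, map_mul, ← mul_assoc]
  refine mul_idem_eq ν fun f => ?_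
  simp only [Module.End.mul_apply, τop, σop, op_single, hB, mulOp_single, Pi.one_apply,
    Pi.zero_apply, one_mul, zero_mul, Pi.single_zero, add_zero, map_mul, hF]

lemma changeVar_oe_one (ν : D.Comp β n) : D.changeVar β n (D.oe ν 1) = D.oe ν 1 := by
  classical
  ext1 μ
  rw [changeVar_apply, oe]
  by_cases h : μ = ν
  · subst h
    rw [Pi.single_eq_same, Pi.one_apply, map_one]
  · rw [Pi.single_eq_of_ne h, map_zero]

lemma changeVar_oe_X (l : Fin n) (ν : D.Comp β n) :
    D.changeVar β n (D.oe ν (fun _ => MvPowerSeries.X l)) =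
      D.oe ν (D.oC (D.X (ν l) : k) * (D.oX l)⁻¹ - D.oX l * D.oC (D.X (ν l) : k)⁻¹) := by
  classical
  ext1 μ
  rw [changeVar_apply, oe, oe]
  by_cases h : μ = ν
  · subst h
    rw [Pi.single_eq_same, Pi.single_eq_same]
    change toNear (D.point μ) (MvPowerSeries.X l) = _
    rw [toNear, mkSubst_X]
    rfl
  · rw [Pi.single_eq_of_ne h, Pi.single_eq_of_ne h, map_zero]

/-- With X = at and X' = at' the two inverted factors multiply to (t + 1/t')(t'/t - 1) = x_m -
x_{m+1}. -/
theorem toLoc_τ_of_eq {i : Fin n} (hi : i.1 ≠ 0) {ν : D.Comp β n} (h : ν (prev i) = ν i) :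
    D.toLoc (D.completedEquiv β n (OKLRhat.ofOKLR k D.quiver β n (OKLR.τ i * OKLR.e ν))) =
      ((D.kX (prev i) / D.kC (D.X (ν i) : k) + D.kC (D.X (ν (prev i)) : k) / D.kX i)⁻¹ *
        (D.kX i / D.kX (prev i) - 1)⁻¹ : D.Khat β n) •
        (D.Φ i (D.ofO β n (D.oe ν 1)) - D.toLoc (D.ofO β n (D.oe ν 1))) := by
  refine D.locRep_injective ?_
  rw [rep_τ_e, locRep_smul, map_sub, locRep_Φ D hi, locRep_toLoc, hatRep_ofO]
  refine D.τop_mul_of_fixed (Comp.s_eq_self hi h) ?_ ?_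
  · rw [τA, τB, if_neg hi, if_neg hi, cA, cB, if_pos h, if_pos h]
  · have ha := fieldC_ne_zero (n := n) (D.X (ν i)).ne_zero
    have hT := fieldT_ne_zero (k := k) (prev i)
    have hS := fieldT_ne_zero (k := k) i
    rw [τA, if_neg hi, cA, if_pos h, map_mul, fracMap_inv, fracMap_inv, ← mul_inv, Pi.inv_apply]
    congr 1
    simp only [map_add, map_sub, map_one, fracMap_div, fracMap_kX, fracMap_kC, Pi.mul_apply,
      Pi.add_apply, Pi.sub_apply, Pi.div_apply, Pi.one_apply, Pi.algebraMap_apply, ratX, h,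
      ← inv_fieldT_sub]
    field_simp
    ring

/-- The entries of ν cancel, which leaves (t + 1/t')(1 - t'/t) = (1/t' - t') - (1/t - t). -/
lemma hatMap_factor {i : Fin n} (ν : D.Comp β n) :
    D.hatMap β n ((D.oX (prev i) * D.oC (D.X (ν i) : k)⁻¹ +
      D.oC (D.X (ν (prev i)) : k) * (D.oX i)⁻¹) *
        (D.oC ((D.X (ν i) : k) / D.X (ν (prev i))) - D.oX i * (D.oX (prev i))⁻¹)) ν =
      fieldX i - fieldX (prev i) := by
  have ha := fieldC_ne_zero (n := n) (D.X (ν i)).ne_zero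
  have hb := fieldC_ne_zero (n := n) (D.X (ν (prev i))).ne_zero
  have hT := fieldT_ne_zero (k := k) (prev i)
  have hS := fieldT_ne_zero (k := k) i
  simp only [map_add, map_sub, map_mul, hatMap_oX, hatMap_oX_inv, hatMap_oC, Pi.mul_apply,
    Pi.add_apply, Pi.sub_apply, Pi.inv_apply, Pi.algebraMap_apply, ratX, ← inv_fieldT_sub,
    map_div₀, map_inv₀]
  field_simp
  ring

theorem toLoc_τ_of_arrow {i : Fin n} (hi : i.1 ≠ 0) {ν : D.Comp β n} (h : ν (prev i) ≠ ν i)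
    (hq : (D.X (ν (prev i)) : k) = (D.q : k) ^ 2 * D.X (ν i)) :
    D.toLoc (D.completedEquiv β n (OKLRhat.ofOKLR k D.quiver β n (OKLR.τ i * OKLR.e ν))) =
      D.Φ i (D.ofO β n (D.oe ν ((D.oX (prev i) * D.oC (D.X (ν i) : k)⁻¹ +
        D.oC (D.X (ν (prev i)) : k) * (D.oX i)⁻¹) *
          (D.oC ((D.X (ν i) : k) / D.X (ν (prev i))) - D.oX i * (D.oX (prev i))⁻¹)))) := by
  classical
  refine D.locRep_injective ?_
  rw [rep_τ_e, locRep_Φ D hi, hatRep_ofO]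
  refine D.τop_mul_of_moved ?_ ?_
  · rw [τB, if_neg hi, cB, if_neg h]
  · have hq' : (ν (prev i)).1 = D.q ^ 2 * (ν i).1 := Units.ext (by
      rw [Units.val_mul, Units.val_pow_eq_pow_val]
      exact hq)
    rw [hatMap_factor, map_sub, sK_fieldX hi, sK_fieldX hi, τA, if_neg hi, cA, Comp.s_apply hi,
      Comp.s_apply hi, Equiv.swap_apply_left, Equiv.swap_apply_right, if_neg h.symm, arr_quiver,
      if_pos hq', pow_one]

theorem toLoc_τ_of_no_arrow {i : Fin n} (hi : i.1 ≠ 0) {ν : D.Comp β n} (h : ν (prev i) ≠ ν i)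
    (hq : (D.X (ν (prev i)) : k) ≠ (D.q : k) ^ 2 * D.X (ν i)) :
    D.toLoc (D.completedEquiv β n (OKLRhat.ofOKLR k D.quiver β n (OKLR.τ i * OKLR.e ν))) =
      D.Φ i (D.ofO β n (D.oe ν 1)) := by
  classical
  refine D.locRep_injective ?_
  rw [rep_τ_e, locRep_Φ D hi, hatRep_ofO]
  refine D.τop_mul_of_moved ?_ ?_
  · rw [τB, if_neg hi, cB, if_neg h]
  · have hq' : ¬(ν (prev i)).1 = D.q ^ 2 * (ν i).1 := fun h' => hq (by
      rw [X, h', Units.val_mul, Units.val_pow_eq_pow_val]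
      rfl)
    rw [map_one, Pi.one_apply, map_one, τA, if_neg hi, cA, Comp.s_apply hi,
      Comp.s_apply hi, Equiv.swap_apply_left, Equiv.swap_apply_right, if_neg h.symm, arr_quiver,
      if_neg hq', pow_zero]

/-- At a fixed point ν_1⁻¹ = ν_1, hence X_1⁻¹ - X_1 = ν_1x_1, and the prefactor is 1/x_1. -/
theorem toLoc_τ_zero_of_eq {o : Fin n} (ho : o.1 = 0) {ν : D.Comp β n}
    (h : ν o = D.quiver.θ (ν o)) :
    D.toLoc (D.completedEquiv β n (OKLRhat.ofOKLR k D.quiver β n (OKLR.τ o * OKLR.e ν))) =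
      (D.kC (D.X (ν o) : k) * ((D.kX o)⁻¹ - D.kX o)⁻¹ : D.Khat β n) •
        (D.Φ₀ o (D.ofO β n (D.oe ν 1)) - D.toLoc (D.ofO β n (D.oe ν 1))) := by
  refine D.locRep_injective ?_
  rw [rep_τ_e, locRep_smul, map_sub, locRep_Φ₀ D ho, locRep_toLoc, hatRep_ofO]
  refine D.τop_mul_of_fixed (Comp.s_zero_eq_self ho h) ?_ ?_
  · rw [τA, τB, if_pos ho, if_pos ho, cA₀, cB₀, if_pos h, if_pos h]
  · have ha := fieldC_ne_zero (n := n) (D.X (ν o)).ne_zero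
    have hT := fieldT_ne_zero (k := k) o
    have ha2 : fieldC k n (D.X (ν o)) ^ 2 = 1 := by
      rw [← map_pow, D.sq_eq_one_of_fixed h, map_one]
    have hx := fieldX_ne_zero (k := k) o
    rw [τA, if_pos ho, cA₀, if_pos h, map_mul, fracMap_inv]
    simp only [map_sub, fracMap_inv, fracMap_kX, fracMap_kC, Pi.mul_apply,
      Pi.sub_apply, Pi.inv_apply, Pi.algebraMap_apply, ratX]
    change fieldC k n (D.X (ν o)) * _ = _
    have e : (fieldC k n (D.X (ν o)) * fieldT k o)⁻¹ - fieldC k n (D.X (ν o)) * fieldT k o =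
        fieldC k n (D.X (ν o)) * fieldX o := by
      rw [← inv_fieldT_sub, mul_inv, inv_eq_of_mul_eq_one_left ((pow_two _).symm.trans ha2)]
      ring
    rw [e, mul_inv, mul_inv_cancel_left₀ ha]

/-- The base X_1/ν_1 - ν_1/X_1 is t - t⁻¹ = -x_1, which s_0 sends to x_1; the exponent is the
framing at the first entry θ(ν_1) of s_0ν. -/
theorem toLoc_τ_zero_of_ne {o : Fin n} (ho : o.1 = 0) {ν : D.Comp β n}
    (h : ν o ≠ D.quiver.θ (ν o)) :
    D.toLoc (D.completedEquiv β n (OKLRhat.ofOKLR k D.quiver β n (OKLR.τ o * OKLR.e ν))) =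
      D.Φ₀ o (D.ofO β n (D.oe ν ((D.oX o * D.oC (D.X (ν o) : k)⁻¹ -
        D.oC (D.X (ν o) : k) * (D.oX o)⁻¹) ^ D.quiver.lam (D.quiver.θ (ν o))))) := by
  refine D.locRep_injective ?_
  rw [rep_τ_e, locRep_Φ₀ D ho, hatRep_ofO]
  refine D.τop_mul_of_moved ?_ ?_
  · rw [τB, if_pos ho, cB₀, if_neg h]
  · have ha := fieldC_ne_zero (n := n) (D.X (ν o)).ne_zero
    have e : D.hatMap β n (D.oX o * D.oC (D.X (ν o) : k)⁻¹ -
        D.oC (D.X (ν o) : k) * (D.oX o)⁻¹) ν = -fieldX o := by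
      have hT := fieldT_ne_zero (k := k) o
      simp only [map_sub, map_mul, hatMap_oX, hatMap_oX_inv, hatMap_oC, Pi.mul_apply,
        Pi.sub_apply, Pi.inv_apply, Pi.algebraMap_apply, ratX, ← inv_fieldT_sub, map_inv₀]
      field_simp
      ring
    have h' : ¬D.quiver.θ (ν o) = D.quiver.θ (D.quiver.θ (ν o)) := by
      rw [D.quiver.θ_invol]
      exact h.symm
    rw [map_pow, Pi.pow_apply, e, map_pow, map_neg, sK_zero_fieldX ho, neg_neg, τA, if_pos ho, cA₀,
      Comp.s_apply_zero ho, if_neg h']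

end BKRParam

end

theorem mainTheorem3 {k : Type*} [Field k] [CharZero k] (D : BKRParam k) (n : ℕ)
    (β : D.J →₀ ℕ) (hβ : ∀ i, β (D.quiver.θ i) = β i)
    (hβ_even : ∀ i, D.quiver.θ i = i → Even (β i)) (hβn : β.sum (fun _ m => m) = 2 * n) :
    -- the two completed algebras are the tensor products `R ⊗_P P̂` and `H ⊗_O Ô`
    Function.Bijective (tensorToExt k (EnhancedQuiver.OGlue k D.quiver β n)
      (EnhancedQuiver.OCross k D.quiver β n)) ∧
    Function.Bijective (D.tensorToHhat β n) ∧
    -- equations in the completed affine Hecke algebra may be checked after localization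
    Function.Injective (D.toLoc (β := β) (n := n)) ∧
    -- the change of variables
    ∃ φ : EnhancedQuiver.Phat k D.quiver β n ≃ₐ[k] D.Ohat β n,
      (∀ ν : D.Comp β n, φ (D.oe ν 1) = D.oe ν 1) ∧
      (∀ (l : Fin n) (ν : D.Comp β n),
        φ (D.oe ν (fun _ => MvPowerSeries.X l)) =
          D.oe ν (D.oC (D.X (ν l) : k) * (D.oX l)⁻¹ - D.oX l * D.oC (D.X (ν l) : k)⁻¹)) ∧
      -- it extends to an isomorphism of the completed algebras
      ∃ ψ : EnhancedQuiver.OKLRhat k D.quiver β n ≃ₐ[k] D.Hhat β n,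
        (∀ F, ψ (EnhancedQuiver.OKLRhat.ofPhat k D.quiver β n F) = D.ofO β n (φ F)) ∧
        -- the images of `τ_i e(ν)` for `i ≠ 0`
        (∀ (i : Fin n), i.1 ≠ 0 → ∀ ν : D.Comp β n,
          let τe := EnhancedQuiver.OKLRhat.ofOKLR k D.quiver β n
            (EnhancedQuiver.OKLR.τ i * EnhancedQuiver.OKLR.e ν)
          let a : k := D.X (ν (prev i))
          let b : k := D.X (ν i)
          (ν (prev i) = ν i →
            D.toLoc (ψ τe) =
              ((D.kX (prev i) / D.kC b + D.kC a / D.kX i)⁻¹ *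
                (D.kX i / D.kX (prev i) - 1)⁻¹ : D.Khat β n) •
                (D.Φ i (D.ofO β n (D.oe ν 1)) - D.toLoc (D.ofO β n (D.oe ν 1)))) ∧
          (ν (prev i) ≠ ν i → a = (D.q : k) ^ 2 * b →
            D.toLoc (ψ τe) =
              D.Φ i (D.ofO β n (D.oe ν
                ((D.oX (prev i) * D.oC b⁻¹ + D.oC a * (D.oX i)⁻¹) *
                  (D.oC (b / a) - D.oX i * (D.oX (prev i))⁻¹))))) ∧
          (ν (prev i) ≠ ν i → a ≠ (D.q : k) ^ 2 * b →
            D.toLoc (ψ τe) = D.Φ i (D.ofO β n (D.oe ν 1)))) ∧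
        -- the images of `τ_0 e(ν)`
        (∀ (o : Fin n), o.1 = 0 → ∀ ν : D.Comp β n,
          let τe := EnhancedQuiver.OKLRhat.ofOKLR k D.quiver β n
            (EnhancedQuiver.OKLR.τ o * EnhancedQuiver.OKLR.e ν)
          let a : k := D.X (ν o)
          (ν o = D.quiver.θ (ν o) →
            D.toLoc (ψ τe) =
              (D.kC a * ((D.kX o)⁻¹ - D.kX o)⁻¹ : D.Khat β n) •
                (D.Φ₀ o (D.ofO β n (D.oe ν 1)) - D.toLoc (D.ofO β n (D.oe ν 1)))) ∧
          (ν o ≠ D.quiver.θ (ν o) →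
            D.toLoc (ψ τe) =
              D.Φ₀ o (D.ofO β n (D.oe ν
                ((D.oX o * D.oC a⁻¹ - D.oC a * (D.oX o)⁻¹) ^
                  D.quiver.lam (D.quiver.θ (ν o)))))))
    := by
  refine ⟨EnhancedQuiver.OKLRhat.bijective_and_faithful.1, D.bijective_and_faithful.1,
    D.toLoc_injective, D.changeVar β n, D.changeVar_oe_one, D.changeVar_oe_X,
    D.completedEquiv β n, D.completedEquiv_ofPhat, fun i hi ν => ?_, fun o ho ν => ?_⟩
  · exact ⟨D.toLoc_τ_of_eq hi, D.toLoc_τ_of_arrow hi, D.toLoc_τ_of_no_arrow hi⟩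
  · exact ⟨D.toLoc_τ_zero_of_eq ho, D.toLoc_τ_zero_of_ne ho⟩
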